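/- Let $\tau\in\mathbb{R}$, $\tau\neq0$, and $p=(p_0,\boldsymbol{p})\in\mathbb{R}\times\mathbb{R}^{25}$. Let $\mathsf{F}(p)$ be the complex Fock space obtained from a vector $|p\rangle$ by the creation operators $x^\mu_{n\le-1}$, $(\pi_\mu)_{n\le-1}$ ($0\le\mu\le25$, bosonic) and $b_{n\le-2}$, $B_{n\le-2}$, $c_{n\le1}$, $C_{n\le1}$ (fermionic). The modes obey the relations, all other (anti)commutators being zero, $[(\pi_\mu)_m,x^\nu_n]=\delta_\mu^\nu\delta_{m+n,0}$, $[b_m,c_n]=\delta_{m+n,0}=[B_m,C_n]$; moreover $(\pi_\mu)_0=ip_\mu$, and the modes $x^\mu_{n\ge1}$, $(\pi_\mu)_{n\ge1}$, $b_{n\ge-1}$, $B_{n\ge-1}$, $c_{n\ge2}$, $C_{n\ge2}$ annihilate $|p\rangle$. With $X^\mu(z)=\sum_n x^\mu_nz^{-n}$ (only $\partial X^\mu$ is used), $\Pi_\mu(z)=\sum_n(\pi_\mu)_nz^{-n-1}$, $b(z)=\sum_n b_nz^{-n-2}$, $c(z)=\sum_n c_nz^{-n+1}$, and likewise $B$,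 $C$, put $$T=\partial X^\mu\Pi_\mu,\qquad M=\tfrac12\Pi_0\Pi_0-\tfrac12\tau^2\sum_{i=1}^{25}\partial X^i\partial X^i,$$ $$T^{\mathrm{gh}}=-2b\,\partial c-\partial b\,c-2B\,\partial C-\partial B\,C,\qquad M^{\mathrm{gh}}=-2B\,\partial c-\partial B\,c,$$ $$J=cT+CM+\tfrac12cT^{\mathrm{gh}}+\tfrac12CM^{\mathrm{gh}},$$ all products being normal ordered. Let $d=J_0$ be the zero mode of $J$, let $L_0^{\mathrm{tot}}$ be the zero mode of $T+T^{\mathrm{gh}}$, and let $\mathsf{C}^n_{\mathrm{rel}}(p)\subset\ker b_0\cap\ker L_0^{\mathrm{tot}}\subset\mathsf{F}(p)$ be the subspace of ghost number $n$ ($c,C$ count $+1$; $b,B$ count $-1$; $|p\rangle$ has ghost number $0$). Put $\mathsf{Z}^n_{\mathrm{rel}}=\mathsf{C}^n_{\mathrm{rel}}\cap\ker d$, $\mathsf{B}^n_{\mathrm{rel}}=d\,\mathsf{C}^{n-1}_{\mathrm{rel}}$. The stabiliser of $p$ is the group of those $R\in\mathrm{SO}(25)$ with $R\boldsymbol{p}=\boldsymbol{p}$;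 it acts on these spaces by rotating $x^i_n$ and $(\pi_i)_n$, $1\le i\le25$, as vectors, and fixing $|p\rangle$ and all other modes. Then for every $p=(0,\boldsymbol{p})$ one has $\mathsf{B}^n_{\mathrm{rel}}(p)\subset\mathsf{Z}^n_{\mathrm{rel}}(p)$ for all $n$, $\mathsf{C}^n_{\mathrm{rel}}(p)=0$ unless $0\le n\le5$, and the relative cohomology $\mathsf{H}^n_{\mathrm{rel}}=\mathsf{Z}^n_{\mathrm{rel}}/\mathsf{B}^n_{\mathrm{rel}}$ displays Poincaré duality: for all $n$, $$\mathsf{H}^n_{\mathrm{rel}}(p)\cong\mathsf{H}^{5-n}_{\mathrm{rel}}(p)$$ as representations of the stabiliser of $p$. Moreover, as representations of the stabiliser of $p$, the cochains, cocycles, coboundaries and cohomology are as follows, where $V=\mathbb{C}^{25}$, $V^\perp=\{v\in V: \boldsymbol{p}\cdot v=0\}$, $\odot^2_0$ denotes traceless symmetric and $\wedge^2$ skewsymmetric $2$-tensors, and $(z_1,z_2,z_3,z_4)$ stands for $z_1\mathbb{C}\oplus z_2V\oplus z_3\odot^2_0V\oplus z_4\wedge^2V$ if $\boldsymbol{p}=\boldsymbol{0}$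 and for $z_1\mathbb{C}\oplus z_2V^\perp\oplus z_3\odot^2_0V^\perp\oplus z_4\wedge^2V^\perp$ if $\boldsymbol{p}\neq\boldsymbol{0}$. For $p=(0,\boldsymbol{p})$ with $\boldsymbol{p}\neq\boldsymbol{0}$: $$\begin{array}{c|cccc} n&\mathsf{C}^n_{\mathrm{rel}}&\mathsf{Z}^n_{\mathrm{rel}}&\mathsf{B}^n_{\mathrm{rel}}&\mathsf{H}^n_{\mathrm{rel}}\\\hline 0&(1,0,0,0)&0&0&0\\ 1&(11,4,0,0)&(2,1,0,0)&(1,0,0,0)&(1,1,0,0)\\ 2&(31,14,3,1)&(12,6,1,1)&(9,3,0,0)&(3,3,1,1)\\ 3&(31,14,3,1)&(22,11,3,1)&(19,8,2,0)&(3,3,1,1)\\ 4&(11,4,0,0)&(10,4,0,0)&(9,3,0,0)&(1,1,0,0)\\ 5&(1,0,0,0)&(1,0,0,0)&(1,0,0,0)&0 \end{array}$$ For $p=0$: $$\begin{array}{c|cccc} n&\mathsf{C}^n_{\mathrm{rel}}&\mathsf{Z}^n_{\mathrm{rel}}&\mathsf{B}^n_{\mathrm{rel}}&\mathsf{H}^n_{\mathrm{rel}}\\\hline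 0&(1,0,0,0)&(1,0,0,0)&0&(1,0,0,0)\\ 1&(7,4,0,0)&(2,2,0,0)&0&(2,2,0,0)\\ 2&(18,10,3,1)&(8,4,1,1)&(5,2,0,0)&(3,2,1,1)\\ 3&(18,10,3,1)&(13,8,3,1)&(10,6,2,0)&(3,2,1,1)\\ 4&(7,4,0,0)&(7,4,0,0)&(5,2,0,0)&(2,2,0,0)\\ 5&(1,0,0,0)&(1,0,0,0)&0&(1,0,0,0) \end{array}$$ -/

import Mathlib

open scoped BigOperators

namespace CarrollString

noncomputable section

/-! ### Fields on a vector space and their normal ordered products -/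

section Fields

variable {W : Type*} [AddCommGroup W] [Module ℂ W]

/-- Quantum fields `A(z) = ∑ₙ A₍ₙ₎ z^{-n-1}` on `W`: families of endomorphisms `A₍ₙ₎`, `n ∈ ℤ`, such
that every vector is killed by `A₍ₙ₎` for all sufficiently large `n`.
The modes `A_n` adapted to a conformal weight `h`, `A(z) = ∑ₙ A_n z^{-n-h}`, are
`A_n = A₍ₙ₊ₕ₋₁₎`. -/
def Fields (W : Type*) [AddCommGroup W] [Module ℂ W] :
    Submodule ℂ (ℤ → Module.End ℂ W) where
  carrier := {A | ∀ v : W, ∃ N : ℤ, ∀ n : ℤ, N ≤ n → A n v = 0}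
  add_mem' := by
    intro A B hA hB v
    obtain ⟨N, hN⟩ := hA v
    obtain ⟨M, hM⟩ := hB v
    refine ⟨max N M, fun n hn => ?_⟩
    simp [hN n (le_trans (le_max_left _ _) hn), hM n (le_trans (le_max_right _ _) hn)]
  zero_mem' := fun v => ⟨0, fun n _ => by simp⟩
  smul_mem' := by
    intro a A hA v
    obtain ⟨N, hN⟩ := hA v
    exact ⟨N, fun n hn => by simp [hN n hn]⟩

instance : AddCommGroup (Fields W) := inferInstance

instance : Module ℂ (Fields W) := inferInstance

/-- The mode `A₍ₙ₎`, the coefficient of `z^{-n-1}` in `A(z)`. -/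
def mode (A : Fields W) (n : ℤ) : Module.End ℂ W := A.1 n

theorem mode_trunc (A : Fields W) (v : W) : ∃ N : ℤ, ∀ n : ℤ, N ≤ n → mode A n v = 0 := A.2 v

@[simp] theorem mode_add (A B : Fields W) (n : ℤ) : mode (A + B) n = mode A n + mode B n := rfl
@[simp] theorem mode_sub (A B : Fields W) (n : ℤ) : mode (A - B) n = mode A n - mode B n := rfl
@[simp] theorem mode_smul (a : ℂ) (A : Fields W) (n : ℤ) : mode (a • A) n = a • mode A n := rfl

theorem Fields.ext {A B : Fields W} (h : ∀ n v, mode A n v = mode B n v) : A = B :=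
  Subtype.ext (funext fun n => LinearMap.ext fun v => h n v)

/-- The derivative `∂A(z) = ∑ₙ -n A₍ₙ₋₁₎ z^{-n-1}`. -/
def deriv (A : Fields W) : Fields W :=
  ⟨fun n => (-(n : ℂ)) • mode A (n - 1), by
    intro v
    obtain ⟨N, hN⟩ := mode_trunc A v
    exact ⟨N + 1, fun n hn => by simp [hN (n - 1) (by omega)]⟩⟩

theorem mode_deriv (A : Fields W) (n : ℤ) :
    mode (deriv A) n = (-(n : ℂ)) • mode A (n - 1) := rfl

/-- The `i`-th term of the normal ordered product, applied to a vector. -/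
def normalTerm (ε : ℂ) (A B : Fields W) (n : ℤ) (i : ℕ) : Module.End ℂ W :=
  mode A (-1 - i) * mode B (n + i) + ε • (mode B (n - 1 - i) * mode A i)

theorem normalTerm_apply (ε : ℂ) (A B : Fields W) (n : ℤ) (i : ℕ) (v : W) :
    normalTerm ε A B n i v =
      mode A (-1 - i) (mode B (n + i) v) + ε • mode B (n - 1 - i) (mode A i v) := rfl

theorem normalTerm_finite (ε : ℂ) (A B : Fields W) (n : ℤ) (v : W) :
    (Function.support fun i => normalTerm ε A B n i v).Finite := by
  obtain ⟨N, hN⟩ := mode_trunc A v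
  obtain ⟨M, hM⟩ := mode_trunc B v
  refine (Set.finite_lt_nat (max N (M - n)).toNat).subset fun i hi => ?_
  by_contra hlt
  simp only [Set.mem_ofPred_eq, not_lt] at hlt
  have h1 : N ≤ (i : ℤ) := by omega
  have h2 : M ≤ n + (i : ℤ) := by omega
  exact hi (by simp [normalTerm_apply, hN _ h1, hM _ h2])

/-- The `n`-th mode of the normal ordered product: on each vector only finitely many terms are
nonzero. -/
def normalMode (ε : ℂ) (A B : Fields W) (n : ℤ) : Module.End ℂ W where
  toFun v := ∑ᶠ i : ℕ, normalTerm ε A B n i v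
  map_add' v w := by
    simp only [map_add]
    exact finsum_add_distrib (normalTerm_finite ε A B n v) (normalTerm_finite ε A B n w)
  map_smul' a v := by
    simp only [map_smul, RingHom.id_apply]
    exact (smul_finsum' a (normalTerm_finite ε A B n v)).symm

/-- The normal ordered product
`(AB)₍ₙ₎ = ∑_{j ≤ -1} A₍ⱼ₎ B₍ₙ₋ⱼ₋₁₎ + ε ∑_{j ≥ 0} B₍ₙ₋ⱼ₋₁₎ A₍ⱼ₎`,
the regular part of `A(z)B(w)` as `z → w`. The sign `ε` is `-1` if both fields are fermionic and
`1` otherwise. -/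
def normalProd (ε : ℂ) (A B : Fields W) : Fields W :=
  ⟨normalMode ε A B, by
    intro v
    obtain ⟨N, hN⟩ := mode_trunc A v
    obtain ⟨M, hM⟩ := mode_trunc B v
    choose K hK using fun i : ℕ => mode_trunc B (mode A (i : ℤ) v)
    obtain ⟨L, hL⟩ : ∃ L : ℤ, ∀ i : ℕ, (i : ℤ) < N → K i ≤ L := by
      obtain ⟨L, hL⟩ := ((Finset.range N.toNat).image K).bddAbove
      exact ⟨L, fun i hi => hL (by
        simp only [Finset.coe_image, Set.mem_image, Finset.coe_range, Set.mem_Iio]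
        exact ⟨i, by omega, rfl⟩)⟩
    refine ⟨max M (L + 1 + max N 0), fun n hn => ?_⟩
    have hz : ∀ i : ℕ, normalTerm ε A B n i v = 0 := by
      intro i
      rw [normalTerm_apply, hM (n + i) (by omega)]
      by_cases hi : (i : ℤ) < N
      · have := hL i hi
        rw [hK i (n - 1 - i) (by omega)]
        simp
      · rw [hN i (by omega)]
        simp
    change ∑ᶠ i : ℕ, normalTerm ε A B n i v = 0
    simp [hz]⟩

theorem normalProd_add_left (ε : ℂ) (A A' B : Fields W) :
    normalProd ε (A + A') B = normalProd ε A B + normalProd ε A' B := by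
  refine Fields.ext fun n v => ?_
  rw [mode_add, LinearMap.add_apply]
  refine Eq.trans ?_ (finsum_add_distrib (normalTerm_finite ε A B n v)
    (normalTerm_finite ε A' B n v))
  refine finsum_congr fun i => ?_
  simp only [normalTerm_apply, mode_add, LinearMap.add_apply, map_add, smul_add]
  abel

theorem normalProd_add_right (ε : ℂ) (A B B' : Fields W) :
    normalProd ε A (B + B') = normalProd ε A B + normalProd ε A B' := by
  refine Fields.ext fun n v => ?_
  rw [mode_add, LinearMap.add_apply]
  refine Eq.trans ?_ (finsum_add_distrib (normalTerm_finite ε A B n v)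
    (normalTerm_finite ε A B' n v))
  refine finsum_congr fun i => ?_
  simp only [normalTerm_apply, mode_add, LinearMap.add_apply, map_add, smul_add]
  abel

theorem normalProd_smul_left (ε : ℂ) (a : ℂ) (A B : Fields W) :
    normalProd ε (a • A) B = a • normalProd ε A B := by
  refine Fields.ext fun n v => ?_
  rw [mode_smul, LinearMap.smul_apply]
  refine Eq.trans ?_ (smul_finsum' a (normalTerm_finite ε A B n v)).symm
  refine finsum_congr fun i => ?_
  simp only [normalTerm_apply, mode_smul, LinearMap.smul_apply, map_smul, smul_add,
    smul_comm ε a]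

theorem normalProd_smul_right (ε : ℂ) (a : ℂ) (A B : Fields W) :
    normalProd ε A (a • B) = a • normalProd ε A B := by
  refine Fields.ext fun n v => ?_
  rw [mode_smul, LinearMap.smul_apply]
  refine Eq.trans ?_ (smul_finsum' a (normalTerm_finite ε A B n v)).symm
  refine finsum_congr fun i => ?_
  simp only [normalTerm_apply, mode_smul, LinearMap.smul_apply, map_smul, smul_add,
    smul_comm ε a]

/-- The normal ordered product as a bilinear map. -/
def normalProdBilin (ε : ℂ) : Fields W →ₗ[ℂ] Fields W →ₗ[ℂ] Fields W :=
  LinearMap.mk₂ ℂ (normalProd ε) (normalProd_add_left ε) (normalProd_smul_left ε)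
    (normalProd_add_right ε) (normalProd_smul_right ε)

/-- `U` intertwines the field `A` with the field `A'`. -/
def Intertwines (U : Module.End ℂ W) (A A' : Fields W) : Prop :=
  ∀ n v, U (mode A n v) = mode A' n (U v)

theorem Intertwines.add {U : Module.End ℂ W} {A A' B B' : Fields W}
    (hA : Intertwines U A A') (hB : Intertwines U B B') : Intertwines U (A + B) (A' + B') := by
  intro n v
  simp [hA n v, hB n v]

theorem Intertwines.sub {U : Module.End ℂ W} {A A' B B' : Fields W}
    (hA : Intertwines U A A') (hB : Intertwines U B B') : Intertwines U (A - B) (A' - B') := by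
  intro n v
  simp [hA n v, hB n v]

theorem Intertwines.smul {U : Module.End ℂ W} {A A' : Fields W} (a : ℂ)
    (hA : Intertwines U A A') : Intertwines U (a • A) (a • A') := by
  intro n v
  simp [hA n v]

theorem Intertwines.sum {ι : Type*} (s : Finset ι) {U : Module.End ℂ W} {A A' : ι → Fields W}
    (hA : ∀ i, Intertwines U (A i) (A' i)) :
    Intertwines U (∑ i ∈ s, A i) (∑ i ∈ s, A' i) := by
  classical
  induction s using Finset.induction_on with
  | empty =>
    intro n v
    exact map_zero U
  | insert i s hi ih =>
    rw [Finset.sum_insert hi, Finset.sum_insert hi]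
    exact (hA i).add ih

theorem Intertwines.deriv {U : Module.End ℂ W} {A A' : Fields W}
    (hA : Intertwines U A A') : Intertwines U (deriv A) (deriv A') := by
  intro n v
  simp [mode_deriv, hA (n - 1) v]

theorem Intertwines.normalProd {U : Module.End ℂ W} {A A' B B' : Fields W} (ε : ℂ)
    (hA : Intertwines U A A') (hB : Intertwines U B B') :
    Intertwines U (normalProd ε A B) (normalProd ε A' B') := by
  intro n v
  refine (U.toAddMonoidHom.map_finsum (normalTerm_finite ε A B n v)).trans
    (finsum_congr fun i => ?_)
  have h1 := hA (-1 - i) (mode B (n + i) v)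
  have h2 := hB (n + i) v
  have h3 := hB (n - 1 - i) (mode A (i : ℤ) v)
  have h4 := hA (i : ℤ) v
  simp only [LinearMap.toAddMonoidHom_coe, normalTerm_apply, map_add, map_smul, h1, h2, h3, h4]

theorem mode_normalProd (ε : ℂ) (A B : Fields W) (n : ℤ) (v : W) :
    mode (normalProd ε A B) n v = ∑ᶠ i : ℕ, normalTerm ε A B n i v := rfl

end Fields

/-! ### The Fock space -/

/-- The bosonic creation operators, for `μ ∈ {0, …, 25}` and `k = 0, 1, 2, …`:
`x μ k` stands for `x^μ_{-(k+1)}` and `pi μ k` for `(π_μ)_{-(k+1)}`. -/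
inductive Osc : Type
  | x (μ : Fin 26) (k : ℕ)
  | pi (μ : Fin 26) (k : ℕ)

/-- The number `k` of an oscillator. -/
def Osc.idx : Osc → ℕ
  | .x _ k => k
  | .pi _ k => k

/-- The fermionic creation operators: for `k = 0, 1, 2, …`, `(0, k)` stands for `c_{1-k}`,
`(1, k)` for `C_{1-k}`, `(2, k)` for `b_{-2-k}` and `(3, k)` for `B_{-2-k}`. In each case this is
the mode `₍₋₁₋ₖ₎` of the field. They are ordered lexicographically. -/
abbrev Ghost : Type := Fin 4 ×ₗ ℕ

/-- The Fock space of states obtained from `|p⟩` by the action of the creation operators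
`x^μ_{n ≤ -1}`, `(π_μ)_{n ≤ -1}`, `b_{n ≤ -2}`, `B_{n ≤ -2}`, `c_{n ≤ 1}`, `C_{n ≤ 1}`: polynomials in
the bosonic creation operators with values in the exterior algebra on the fermionic ones. -/
def Fock : Type := Finset Ghost →₀ MvPolynomial Osc ℂ

instance : AddCommGroup Fock :=
  inferInstanceAs (AddCommGroup (Finset Ghost →₀ MvPolynomial Osc ℂ))

instance : Module ℂ Fock := inferInstanceAs (Module ℂ (Finset Ghost →₀ MvPolynomial Osc ℂ))

/-- The state `f g₁ g₂ ⋯ gᵣ |p⟩`, where `f` is a polynomial in the bosonic creation operators and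
`S = {g₁ < ⋯ < gᵣ}`. -/
def state (S : Finset Ghost) : MvPolynomial Osc ℂ →ₗ[ℂ] Fock :=
  Finsupp.lsingle (M := MvPolynomial Osc ℂ) (R := ℂ) S

/-- The coefficient of `g₁ g₂ ⋯ gᵣ |p⟩`, `S = {g₁ < ⋯ < gᵣ}`, in a state. -/
def coeff (S : Finset Ghost) : Fock →ₗ[ℂ] MvPolynomial Osc ℂ :=
  Finsupp.lapply (M := MvPolynomial Osc ℂ) (R := ℂ) S

/-- The operator on the Fock space with given values on the states `state S f`. -/
def lift (F : Finset Ghost → MvPolynomial Osc ℂ →ₗ[ℂ] Fock) : Module.End ℂ Fock :=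
  Finsupp.lsum (M := MvPolynomial Osc ℂ) (R := ℂ) ℂ F

theorem lift_state (F : Finset Ghost → MvPolynomial Osc ℂ →ₗ[ℂ] Fock) (S : Finset Ghost)
    (f : MvPolynomial Osc ℂ) : lift F (state S f) = F S f :=
  Finsupp.lsum_single (M := MvPolynomial Osc ℂ) (R := ℂ) ℂ F S f

theorem coeff_state (S S' : Finset Ghost) (f : MvPolynomial Osc ℂ) :
    coeff S' (state S f) = if S = S' then f else 0 := by
  classical
  exact Finsupp.single_apply

theorem Fock.ext {v w : Fock} (h : ∀ S, coeff S v = coeff S w) : v = w := Finsupp.ext h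

theorem Fock.hom_ext {A B : Module.End ℂ Fock} (h : ∀ S f, A (state S f) = B (state S f)) :
    A = B :=
  Finsupp.lhom_ext (M := MvPolynomial Osc ℂ) (R := ℂ) h

theorem Fock.finite_support (v : Fock) : {S | coeff S v ≠ 0}.Finite :=
  Finsupp.hasFiniteSupport (M := MvPolynomial Osc ℂ) v

theorem Fock.eq_sum (v : Fock) : v = ∑ S ∈ v.finite_support.toFinset, state S (coeff S v) := by
  classical
  refine Fock.ext fun S => ?_
  simp only [map_sum, coeff_state]
  rw [Finset.sum_ite_eq']
  by_cases h : coeff S v = 0 <;> simp [h]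

/-- A bosonic operator on the Fock space. -/
def bos (f : Module.End ℂ (MvPolynomial Osc ℂ)) : Module.End ℂ Fock := lift fun S => state S ∘ₗ f

theorem coeff_bos (f : Module.End ℂ (MvPolynomial Osc ℂ)) (S : Finset Ghost) (v : Fock) :
    coeff S (bos f v) = f (coeff S v) := by
  classical
  rw [v.eq_sum]
  simp only [map_sum, bos, lift_state, LinearMap.comp_apply, coeff_state]
  refine Finset.sum_congr rfl fun S' _ => ?_
  split_ifs <;> simp

/-- The number of fermionic creation operators in `S` that stand before `g`, as a sign. -/
def ghostSign (g : Ghost) (S : Finset Ghost) : ℂ := (-1) ^ (S.filter (· < g)).card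

/-- The fermionic creation operator `g`: left multiplication by `g`. -/
def create (g : Ghost) : Module.End ℂ Fock :=
  lift fun S => if g ∈ S then 0 else ghostSign g S • state (insert g S)

/-- The fermionic annihilation operator, which anticommutes with all fermionic creation operators
except for `g`, with which its anticommutator is `1`, and kills `|p⟩`. -/
def annihilate (g : Ghost) : Module.End ℂ Fock :=
  lift fun S => if g ∈ S then ghostSign g S • state (S.erase g) else 0

theorem exists_pderiv_bound (v : Fock) :
    ∃ N : ℕ, ∀ o : Osc, N ≤ o.idx → bos (MvPolynomial.pderiv o).toLinearMap v = 0 := by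
  classical
  obtain ⟨N, hN⟩ := ((v.finite_support.toFinset.biUnion fun S =>
    (coeff S v).vars).image Osc.idx).bddAbove
  refine ⟨N + 1, fun o ho => Fock.ext fun S => ?_⟩
  rw [coeff_bos, map_zero]
  change MvPolynomial.pderiv o (coeff S v) = 0
  by_cases hS : coeff S v = 0
  · simp [hS]
  refine MvPolynomial.pderiv_eq_zero_of_notMem_vars fun hmem => ?_
  have h := hN (a := o.idx) (by
    simp only [Finset.coe_image, Set.mem_image, Finset.mem_coe, Finset.mem_biUnion]
    exact ⟨o, ⟨S, by simpa using hS, hmem⟩, rfl⟩)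
  omega

theorem exists_annihilate_bound (v : Fock) :
    ∃ N : ℕ, ∀ (t : Fin 4) (k : ℕ), N ≤ k → annihilate (toLex (t, k)) v = 0 := by
  classical
  obtain ⟨N, hN⟩ := ((v.finite_support.toFinset.biUnion fun S => S).image
    fun g => (ofLex g).2).bddAbove
  refine ⟨N + 1, fun t k hk => ?_⟩
  rw [v.eq_sum, map_sum]
  refine Finset.sum_eq_zero fun S hS => ?_
  have hmem : toLex (t, k) ∉ S := fun hmem => by
    have h := hN (a := k) (by
      simp only [Finset.coe_image, Set.mem_image, Finset.mem_coe, Finset.mem_biUnion]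
      exact ⟨toLex (t, k), ⟨S, hS, hmem⟩, rfl⟩)
    omega
  rw [annihilate, lift_state, if_neg hmem]
  rfl

/-! ### The elementary fields -/

/-- The modes of `∂X^μ(z) = ∑ₙ -n x^μ_n z^{-n-1}`. Here `x^μ_n`, `n ≥ 1`, acts as
`-∂/∂(π_μ)_{-n}`, since `[(π_μ)_{-n}, x^μ_n] = 1`. -/
def dXMode (μ : Fin 26) (n : ℤ) : Module.End ℂ Fock :=
  if n < 0 then
    (-(n : ℂ)) • bos (LinearMap.mulLeft ℂ (MvPolynomial.X (.x μ (-n - 1).toNat)))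
  else if n = 0 then 0
  else (n : ℂ) • bos (MvPolynomial.pderiv (.pi μ (n - 1).toNat)).toLinearMap

/-- The field `∂X^μ(z)`. -/
def dX (μ : Fin 26) : Fields Fock :=
  ⟨dXMode μ, fun v => by
    obtain ⟨N, hN⟩ := exists_pderiv_bound v
    refine ⟨N + 1, fun n hn => ?_⟩
    have h1 : ¬ n < 0 := by omega
    have h2 : n ≠ 0 := by omega
    rw [dXMode, if_neg h1, if_neg h2, LinearMap.smul_apply,
      hN (.pi μ (n - 1).toNat) (show N ≤ (n - 1).toNat by omega), smul_zero]⟩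

/-- The modes of `Π_μ(z) = ∑ₙ (π_μ)_n z^{-n-1}` at momentum `p`: `(π_μ)_0` acts as `i p_μ`, and
`(π_μ)_n`, `n ≥ 1`, acts as `∂/∂x^μ_{-n}`, since `[(π_μ)_n, x^μ_{-n}] = 1`. -/
def piMode (p : Fin 26 → ℝ) (μ : Fin 26) (n : ℤ) : Module.End ℂ Fock :=
  if n < 0 then bos (LinearMap.mulLeft ℂ (MvPolynomial.X (.pi μ (-n - 1).toNat)))
  else if n = 0 then (Complex.I * (p μ : ℂ)) • (1 : Module.End ℂ Fock)
  else bos (MvPolynomial.pderiv (.x μ (n - 1).toNat)).toLinearMap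

/-- The field `Π_μ(z)` at momentum `p`. -/
def Pi (p : Fin 26 → ℝ) (μ : Fin 26) : Fields Fock :=
  ⟨piMode p μ, fun v => by
    obtain ⟨N, hN⟩ := exists_pderiv_bound v
    refine ⟨N + 1, fun n hn => ?_⟩
    have h1 : ¬ n < 0 := by omega
    have h2 : n ≠ 0 := by omega
    rw [piMode, if_neg h1, if_neg h2,
      hN (.x μ (n - 1).toNat) (show N ≤ (n - 1).toNat by omega)]⟩

/-- The modes of a ghost field of type `t`, whose conjugate ghost field has type `t'`. In terms of the
modes `₍ₙ₎` the brackets `[b_m, c_n] = δ_{m+n,0}` read `[b₍ₘ₎, c₍ₙ₎] = δ_{m+n,-1}`. -/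
def ghostMode (t t' : Fin 4) (n : ℤ) : Module.End ℂ Fock :=
  if n < 0 then create (toLex (t, (-n - 1).toNat)) else annihilate (toLex (t', n.toNat))

/-- The ghost field of type `t`, whose conjugate ghost field has type `t'`. -/
def ghostField (t t' : Fin 4) : Fields Fock :=
  ⟨ghostMode t t', fun v => by
    obtain ⟨N, hN⟩ := exists_annihilate_bound v
    refine ⟨N, fun n hn => ?_⟩
    have h1 : ¬ n < 0 := by omega
    rw [ghostMode, if_neg h1, hN _ _ (show N ≤ n.toNat by omega)]⟩

/-- `c(z) = ∑ₙ c_n z^{-n+1}`, of weight `-1`, so that `c_n = c₍ₙ₋₂₎`. -/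
def ghc : Fields Fock := ghostField 0 2
/-- `C(z) = ∑ₙ C_n z^{-n+1}`, of weight `-1`, so that `C_n = C₍ₙ₋₂₎`. -/
def ghC : Fields Fock := ghostField 1 3
/-- `b(z) = ∑ₙ b_n z^{-n-2}`, of weight `2`, so that `b_n = b₍ₙ₊₁₎`. -/
def ghb : Fields Fock := ghostField 2 0
/-- `B(z) = ∑ₙ B_n z^{-n-2}`, of weight `2`, so that `B_n = B₍ₙ₊₁₎`. -/
def ghB : Fields Fock := ghostField 3 1

/-! ### The BRST current and the relative complex -/

/-- `T = ∂X^μ Π_μ`. -/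
def matterT (p : Fin 26 → ℝ) : Fields Fock := ∑ μ : Fin 26, normalProd 1 (dX μ) (Pi p μ)

/-- `M = ½ Π_0 Π_0 - ½ τ² ∂X^i ∂X^i`, `i` running over `1, …, 25`. -/
def matterM (τ : ℝ) (p : Fin 26 → ℝ) : Fields Fock :=
  (1 / 2 : ℂ) • normalProd 1 (Pi p 0) (Pi p 0) -
    (1 / 2 * (τ : ℂ) ^ 2) • ∑ i : Fin 25, normalProd 1 (dX i.succ) (dX i.succ)

/-- `T^gh = -2 b ∂c - ∂b c - 2 B ∂C - ∂B C`. -/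
def ghostT : Fields Fock :=
  (-2 : ℂ) • normalProd (-1) ghb (deriv ghc) - normalProd (-1) (deriv ghb) ghc
    - (2 : ℂ) • normalProd (-1) ghB (deriv ghC) - normalProd (-1) (deriv ghB) ghC

/-- `M^gh = -2 B ∂c - ∂B c`. -/
def ghostM : Fields Fock :=
  (-2 : ℂ) • normalProd (-1) ghB (deriv ghc) - normalProd (-1) (deriv ghB) ghc

/-- The BRST current `J = c T + C M + ½ c T^gh + ½ C M^gh`. -/
def brstCurrent (τ : ℝ) (p : Fin 26 → ℝ) : Fields Fock :=
  normalProd 1 ghc (matterT p) + normalProd 1 ghC (matterM τ p)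
    + (1 / 2 : ℂ) • normalProd 1 ghc ghostT + (1 / 2 : ℂ) • normalProd 1 ghC ghostM

/-- The BRST differential: the zero mode of the BRST current, which has weight `1`. -/
def brst (τ : ℝ) (p : Fin 26 → ℝ) : Module.End ℂ Fock := mode (brstCurrent τ p) 0

/-- The antighost zero mode `b_0`. -/
def bZero : Module.End ℂ Fock := mode ghb 1

/-- `L_0^tot`, the zero mode of `T^tot = T + T^gh`, which has weight `2`. -/
def LZero (p : Fin 26 → ℝ) : Module.End ℂ Fock := mode (matterT p + ghostT) 1

/-- The ghost number of a monomial in the ghosts: `1` for `c`, `C` and `-1` for `b`, `B`. -/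
def ghostNumber (S : Finset Ghost) : ℤ := ∑ g ∈ S, if (ofLex g).1 < 2 then 1 else -1

/-- The states of ghost number `n`. -/
def ghostGrade (n : ℤ) : Submodule ℂ Fock where
  carrier := {v | ∀ S : Finset Ghost, ghostNumber S ≠ n → coeff S v = 0}
  add_mem' := fun {v w} hv hw S hS => by rw [map_add, hv S hS, hw S hS, add_zero]
  zero_mem' := fun S _ => map_zero _
  smul_mem' := fun a v hv S hS => by rw [map_smul, hv S hS, smul_zero]

/-- The relative cochains `C_rel^n(p)`: the states of ghost number `n` in
`ker b_0 ∩ ker L_0^tot`. -/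
def Crel (p : Fin 26 → ℝ) (n : ℤ) : Submodule ℂ Fock :=
  LinearMap.ker bZero ⊓ LinearMap.ker (LZero p) ⊓ ghostGrade n

/-- The relative cocycles `Z_rel^n(p)`. -/
def Zrel (τ : ℝ) (p : Fin 26 → ℝ) (n : ℤ) : Submodule ℂ Fock :=
  Crel p n ⊓ LinearMap.ker (brst τ p)

/-- The relative coboundaries `B_rel^n(p)`. -/
def Brel (τ : ℝ) (p : Fin 26 → ℝ) (n : ℤ) : Submodule ℂ Fock :=
  (Crel p (n - 1)).map (brst τ p)

/-! ### Transverse rotations -/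

/-- The group `SO(25)` of transverse rotations. -/
abbrev SO25 : Type := Matrix.specialOrthogonalGroup (Fin 25) ℝ

/-- The stabiliser of `p = (p_0, 𝐩)` in `SO(25)`, where `R · (p_0, 𝐩) = (p_0, R 𝐩)`. -/
def Stab (p : Fin 26 → ℝ) : Subgroup SO25 where
  carrier := {R | Matrix.mulVec R.1 (Fin.tail p) = Fin.tail p}
  mul_mem' := by
    intro R S hR hS
    simp only [Set.mem_ofPred_eq] at *
    rw [Submonoid.coe_mul, ← Matrix.mulVec_mulVec, hS, hR]
  one_mem' := by simp
  inv_mem' := by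
    intro R hR
    simp only [Set.mem_ofPred_eq] at *
    have h : ((R⁻¹ : SO25) * R : SO25).1 = 1 := by rw [inv_mul_cancel]; rfl
    rw [Submonoid.coe_mul] at h
    conv_lhs => rw [← hR]
    rw [Matrix.mulVec_mulVec, h, Matrix.one_mulVec]

/-- The action of a rotation on the oscillators: `x^0` and `π_0` are invariant, `x^i` and `π_i` are
vectors. -/
def rotOsc (R : Matrix (Fin 25) (Fin 25) ℝ) : Osc → MvPolynomial Osc ℂ
  | .x μ k => Fin.cases (MvPolynomial.X (.x 0 k))
      (fun i => ∑ j : Fin 25, (R j i : ℂ) • MvPolynomial.X (.x j.succ k)) μ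
  | .pi μ k => Fin.cases (MvPolynomial.X (.pi 0 k))
      (fun i => ∑ j : Fin 25, (R j i : ℂ) • MvPolynomial.X (.pi j.succ k)) μ

/-- The action of a rotation on polynomials in the oscillators. -/
def rotPoly (R : Matrix (Fin 25) (Fin 25) ℝ) : MvPolynomial Osc ℂ →ₐ[ℂ] MvPolynomial Osc ℂ :=
  MvPolynomial.aeval (rotOsc R)

/-- The action of a rotation on states; it fixes the ghosts. -/
def rot (R : Matrix (Fin 25) (Fin 25) ℝ) : Module.End ℂ Fock := bos (rotPoly R).toLinearMap

theorem rotPoly_x (R : Matrix (Fin 25) (Fin 25) ℝ) (i : Fin 25) (k : ℕ) :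
    rotPoly R (MvPolynomial.X (.x i.succ k)) =
      ∑ j : Fin 25, (R j i : ℂ) • MvPolynomial.X (.x j.succ k) := by
  simp [rotPoly, rotOsc]

theorem rotPoly_x_zero (R : Matrix (Fin 25) (Fin 25) ℝ) (k : ℕ) :
    rotPoly R (MvPolynomial.X (.x 0 k)) = MvPolynomial.X (.x 0 k) := by
  simp [rotPoly, rotOsc]

theorem rotPoly_pi (R : Matrix (Fin 25) (Fin 25) ℝ) (i : Fin 25) (k : ℕ) :
    rotPoly R (MvPolynomial.X (.pi i.succ k)) =
      ∑ j : Fin 25, (R j i : ℂ) • MvPolynomial.X (.pi j.succ k) := by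
  simp [rotPoly, rotOsc]

theorem rotPoly_pi_zero (R : Matrix (Fin 25) (Fin 25) ℝ) (k : ℕ) :
    rotPoly R (MvPolynomial.X (.pi 0 k)) = MvPolynomial.X (.pi 0 k) := by
  simp [rotPoly, rotOsc]

theorem rotPoly_one : rotPoly 1 = AlgHom.id ℂ (MvPolynomial Osc ℂ) := by
  refine MvPolynomial.algHom_ext fun o => ?_
  obtain ⟨μ, k⟩ | ⟨μ, k⟩ := o <;> refine Fin.cases ?_ (fun i => ?_) μ
  · simp [rotPoly_x_zero]
  · simp [rotPoly_x, Matrix.one_apply]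
  · simp [rotPoly_pi_zero]
  · simp [rotPoly_pi, Matrix.one_apply]

theorem rotPoly_mul (R S : Matrix (Fin 25) (Fin 25) ℝ) :
    rotPoly (R * S) = (rotPoly R).comp (rotPoly S) := by
  refine MvPolynomial.algHom_ext fun o => ?_
  obtain ⟨μ, k⟩ | ⟨μ, k⟩ := o <;> refine Fin.cases ?_ (fun i => ?_) μ
  · simp [rotPoly_x_zero]
  · simp only [rotPoly_x, AlgHom.comp_apply, map_sum, map_smul, Finset.smul_sum, smul_smul]
    rw [Finset.sum_comm]
    refine Finset.sum_congr rfl fun j _ => ?_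
    rw [← Finset.sum_smul]
    simp [Matrix.mul_apply, mul_comm]
  · simp [rotPoly_pi_zero]
  · simp only [rotPoly_pi, AlgHom.comp_apply, map_sum, map_smul, Finset.smul_sum, smul_smul]
    rw [Finset.sum_comm]
    refine Finset.sum_congr rfl fun j _ => ?_
    rw [← Finset.sum_smul]
    simp [Matrix.mul_apply, mul_comm]

/-- The states at momentum `p` as a representation of the stabiliser of `p`. -/
def fockRep (p : Fin 26 → ℝ) : Representation ℂ (Stab p) Fock where
  toFun g := rot g.1.1
  map_one' := by
    refine LinearMap.ext fun v => Fock.ext fun S => ?_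
    refine (coeff_bos _ S v).trans ?_
    change rotPoly 1 (coeff S v) = coeff S v
    rw [rotPoly_one]
    rfl
  map_mul' g h := by
    refine LinearMap.ext fun v => Fock.ext fun S => ?_
    refine (coeff_bos _ S v).trans (Eq.symm ((coeff_bos _ S _).trans ?_))
    change rotPoly g.1.1 (coeff S (rot h.1.1 v)) = rotPoly (g.1.1 * h.1.1) (coeff S v)
    rw [rot, coeff_bos, rotPoly_mul]
    rfl

theorem fockRep_apply (p : Fin 26 → ℝ) (g : Stab p) (v : Fock) :
    fockRep p g v = rot g.1.1 v := rfl

theorem sum_orth {R : Matrix (Fin 25) (Fin 25) ℝ} (hR : R.transpose * R = 1) (i k : Fin 25) :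
    ∑ j : Fin 25, (R j i : ℂ) * (R j k : ℂ) = if i = k then 1 else 0 := by
  have h := congrFun (congrFun hR i) k
  simp only [Matrix.mul_apply, Matrix.transpose_apply, Matrix.one_apply] at h
  have h' := congrArg (fun t : ℝ => (t : ℂ)) h
  push_cast at h'
  rw [h']
  split <;> simp

theorem stab_orth {p : Fin 26 → ℝ} (g : Stab p) : g.1.1.transpose * g.1.1 = 1 := g.1.2.1.1

theorem stab_orth' {p : Fin 26 → ℝ} (g : Stab p) : g.1.1 * g.1.1.transpose = 1 := g.1.2.1.2


theorem stab_fix {p : Fin 26 → ℝ} (g : Stab p) (i : Fin 25) :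
    ∑ j : Fin 25, (g.1.1 j i : ℂ) * (p j.succ : ℂ) = (p i.succ : ℂ) := by
  have h : Matrix.mulVec g.1.1.transpose (Fin.tail p) = Fin.tail p := by
    have h1 : Matrix.mulVec g.1.1 (Fin.tail p) = Fin.tail p := g.2
    conv_lhs => rw [← h1]
    rw [Matrix.mulVec_mulVec, stab_orth, Matrix.one_mulVec]
  have h2 := congrArg (fun t : ℝ => (t : ℂ)) (congrFun h i)
  simp only [Matrix.mulVec, dotProduct, Matrix.transpose_apply, Fin.tail] at h2
  push_cast at h2
  exact h2

theorem coeff_rot (R : Matrix (Fin 25) (Fin 25) ℝ) (S : Finset Ghost) (v : Fock) :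
    coeff S (rot R v) = rotPoly R (coeff S v) := coeff_bos _ S v

theorem mode_sum {ι : Type*} (s : Finset ι) (A : ι → Fields Fock) (n : ℤ) (v : Fock) :
    mode (∑ i ∈ s, A i) n v = ∑ i ∈ s, mode (A i) n v := by
  classical
  induction s using Finset.induction_on with
  | empty => rfl
  | insert i s hi ih => rw [Finset.sum_insert hi, Finset.sum_insert hi, ← ih]; rfl

theorem algHom_derivation (φ : MvPolynomial Osc ℂ →ₐ[ℂ] MvPolynomial Osc ℂ)
    (D D' : Derivation ℂ (MvPolynomial Osc ℂ) (MvPolynomial Osc ℂ))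
    (h : ∀ o, φ (D (MvPolynomial.X o)) = D' (φ (MvPolynomial.X o))) (f : MvPolynomial Osc ℂ) :
    φ (D f) = D' (φ f) := by
  induction f using MvPolynomial.induction_on with
  | C a => simp [MvPolynomial.algHom_C, MvPolynomial.derivation_C]
  | add f g hf hg => simp [hf, hg]
  | mul_X f o hf => simp [hf, h o]

theorem derivation_sum_apply {ι : Type*} (s : Finset ι) (a : ι → ℂ)
    (D : ι → Derivation ℂ (MvPolynomial Osc ℂ) (MvPolynomial Osc ℂ)) (f : MvPolynomial Osc ℂ) :
    (∑ j ∈ s, a j • D j) f = ∑ j ∈ s, a j • D j f := by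
  classical
  induction s using Finset.induction_on with
  | empty => simp
  | insert i s hi ih => rw [Finset.sum_insert hi, Finset.sum_insert hi, ← ih]; rfl

theorem rotPoly_pderiv_x {R : Matrix (Fin 25) (Fin 25) ℝ} (hR : R * R.transpose = 1)
    (i : Fin 25) (k : ℕ) (f : MvPolynomial Osc ℂ) :
    rotPoly R (MvPolynomial.pderiv (.x i.succ k) f) =
      ∑ j : Fin 25, (R j i : ℂ) • MvPolynomial.pderiv (.x j.succ k) (rotPoly R f) := by
  classical
  rw [← derivation_sum_apply]
  refine algHom_derivation _ _ _ (fun o => ?_) f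
  rw [derivation_sum_apply]
  have hR' : R.transpose * R = 1 := mul_eq_one_comm.mp hR
  obtain ⟨μ, l⟩ | ⟨μ, l⟩ := o <;> refine Fin.cases ?_ (fun m => ?_) μ
  · simp [rotPoly_x_zero, MvPolynomial.pderiv_X]
  · by_cases hkl : l = k
    · subst hkl
      have h1 : ∀ j : Fin 25, MvPolynomial.pderiv (.x j.succ l)
          (rotPoly R (MvPolynomial.X (.x m.succ l))) = MvPolynomial.C (R j m : ℂ) := fun j => by
        simp [rotPoly_x, MvPolynomial.pderiv_X, Pi.single_apply, MvPolynomial.C_eq_smul_one]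
      simp only [h1, MvPolynomial.smul_eq_C_mul, ← map_mul, ← map_sum, sum_orth hR']
      by_cases him : i = m
      · subst him
        simp
      · simp [him, MvPolynomial.pderiv_X, Ne.symm him]
    · simp [rotPoly_x, MvPolynomial.pderiv_X, hkl]
  · simp [rotPoly_pi_zero, MvPolynomial.pderiv_X]
  · simp [rotPoly_pi, MvPolynomial.pderiv_X]

theorem rotPoly_pderiv_x_zero (R : Matrix (Fin 25) (Fin 25) ℝ) (k : ℕ) (f : MvPolynomial Osc ℂ) :
    rotPoly R (MvPolynomial.pderiv (.x 0 k) f) = MvPolynomial.pderiv (.x 0 k) (rotPoly R f) := by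
  classical
  refine algHom_derivation _ _ _ (fun o => ?_) f
  obtain ⟨μ, l⟩ | ⟨μ, l⟩ := o <;> refine Fin.cases ?_ (fun m => ?_) μ
  · by_cases hkl : l = k
    · subst hkl
      simp [rotPoly_x_zero]
    · simp [rotPoly_x_zero, MvPolynomial.pderiv_X, hkl]
  · simp [rotPoly_x, MvPolynomial.pderiv_X]
  · simp [rotPoly_pi_zero, MvPolynomial.pderiv_X]
  · simp [rotPoly_pi, MvPolynomial.pderiv_X]

theorem rotPoly_pderiv_pi {R : Matrix (Fin 25) (Fin 25) ℝ} (hR : R * R.transpose = 1)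
    (i : Fin 25) (k : ℕ) (f : MvPolynomial Osc ℂ) :
    rotPoly R (MvPolynomial.pderiv (.pi i.succ k) f) =
      ∑ j : Fin 25, (R j i : ℂ) • MvPolynomial.pderiv (.pi j.succ k) (rotPoly R f) := by
  classical
  rw [← derivation_sum_apply]
  refine algHom_derivation _ _ _ (fun o => ?_) f
  rw [derivation_sum_apply]
  have hR' : R.transpose * R = 1 := mul_eq_one_comm.mp hR
  obtain ⟨μ, l⟩ | ⟨μ, l⟩ := o <;> refine Fin.cases ?_ (fun m => ?_) μ
  · simp [rotPoly_x_zero, MvPolynomial.pderiv_X]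
  · simp [rotPoly_x, MvPolynomial.pderiv_X]
  · simp [rotPoly_pi_zero, MvPolynomial.pderiv_X]
  · by_cases hkl : l = k
    · subst hkl
      have h1 : ∀ j : Fin 25, MvPolynomial.pderiv (.pi j.succ l)
          (rotPoly R (MvPolynomial.X (.pi m.succ l))) = MvPolynomial.C (R j m : ℂ) := fun j => by
        simp [rotPoly_pi, MvPolynomial.pderiv_X, Pi.single_apply, MvPolynomial.C_eq_smul_one]
      simp only [h1, MvPolynomial.smul_eq_C_mul, ← map_mul, ← map_sum, sum_orth hR']
      by_cases him : i = m
      · subst him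
        simp
      · simp [him, MvPolynomial.pderiv_X, Ne.symm him]
    · simp [rotPoly_pi, MvPolynomial.pderiv_X, hkl]

theorem rotPoly_pderiv_pi_zero (R : Matrix (Fin 25) (Fin 25) ℝ) (k : ℕ) (f : MvPolynomial Osc ℂ) :
    rotPoly R (MvPolynomial.pderiv (.pi 0 k) f) = MvPolynomial.pderiv (.pi 0 k) (rotPoly R f) := by
  classical
  refine algHom_derivation _ _ _ (fun o => ?_) f
  obtain ⟨μ, l⟩ | ⟨μ, l⟩ := o <;> refine Fin.cases ?_ (fun m => ?_) μ
  · simp [rotPoly_x_zero, MvPolynomial.pderiv_X]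
  · simp [rotPoly_x, MvPolynomial.pderiv_X]
  · by_cases hkl : l = k
    · subst hkl
      simp [rotPoly_pi_zero]
    · simp [rotPoly_pi_zero, MvPolynomial.pderiv_X, hkl]
  · simp [rotPoly_pi, MvPolynomial.pderiv_X]

theorem rot_ghostMode (R : Matrix (Fin 25) (Fin 25) ℝ) (t t' : Fin 4) (n : ℤ) (v : Fock) :
    rot R (ghostMode t t' n v) = ghostMode t t' n (rot R v) := by
  suffices h : rot R * ghostMode t t' n = ghostMode t t' n * rot R from LinearMap.congr_fun h v
  refine Fock.hom_ext fun S f => ?_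
  have hr : ∀ (S : Finset Ghost) (f : MvPolynomial Osc ℂ),
      rot R (state S f) = state S (rotPoly R f) := fun S f => lift_state _ S f
  rw [Module.End.mul_apply, Module.End.mul_apply, hr, ghostMode]
  split
  · rw [create, lift_state, lift_state]
    split <;> simp [hr]
  · rw [annihilate, lift_state, lift_state]
    split <;> simp [hr]

theorem rot_dX {p : Fin 26 → ℝ} (g : Stab p) (i : Fin 25) :
    Intertwines (rot g.1.1) (dX i.succ) (∑ j : Fin 25, (g.1.1 j i : ℂ) • dX j.succ) := by
  intro n v
  refine Fock.ext fun S => ?_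
  rw [mode_sum, map_sum]
  change coeff S (rot g.1.1 (dXMode i.succ n v)) =
    ∑ j : Fin 25, (g.1.1 j i : ℂ) • coeff S (dXMode j.succ n (rot g.1.1 v))
  unfold dXMode
  split_ifs
  · simp only [LinearMap.smul_apply, coeff_bos, LinearMap.mulLeft_apply,
      map_smul, map_mul, rotPoly_x, coeff_rot, Finset.sum_mul, Finset.smul_sum,
      smul_mul_assoc, smul_comm (-(n : ℂ))]
  · simp
  · simp only [LinearMap.smul_apply, coeff_bos, map_smul,
      Derivation.coeFn_coe,
      rotPoly_pderiv_pi (stab_orth' g), coeff_rot, Finset.smul_sum, smul_comm (n : ℂ)]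

theorem rot_dX_zero {p : Fin 26 → ℝ} (g : Stab p) :
    Intertwines (rot g.1.1) (dX 0) (dX 0) := by
  intro n v
  refine Fock.ext fun S => ?_
  change coeff S (rot g.1.1 (dXMode 0 n v)) =
    coeff S (dXMode 0 n (rot g.1.1 v))
  unfold dXMode
  split_ifs
  · simp only [LinearMap.smul_apply, coeff_bos, LinearMap.mulLeft_apply,
      map_smul, map_mul, rotPoly_x_zero, coeff_rot]
  · simp
  · simp only [LinearMap.smul_apply, coeff_bos, map_smul,
      Derivation.coeFn_coe, rotPoly_pderiv_pi_zero, coeff_rot]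

theorem rot_Pi {p : Fin 26 → ℝ} (g : Stab p) (i : Fin 25) :
    Intertwines (rot g.1.1) (Pi p i.succ) (∑ j : Fin 25, (g.1.1 j i : ℂ) • Pi p j.succ) := by
  intro n v
  refine Fock.ext fun S => ?_
  rw [mode_sum, map_sum]
  change coeff S (rot g.1.1 (piMode p i.succ n v)) =
    ∑ j : Fin 25, (g.1.1 j i : ℂ) • coeff S (piMode p j.succ n (rot g.1.1 v))
  unfold piMode
  split_ifs
  · simp only [coeff_bos, LinearMap.mulLeft_apply,
      map_mul, rotPoly_pi, coeff_rot, Finset.sum_mul, smul_mul_assoc]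
  · simp only [LinearMap.smul_apply, Module.End.one_apply, map_smul, coeff_rot,
      smul_smul, ← Finset.sum_smul]
    congr 1
    rw [← stab_fix g i, Finset.mul_sum]
    exact Finset.sum_congr rfl fun j _ => by ring
  · simp only [coeff_bos,
      Derivation.coeFn_coe,
      rotPoly_pderiv_x (stab_orth' g), coeff_rot]

theorem rot_Pi_zero {p : Fin 26 → ℝ} (g : Stab p) :
    Intertwines (rot g.1.1) (Pi p 0) (Pi p 0) := by
  intro n v
  refine Fock.ext fun S => ?_
  change coeff S (rot g.1.1 (piMode p 0 n v)) =
    coeff S (piMode p 0 n (rot g.1.1 v))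
  unfold piMode
  split_ifs
  · simp only [coeff_bos, LinearMap.mulLeft_apply, map_mul, rotPoly_pi_zero, coeff_rot]
  · simp only [LinearMap.smul_apply, Module.End.one_apply, map_smul, coeff_rot]
  · simp only [coeff_bos, Derivation.coeFn_coe,
      rotPoly_pderiv_x_zero, coeff_rot]

theorem rot_ghostField (R : Matrix (Fin 25) (Fin 25) ℝ) (t t' : Fin 4) :
    Intertwines (rot R) (ghostField t t') (ghostField t t') := rot_ghostMode R t t'

/-- Contraction of two vectors of fields is invariant under rotations. -/
theorem sum_normalProd_orth {R : Matrix (Fin 25) (Fin 25) ℝ} (hR : R * R.transpose = 1)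
    (A B : Fin 25 → Fields Fock) :
    ∑ i : Fin 25, normalProd 1 (∑ j : Fin 25, (R j i : ℂ) • A j) (∑ k : Fin 25, (R k i : ℂ) • B k)
      = ∑ i : Fin 25, normalProd 1 (A i) (B i) := by
  have hR' : R.transpose.transpose * R.transpose = 1 := by simpa using hR
  change ∑ i : Fin 25, normalProdBilin 1 (∑ j : Fin 25, (R j i : ℂ) • A j)
    (∑ k : Fin 25, (R k i : ℂ) • B k) = ∑ i : Fin 25, normalProdBilin 1 (A i) (B i)
  simp only [map_sum, map_smul, LinearMap.sum_apply, LinearMap.smul_apply, Finset.smul_sum,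
    smul_smul]
  rw [Finset.sum_comm]
  refine Finset.sum_congr rfl fun k _ => ?_
  rw [Finset.sum_comm]
  simp only [← Finset.sum_smul]
  have h := fun j => sum_orth hR' k j
  simp only [Matrix.transpose_apply] at h
  simp [h]

theorem rot_matterT {p : Fin 26 → ℝ} (g : Stab p) :
    Intertwines (rot g.1.1) (matterT p) (matterT p) := by
  have h := ((rot_dX_zero g).normalProd 1 (rot_Pi_zero g)).add
    (Intertwines.sum Finset.univ fun i : Fin 25 => (rot_dX g i).normalProd 1 (rot_Pi g i))
  rw [sum_normalProd_orth (stab_orth' g) (fun j => dX j.succ) (fun j => Pi p j.succ),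
    ← Fin.sum_univ_succ (fun μ => normalProd 1 (dX μ) (Pi p μ))] at h
  exact h

theorem rot_matterM (τ : ℝ) {p : Fin 26 → ℝ} (g : Stab p) :
    Intertwines (rot g.1.1) (matterM τ p) (matterM τ p) := by
  have h := Intertwines.sum Finset.univ fun i : Fin 25 => (rot_dX g i).normalProd 1 (rot_dX g i)
  rw [sum_normalProd_orth (stab_orth' g) (fun j => dX j.succ) (fun j => dX j.succ)] at h
  exact (((rot_Pi_zero g).normalProd 1 (rot_Pi_zero g)).smul _).sub (h.smul _)

theorem rot_ghostT (R : Matrix (Fin 25) (Fin 25) ℝ) : Intertwines (rot R) ghostT ghostT := by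
  have hb := rot_ghostField R 2 0
  have hc := rot_ghostField R 0 2
  have hB := rot_ghostField R 3 1
  have hC := rot_ghostField R 1 3
  exact ((((hb.normalProd _ hc.deriv).smul _).sub (hb.deriv.normalProd _ hc)).sub
    ((hB.normalProd _ hC.deriv).smul _)).sub (hB.deriv.normalProd _ hC)

theorem rot_ghostM (R : Matrix (Fin 25) (Fin 25) ℝ) : Intertwines (rot R) ghostM ghostM := by
  have hc := rot_ghostField R 0 2
  have hB := rot_ghostField R 3 1
  exact ((hB.normalProd _ hc.deriv).smul _).sub (hB.deriv.normalProd _ hc)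

theorem rot_brstCurrent (τ : ℝ) {p : Fin 26 → ℝ} (g : Stab p) :
    Intertwines (rot g.1.1) (brstCurrent τ p) (brstCurrent τ p) := by
  have hc : Intertwines (rot g.1.1) ghc ghc := rot_ghostField g.1.1 0 2
  have hC : Intertwines (rot g.1.1) ghC ghC := rot_ghostField g.1.1 1 3
  have h1 := hc.normalProd 1 (rot_matterT g)
  have h2 := hC.normalProd 1 (rot_matterM τ g)
  have h3 := (hc.normalProd 1 (rot_ghostT g.1.1)).smul (1 / 2)
  have h4 := (hC.normalProd 1 (rot_ghostM g.1.1)).smul (1 / 2)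
  unfold brstCurrent
  exact ((h1.add h2).add h3).add h4

theorem rot_brst (τ : ℝ) {p : Fin 26 → ℝ} (g : Stab p) (v : Fock) :
    rot g.1.1 (brst τ p v) = brst τ p (rot g.1.1 v) := rot_brstCurrent τ g 0 v

theorem Crel_rot {p : Fin 26 → ℝ} (n : ℤ) (g : Stab p) :
    Crel p n ≤ (Crel p n).comap (fockRep p g) := by
  rintro v ⟨⟨hb, hL⟩, hn⟩
  refine ⟨⟨?_, ?_⟩, ?_⟩
  · change bZero (rot g.1.1 v) = 0
    have h := rot_ghostField g.1.1 2 0 1 v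
    have hb' : mode (ghostField 2 0) 1 v = 0 := hb
    rw [hb', map_zero] at h
    exact h.symm
  · change LZero p (rot g.1.1 v) = 0
    have h := ((rot_matterT g).add (rot_ghostT g.1.1)) 1 v
    have hL' : mode (matterT p + ghostT) 1 v = 0 := hL
    rw [hL', map_zero] at h
    exact h.symm
  · intro S hS
    change coeff S (rot g.1.1 v) = 0
    rw [coeff_rot, hn S hS, map_zero]

theorem Zrel_rot (τ : ℝ) {p : Fin 26 → ℝ} (n : ℤ) (g : Stab p) :
    Zrel τ p n ≤ (Zrel τ p n).comap (fockRep p g) := by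
  rintro v ⟨hC, hd⟩
  rw [Submodule.mem_comap]
  refine ⟨Crel_rot n g hC, ?_⟩
  have h := rot_brst τ g v
  rw [LinearMap.mem_ker.mp hd, map_zero] at h
  rw [fockRep_apply]
  exact LinearMap.mem_ker.mpr h.symm

theorem Brel_rot (τ : ℝ) {p : Fin 26 → ℝ} (n : ℤ) (g : Stab p) :
    Brel τ p n ≤ (Brel τ p n).comap (fockRep p g) := by
  rintro _ ⟨v, hv, rfl⟩
  rw [Submodule.mem_comap, fockRep_apply, rot_brst τ g v]
  exact ⟨rot g.1.1 v, Crel_rot (n - 1) g hv, rfl⟩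

/-! ### Cochains, cocycles, coboundaries and cohomology as representations -/

/-- `C_rel^n(p)` as a representation of the stabiliser of `p`. -/
def cochainRep (p : Fin 26 → ℝ) (n : ℤ) : Representation ℂ (Stab p) (Crel p n) :=
  (fockRep p).subrepresentation (Crel p n) (Crel_rot n)

/-- `Z_rel^n(p)` as a representation of the stabiliser of `p`. -/
def cocycleRep (τ : ℝ) (p : Fin 26 → ℝ) (n : ℤ) : Representation ℂ (Stab p) (Zrel τ p n) :=
  (fockRep p).subrepresentation (Zrel τ p n) (Zrel_rot τ n)

/-- `B_rel^n(p)` as a representation of the stabiliser of `p`. -/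
def coboundaryRep (τ : ℝ) (p : Fin 26 → ℝ) (n : ℤ) : Representation ℂ (Stab p) (Brel τ p n) :=
  (fockRep p).subrepresentation (Brel τ p n) (Brel_rot τ n)

/-- The relative cohomology `H_rel^n(p) = Z_rel^n(p) / B_rel^n(p)`. -/
abbrev Hrel (τ : ℝ) (p : Fin 26 → ℝ) (n : ℤ) : Type :=
  Zrel τ p n ⧸ (Brel τ p n).submoduleOf (Zrel τ p n)

/-- `H_rel^n(p)` as a representation of the stabiliser of `p`. -/
def cohomologyRep (τ : ℝ) (p : Fin 26 → ℝ) (n : ℤ) : Representation ℂ (Stab p) (Hrel τ p n) :=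
  (cocycleRep τ p n).quotient ((Brel τ p n).submoduleOf (Zrel τ p n))
    fun g _ hv => Brel_rot τ n g hv

/-! ### The representations in the tables -/

/-- The rotation `R` as a complex matrix. -/
def cplx (R : Matrix (Fin 25) (Fin 25) ℝ) : Matrix (Fin 25) (Fin 25) ℂ := R.map (fun t => (t : ℂ))

theorem cplx_one : cplx 1 = 1 := by
  simp [cplx, Matrix.map_one]

theorem cplx_mul (R S : Matrix (Fin 25) (Fin 25) ℝ) : cplx (R * S) = cplx R * cplx S := by
  ext i j
  simp [cplx, Matrix.mul_apply]

/-- The complex vector representation `ℂ²⁵`. -/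
def vecRep (p : Fin 26 → ℝ) : Representation ℂ (Stab p) (Fin 25 → ℂ) where
  toFun g := (cplx g.1.1).mulVecLin
  map_one' := by
    change (cplx 1).mulVecLin = 1
    rw [cplx_one, Matrix.mulVecLin_one]
    rfl
  map_mul' g h := by
    change (cplx (g.1.1 * h.1.1)).mulVecLin = _
    rw [cplx_mul, Matrix.mulVecLin_mul]
    rfl

/-- The `2`-tensors over `ℂ²⁵`, on which `R` acts by `T ↦ R T Rᵀ`. -/
def tensorRep (p : Fin 26 → ℝ) : Representation ℂ (Stab p) (Matrix (Fin 25) (Fin 25) ℂ) where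
  toFun g :=
    { toFun := fun T => cplx g.1.1 * T * (cplx g.1.1).transpose
      map_add' := fun T U => by rw [Matrix.mul_add, Matrix.add_mul]
      map_smul' := fun a T => by simp }
  map_one' := by
    refine LinearMap.ext fun T => ?_
    change cplx 1 * T * (cplx 1).transpose = T
    simp [cplx_one]
  map_mul' g h := by
    refine LinearMap.ext fun T => ?_
    change cplx (g.1.1 * h.1.1) * T * (cplx (g.1.1 * h.1.1)).transpose =
      cplx g.1.1 * (cplx h.1.1 * T * (cplx h.1.1).transpose) * (cplx g.1.1).transpose
    simp [cplx_mul, Matrix.transpose_mul, Matrix.mul_assoc]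

/-- The spatial momentum `𝐩` as a complex vector. -/
def spatial (p : Fin 26 → ℝ) : Fin 25 → ℂ := fun i => (p i.succ : ℂ)

/-- The transverse vectors `v`, `𝐩 · v = 0`. This is all of `V = ℂ²⁵` if `𝐩 = 0` and `V^⊥` otherwise. -/
def transVec (p : Fin 26 → ℝ) : Submodule ℂ (Fin 25 → ℂ) where
  carrier := {v | spatial p ⬝ᵥ v = 0}
  add_mem' := fun {v w} hv hw => by
    simp only [Set.mem_ofPred_eq] at *
    rw [dotProduct_add, hv, hw, add_zero]
  zero_mem' := by simp
  smul_mem' := fun a v hv => by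
    simp only [Set.mem_ofPred_eq] at *
    rw [dotProduct_smul, hv, smul_zero]

/-- The transverse traceless symmetric tensors, `Tᵀ = T`, `Tr T = 0`, `T 𝐩 = 0`. This is `⊙²₀ V` if
`𝐩 = 0` and `⊙²₀ V^⊥` otherwise. -/
def transSym (p : Fin 26 → ℝ) : Submodule ℂ (Matrix (Fin 25) (Fin 25) ℂ) where
  carrier := {T | T.transpose = T ∧ T.trace = 0 ∧ T.mulVec (spatial p) = 0}
  add_mem' := fun {T U} hT hU => by
    simp only [Set.mem_ofPred_eq] at *
    refine ⟨?_, ?_, ?_⟩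
    · rw [Matrix.transpose_add, hT.1, hU.1]
    · rw [Matrix.trace_add, hT.2.1, hU.2.1, add_zero]
    · rw [Matrix.add_mulVec, hT.2.2, hU.2.2, add_zero]
  zero_mem' := by simp
  smul_mem' := fun a T hT => by
    simp only [Set.mem_ofPred_eq] at *
    refine ⟨?_, ?_, ?_⟩
    · rw [Matrix.transpose_smul, hT.1]
    · rw [Matrix.trace_smul, hT.2.1, smul_zero]
    · rw [Matrix.smul_mulVec, hT.2.2, smul_zero]

/-- The transverse skewsymmetric tensors, `Tᵀ = -T`, `T 𝐩 = 0`. This is `⋀² V` if `𝐩 = 0` and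
`⋀² V^⊥` otherwise. -/
def transSkew (p : Fin 26 → ℝ) : Submodule ℂ (Matrix (Fin 25) (Fin 25) ℂ) where
  carrier := {T | T.transpose = -T ∧ T.mulVec (spatial p) = 0}
  add_mem' := fun {T U} hT hU => by
    simp only [Set.mem_ofPred_eq] at *
    refine ⟨?_, ?_⟩
    · rw [Matrix.transpose_add, hT.1, hU.1, neg_add]
    · rw [Matrix.add_mulVec, hT.2, hU.2, add_zero]
  zero_mem' := by simp
  smul_mem' := fun a T hT => by
    simp only [Set.mem_ofPred_eq] at *
    refine ⟨?_, ?_⟩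
    · rw [Matrix.transpose_smul, hT.1, smul_neg]
    · rw [Matrix.smul_mulVec, hT.2, smul_zero]

theorem cplx_orth {p : Fin 26 → ℝ} (g : Stab p) : (cplx g.1.1).transpose * cplx g.1.1 = 1 := by
  have h : (cplx g.1.1).transpose = cplx g.1.1.transpose := rfl
  rw [h, ← cplx_mul, stab_orth, cplx_one]

theorem cplx_transpose_fix {p : Fin 26 → ℝ} (g : Stab p) :
    (cplx g.1.1).transpose.mulVec (spatial p) = spatial p :=
  funext fun i => stab_fix g i

theorem transVec_rot (p : Fin 26 → ℝ) (g : Stab p) :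
    transVec p ≤ (transVec p).comap (vecRep p g) := by
  intro v hv
  change spatial p ⬝ᵥ (cplx g.1.1).mulVec v = 0
  rw [Matrix.dotProduct_mulVec, ← Matrix.mulVec_transpose, cplx_transpose_fix]
  exact hv

theorem tensor_trans (p : Fin 26 → ℝ) (g : Stab p) (T : Matrix (Fin 25) (Fin 25) ℂ)
    (hT : T.mulVec (spatial p) = 0) :
    (cplx g.1.1 * T * (cplx g.1.1).transpose).mulVec (spatial p) = 0 := by
  rw [← Matrix.mulVec_mulVec, cplx_transpose_fix, ← Matrix.mulVec_mulVec, hT, Matrix.mulVec_zero]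

theorem transSym_rot (p : Fin 26 → ℝ) (g : Stab p) :
    transSym p ≤ (transSym p).comap (tensorRep p g) := by
  rintro T ⟨h1, h2, h3⟩
  refine ⟨?_, ?_, tensor_trans p g T h3⟩
  · change (cplx g.1.1 * T * (cplx g.1.1).transpose).transpose =
      cplx g.1.1 * T * (cplx g.1.1).transpose
    simp [Matrix.transpose_mul, h1, Matrix.mul_assoc]
  · change (cplx g.1.1 * T * (cplx g.1.1).transpose).trace = 0
    rw [Matrix.mul_assoc, Matrix.trace_mul_comm, Matrix.mul_assoc, cplx_orth, Matrix.mul_one, h2]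

theorem transSkew_rot (p : Fin 26 → ℝ) (g : Stab p) :
    transSkew p ≤ (transSkew p).comap (tensorRep p g) := by
  rintro T ⟨h1, h3⟩
  refine ⟨?_, tensor_trans p g T h3⟩
  change (cplx g.1.1 * T * (cplx g.1.1).transpose).transpose =
    -(cplx g.1.1 * T * (cplx g.1.1).transpose)
  simp [Matrix.transpose_mul, h1, Matrix.mul_assoc]

/-- `m` copies of a representation. -/
def copies {G X : Type*} [Monoid G] [AddCommMonoid X] [Module ℂ X] (m : ℕ)
    (ρ : Representation ℂ G X) : Representation ℂ G (Fin m → X) where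
  toFun g := LinearMap.pi fun i => ρ g ∘ₗ LinearMap.proj i
  map_one' := by
    refine LinearMap.ext fun v => funext fun i => ?_
    simp
  map_mul' g h := by
    refine LinearMap.ext fun v => funext fun i => ?_
    simp

/-- The representation `z₁ ℂ ⊕ z₂ V ⊕ z₃ ⊙²₀ V ⊕ z₄ ⋀² V` of the stabiliser of `p`, where for
`𝐩 ≠ 0` the representation `V` is replaced by `V^⊥`. -/
def tableRep (p : Fin 26 → ℝ) (z₁ z₂ z₃ z₄ : ℕ) :
    Representation ℂ (Stab p)
      ((Fin z₁ → ℂ) × (Fin z₂ → transVec p) × (Fin z₃ → transSym p) × (Fin z₄ → transSkew p)) :=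
  (copies z₁ (Representation.trivial ℂ (Stab p) ℂ)).prod
    ((copies z₂ ((vecRep p).subrepresentation (transVec p) (transVec_rot p))).prod
      ((copies z₃ ((tensorRep p).subrepresentation (transSym p) (transSym_rot p))).prod
        (copies z₄ ((tensorRep p).subrepresentation (transSkew p) (transSkew_rot p)))))

/-- `ρ ≅ z₁ ℂ ⊕ z₂ V ⊕ z₃ ⊙²₀ V ⊕ z₄ ⋀² V` as representations of the stabiliser of `p`, where
`z = ![z₁, z₂, z₃, z₄]` and for `𝐩 ≠ 0` the representation `V` is replaced by `V^⊥`. -/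
def Decomposes {p : Fin 26 → ℝ} {X : Type*} [AddCommGroup X] [Module ℂ X]
    (ρ : Representation ℂ (Stab p) X) (z : Fin 4 → ℕ) : Prop :=
  Nonempty (ρ.Equiv (tableRep p (z 0) (z 1) (z 2) (z 3)))

/-- The row of ghost number `n`: the decompositions of the cochains, cocycles, coboundaries and
cohomology at momentum `p`. -/
def TableRow (τ : ℝ) (p : Fin 26 → ℝ) (n : ℤ) (zC zZ zB zH : Fin 4 → ℕ) : Prop :=
  Decomposes (cochainRep p n) zC ∧ Decomposes (cocycleRep τ p n) zZ ∧
    Decomposes (coboundaryRep τ p n) zB ∧ Decomposes (cohomologyRep τ p n) zH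

end

end CarrollString

namespace CarrollString

/-! ### Decompositions of representations -/

section Decompositions

variable {p : Fin 26 → ℝ}

/-! The relative complex is finite dimensional. Monomials are eigenvectors of L₀^tot, with
eigenvalue the total weight, and only c₁ and C₁ have negative weight, namely −1 each. Hence the
matter factor of a relative cochain is a polynomial of weight 0, 1 or 2 in the oscillators, and once
c₀ is excluded exactly thirty ghost monomials remain (`mem_Crel_iff`, `exists_relMasks_of_subset`,
`Crel_eq_cochainRange`). A relative cochain thus becomes a tuple of scalars, vectors and 2-tensors
over ℂ²⁵, on which the stabiliser acts in the obvious way.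

The differential in these coordinates has two ingredients. The ghost part is finite combinatorics:
on low-lying states all normal ordered sums truncate, and 2d is a list of words in ghost creation
and annihilation operators, each paired with one mode of T or M (`two_smul_brst_state`). Ghost
monomials are encoded as bit masks, so that the words can be evaluated by the kernel. The matter
part consists of the modes L₋₂, …, L₂ and M₋₂, …, M₂, where L_n = T₍ₙ₊₁₎ and M_n = M₍ₙ₊₁₎. Since p₀
= 0, the modes with n = 0, 1 are derivations, those with n = 2 are derivations up to one
second-order term, and the values on generators determine them. Together this yields
`brst_cochain₀`, …, `brst_cochain₅`.

The homological part is a splitting Cⁿ = d Eⁿ⁻¹ ⊕ Kⁿ ⊕ Eⁿ, compatible with rotations, with d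
injective on Eⁿ and d Kⁿ ⊂ Kⁿ⁺¹. The pairs Eⁿ → d Eⁿ are contractible, so the cohomology is that of
the reduced complex K, whose terms ℂ, `Lin`, `Core₂`, `Core₂`, `Lin`, ℂ are visibly symmetric.
Directness of the sum follows by applying d once and using the next degree; that it exhausts Cⁿ is a
count of dimensions (`isSplitting_splitMap`). The identity d² = 0 is needed on Eⁿ only and is
checked there in coordinates; this check uses the critical dimension 26.

The differential of K is built from the eigenvalue P = i𝐩 of π₀. For 𝐩 = 0 it vanishes, and Kⁿ is
the cohomology. For 𝐩 ≠ 0 one has P·P ≠ 0, vectors and tensors split into longitudinal and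
transverse parts, and every Kⁿ splits once more into boundaries, classes and a complement of the
cocycles (`IsSplitting.refine`, `refine₀`, …, `refine₅`). In both cases three consecutive splittings
give the four columns of a row (`tableRow_of_isSplitting`), and Poincaré duality is the symmetry of
the last column. -/

theorem Decomposes.of_bijective {X Y : Type*} [AddCommGroup X] [Module ℂ X] [AddCommGroup Y]
    [Module ℂ Y] {ρ : Representation ℂ (Stab p) X} {σ : Representation ℂ (Stab p) Y}
    {z : Fin 4 → ℕ} (h : Decomposes ρ z) (f : X →ₗ[ℂ] Y) (hinj : ∀ x, f x = 0 → x = 0)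
    (hsurj : ∀ y, ∃ x, f x = y) (hf : ∀ g x, f (ρ g x) = σ g (f x)) : Decomposes σ z := by
  obtain ⟨e⟩ := h
  let E : X ≃ₗ[ℂ] Y := LinearEquiv.ofBijective f
    ⟨(injective_iff_map_eq_zero f).mpr hinj, hsurj⟩
  have hE : ρ.Equiv σ := Representation.Equiv.mk E fun g => LinearMap.ext fun x => hf g x
  exact ⟨hE.symm.trans e⟩

/-- `m + n` copies are `m` copies and `n` copies. -/
def appendCopies (m n : ℕ) (X : Type*) [AddCommGroup X] [Module ℂ X] :
    ((Fin m → X) × (Fin n → X)) ≃ₗ[ℂ] (Fin (m + n) → X) :=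
  (LinearEquiv.sumArrowLequivProdArrow (Fin m) (Fin n) ℂ X).symm ≪≫ₗ
    LinearEquiv.funCongrLeft ℂ X finSumFinEquiv.symm

theorem appendCopies_equivariant {X : Type*} [AddCommGroup X] [Module ℂ X]
    (ρ : Representation ℂ (Stab p) X) (m n : ℕ) (g : Stab p) (x : (Fin m → X) × (Fin n → X)) :
    appendCopies m n X (copies m ρ g x.1, copies n ρ g x.2) =
      copies (m + n) ρ g (appendCopies m n X x) := by
  funext i
  obtain ⟨i | i, rfl⟩ := finSumFinEquiv.surjective i <;>
  simp [appendCopies, copies, LinearEquiv.funCongrLeft, LinearMap.funLeft] <;> rfl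

/-- Adding up the rows of a table. -/
def appendTable (p : Fin 26 → ℝ) (z y : Fin 4 → ℕ) :
    (((Fin (z 0) → ℂ) × (Fin (z 1) → transVec p) × (Fin (z 2) → transSym p) ×
      (Fin (z 3) → transSkew p)) × ((Fin (y 0) → ℂ) × (Fin (y 1) → transVec p) ×
      (Fin (y 2) → transSym p) × (Fin (y 3) → transSkew p))) →ₗ[ℂ]
    ((Fin (z 0 + y 0) → ℂ) × (Fin (z 1 + y 1) → transVec p) × (Fin (z 2 + y 2) → transSym p) ×
      (Fin (z 3 + y 3) → transSkew p)) where
  toFun x := (appendCopies _ _ _ (x.1.1, x.2.1), appendCopies _ _ _ (x.1.2.1, x.2.2.1),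
    appendCopies _ _ _ (x.1.2.2.1, x.2.2.2.1), appendCopies _ _ _ (x.1.2.2.2, x.2.2.2.2))
  map_add' x y := by
    simp only [Prod.fst_add, Prod.snd_add, ← Prod.mk_add_mk, map_add]
  map_smul' a x := by
    simp only [Prod.smul_fst, Prod.smul_snd, ← Prod.smul_mk, map_smul, RingHom.id_apply]

theorem appendTable_bijective (z y : Fin 4 → ℕ) : Function.Bijective (appendTable p z y) := by
  constructor
  · refine (injective_iff_map_eq_zero _).mpr ?_
    rintro ⟨⟨x1, x2, x3, x4⟩, ⟨y1, y2, y3, y4⟩⟩ hx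
    simp only [appendTable, LinearMap.coe_mk, AddHom.coe_mk, Prod.mk_eq_zero,
      EmbeddingLike.map_eq_zero_iff] at hx
    obtain ⟨⟨rfl, rfl⟩, ⟨rfl, rfl⟩, ⟨rfl, rfl⟩, rfl, rfl⟩ := hx
    rfl
  · rintro ⟨x1, x2, x3, x4⟩
    refine ⟨((((appendCopies _ _ _).symm x1).1, ((appendCopies _ _ _).symm x2).1,
      ((appendCopies _ _ _).symm x3).1, ((appendCopies _ _ _).symm x4).1),
      (((appendCopies _ _ _).symm x1).2, ((appendCopies _ _ _).symm x2).2,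
      ((appendCopies _ _ _).symm x3).2, ((appendCopies _ _ _).symm x4).2)), ?_⟩
    simp [appendTable]

theorem appendTable_equivariant (z y : Fin 4 → ℕ) (g : Stab p) (x) :
    appendTable p z y (tableRep p (z 0) (z 1) (z 2) (z 3) g x.1,
      tableRep p (y 0) (y 1) (y 2) (y 3) g x.2) =
    tableRep p (z 0 + y 0) (z 1 + y 1) (z 2 + y 2) (z 3 + y 3) g (appendTable p z y x) :=
  Prod.ext (appendCopies_equivariant (Representation.trivial ℂ (Stab p) ℂ) _ _ g (x.1.1, x.2.1))
    (Prod.ext (appendCopies_equivariant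
      ((vecRep p).subrepresentation (transVec p) (transVec_rot p)) _ _ g (x.1.2.1, x.2.2.1))
    (Prod.ext (appendCopies_equivariant
      ((tensorRep p).subrepresentation (transSym p) (transSym_rot p)) _ _ g (x.1.2.2.1, x.2.2.2.1))
    (appendCopies_equivariant
      ((tensorRep p).subrepresentation (transSkew p) (transSkew_rot p)) _ _ g (x.1.2.2.2, x.2.2.2.2))))

/-- Multiplicities add over direct sums. Every row of the tables is obtained by adding rows of known
summands in this way. -/
theorem Decomposes.prod {X Y : Type*} [AddCommGroup X] [Module ℂ X] [AddCommGroup Y]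
    [Module ℂ Y] {ρ : Representation ℂ (Stab p) X} {σ : Representation ℂ (Stab p) Y}
    {z y : Fin 4 → ℕ} (h : Decomposes ρ z) (h' : Decomposes σ y) :
    Decomposes (ρ.prod σ) (z + y) := by
  obtain ⟨e⟩ := h
  obtain ⟨e'⟩ := h'
  let E := (e.toLinearEquiv.prodCongr e'.toLinearEquiv) ≪≫ₗ
    LinearEquiv.ofBijective (appendTable p z y) (appendTable_bijective z y)
  refine ⟨Representation.Equiv.mk E fun g => LinearMap.ext fun x => ?_⟩
  have h1 : e (ρ g x.1) = tableRep p (z 0) (z 1) (z 2) (z 3) g (e x.1) :=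
    LinearMap.congr_fun (e.toIntertwiningMap.isIntertwining' g) x.1
  have h2 : e' (σ g x.2) = tableRep p (y 0) (y 1) (y 2) (y 3) g (e' x.2) :=
    LinearMap.congr_fun (e'.toIntertwiningMap.isIntertwining' g) x.2
  change appendTable p z y (e (ρ g x.1), e' (σ g x.2)) = _
  rw [h1, h2]
  exact appendTable_equivariant z y g (e x.1, e' x.2)

theorem Decomposes.of_subsingleton {X : Type*} [AddCommGroup X] [Module ℂ X] [Subsingleton X]
    (ρ : Representation ℂ (Stab p) X) : Decomposes ρ ![0, 0, 0, 0] := by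
  -- Families indexed by `Fin 0` form a point, so both spaces are zero and the zero map is
  -- bijective.
  refine Decomposes.of_bijective ⟨Representation.Equiv.refl (tableRep p 0 0 0 0)⟩ 0
    (fun x _ => Subsingleton.elim _ _) (fun y => ⟨0, Subsingleton.elim _ _⟩)
    fun g x => Subsingleton.elim _ _

/-- This and the next three lemmas are the unit rows: the factors indexed by `Fin 0` are points, and
the one indexed by `Fin 1` is read off at `0`. -/
theorem Decomposes.trivial : Decomposes (Representation.trivial ℂ (Stab p) ℂ) ![1, 0, 0, 0] := by
  refine Decomposes.of_bijective ⟨Representation.Equiv.refl (tableRep p 1 0 0 0)⟩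
    (LinearMap.proj (R := ℂ) (0 : Fin 1) ∘ₗ LinearMap.fst ℂ _ _) ?_
    (fun y => ⟨(fun _ => y, 0), rfl⟩) fun g x => rfl
  rintro ⟨x1, x2⟩ hx
  exact Prod.ext (funext fun i => by rw [Subsingleton.elim i 0]; exact hx) (Subsingleton.elim _ _)

theorem Decomposes.transVec :
    Decomposes ((vecRep p).subrepresentation (transVec p) (transVec_rot p)) ![0, 1, 0, 0] := by
  refine Decomposes.of_bijective ⟨Representation.Equiv.refl (tableRep p 0 1 0 0)⟩
    (LinearMap.proj (R := ℂ) (0 : Fin 1) ∘ₗ LinearMap.fst ℂ _ _ ∘ₗ LinearMap.snd ℂ _ _) ?_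
    (fun y => ⟨(0, fun _ => y, 0), rfl⟩) fun g x => rfl
  rintro ⟨x1, x2, x3⟩ hx
  exact Prod.ext (Subsingleton.elim _ _)
    (Prod.ext (funext fun i => by rw [Subsingleton.elim i 0]; exact hx) (Subsingleton.elim _ _))

theorem Decomposes.transSym :
    Decomposes ((tensorRep p).subrepresentation (transSym p) (transSym_rot p)) ![0, 0, 1, 0] := by
  refine Decomposes.of_bijective ⟨Representation.Equiv.refl (tableRep p 0 0 1 0)⟩
    (LinearMap.proj (R := ℂ) (0 : Fin 1) ∘ₗ LinearMap.fst ℂ _ _ ∘ₗ LinearMap.snd ℂ _ _ ∘ₗ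
      LinearMap.snd ℂ _ _) ?_ (fun y => ⟨(0, 0, fun _ => y, 0), rfl⟩) fun g x => rfl
  rintro ⟨x1, x2, x3, x4⟩ hx
  exact Prod.ext (Subsingleton.elim _ _) (Prod.ext (Subsingleton.elim _ _)
    (Prod.ext (funext fun i => by rw [Subsingleton.elim i 0]; exact hx) (Subsingleton.elim _ _)))

theorem Decomposes.transSkew :
    Decomposes ((tensorRep p).subrepresentation (transSkew p) (transSkew_rot p))
      ![0, 0, 0, 1] := by
  refine Decomposes.of_bijective ⟨Representation.Equiv.refl (tableRep p 0 0 0 1)⟩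
    (LinearMap.proj (R := ℂ) (0 : Fin 1) ∘ₗ LinearMap.snd ℂ _ _ ∘ₗ LinearMap.snd ℂ _ _ ∘ₗ
      LinearMap.snd ℂ _ _) ?_ (fun y => ⟨(0, 0, 0, fun _ => y), rfl⟩) fun g x => rfl
  rintro ⟨x1, x2, x3, x4⟩ hx
  exact Prod.ext (Subsingleton.elim _ _) (Prod.ext (Subsingleton.elim _ _)
    (Prod.ext (Subsingleton.elim _ _) (funext fun i => by rw [Subsingleton.elim i 0]; exact hx)))

end Decompositions

end CarrollString

namespace CarrollString

noncomputable section

/-! ### Vectors and tensors under the stabiliser -/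

/-- Vectors `ℂ²⁵`. -/
abbrev Vect : Type := Fin 25 → ℂ

/-- `2`-tensors over `ℂ²⁵`. -/
abbrev Tens : Type := Matrix (Fin 25) (Fin 25) ℂ

/-- Symmetric `2`-tensors. -/
def symTens : Submodule ℂ Tens where
  carrier := {T | T.transpose = T}
  add_mem' := fun {T U} hT hU => by
    simp only [Set.mem_ofPred_eq] at *
    rw [Matrix.transpose_add, hT, hU]
  zero_mem' := by simp
  smul_mem' := fun a T hT => by
    simp only [Set.mem_ofPred_eq] at *
    rw [Matrix.transpose_smul, hT]

/-- Skewsymmetric `2`-tensors. -/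
def skewTens : Submodule ℂ Tens where
  carrier := {T | T.transpose = -T}
  add_mem' := fun {T U} hT hU => by
    simp only [Set.mem_ofPred_eq] at *
    rw [Matrix.transpose_add, hT, hU, neg_add]
  zero_mem' := by simp
  smul_mem' := fun a T hT => by
    simp only [Set.mem_ofPred_eq] at *
    rw [Matrix.transpose_smul, hT, smul_neg]

theorem symTens_transpose (S : symTens) : (S : Tens).transpose = S := S.2

theorem skewTens_transpose (A : skewTens) : (A : Tens).transpose = -(A : Tens) := A.2

/-- The transverse symmetric tensors. -/
def transSymTens (p : Fin 26 → ℝ) : Submodule ℂ Tens where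
  carrier := {T | T.transpose = T ∧ T.mulVec (spatial p) = 0}
  add_mem' := fun {T U} hT hU => by
    simp only [Set.mem_ofPred_eq] at *
    exact ⟨by rw [Matrix.transpose_add, hT.1, hU.1],
      by rw [Matrix.add_mulVec, hT.2, hU.2, add_zero]⟩
  zero_mem' := by simp
  smul_mem' := fun a T hT => by
    simp only [Set.mem_ofPred_eq] at *
    exact ⟨by rw [Matrix.transpose_smul, hT.1], by rw [Matrix.smul_mulVec, hT.2, smul_zero]⟩

section Representations

variable (p : Fin 26 → ℝ)

theorem symTens_rot (g : Stab p) : symTens ≤ symTens.comap (tensorRep p g) := by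
  intro T hT
  have hT : T.transpose = T := hT
  change (cplx g.1.1 * T * (cplx g.1.1).transpose).transpose =
    cplx g.1.1 * T * (cplx g.1.1).transpose
  simp [Matrix.transpose_mul, hT, Matrix.mul_assoc]

theorem skewTens_rot (g : Stab p) : skewTens ≤ skewTens.comap (tensorRep p g) := by
  intro T hT
  have hT : T.transpose = -T := hT
  change (cplx g.1.1 * T * (cplx g.1.1).transpose).transpose =
    -(cplx g.1.1 * T * (cplx g.1.1).transpose)
  simp [Matrix.transpose_mul, hT, Matrix.mul_assoc]

theorem transSymTens_rot (g : Stab p) :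
    transSymTens p ≤ (transSymTens p).comap (tensorRep p g) := fun T hT =>
  ⟨symTens_rot p g hT.1, tensor_trans p g T hT.2⟩

/-- The trivial representation. -/
abbrev scalarRep : Representation ℂ (Stab p) ℂ := Representation.trivial ℂ (Stab p) ℂ

/-- The representation on symmetric tensors. -/
abbrev symRep : Representation ℂ (Stab p) symTens :=
  (tensorRep p).subrepresentation symTens (symTens_rot p)

/-- The representation on skewsymmetric tensors. -/
abbrev skewRep : Representation ℂ (Stab p) skewTens :=
  (tensorRep p).subrepresentation skewTens (skewTens_rot p)

/-- The representation on transverse symmetric tensors. -/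
abbrev transSymTensRep : Representation ℂ (Stab p) (transSymTens p) :=
  (tensorRep p).subrepresentation (transSymTens p) (transSymTens_rot p)

/-- The representation on transverse vectors. -/
abbrev transVecRep : Representation ℂ (Stab p) (transVec p) :=
  (vecRep p).subrepresentation (transVec p) (transVec_rot p)

/-- The representation on transverse skewsymmetric tensors. -/
abbrev transSkewRep : Representation ℂ (Stab p) (transSkew p) :=
  (tensorRep p).subrepresentation (transSkew p) (transSkew_rot p)

variable {p}

theorem vecRep_apply (g : Stab p) (v : Vect) : vecRep p g v = (cplx g.1.1).mulVec v := rfl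

theorem tensorRep_apply (g : Stab p) (T : Tens) :
    tensorRep p g T = cplx g.1.1 * T * (cplx g.1.1).transpose := rfl

theorem coe_symRep (g : Stab p) (T : symTens) :
    (symRep p g T : Tens) = cplx g.1.1 * T * (cplx g.1.1).transpose := rfl

theorem coe_skewRep (g : Stab p) (T : skewTens) :
    (skewRep p g T : Tens) = cplx g.1.1 * T * (cplx g.1.1).transpose := rfl

theorem cplx_orth' (g : Stab p) : cplx g.1.1 * (cplx g.1.1).transpose = 1 := by
  have h : (cplx g.1.1).transpose = cplx g.1.1.transpose := rfl
  rw [h, ← cplx_mul, stab_orth', cplx_one]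

theorem cplx_fix (g : Stab p) : (cplx g.1.1).mulVec (spatial p) = spatial p := by
  conv_lhs => rw [← cplx_transpose_fix g, Matrix.mulVec_mulVec, cplx_orth', Matrix.one_mulVec]

theorem dotProduct_cplx (g : Stab p) (v w : Vect) :
    (cplx g.1.1).mulVec v ⬝ᵥ (cplx g.1.1).mulVec w = v ⬝ᵥ w := by
  rw [Matrix.dotProduct_mulVec, Matrix.vecMul_mulVec, cplx_orth, Matrix.vecMul_one]

theorem vecMulVec_cplx (g : Stab p) (v w : Vect) :
    Matrix.vecMulVec ((cplx g.1.1).mulVec v) ((cplx g.1.1).mulVec w) =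
      cplx g.1.1 * Matrix.vecMulVec v w * (cplx g.1.1).transpose := by
  rw [Matrix.mul_vecMulVec, Matrix.vecMulVec_mul, Matrix.vecMul_transpose]

theorem trace_cplx (g : Stab p) (T : Tens) :
    (cplx g.1.1 * T * (cplx g.1.1).transpose).trace = T.trace := by
  rw [Matrix.mul_assoc, Matrix.trace_mul_comm, Matrix.mul_assoc, cplx_orth, Matrix.mul_one]

theorem mulVec_cplx (g : Stab p) (T : Tens) (v : Vect) :
    (cplx g.1.1 * T * (cplx g.1.1).transpose).mulVec ((cplx g.1.1).mulVec v) =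
      (cplx g.1.1).mulVec (T.mulVec v) := by
  rw [Matrix.mulVec_mulVec, Matrix.mul_assoc, cplx_orth, Matrix.mul_one, Matrix.mulVec_mulVec]

theorem spatial_dotProduct_self : spatial p ⬝ᵥ spatial p = ((∑ i, p (Fin.succ i) ^ 2 : ℝ) : ℂ) := by
  simp [dotProduct, spatial, sq]

/-- The bilinear square of a complex vector may vanish, but 𝐩 is real and its square is a sum of
real squares. All longitudinal projections for 𝐩 ≠ 0 divide by this number. -/
theorem spatial_dotProduct_ne_zero (hp : Fin.tail p ≠ 0) : spatial p ⬝ᵥ spatial p ≠ 0 := by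
  rw [spatial_dotProduct_self, Ne, Complex.ofReal_eq_zero,
    Finset.sum_eq_zero_iff_of_nonneg fun i _ => sq_nonneg _]
  intro h
  exact hp (funext fun i => by simpa [Fin.tail] using h i (Finset.mem_univ i))

theorem spatial_eq_zero (hp : Fin.tail p = 0) : spatial p = 0 :=
  funext fun i => by
    have h := congrFun hp i
    simp only [Fin.tail, Pi.zero_apply] at h
    simp [spatial, h]

/-! ### Longitudinal and transverse parts -/

variable (p)

/-- Longitudinal and transverse parts of a vector. -/
def joinVec : ℂ × transVec p →ₗ[ℂ] Vect where
  toFun x := x.1 • spatial p + x.2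
  map_add' x y := by simp [add_smul]; abel
  map_smul' a x := by simp [mul_smul]

/-- The symmetrised product of two vectors. -/
def symProd (q : Vect) : Vect →ₗ[ℂ] symTens where
  toFun w := ⟨Matrix.vecMulVec q w + Matrix.vecMulVec w q, by
    change Matrix.transpose _ = _
    rw [Matrix.transpose_add, Matrix.transpose_vecMulVec, Matrix.transpose_vecMulVec, add_comm]⟩
  map_add' v w := Subtype.ext (by
    simp only [Submodule.coe_add, Matrix.vecMulVec_add, Matrix.add_vecMulVec]; abel)
  map_smul' a w := Subtype.ext (by
    simp [Matrix.vecMulVec_smul, Matrix.smul_vecMulVec])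

theorem coe_symProd (q w : Vect) :
    (symProd q w : Tens) = Matrix.vecMulVec q w + Matrix.vecMulVec w q := rfl

theorem symProd_mulVec (q w u : Vect) :
    (symProd q w : Tens).mulVec u = (w ⬝ᵥ u) • q + (q ⬝ᵥ u) • w := by
  rw [coe_symProd, Matrix.add_mulVec, Matrix.vecMulVec_mulVec, Matrix.vecMulVec_mulVec]
  simp

/-- The skewsymmetrised product of two vectors. -/
def skewProd (q : Vect) : Vect →ₗ[ℂ] skewTens where
  toFun w := ⟨Matrix.vecMulVec q w - Matrix.vecMulVec w q, by
    change Matrix.transpose _ = _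
    rw [Matrix.transpose_sub, Matrix.transpose_vecMulVec, Matrix.transpose_vecMulVec, neg_sub]⟩
  map_add' v w := Subtype.ext (by
    simp only [Submodule.coe_add, Matrix.vecMulVec_add, Matrix.add_vecMulVec]; abel)
  map_smul' a w := Subtype.ext (by
    simp [Matrix.vecMulVec_smul, Matrix.smul_vecMulVec, smul_sub])

theorem coe_skewProd (q w : Vect) :
    (skewProd q w : Tens) = Matrix.vecMulVec q w - Matrix.vecMulVec w q := rfl

theorem skewProd_mulVec (q w u : Vect) :
    (skewProd q w : Tens).mulVec u = (w ⬝ᵥ u) • q - (q ⬝ᵥ u) • w := by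
  rw [coe_skewProd, Matrix.sub_mulVec, Matrix.vecMulVec_mulVec, Matrix.vecMulVec_mulVec]
  simp

/-- Longitudinal and transverse parts of a symmetric tensor. -/
def joinSym : transSymTens p × Vect →ₗ[ℂ] symTens where
  toFun x := ⟨x.1, x.1.2.1⟩ + symProd (spatial p) x.2
  map_add' x y := by
    refine Subtype.ext ?_
    simp
    abel
  map_smul' a x := by
    refine Subtype.ext ?_
    simp

/-- Longitudinal and transverse parts of a skewsymmetric tensor. -/
def joinSkew : transSkew p × transVec p →ₗ[ℂ] skewTens where
  toFun x := ⟨x.1, x.1.2.1⟩ + skewProd (spatial p) x.2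
  map_add' x y := by
    refine Subtype.ext ?_
    simp
    abel
  map_smul' a x := by
    refine Subtype.ext ?_
    simp

/-- The transverse metric. -/
def transMetric : transSymTens p :=
  ⟨1 - (spatial p ⬝ᵥ spatial p)⁻¹ • Matrix.vecMulVec (spatial p) (spatial p), by
    refine ⟨by simp [Matrix.transpose_vecMulVec], ?_⟩
    rw [Matrix.sub_mulVec, Matrix.one_mulVec, Matrix.smul_mulVec, Matrix.vecMulVec_mulVec]
    -- For 𝐩 = 0 the convention `0⁻¹ = 0` makes the transverse metric the identity, so one
    -- definition serves both cases.
    by_cases hp : Fin.tail p = 0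
    · simp [spatial_eq_zero hp]
    · have h := spatial_dotProduct_ne_zero hp
      simp [smul_smul, h]⟩

theorem coe_transMetric : (transMetric p : Tens) =
    1 - (spatial p ⬝ᵥ spatial p)⁻¹ • Matrix.vecMulVec (spatial p) (spatial p) := rfl

/-- The trace is 25 for 𝐩 = 0 and 24 otherwise. Being nonzero, it allows multiples of the metric to
be split off from the traceless tensors. -/
theorem trace_transMetric : (transMetric p : Tens).trace ≠ 0 := by
  rw [coe_transMetric, Matrix.trace_sub, Matrix.trace_one, Matrix.trace_smul,
    Matrix.trace_vecMulVec]
  by_cases hp : Fin.tail p = 0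
  · simp [spatial_eq_zero hp]
  · have h := spatial_dotProduct_ne_zero hp
    rw [smul_eq_mul, inv_mul_cancel₀ h]
    norm_num

/-- Trace and traceless parts of a transverse symmetric tensor. -/
def joinTrace : ℂ × transSym p →ₗ[ℂ] transSymTens p where
  toFun x := x.1 • transMetric p + ⟨x.2, x.2.2.1, x.2.2.2.2⟩
  map_add' x y := by
    refine Subtype.ext ?_
    simp only [Prod.fst_add, Prod.snd_add, Submodule.coe_add, add_smul]
    abel
  map_smul' a x := by
    refine Subtype.ext ?_
    simp [mul_smul]

variable {p}

theorem joinVec_rot (g : Stab p) (x : ℂ × transVec p) :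
    joinVec p (x.1, transVecRep p g x.2) = vecRep p g (joinVec p x) := by
  simp only [joinVec, LinearMap.coe_mk, AddHom.coe_mk, vecRep_apply, Matrix.mulVec_add,
    Matrix.mulVec_smul, cplx_fix]
  rfl

theorem joinVec_injective (hp : Fin.tail p ≠ 0) (x : ℂ × transVec p) (hx : joinVec p x = 0) :
    x = 0 := by
  obtain ⟨s, v, hv⟩ := x
  have hv : spatial p ⬝ᵥ v = 0 := hv
  have hx : s • spatial p + v = 0 := hx
  -- Pairing with 𝐩 kills the transverse part and leaves `s` times the nonzero square of 𝐩.
  have h := congrArg (fun u => spatial p ⬝ᵥ u) hx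
  simp only [dotProduct_add, dotProduct_smul, hv, add_zero, dotProduct_zero, smul_eq_mul,
    mul_eq_zero, spatial_dotProduct_ne_zero hp, or_false] at h
  subst h
  rw [zero_smul, zero_add] at hx
  subst hx
  rfl

theorem joinVec_surjective (hp : Fin.tail p ≠ 0) (v : Vect) : ∃ x, joinVec p x = v := by
  have h := spatial_dotProduct_ne_zero hp
  refine ⟨((spatial p ⬝ᵥ v) / (spatial p ⬝ᵥ spatial p),
    ⟨v - ((spatial p ⬝ᵥ v) / (spatial p ⬝ᵥ spatial p)) • spatial p, ?_⟩), ?_⟩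
  · change spatial p ⬝ᵥ _ = 0
    rw [dotProduct_sub, dotProduct_smul, smul_eq_mul, div_mul_cancel₀ _ h, sub_self]
  · simp [joinVec]

theorem symProd_rot {q : Vect} (g : Stab p) (hq : (cplx g.1.1).mulVec q = q) (w : Vect) :
    symProd q (vecRep p g w) = symRep p g (symProd q w) := by
  refine Subtype.ext ?_
  rw [coe_symRep, coe_symProd, coe_symProd, vecRep_apply, Matrix.mul_add, Matrix.add_mul,
    ← vecMulVec_cplx, ← vecMulVec_cplx, hq]

theorem skewProd_rot {q : Vect} (g : Stab p) (hq : (cplx g.1.1).mulVec q = q) (w : Vect) :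
    skewProd q (vecRep p g w) = skewRep p g (skewProd q w) := by
  refine Subtype.ext ?_
  rw [coe_skewRep, coe_skewProd, coe_skewProd, vecRep_apply, Matrix.mul_sub, Matrix.sub_mul,
    ← vecMulVec_cplx, ← vecMulVec_cplx, hq]

theorem joinSym_rot (g : Stab p) (x : transSymTens p × Vect) :
    joinSym p (transSymTensRep p g x.1, vecRep p g x.2) = symRep p g (joinSym p x) := by
  simp only [joinSym, LinearMap.coe_mk, AddHom.coe_mk, map_add, symProd_rot g (cplx_fix g)]
  rfl

/-- Contraction with 𝐩 removes the transverse tensor and leaves (w·𝐩)𝐩 + (𝐩·𝐩)w = 0. A second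
contraction gives 2(𝐩·𝐩)(w·𝐩) = 0, hence w = 0. -/
theorem joinSym_injective (hp : Fin.tail p ≠ 0) (x : transSymTens p × Vect)
    (hx : joinSym p x = 0) : x = 0 := by
  obtain ⟨⟨S, hS, hS'⟩, w⟩ := x
  have h0 := spatial_dotProduct_ne_zero hp
  have hx : S + (symProd (spatial p) w : Tens) = 0 := congrArg Subtype.val hx
  have h1 : (w ⬝ᵥ spatial p) • spatial p + (spatial p ⬝ᵥ spatial p) • w = 0 := by
    rw [← symProd_mulVec]
    have h := congrArg (fun T : Tens => T.mulVec (spatial p)) hx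
    simpa [Matrix.add_mulVec, hS'] using h
  have h2 := congrArg (fun u => u ⬝ᵥ spatial p) h1
  simp only [add_dotProduct, smul_dotProduct, smul_eq_mul, zero_dotProduct] at h2
  have h3 : w ⬝ᵥ spatial p = 0 := by
    have : 2 * (spatial p ⬝ᵥ spatial p) * (w ⬝ᵥ spatial p) = 0 := by linear_combination h2
    simpa [h0] using this
  rw [h3, zero_smul, zero_add, smul_eq_zero, or_iff_right h0] at h1
  subst h1
  rw [map_zero, Submodule.coe_zero, add_zero] at hx
  subst hx
  rfl

theorem joinSym_surjective (hp : Fin.tail p ≠ 0) (T : symTens) : ∃ x, joinSym p x = T := by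
  have h0 := spatial_dotProduct_ne_zero hp
  obtain ⟨T, hT⟩ := T
  have hT : T.transpose = T := hT
  set q := spatial p with hq
  set n := q ⬝ᵥ q with hn
  -- This is the solution of (w·q)q + n w = T q: pairing with q gives w·q = (T q·q)/(2n), and the
  -- equation then determines w.
  let w : Vect := n⁻¹ • (T.mulVec q - ((T.mulVec q ⬝ᵥ q) / (2 * n)) • q)
  have hw : w ⬝ᵥ q = (T.mulVec q ⬝ᵥ q) / (2 * n) := by
    simp only [w, smul_dotProduct, sub_dotProduct, smul_eq_mul, ← hn]
    field_simp
    ring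
  refine ⟨(⟨T - symProd q w, ⟨?_, ?_⟩⟩, w), Subtype.ext ?_⟩
  · rw [Matrix.transpose_sub, hT, symTens_transpose]
  · rw [Matrix.sub_mulVec, symProd_mulVec, hw, ← hn, smul_smul, mul_inv_cancel₀ h0]
    module
  · simp [joinSym, ← hq]

theorem joinSkew_rot (g : Stab p) (x : transSkew p × transVec p) :
    joinSkew p (transSkewRep p g x.1, transVecRep p g x.2) = skewRep p g (joinSkew p x) := by
  simp only [joinSkew, LinearMap.coe_mk, AddHom.coe_mk, map_add,
    ← skewProd_rot g (cplx_fix g)]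
  rfl

theorem joinSkew_injective (hp : Fin.tail p ≠ 0) (x : transSkew p × transVec p)
    (hx : joinSkew p x = 0) : x = 0 := by
  obtain ⟨⟨S, hS, hS'⟩, ⟨w, hw⟩⟩ := x
  have hw : spatial p ⬝ᵥ w = 0 := hw
  have h0 := spatial_dotProduct_ne_zero hp
  have hx : S + (skewProd (spatial p) w : Tens) = 0 := congrArg Subtype.val hx
  have h1 : (spatial p ⬝ᵥ spatial p) • w = 0 := by
    have h := congrArg (fun T : Tens => T.mulVec (spatial p)) hx
    simpa [Matrix.add_mulVec, hS', skewProd_mulVec, dotProduct_comm w, hw] using h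
  rw [smul_eq_zero, or_iff_right h0] at h1
  subst h1
  rw [map_zero, Submodule.coe_zero, add_zero] at hx
  subst hx
  rfl

theorem joinSkew_surjective (hp : Fin.tail p ≠ 0) (T : skewTens) : ∃ x, joinSkew p x = T := by
  have h0 := spatial_dotProduct_ne_zero hp
  obtain ⟨T, hT⟩ := T
  have hT : T.transpose = -T := hT
  set q := spatial p with hq
  set n := q ⬝ᵥ q with hn
  -- A skewsymmetric form vanishes on the diagonal, so T q is transverse. This is why the
  -- longitudinal part of a skewsymmetric tensor is a transverse vector, whereas that of a symmetric
  -- tensor is an arbitrary one.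
  have hTq : q ⬝ᵥ T.mulVec q = 0 := by
    have h : q ⬝ᵥ T.mulVec q = -(q ⬝ᵥ T.mulVec q) := by
      conv_lhs => rw [Matrix.dotProduct_mulVec, ← Matrix.mulVec_transpose, hT, Matrix.neg_mulVec,
        neg_dotProduct, dotProduct_comm]
    exact self_eq_neg.mp h
  -- For transverse w the tensor `skewProd q w` sends q to −n w, which explains the sign of the
  -- witness.
  have hw : q ⬝ᵥ (-n⁻¹ • T.mulVec q) = 0 := by rw [dotProduct_smul, hTq, smul_zero]
  refine ⟨(⟨T - skewProd q (-n⁻¹ • T.mulVec q), ⟨?_, ?_⟩⟩, ⟨-n⁻¹ • T.mulVec q, hw⟩),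
    Subtype.ext ?_⟩
  · rw [Matrix.transpose_sub, hT, skewTens_transpose]
    abel
  · rw [Matrix.sub_mulVec, skewProd_mulVec, dotProduct_comm _ q, hw, ← hn, smul_smul, mul_neg,
      mul_inv_cancel₀ h0]
    module
  · simp [joinSkew, ← hq]

theorem joinTrace_rot (g : Stab p) (x : ℂ × transSym p) :
    joinTrace p (x.1, (tensorRep p).subrepresentation (transSym p) (transSym_rot p) g x.2) =
      transSymTensRep p g (joinTrace p x) := by
  have h : transSymTensRep p g (transMetric p) = transMetric p := by
    refine Subtype.ext ?_
    change cplx g.1.1 * (transMetric p : Tens) * (cplx g.1.1).transpose = transMetric p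
    rw [coe_transMetric, Matrix.mul_sub, Matrix.sub_mul, Matrix.mul_one, cplx_orth',
      Matrix.mul_smul, Matrix.smul_mul, ← vecMulVec_cplx, cplx_fix]
  simp only [joinTrace, LinearMap.coe_mk, AddHom.coe_mk, map_add, map_smul, h]
  rfl

theorem joinTrace_injective (x : ℂ × transSym p) (hx : joinTrace p x = 0) : x = 0 := by
  obtain ⟨s, ⟨S, hS, hS', hS''⟩⟩ := x
  have hx : s • (transMetric p : Tens) + S = 0 := congrArg Subtype.val hx
  have h := congrArg Matrix.trace hx
  rw [Matrix.trace_add, Matrix.trace_smul, hS', add_zero, Matrix.trace_zero, smul_eq_zero,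
    or_iff_left (trace_transMetric p)] at h
  subst h
  rw [zero_smul, zero_add] at hx
  subst hx
  rfl

theorem joinTrace_surjective (T : transSymTens p) : ∃ x, joinTrace p x = T := by
  obtain ⟨T, hT, hT'⟩ := T
  have h0 := trace_transMetric p
  refine ⟨(T.trace / (transMetric p : Tens).trace,
    ⟨T - (T.trace / (transMetric p : Tens).trace) • (transMetric p : Tens), ?_, ?_, ?_⟩),
    Subtype.ext ?_⟩
  · rw [Matrix.transpose_sub, hT, Matrix.transpose_smul, (transMetric p).2.1]
  · rw [Matrix.trace_sub, Matrix.trace_smul, smul_eq_mul, div_mul_cancel₀ _ h0, sub_self]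
  · rw [Matrix.sub_mulVec, hT', Matrix.smul_mulVec, (transMetric p).2.2]
    simp
  · simp [joinTrace]

theorem Decomposes.transSymTens : Decomposes (transSymTensRep p) ![1, 0, 1, 0] := by
  have h := Decomposes.of_bijective (Decomposes.trivial.prod (Decomposes.transSym (p := p)))
    (joinTrace p) joinTrace_injective joinTrace_surjective fun g x => joinTrace_rot g x
  simpa using h

theorem Decomposes.vect (hp : Fin.tail p ≠ 0) : Decomposes (vecRep p) ![1, 1, 0, 0] := by
  have h := Decomposes.of_bijective (Decomposes.trivial.prod (Decomposes.transVec (p := p)))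
    (joinVec p) (joinVec_injective hp) (joinVec_surjective hp) fun g x => joinVec_rot g x
  simpa using h

/-- Here ⊙²V = ⊙²V^⊥ ⊕ 𝐩⊙V: the first summand contributes its trace and ⊙²₀V^⊥, the second a copy of
V = ℂ𝐩 ⊕ V^⊥. -/
theorem Decomposes.symTens (hp : Fin.tail p ≠ 0) : Decomposes (symRep p) ![2, 1, 1, 0] := by
  have h := Decomposes.of_bijective (Decomposes.transSymTens.prod (Decomposes.vect hp))
    (joinSym p) (joinSym_injective hp) (joinSym_surjective hp) fun g x => joinSym_rot g x
  simpa using h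

theorem Decomposes.skewTens (hp : Fin.tail p ≠ 0) : Decomposes (skewRep p) ![0, 1, 0, 1] := by
  have h := Decomposes.of_bijective (Decomposes.transSkew.prod (Decomposes.transVec (p := p)))
    (joinSkew p) (joinSkew_injective hp) (joinSkew_surjective hp) fun g x => joinSkew_rot g x
  simpa using h

/-- For 𝐩 = 0 transversality is no condition; the same remark gives the next two lemmas. -/
theorem Decomposes.vect_of_tail_eq_zero (hp : Fin.tail p = 0) :
    Decomposes (vecRep p) ![0, 1, 0, 0] :=
  Decomposes.transVec.of_bijective (CarrollString.transVec p).subtype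
    (fun _ hx => Subtype.ext hx)
    (fun v => ⟨⟨v, by
      change spatial p ⬝ᵥ v = 0
      rw [spatial_eq_zero hp, zero_dotProduct]⟩, rfl⟩) fun _ _ => rfl

theorem Decomposes.symTens_of_tail_eq_zero (hp : Fin.tail p = 0) :
    Decomposes (symRep p) ![1, 0, 1, 0] :=
  Decomposes.transSymTens.of_bijective
    (Submodule.inclusion fun (T : Tens) (hT : T ∈ CarrollString.transSymTens p) => hT.1)
    (fun x hx => Submodule.inclusion_injective _ (hx.trans (map_zero _).symm))
    (fun T => ⟨⟨T, T.2, by rw [spatial_eq_zero hp, Matrix.mulVec_zero]⟩, rfl⟩) fun _ _ => rfl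

theorem Decomposes.skewTens_of_tail_eq_zero (hp : Fin.tail p = 0) :
    Decomposes (skewRep p) ![0, 0, 0, 1] :=
  Decomposes.transSkew.of_bijective
    (Submodule.inclusion fun (T : Tens) (hT : T ∈ CarrollString.transSkew p) => hT.1)
    (fun x hx => Submodule.inclusion_injective _ (hx.trans (map_zero _).symm))
    (fun T => ⟨⟨T, T.2, by rw [spatial_eq_zero hp, Matrix.mulVec_zero]⟩, rfl⟩) fun _ _ => rfl

end Representations

end

end CarrollString

namespace CarrollString

noncomputable section

/-! ### Bosonic operators and ghost operators on states -/

theorem bos_state (F : Module.End ℂ (MvPolynomial Osc ℂ)) (S : Finset Ghost)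
    (f : MvPolynomial Osc ℂ) : bos F (state S f) = state S (F f) := lift_state _ S f

theorem create_state (g : Ghost) (S : Finset Ghost) (f : MvPolynomial Osc ℂ) :
    create g (state S f) = if g ∈ S then 0 else ghostSign g S • state (insert g S) f := by
  rw [create, lift_state]
  split <;> rfl

theorem annihilate_state (g : Ghost) (S : Finset Ghost) (f : MvPolynomial Osc ℂ) :
    annihilate g (state S f) = if g ∈ S then ghostSign g S • state (S.erase g) f else 0 := by
  rw [annihilate, lift_state]
  split <;> rfl

theorem annihilate_state_of_notMem {g : Ghost} {S : Finset Ghost} (h : g ∉ S)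
    (f : MvPolynomial Osc ℂ) : annihilate g (state S f) = 0 := by
  rw [annihilate_state, if_neg h]

theorem annihilate_annihilate_state_of_notMem {g : Ghost} {S : Finset Ghost} (h : g ∉ S)
    (g' : Ghost) (f : MvPolynomial Osc ℂ) : annihilate g (annihilate g' (state S f)) = 0 := by
  rw [annihilate_state]
  split
  · rw [map_smul, annihilate_state_of_notMem fun hg => h (Finset.mem_of_mem_erase hg), smul_zero]
  · exact map_zero _

/-! ### Ghost sets as bit masks -/

/-- The ghost mode number `j = 8 t + k`, for `k < 8`. -/
def ghostOfBit (j : Fin 32) : Ghost := toLex (⟨j.1 / 8, by omega⟩, j.1 % 8)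

/-- The numbering of bits respects the lexicographic order of the ghosts; hence fermionic signs may
be computed on bit masks. -/
theorem ghostOfBit_lt {i j : Fin 32} : ghostOfBit i < ghostOfBit j ↔ i < j := by
  rw [ghostOfBit, ghostOfBit, Prod.Lex.toLex_lt_toLex, Fin.lt_def, Fin.lt_def, Fin.ext_iff]
  dsimp only
  omega

theorem ghostOfBit_injective : Function.Injective ghostOfBit := fun i j h => by
  rcases lt_trichotomy i j with h' | h' | h'
  · exact absurd h (ghostOfBit_lt.mpr h').ne
  · exact h'
  · exact absurd h (ghostOfBit_lt.mpr h').ne'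

/-- The set of ghosts with bit mask `m`. -/
def ghostSet (m : ℕ) : Finset Ghost :=
  (Finset.univ.filter fun j : Fin 32 => m.testBit j).map ⟨ghostOfBit, ghostOfBit_injective⟩

theorem mem_ghostSet {m : ℕ} {g : Ghost} :
    g ∈ ghostSet m ↔ ∃ j : Fin 32, m.testBit j = true ∧ ghostOfBit j = g := by
  simp [ghostSet]

theorem ghostOfBit_mem_ghostSet {m : ℕ} {j : Fin 32} :
    ghostOfBit j ∈ ghostSet m ↔ m.testBit j = true := by
  simp [mem_ghostSet, ghostOfBit_injective.eq_iff]

/-- Flipping a bit. -/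
def flipBit (m : ℕ) (j : Fin 32) : ℕ := m ^^^ 2 ^ j.1

theorem testBit_flipBit (m : ℕ) (i j : Fin 32) :
    (flipBit m j).testBit i = xor (m.testBit i) (decide (j = i)) := by
  rw [flipBit, Nat.testBit_xor, Nat.testBit_two_pow]
  simp [Fin.ext_iff]

theorem insert_ghostSet {m : ℕ} {j : Fin 32} (h : m.testBit j = false) :
    insert (ghostOfBit j) (ghostSet m) = ghostSet (flipBit m j) := by
  ext g
  simp only [Finset.mem_insert, mem_ghostSet, testBit_flipBit]
  constructor
  · rintro (rfl | ⟨i, hi, rfl⟩)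
    · exact ⟨j, by simp [h], rfl⟩
    · have hij : j ≠ i := by
        rintro rfl
        simp [h] at hi
      exact ⟨i, by simp [hi, hij], rfl⟩
  · rintro ⟨i, hi, rfl⟩
    by_cases hij : j = i
    · exact Or.inl (by rw [hij])
    · exact Or.inr ⟨i, by simpa [hij] using hi, rfl⟩

theorem erase_ghostSet {m : ℕ} {j : Fin 32} (h : m.testBit j = true) :
    (ghostSet m).erase (ghostOfBit j) = ghostSet (flipBit m j) := by
  ext g
  simp only [Finset.mem_erase, mem_ghostSet, testBit_flipBit]
  constructor
  · rintro ⟨hg, i, hi, rfl⟩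
    have hij : j ≠ i := by
      rintro rfl
      exact hg rfl
    exact ⟨i, by simp [hi, hij], rfl⟩
  · rintro ⟨i, hi, rfl⟩
    have hij : j ≠ i := by
      rintro rfl
      simp [h] at hi
    exact ⟨fun h' => hij (ghostOfBit_injective h').symm, i, by simpa [hij] using hi, rfl⟩

/-- The sign of a bit in a bit mask. -/
def bitSign (m : ℕ) (j : Fin 32) : ℤ := (-1) ^ ((List.range j).countP fun i => m.testBit i)

/-- Both signs count the occupied places before the given one. The count along a list of bits is the
form that evaluates efficiently. -/
theorem ghostSign_ghostSet (m : ℕ) (j : Fin 32) :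
    ghostSign (ghostOfBit j) (ghostSet m) = bitSign m j := by
  have h : ((ghostSet m).filter (· < ghostOfBit j)).card =
      (List.range j).countP fun i => m.testBit i := by
    rw [ghostSet, Finset.filter_map, Finset.card_map, List.countP_eq_length_filter,
      ← List.toFinset_card_of_nodup (List.nodup_range.filter _)]
    refine Finset.card_bij (fun i _ => i.1) ?_ (fun i _ i' _ h => Fin.ext h) ?_
    · intro i hi
      simp only [Finset.mem_filter, Finset.mem_univ, true_and, Function.comp_apply,
        Function.Embedding.coeFn_mk, ghostOfBit_lt] at hi
      simpa using ⟨hi.2, hi.1⟩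
    · intro i hi
      simp only [List.mem_toFinset, List.mem_filter, List.mem_range] at hi
      refine ⟨⟨i, by omega⟩, ?_, rfl⟩
      simpa [ghostOfBit_lt] using ⟨hi.2, hi.1⟩
  rw [ghostSign, h, bitSign]
  push_cast
  rfl

/-- The state with ghost set given by the bit mask `m`. -/
def bitState (m : ℕ) : MvPolynomial Osc ℂ →ₗ[ℂ] Fock := state (ghostSet m)

/-- A ghost set remembers the lowest 32 bits of a mask only, whence the bounds. -/
theorem ghostSet_injOn {m n : ℕ} (hm : m < 2 ^ 32) (hn : n < 2 ^ 32)
    (h : ghostSet m = ghostSet n) : m = n := by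
  refine Nat.eq_of_testBit_eq fun i => ?_
  by_cases hi : i < 32
  · have := ghostOfBit_mem_ghostSet (m := m) (j := ⟨i, hi⟩)
    rw [h, ghostOfBit_mem_ghostSet] at this
    exact Bool.eq_iff_iff.mpr this.symm
  · have h2 : 2 ^ 32 ≤ 2 ^ i := Nat.pow_le_pow_right (by norm_num) (by omega)
    rw [Nat.testBit_lt_two_pow (by omega), Nat.testBit_lt_two_pow (by omega)]

theorem coeff_bitState {m n : ℕ} (hm : m < 2 ^ 32) (hn : n < 2 ^ 32) (f : MvPolynomial Osc ℂ) :
    coeff (ghostSet n) (bitState m f) = if m = n then f else 0 := by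
  rw [bitState, coeff_state]
  exact if_congr ⟨ghostSet_injOn hm hn, fun h => h ▸ rfl⟩ rfl rfl

/-! ### Words of ghost operators -/

/-- A ghost creation (`true`) or annihilation (`false`) operator. -/
def letterOp (l : Bool × Fin 32) : Module.End ℂ Fock :=
  if l.1 then create (ghostOfBit l.2) else annihilate (ghostOfBit l.2)

/-- The action of a ghost operator on a bit mask with coefficient. -/
def letterStep (l : Bool × Fin 32) (x : ℤ × ℕ) : ℤ × ℕ :=
  if x.2.testBit l.2 = l.1 then (0, 0) else (x.1 * bitSign x.2 l.2, flipBit x.2 l.2)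

/-- A ghost operator sends a monomial to a signed monomial or to zero, the latter being recorded as
coefficient `0` on the mask `0`. Operator algebra thereby becomes arithmetic on pairs. -/
theorem letterOp_bitState (l : Bool × Fin 32) (x : ℤ × ℕ) (f : MvPolynomial Osc ℂ) :
    letterOp l ((x.1 : ℂ) • bitState x.2 f) =
      ((letterStep l x).1 : ℂ) • bitState (letterStep l x).2 f := by
  obtain ⟨a, j⟩ := l
  obtain ⟨c, m⟩ := x
  rw [map_smul]
  cases a <;> cases h : m.testBit j <;>
  simp [letterOp, letterStep, bitState, create_state, annihilate_state, h,
    ghostOfBit_mem_ghostSet, insert_ghostSet, erase_ghostSet, ghostSign_ghostSet, smul_smul]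

/-- A word of ghost operators. -/
def wordOp (w : List (Bool × Fin 32)) : Module.End ℂ Fock := (w.map letterOp).prod

theorem wordOp_cons (l : Bool × Fin 32) (w : List (Bool × Fin 32)) :
    wordOp (l :: w) = letterOp l * wordOp w := rfl

theorem wordOp_bitState (w : List (Bool × Fin 32)) (x : ℤ × ℕ) (f : MvPolynomial Osc ℂ) :
    wordOp w ((x.1 : ℂ) • bitState x.2 f) =
      ((w.foldr letterStep x).1 : ℂ) • bitState (w.foldr letterStep x).2 f := by
  induction w with
  | nil => rfl
  | cons l w ih =>
    rw [wordOp_cons, Module.End.mul_apply, ih, List.foldr_cons, letterOp_bitState]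

/-- A linear combination of words of ghost operators, each one together with an operator on the
matter, numbered by `ι`. -/
def sumOp {ι : Type*} (O : ι → Module.End ℂ (MvPolynomial Osc ℂ))
    (L : List (ℤ × List (Bool × Fin 32) × ι)) : Module.End ℂ Fock :=
  (L.map fun x => (x.1 : ℂ) • (wordOp x.2.1 * bos (O x.2.2))).sum

/-- A linear combination of states. -/
def sumState {ι : Type*} (O : ι → Module.End ℂ (MvPolynomial Osc ℂ)) (L : List (ℤ × ℕ × ι))
    (f : MvPolynomial Osc ℂ) : Fock :=
  (L.map fun x => (x.1 : ℂ) • bitState x.2.1 (O x.2.2 f)).sum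

/-- The action of a linear combination of words on a bit mask. -/
def runWords {ι : Type*} (L : List (ℤ × List (Bool × Fin 32) × ι)) (m : ℕ) : List (ℤ × ℕ × ι) :=
  L.map fun x => ((x.2.1.foldr letterStep (x.1, m)).1, (x.2.1.foldr letterStep (x.1, m)).2, x.2.2)

/-- Words act on the ghosts and the operators `O` on the coefficients, so the ghost part can be
evaluated while the matter operators remain mere labels in `ι`. -/
theorem sumOp_bitState {ι : Type*} (O : ι → Module.End ℂ (MvPolynomial Osc ℂ))
    (L : List (ℤ × List (Bool × Fin 32) × ι)) (m : ℕ) (f : MvPolynomial Osc ℂ) :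
    sumOp O L (bitState m f) = sumState O (runWords L m) f := by
  induction L with
  | nil => rfl
  | cons x L ih =>
    have h := wordOp_bitState x.2.1 (x.1, m) (O x.2.2 f)
    rw [map_smul] at h
    have h' : bos (O x.2.2) (bitState m f) = bitState m (O x.2.2 f) := bos_state _ _ _
    simp only [sumOp, sumState, runWords, List.map_cons, List.sum_cons, LinearMap.add_apply] at ih ⊢
    rw [ih, LinearMap.smul_apply, Module.End.mul_apply, h', h]

/-- Adding a term to a linear combination of states. -/
def addTerm {ι : Type*} [DecidableEq ι] (x : ℤ × ℕ × ι) : List (ℤ × ℕ × ι) → List (ℤ × ℕ × ι)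
  | [] => if x.1 = 0 then [] else [x]
  | y :: L => if x.1 = 0 then y :: L else
      if x.2 = y.2 then (if x.1 + y.1 = 0 then L else (x.1 + y.1, y.2) :: L)
      else y :: addTerm x L

theorem sumState_addTerm {ι : Type*} [DecidableEq ι] (O : ι → Module.End ℂ (MvPolynomial Osc ℂ))
    (x : ℤ × ℕ × ι) (L : List (ℤ × ℕ × ι)) (f : MvPolynomial Osc ℂ) :
    sumState O (addTerm x L) f = (x.1 : ℂ) • bitState x.2.1 (O x.2.2 f) + sumState O L f := by
  induction L with
  | nil =>
    rw [addTerm]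
    split_ifs with h
    · simp [h]
    · simp [sumState]
  | cons y L ih =>
    rw [addTerm]
    split_ifs with h1 h2 h3
    · simp [h1]
    · have h4 : (x.1 : ℂ) = -(y.1 : ℂ) := by
        rw [eq_neg_iff_add_eq_zero]
        exact_mod_cast h3
      simp [sumState, h4, h2]
    · simp [sumState, h2, add_smul, add_assoc]
    · simp only [sumState, List.map_cons, List.sum_cons] at ih ⊢
      rw [ih]
      abel

/-- Collecting terms. -/
def collectTerms {ι : Type*} [DecidableEq ι] (L : List (ℤ × ℕ × ι)) : List (ℤ × ℕ × ι) :=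
  L.foldr addTerm []

/-- Terms with the same mask and the same label are merged and vanishing ones dropped, so that the
differential of a monomial is a short explicit list. -/
theorem sumState_collectTerms {ι : Type*} [DecidableEq ι]
    (O : ι → Module.End ℂ (MvPolynomial Osc ℂ)) (L : List (ℤ × ℕ × ι))
    (f : MvPolynomial Osc ℂ) : sumState O (collectTerms L) f = sumState O L f := by
  induction L with
  | nil => rfl
  | cons x L ih =>
    rw [collectTerms, List.foldr_cons, sumState_addTerm, ← collectTerms, ih]
    simp [sumState]

end

end CarrollString

namespace CarrollString

noncomputable section

/-! ### Truncated normal ordered products -/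

theorem mode_normalProd_eq_sum {W : Type*} [AddCommGroup W] [Module ℂ W] (ε : ℂ) (A B : Fields W)
    (n : ℤ) (v : W) (N : ℕ) (h : ∀ i : ℕ, N ≤ i → normalTerm ε A B n i v = 0) :
    mode (normalProd ε A B) n v = ∑ i ∈ Finset.range N, normalTerm ε A B n i v := by
  rw [mode_normalProd]
  refine finsum_eq_sum_of_support_subset _ fun i hi => ?_
  simp only [Finset.coe_range, Set.mem_Iio]
  by_contra hlt
  exact hi (h i (not_lt.mp hlt))

/-- In terms of F_j = b₍₋₁₋ⱼ₎c₍ₙ₊ⱼ₋₁₎ and G_j = c₍ₙ₋₂₋ⱼ₎b₍ⱼ₎, the product b∂c has coefficients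
−(n+j) and n−1−j, and ∂b c has coefficients j and j+1. The combination −2 b∂c − ∂b c therefore has
coefficients 2n+j and j+1−2n. The vanishing assumptions leave j < 4. -/
theorem mode_pair {W : Type*} [AddCommGroup W] [Module ℂ W] (b c : Fields W) (n : ℤ) (hn : -2 ≤ n)
    (v : W) (hb : ∀ i : ℤ, 4 ≤ i → mode b i v = 0) (hc : ∀ i : ℤ, 1 ≤ i → mode c i v = 0) :
    (-2 : ℂ) • mode (normalProd (-1) b (deriv c)) n v - mode (normalProd (-1) (deriv b) c) n v =
      ∑ j ∈ Finset.range 4, (((2 * n + j : ℤ) : ℂ) • mode b (-1 - j) (mode c (n + j - 1) v) +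
        ((j + 1 - 2 * n : ℤ) : ℂ) • mode c (n - 2 - j) (mode b j v)) := by
  set F : ℕ → W := fun j => mode b (-1 - j) (mode c (n + j - 1) v) with hF
  set G : ℕ → W := fun j => mode c (n - 2 - j) (mode b j v) with hG
  have h1 : ∀ i : ℕ, normalTerm (-1) b (deriv c) n i v =
      (-(n + i : ℂ)) • F i + (n - 1 - i : ℂ) • G i := by
    intro i
    rw [normalTerm_apply, mode_deriv, mode_deriv, LinearMap.smul_apply, map_smul,
      LinearMap.smul_apply, smul_smul, hF, hG]
    rw [show n - 1 - (i : ℤ) - 1 = n - 2 - i by ring]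
    push_cast
    module
  have h2 : ∀ i : ℕ, normalTerm (-1) (deriv b) c n (i + 1) v =
      (i + 2 : ℂ) • F (i + 2) + (i + 1 : ℂ) • G i := by
    intro i
    rw [normalTerm_apply, mode_deriv, mode_deriv, LinearMap.smul_apply, LinearMap.smul_apply,
      map_smul, hF, hG]
    push_cast
    rw [show -1 - ((i : ℤ) + 1) - 1 = -1 - (i + 2) by ring, show (i : ℤ) + 1 - 1 = i by ring,
      show n + ((i : ℤ) + 1) = n + (i + 2) - 1 by ring,
      show n - 1 - ((i : ℤ) + 1) = n - 2 - i by ring]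
    module
  have h3 : normalTerm (-1) (deriv b) c n 0 v = F 1 := by
    rw [normalTerm_apply, mode_deriv, mode_deriv, LinearMap.smul_apply, LinearMap.smul_apply, hF]
    simp
  have hF0 : ∀ j : ℕ, 4 ≤ j → F j = 0 := fun j hj => by
    rw [hF]
    dsimp only
    rw [hc _ (by omega), map_zero]
  have hG0 : ∀ j : ℕ, 4 ≤ j → G j = 0 := fun j hj => by
    rw [hG]
    dsimp only
    rw [hb _ (by omega), map_zero]
  change _ = ∑ j ∈ Finset.range 4, (((2 * n + j : ℤ) : ℂ) • F j +
    ((j + 1 - 2 * n : ℤ) : ℂ) • G j)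
  rw [mode_normalProd_eq_sum (-1) b (deriv c) n v 4 fun i hi => by
      rw [h1, hF0 i hi, hG0 i hi, smul_zero, smul_zero, add_zero],
    -- One more term is kept here, because the term of index i + 1 carries G_i.
    mode_normalProd_eq_sum (-1) (deriv b) c n v 5 fun i hi => by
      obtain ⟨i, rfl⟩ := Nat.exists_eq_add_of_le' (show 1 ≤ i by omega)
      rw [h2, hF0 (i + 2) (by omega), hG0 i (by omega), smul_zero, smul_zero, add_zero],
    Finset.sum_range_succ' (fun i => normalTerm (-1) (deriv b) c n i v), h3]
  simp only [h1, h2, Finset.sum_range_succ, Finset.sum_range_zero, hF0 4 le_rfl,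
    hF0 5 (by norm_num)]
  push_cast
  module

/-! ### The matter modes on polynomials -/

/-- The modes of `∂X^μ` on polynomials. -/
def dXPoly (μ : Fin 26) (n : ℤ) : Module.End ℂ (MvPolynomial Osc ℂ) :=
  if n < 0 then (-(n : ℂ)) • LinearMap.mulLeft ℂ (MvPolynomial.X (.x μ (-n - 1).toNat))
  else if n = 0 then 0
  else (n : ℂ) • (MvPolynomial.pderiv (.pi μ (n - 1).toNat)).toLinearMap

/-- The modes of `Π_μ` on polynomials. -/
def piPoly (p : Fin 26 → ℝ) (μ : Fin 26) (n : ℤ) : Module.End ℂ (MvPolynomial Osc ℂ) :=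
  if n < 0 then LinearMap.mulLeft ℂ (MvPolynomial.X (.pi μ (-n - 1).toNat))
  else if n = 0 then (Complex.I * (p μ : ℂ)) • 1
  else (MvPolynomial.pderiv (.x μ (n - 1).toNat)).toLinearMap

theorem mode_dX_state (μ : Fin 26) (n : ℤ) (S : Finset Ghost) (f : MvPolynomial Osc ℂ) :
    mode (dX μ) n (state S f) = state S (dXPoly μ n f) := by
  change dXMode μ n (state S f) = _
  unfold dXMode dXPoly
  split_ifs <;> simp [bos_state]

theorem mode_Pi_state (p : Fin 26 → ℝ) (μ : Fin 26) (n : ℤ) (S : Finset Ghost)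
    (f : MvPolynomial Osc ℂ) : mode (Pi p μ) n (state S f) = state S (piPoly p μ n f) := by
  change piMode p μ n (state S f) = _
  unfold piMode piPoly
  split_ifs <;> simp [bos_state]

/-- Polynomials in which no monomial has weight larger than `2`, as far as derivatives see it. -/
def LowPoly (f : MvPolynomial Osc ℂ) : Prop :=
  (∀ o : Osc, 2 ≤ o.idx → MvPolynomial.pderiv o f = 0) ∧
    ∀ o o' : Osc, 1 ≤ o.idx + o'.idx → MvPolynomial.pderiv o (MvPolynomial.pderiv o' f) = 0

theorem LowPoly.dXPoly {f : MvPolynomial Osc ℂ} (hf : LowPoly f) (μ : Fin 26) {n : ℤ}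
    (hn : 3 ≤ n) : dXPoly μ n f = 0 := by
  rw [CarrollString.dXPoly, if_neg (by omega), if_neg (by omega)]
  have h := hf.1 (.pi μ (n - 1).toNat) (show 2 ≤ (n - 1).toNat by omega)
  change (n : ℂ) • MvPolynomial.pderiv _ f = 0
  rw [h, smul_zero]

theorem LowPoly.piPoly {f : MvPolynomial Osc ℂ} (hf : LowPoly f) (p : Fin 26 → ℝ) (μ : Fin 26)
    {n : ℤ} (hn : 3 ≤ n) : piPoly p μ n f = 0 := by
  rw [CarrollString.piPoly, if_neg (by omega), if_neg (by omega)]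
  exact hf.1 (.x μ (n - 1).toNat) (show 2 ≤ (n - 1).toNat by omega)

/-- Two derivatives survive on polynomials of low weight only if both belong to oscillators of level
one, that is for m = n = 1; moreover ∂X has no zero mode. -/
theorem LowPoly.piPoly_dXPoly {f : MvPolynomial Osc ℂ} (hf : LowPoly f) (p : Fin 26 → ℝ)
    (μ : Fin 26) {m n : ℤ} (hm : 1 ≤ m) (hn : 0 ≤ n) (h : 3 ≤ m + n) :
    CarrollString.piPoly p μ m (CarrollString.dXPoly μ n f) = 0 := by
  rcases hn.eq_or_lt with rfl | hn
  · simp [CarrollString.dXPoly]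
  rw [CarrollString.piPoly, if_neg (by omega), if_neg (by omega), CarrollString.dXPoly,
    if_neg (by omega), if_neg (by omega)]
  have h := hf.2 (.x μ (m - 1).toNat) (.pi μ (n - 1).toNat)
    (show 1 ≤ (m - 1).toNat + (n - 1).toNat by omega)
  change MvPolynomial.pderiv _ ((n : ℂ) • MvPolynomial.pderiv _ f) = 0
  rw [Derivation.map_smul, h, smul_zero]

theorem LowPoly.dXPoly_dXPoly {f : MvPolynomial Osc ℂ} (hf : LowPoly f)
    (μ : Fin 26) {m n : ℤ} (hm : 0 ≤ m) (hn : 0 ≤ n) (h : 3 ≤ m + n) :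
    CarrollString.dXPoly μ m (CarrollString.dXPoly μ n f) = 0 := by
  rcases hn.eq_or_lt with rfl | hn
  · simp [CarrollString.dXPoly]
  rcases hm.eq_or_lt with rfl | hm
  · simp [CarrollString.dXPoly]
  rw [CarrollString.dXPoly, if_neg (by omega), if_neg (by omega), CarrollString.dXPoly,
    if_neg (by omega), if_neg (by omega)]
  have h := hf.2 (.pi μ (m - 1).toNat) (.pi μ (n - 1).toNat)
    (show 1 ≤ (m - 1).toNat + (n - 1).toNat by omega)
  change (m : ℂ) • MvPolynomial.pderiv _ ((n : ℂ) • MvPolynomial.pderiv _ f) = 0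
  rw [Derivation.map_smul, h, smul_zero, smul_zero]

theorem LowPoly.piPoly_piPoly {f : MvPolynomial Osc ℂ} (hf : LowPoly f) {p : Fin 26 → ℝ}
    {μ : Fin 26} (hp : p μ = 0) {m n : ℤ} (hm : 0 ≤ m) (hn : 0 ≤ n) (h : 3 ≤ m + n) :
    CarrollString.piPoly p μ m (CarrollString.piPoly p μ n f) = 0 := by
  rcases hn.eq_or_lt with rfl | hn
  · simp [CarrollString.piPoly, hp]
  rcases hm.eq_or_lt with rfl | hm
  · simp [CarrollString.piPoly, hp]
  rw [CarrollString.piPoly, if_neg (by omega), if_neg (by omega), CarrollString.piPoly,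
    if_neg (by omega), if_neg (by omega)]
  exact hf.2 (.x μ (m - 1).toNat) (.x μ (n - 1).toNat)
    (show 1 ≤ (m - 1).toNat + (n - 1).toNat by omega)

/-- The modes of `T` on polynomials of low weight. -/
def polyT (p : Fin 26 → ℝ) (n : ℤ) : Module.End ℂ (MvPolynomial Osc ℂ) :=
  ∑ μ : Fin 26, ∑ i ∈ Finset.range 4, (dXPoly μ (-1 - i) * piPoly p μ (n + i) +
    piPoly p μ (n - 1 - i) * dXPoly μ i)

/-- The modes of `M` on polynomials of low weight. -/
def polyM (τ : ℝ) (p : Fin 26 → ℝ) (n : ℤ) : Module.End ℂ (MvPolynomial Osc ℂ) :=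
  (1 / 2 : ℂ) • ∑ i ∈ Finset.range 4, (piPoly p 0 (-1 - i) * piPoly p 0 (n + i) +
    piPoly p 0 (n - 1 - i) * piPoly p 0 i) -
  (1 / 2 * (τ : ℂ) ^ 2) • ∑ j : Fin 25, ∑ i ∈ Finset.range 4,
    (dXPoly j.succ (-1 - i) * dXPoly j.succ (n + i) +
      dXPoly j.succ (n - 1 - i) * dXPoly j.succ i)

/-- For n ≥ −1 and i ≥ 4 the i-th normal ordered term contains Π₍ₙ₊ᵢ₎ with n + i ≥ 3 or ∂X₍ᵢ₎, and
both kill polynomials of low weight. Four terms are thus enough. -/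
theorem mode_matterT_state {p : Fin 26 → ℝ} {n : ℤ} (hn : -1 ≤ n) (S : Finset Ghost)
    {f : MvPolynomial Osc ℂ} (hf : LowPoly f) :
    mode (matterT p) n (state S f) = state S (polyT p n f) := by
  rw [matterT, mode_sum, polyT]
  simp only [LinearMap.sum_apply, map_sum]
  refine Finset.sum_congr rfl fun μ _ => ?_
  have h : ∀ i : ℕ, normalTerm 1 (dX μ) (Pi p μ) n i (state S f) = state S
      (dXPoly μ (-1 - i) (piPoly p μ (n + i) f) + piPoly p μ (n - 1 - i) (dXPoly μ i f)) := by
    intro i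
    rw [normalTerm_apply, mode_Pi_state, mode_dX_state, mode_dX_state, mode_Pi_state, one_smul,
      map_add]
  rw [mode_normalProd_eq_sum _ _ _ _ _ 4 fun i hi => by
    rw [h, hf.piPoly p μ (by omega), hf.dXPoly μ (by omega)]
    simp]
  simp only [h]
  rfl

theorem mode_matterM_state {τ : ℝ} {p : Fin 26 → ℝ} {n : ℤ} (hn : -1 ≤ n)
    (S : Finset Ghost) {f : MvPolynomial Osc ℂ} (hf : LowPoly f) :
    mode (matterM τ p) n (state S f) = state S (polyM τ p n f) := by
  have h1 : ∀ i : ℕ, normalTerm 1 (Pi p 0) (Pi p 0) n i (state S f) = state S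
      (piPoly p 0 (-1 - i) (piPoly p 0 (n + i) f) + piPoly p 0 (n - 1 - i) (piPoly p 0 i f)) := by
    intro i
    rw [normalTerm_apply, mode_Pi_state, mode_Pi_state, mode_Pi_state, mode_Pi_state, one_smul,
      map_add]
  have h2 : ∀ (j : Fin 25) (i : ℕ), normalTerm 1 (dX j.succ) (dX j.succ) n i (state S f) = state S
      (dXPoly j.succ (-1 - i) (dXPoly j.succ (n + i) f) +
        dXPoly j.succ (n - 1 - i) (dXPoly j.succ i f)) := by
    intro j i
    rw [normalTerm_apply, mode_dX_state, mode_dX_state, mode_dX_state, mode_dX_state, one_smul,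
      map_add]
  rw [matterM, mode_sub, mode_smul, mode_smul, LinearMap.sub_apply, LinearMap.smul_apply,
    LinearMap.smul_apply, mode_sum, mode_normalProd_eq_sum _ _ _ _ _ 4 fun i hi => by
      rw [h1, hf.piPoly p 0 (by omega), hf.piPoly p 0 (by omega)]
      simp]
  have h3 : ∀ j : Fin 25, mode (normalProd 1 (dX j.succ) (dX j.succ)) n (state S f) =
      ∑ i ∈ Finset.range 4, normalTerm 1 (dX j.succ) (dX j.succ) n i (state S f) := fun j =>
    mode_normalProd_eq_sum _ _ _ _ _ 4 fun i hi => by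
      rw [h2, hf.dXPoly _ (by omega), hf.dXPoly _ (by omega)]
      simp
  simp only [h1, h2, h3, ← map_sum, ← map_smul, ← map_sub, polyM, LinearMap.sub_apply,
    LinearMap.smul_apply, LinearMap.sum_apply, LinearMap.add_apply, Module.End.mul_apply]

/-- The mode T₍ₙ₎ lowers the weight by n − 1 ≥ 3, while only two units are available. In the second
half of each term either the first derivative already has level three, which happens for i = 3, or
two derivatives are too many. -/
theorem LowPoly.polyT {f : MvPolynomial Osc ℂ} (hf : LowPoly f) (p : Fin 26 → ℝ) {n : ℤ}
    (hn : 4 ≤ n) : polyT p n f = 0 := by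
  rw [CarrollString.polyT, LinearMap.sum_apply]
  refine Finset.sum_eq_zero fun μ _ => ?_
  rw [LinearMap.sum_apply]
  refine Finset.sum_eq_zero fun i hi => ?_
  rw [Finset.mem_range] at hi
  rw [LinearMap.add_apply, Module.End.mul_apply, Module.End.mul_apply, hf.piPoly p μ (by omega),
    map_zero, zero_add]
  by_cases h : i = 3
  · rw [hf.dXPoly μ (by omega), map_zero]
  · exact hf.piPoly_dXPoly p μ (by omega) (by omega) (by omega)

theorem LowPoly.polyM {f : MvPolynomial Osc ℂ} (hf : LowPoly f) (τ : ℝ) {p : Fin 26 → ℝ}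
    (hp : p 0 = 0) {n : ℤ} (hn : 4 ≤ n) : polyM τ p n f = 0 := by
  have h1 : ∑ i ∈ Finset.range 4, (CarrollString.piPoly p 0 (-1 - i) *
      CarrollString.piPoly p 0 (n + i) + CarrollString.piPoly p 0 (n - 1 - i) *
      CarrollString.piPoly p 0 i) f = 0 := by
    refine Finset.sum_eq_zero fun i hi => ?_
    rw [Finset.mem_range] at hi
    rw [LinearMap.add_apply, Module.End.mul_apply, Module.End.mul_apply, hf.piPoly p 0 (by omega),
      map_zero, zero_add, hf.piPoly_piPoly hp (by omega) (by omega) (by omega)]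
  have h2 : ∀ j : Fin 25, ∑ i ∈ Finset.range 4, (CarrollString.dXPoly j.succ (-1 - i) *
      CarrollString.dXPoly j.succ (n + i) + CarrollString.dXPoly j.succ (n - 1 - i) *
      CarrollString.dXPoly j.succ i) f = 0 := by
    refine fun j => Finset.sum_eq_zero fun i hi => ?_
    rw [Finset.mem_range] at hi
    rw [LinearMap.add_apply, Module.End.mul_apply, Module.End.mul_apply, hf.dXPoly _ (by omega),
      map_zero, zero_add, hf.dXPoly_dXPoly _ (by omega) (by omega) (by omega)]
  rw [CarrollString.polyM, LinearMap.sub_apply, LinearMap.smul_apply, LinearMap.smul_apply,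
    LinearMap.sum_apply, LinearMap.sum_apply, h1]
  simp only [LinearMap.sum_apply]
  simp only [h2]
  simp

/-! ### The ghost modes as words -/

/-- The bit of a ghost mode. -/
def ghostBit (t : Fin 4) (k : ℕ) : Fin 32 := ⟨8 * t + k % 8, by omega⟩

/-- The letter of a mode of a ghost field. -/
def modeLetter (t t' : Fin 4) (n : ℤ) : Bool × Fin 32 :=
  if n < 0 then (true, ghostBit t (-n - 1).toNat) else (false, ghostBit t' n.toNat)

theorem ghostOfBit_ghostBit (t : Fin 4) {k : ℕ} (hk : k < 8) :
    ghostOfBit (ghostBit t k) = toLex (t, k) := by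
  rw [ghostOfBit, ghostBit]
  congr 2
  · exact Fin.ext (by dsimp only; omega)
  · dsimp only
    omega

/-- Eight bits are reserved for each type of ghost, so exactly the modes −8, …, 7 are represented
faithfully by letters. -/
theorem mode_ghostField (t t' : Fin 4) {n : ℤ} (h : -8 ≤ n) (h' : n < 8) :
    mode (ghostField t t') n = letterOp (modeLetter t t' n) := by
  change ghostMode t t' n = _
  unfold ghostMode modeLetter
  split_ifs
  · rw [letterOp, if_pos rfl, ghostOfBit_ghostBit _ (by omega)]
  · rw [letterOp, if_neg Bool.false_ne_true, ghostOfBit_ghostBit _ (by omega)]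

theorem mode_ghostField_of_nonneg (t t' : Fin 4) {n : ℤ} (h : 0 ≤ n) :
    mode (ghostField t t') n = annihilate (toLex (t', n.toNat)) := by
  change ghostMode t t' n = _
  rw [ghostMode, if_neg (by omega)]

/-- Ghost sets which contain only `c_n`, `C_n` for `n ≥ -2` and `b_{-2}`, `B_{-2}`. -/
def LowSet (S : Finset Ghost) : Prop :=
  ∀ g ∈ S, (ofLex g).2 < if (ofLex g).1 < 2 then 4 else 1

theorem LowSet.notMem {S : Finset Ghost} (hS : LowSet S) {t : Fin 4} {k : ℕ}
    (h : (if t < 2 then 4 else 1) ≤ k) : toLex (t, k) ∉ S := fun hm =>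
  absurd (hS _ hm) (not_lt.mpr h)

theorem LowSet.erase {S : Finset Ghost} (hS : LowSet S) (g : Ghost) : LowSet (S.erase g) :=
  fun h hh => hS h (Finset.mem_of_mem_erase hh)

theorem LowSet.mode_eq_zero {S : Finset Ghost} (hS : LowSet S) (t : Fin 4) {t' : Fin 4} {n : ℤ}
    (h : (if t' < 2 then 4 else 1) ≤ n) (f : MvPolynomial Osc ℂ) :
    mode (ghostField t t') n (state S f) = 0 := by
  have hn : 0 ≤ n := le_trans (by split_ifs <;> norm_num) h
  rw [mode_ghostField_of_nonneg t t' hn]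
  refine annihilate_state_of_notMem (hS.notMem ?_) f
  split_ifs at h ⊢ <;> omega

theorem LowSet.mode_mode_eq_zero {S : Finset Ghost} (hS : LowSet S) (t s : Fin 4) {t' s' : Fin 4}
    {n m : ℤ} (h : (if t' < 2 then 4 else 1) ≤ n) (hm : 0 ≤ m) (f : MvPolynomial Osc ℂ) :
    mode (ghostField t t') n (mode (ghostField s s') m (state S f)) = 0 := by
  have hn : 0 ≤ n := le_trans (by split_ifs <;> norm_num) h
  rw [mode_ghostField_of_nonneg t t' hn, mode_ghostField_of_nonneg s s' hm]
  refine annihilate_annihilate_state_of_notMem (hS.notMem ?_) _ f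
  split_ifs at h ⊢ <;> omega

/-- The words of the `n`-th mode of `-2 b ∂c - ∂b c`, where `b` has type `t` and conjugate `t'`, and
`c` has type `s` and conjugate `s'`. -/
def pairWords (t t' s s' : Fin 4) (n : ℤ) : List (ℤ × List (Bool × Fin 32)) :=
  (List.range 4).flatMap fun j : ℕ =>
    [(2 * n + j, [modeLetter t t' (-1 - j), modeLetter s s' (n + j - 1)]),
    (j + 1 - 2 * n, [modeLetter s s' (n - 2 - j), modeLetter t t' j])]

/-- A linear combination of words. -/
def wordsOp (L : List (ℤ × List (Bool × Fin 32))) : Module.End ℂ Fock :=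
  (L.map fun x => (x.1 : ℂ) • wordOp x.2).sum

theorem wordsOp_append (L L' : List (ℤ × List (Bool × Fin 32))) :
    wordsOp (L ++ L') = wordsOp L + wordsOp L' := by
  simp [wordsOp]

theorem wordsOp_flatMap_range (F : ℕ → List (ℤ × List (Bool × Fin 32))) (n : ℕ) :
    wordsOp ((List.range n).flatMap F) = ∑ i ∈ Finset.range n, wordsOp (F i) := by
  induction n with
  | zero => rfl
  | succ n ih =>
    rw [List.range_succ, List.flatMap_append, wordsOp_append, ih, Finset.sum_range_succ]
    simp

/-- The bounds −1 ≤ n < 6 keep the mode numbers −1−j, n+j−1, n−2−j and j, for j < 4, inside the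
window −8, …, 7; the extreme case is 5+3−1 = 7. -/
theorem wordsOp_pairWords {t t' s s' : Fin 4} (ht : t' < 2) (hs : ¬ s' < 2) {n : ℤ}
    (hn : -1 ≤ n) (hn' : n < 6) {S : Finset Ghost} (hS : LowSet S) (f : MvPolynomial Osc ℂ) :
    (-2 : ℂ) • mode (normalProd (-1) (ghostField t t') (deriv (ghostField s s'))) n (state S f) -
      mode (normalProd (-1) (deriv (ghostField t t')) (ghostField s s')) n (state S f) =
    wordsOp (pairWords t t' s s' n) (state S f) := by
  rw [mode_pair _ _ n (by omega) _ (fun i hi => hS.mode_eq_zero t (by rwa [if_pos ht]) f)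
    fun i hi => hS.mode_eq_zero s (by rwa [if_neg hs]) f, pairWords, wordsOp_flatMap_range,
    LinearMap.sum_apply]
  refine Finset.sum_congr rfl fun j hj => ?_
  rw [Finset.mem_range] at hj
  rw [mode_ghostField t t' (by omega) (by omega), mode_ghostField t t' (by omega) (by omega),
    mode_ghostField s s' (by omega) (by omega), mode_ghostField s s' (by omega) (by omega)]
  simp [wordsOp, wordOp]

/-- For n ≥ 6 every term contains a mode of the ghost of type `s` with number at least 1. Such a
mode annihilates an antighost beyond the lowest one, and low ghost sets contain none. -/
theorem mode_pair_eq_zero {t t' s s' : Fin 4} (ht : t' < 2) (hs : ¬ s' < 2) {n : ℤ}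
    (hn : 6 ≤ n) {S : Finset Ghost} (hS : LowSet S) (f : MvPolynomial Osc ℂ) :
    (-2 : ℂ) • mode (normalProd (-1) (ghostField t t') (deriv (ghostField s s'))) n (state S f) -
      mode (normalProd (-1) (deriv (ghostField t t')) (ghostField s s')) n (state S f) = 0 := by
  rw [mode_pair _ _ n (by omega) _ (fun i hi => hS.mode_eq_zero t (by rwa [if_pos ht]) f)
    fun i hi => hS.mode_eq_zero s (by rwa [if_neg hs]) f]
  refine Finset.sum_eq_zero fun j hj => ?_
  rw [Finset.mem_range] at hj
  rw [hS.mode_eq_zero s (by rw [if_neg hs]; omega),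
    hS.mode_mode_eq_zero s t (by rw [if_neg hs]; omega) (by omega)]
  simp

end

end CarrollString

namespace CarrollString

noncomputable section

/-! ### The BRST operator as a sum of words -/

/-- Low ghost sets contain no antighosts except b₋₂ and B₋₂. Among the annihilating modes of c or C
only the mode ₍₀₎ can therefore act, which leaves the single reordered term A₍₋₁₎c₍₀₎. -/
theorem mode_zero_ghost_normalProd {t t' : Fin 4} (ht : ¬ t' < 2) (A : Fields Fock) (N : ℕ)
    (hN : 1 ≤ N) {S : Finset Ghost} (hS : LowSet S) (f : MvPolynomial Osc ℂ)
    (hA : ∀ i : ℤ, N ≤ i → mode A i (state S f) = 0) :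
    mode (normalProd 1 (ghostField t t') A) 0 (state S f) =
      ∑ i ∈ Finset.range N, mode (ghostField t t') (-1 - i) (mode A i (state S f)) +
        mode A (-1) (mode (ghostField t t') 0 (state S f)) := by
  have h : ∀ i : ℕ, normalTerm 1 (ghostField t t') A 0 i (state S f) =
      mode (ghostField t t') (-1 - i) (mode A i (state S f)) +
        if i = 0 then mode A (-1) (mode (ghostField t t') 0 (state S f)) else 0 := by
    intro i
    rw [normalTerm_apply, one_smul, zero_add, zero_sub]
    split_ifs with hi
    · subst hi
      simp
    · rw [hS.mode_eq_zero t (by rw [if_neg ht]; omega), map_zero]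
  rw [mode_normalProd_eq_sum _ _ _ _ _ N fun i hi => by
    rw [h, hA i (by omega), map_zero, if_neg (by omega), add_zero]]
  simp only [h, Finset.sum_add_distrib]
  rw [Finset.sum_ite_eq', if_pos (Finset.mem_range.mpr hN)]

/-- The words of the modes of `T^gh`. -/
def ghostTWords (n : ℤ) : List (ℤ × List (Bool × Fin 32)) :=
  pairWords 2 0 0 2 n ++ pairWords 3 1 1 3 n

/-- The words of the modes of `M^gh`. -/
def ghostMWords (n : ℤ) : List (ℤ × List (Bool × Fin 32)) := pairWords 3 1 0 2 n

theorem mode_ghostT (n : ℤ) (v : Fock) : mode ghostT n v =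
    ((-2 : ℂ) • mode (normalProd (-1) (ghostField 2 0) (deriv (ghostField 0 2))) n v -
      mode (normalProd (-1) (deriv (ghostField 2 0)) (ghostField 0 2)) n v) +
    ((-2 : ℂ) • mode (normalProd (-1) (ghostField 3 1) (deriv (ghostField 1 3))) n v -
      mode (normalProd (-1) (deriv (ghostField 3 1)) (ghostField 1 3)) n v) := by
  simp only [ghostT, mode_sub, mode_smul, LinearMap.sub_apply, LinearMap.smul_apply, ghb, ghc, ghB,
    ghC]
  module

theorem mode_ghostM (n : ℤ) (v : Fock) : mode ghostM n v =
    (-2 : ℂ) • mode (normalProd (-1) (ghostField 3 1) (deriv (ghostField 0 2))) n v -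
      mode (normalProd (-1) (deriv (ghostField 3 1)) (ghostField 0 2)) n v := by
  simp only [ghostM, mode_sub, mode_smul, LinearMap.sub_apply, LinearMap.smul_apply, ghc, ghB]

theorem mode_ghostT_state {n : ℤ} (hn : -1 ≤ n) (hn' : n < 6) {S : Finset Ghost} (hS : LowSet S)
    (f : MvPolynomial Osc ℂ) :
    mode ghostT n (state S f) = wordsOp (ghostTWords n) (state S f) := by
  rw [mode_ghostT, wordsOp_pairWords (by decide) (by decide) hn hn' hS,
    wordsOp_pairWords (by decide) (by decide) hn hn' hS, ghostTWords, wordsOp_append,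
    LinearMap.add_apply]

theorem mode_ghostM_state {n : ℤ} (hn : -1 ≤ n) (hn' : n < 6) {S : Finset Ghost} (hS : LowSet S)
    (f : MvPolynomial Osc ℂ) :
    mode ghostM n (state S f) = wordsOp (ghostMWords n) (state S f) := by
  rw [mode_ghostM, wordsOp_pairWords (by decide) (by decide) hn hn' hS, ghostMWords]

theorem mode_ghostT_state_eq_zero {n : ℤ} (hn : 6 ≤ n) {S : Finset Ghost} (hS : LowSet S)
    (f : MvPolynomial Osc ℂ) : mode ghostT n (state S f) = 0 := by
  rw [mode_ghostT, mode_pair_eq_zero (by decide) (by decide) hn hS,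
    mode_pair_eq_zero (by decide) (by decide) hn hS, add_zero]

theorem mode_ghostM_state_eq_zero {n : ℤ} (hn : 6 ≤ n) {S : Finset Ghost} (hS : LowSet S)
    (f : MvPolynomial Osc ℂ) : mode ghostM n (state S f) = 0 := by
  rw [mode_ghostM, mode_pair_eq_zero (by decide) (by decide) hn hS]

/-- The matter operators in the BRST operator: `none` for the identity, `(false, n)` and `(true, n)`
for the `n`-th modes of `T` and `M`. -/
def matterOp (τ : ℝ) (p : Fin 26 → ℝ) : Option (Bool × ℤ) → Module.End ℂ (MvPolynomial Osc ℂ)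
  | none => 1
  | some (false, n) => polyT p n
  | some (true, n) => polyM τ p n

/-- The words of twice the BRST operator, on states of low weight. -/
def brstWords : List (ℤ × List (Bool × Fin 32) × Option (Bool × ℤ)) :=
  ((List.range 4).map fun i : ℕ => (2, [modeLetter 0 2 (-1 - i)], some (false, (i : ℤ)))) ++
  ((List.range 4).map fun i : ℕ => (2, [modeLetter 1 3 (-1 - i)], some (true, (i : ℤ)))) ++
  [(2, [modeLetter 0 2 0], some (false, -1)), (2, [modeLetter 1 3 0], some (true, -1))] ++
  ((List.range 6).flatMap fun i : ℕ => (ghostTWords i).map fun x =>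
    (x.1, modeLetter 0 2 (-1 - i) :: x.2, none)) ++
  ((List.range 6).flatMap fun i : ℕ => (ghostMWords i).map fun x =>
    (x.1, modeLetter 1 3 (-1 - i) :: x.2, none)) ++
  ((ghostTWords (-1)).map fun x => (x.1, x.2 ++ [modeLetter 0 2 0], none)) ++
  ((ghostMWords (-1)).map fun x => (x.1, x.2 ++ [modeLetter 1 3 0], none))

section SumOp

variable {ι : Type*} (O : ι → Module.End ℂ (MvPolynomial Osc ℂ))

theorem sumOp_append (L L' : List (ℤ × List (Bool × Fin 32) × ι)) :
    sumOp O (L ++ L') = sumOp O L + sumOp O L' := by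
  simp [sumOp]

theorem sumOp_flatMap_range (F : ℕ → List (ℤ × List (Bool × Fin 32) × ι)) (n : ℕ) :
    sumOp O ((List.range n).flatMap F) = ∑ i ∈ Finset.range n, sumOp O (F i) := by
  induction n with
  | zero => rfl
  | succ n ih =>
    rw [List.range_succ, List.flatMap_append, sumOp_append, ih, Finset.sum_range_succ]
    simp

theorem sumOp_map_range (F : ℕ → ℤ × List (Bool × Fin 32) × ι) (n : ℕ) :
    sumOp O ((List.range n).map F) = ∑ i ∈ Finset.range n, sumOp O [F i] := by
  rw [← sumOp_flatMap_range O (fun i => [F i]), List.map_eq_flatMap]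

theorem sumOp_cons_words (o : ι) (ho : O o = 1) (l : Bool × Fin 32)
    (L : List (ℤ × List (Bool × Fin 32))) :
    sumOp O (L.map fun x => (x.1, l :: x.2, o)) = letterOp l * wordsOp L := by
  have h1 : bos 1 = 1 := Fock.hom_ext fun S f => bos_state _ _ _
  induction L with
  | nil => simp [sumOp, wordsOp]
  | cons x L ih =>
    simp only [sumOp, wordsOp, List.map_cons, List.sum_cons, mul_add, ho, h1, mul_one] at ih ⊢
    rw [ih, wordOp_cons, mul_smul_comm]

theorem sumOp_words_concat (o : ι) (ho : O o = 1) (l : Bool × Fin 32)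
    (L : List (ℤ × List (Bool × Fin 32))) :
    sumOp O (L.map fun x => (x.1, x.2 ++ [l], o)) = wordsOp L * letterOp l := by
  have h1 : bos 1 = 1 := Fock.hom_ext fun S f => bos_state _ _ _
  induction L with
  | nil => simp [sumOp, wordsOp]
  | cons x L ih =>
    simp only [sumOp, wordsOp, List.map_cons, List.sum_cons, add_mul, ho, h1, mul_one] at ih ⊢
    rw [ih, smul_mul_assoc]
    simp [wordOp]

end SumOp

/-- Removing a ghost from a low set leaves a low set, so a formula for A₍₋₁₎ on low states may still
be applied after an annihilation. -/
theorem mode_neg_one_annihilate {A : Fields Fock} {F : Module.End ℂ Fock}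
    (h : ∀ S, LowSet S → ∀ f, mode A (-1) (state S f) = F (state S f)) {S : Finset Ghost}
    (hS : LowSet S) (f : MvPolynomial Osc ℂ) (g : Ghost) :
    mode A (-1) (annihilate g (state S f)) = F (annihilate g (state S f)) := by
  rw [annihilate_state]
  split_ifs
  · rw [map_smul, map_smul, h _ (hS.erase g)]
  · rw [map_zero, map_zero]

theorem annihilate_bos (g : Ghost) (F : Module.End ℂ (MvPolynomial Osc ℂ)) (S : Finset Ghost)
    (f : MvPolynomial Osc ℂ) :
    bos F (annihilate g (state S f)) = annihilate g (bos F (state S f)) := by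
  rw [bos_state, annihilate_state, annihilate_state]
  split_ifs
  · rw [map_smul, bos_state]
  · rw [map_zero]

theorem mode_ghostField_eq_letterOp (t t' : Fin 4) {i : ℕ} (hi : i < 6) :
    mode (ghostField t t') (-1 - i) = letterOp (modeLetter t t' (-1 - i)) :=
  mode_ghostField t t' (by omega) (by omega)

theorem mode_zero_ghost_normalProd_words {t t' : Fin 4} (ht : ¬ t' < 2) {A : Fields Fock}
    {w : ℤ → List (ℤ × List (Bool × Fin 32))}
    (h : ∀ n, -1 ≤ n → n < 6 → ∀ S, LowSet S → ∀ f,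
      mode A n (state S f) = wordsOp (w n) (state S f))
    (h0 : ∀ n, 6 ≤ n → ∀ S, LowSet S → ∀ f, mode A n (state S f) = 0) {S : Finset Ghost}
    (hS : LowSet S) (f : MvPolynomial Osc ℂ) :
    mode (normalProd 1 (ghostField t t') A) 0 (state S f) =
      ∑ i ∈ Finset.range 6, letterOp (modeLetter t t' (-1 - i)) (wordsOp (w i) (state S f)) +
        wordsOp (w (-1)) (letterOp (modeLetter t t' 0) (state S f)) := by
  have hl0 := mode_ghostField t t' (n := 0) (by norm_num) (by norm_num)
  have hm0 := mode_ghostField_of_nonneg t t' (n := 0) le_rfl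
  rw [mode_zero_ghost_normalProd ht _ 6 (by norm_num) hS f fun i hi =>
    h0 i (by exact_mod_cast hi) S hS f, ← hl0, hm0,
    mode_neg_one_annihilate (fun S hS f => h (-1) le_rfl (by norm_num) S hS f) hS f]
  refine congrArg (· + _) (Finset.sum_congr rfl fun i hi => ?_)
  rw [Finset.mem_range] at hi
  rw [h i (by omega) (by omega) S hS, mode_ghostField_eq_letterOp t t' hi]

theorem mode_zero_ghost_normalProd_bos {t t' : Fin 4} (ht : ¬ t' < 2) {A : Fields Fock}
    {F : ℤ → Module.End ℂ (MvPolynomial Osc ℂ)} {f : MvPolynomial Osc ℂ}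
    (h : ∀ n, -1 ≤ n → ∀ S, mode A n (state S f) = state S (F n f))
    (h0 : ∀ n, 4 ≤ n → F n f = 0) {S : Finset Ghost} (hS : LowSet S) :
    mode (normalProd 1 (ghostField t t') A) 0 (state S f) =
      ∑ i ∈ Finset.range 4, letterOp (modeLetter t t' (-1 - i)) (bos (F i) (state S f)) +
        letterOp (modeLetter t t' 0) (bos (F (-1)) (state S f)) := by
  have hl0 := mode_ghostField t t' (n := 0) (by norm_num) (by norm_num)
  have hm0 := mode_ghostField_of_nonneg t t' (n := 0) le_rfl
  rw [mode_zero_ghost_normalProd ht _ 4 (by norm_num) hS f fun i hi => by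
    rw [h i (by omega), h0 i (by exact_mod_cast hi), map_zero], ← hl0, hm0]
  refine congrArg₂ (· + ·) (Finset.sum_congr rfl fun i hi => ?_) ?_
  · rw [Finset.mem_range] at hi
    rw [h i (by omega), bos_state, mode_ghostField_eq_letterOp t t' (by omega)]
  · rw [← annihilate_bos, annihilate_state]
    split_ifs
    · rw [map_smul, map_smul, h _ le_rfl, bos_state]
    · rw [map_zero, map_zero]

/-- Doubling clears the factors ½ in front of the ghost currents and makes all coefficients of words
integral; the ½ in M stays inside `polyM`. The matter currents contribute the modes −1, …, 3 and the
ghost currents the modes −1, …, 5. -/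
theorem two_smul_brst_state {τ : ℝ} {p : Fin 26 → ℝ} (hp : p 0 = 0) {S : Finset Ghost}
    (hS : LowSet S) {f : MvPolynomial Osc ℂ} (hf : LowPoly f) :
    (2 : ℂ) • brst τ p (state S f) = sumOp (matterOp τ p) brstWords (state S f) := by
  rw [brst, brstCurrent, mode_add, mode_add, mode_add, mode_smul, mode_smul, LinearMap.add_apply,
    LinearMap.add_apply, LinearMap.add_apply, LinearMap.smul_apply, LinearMap.smul_apply, ghc, ghC,
    mode_zero_ghost_normalProd_bos (F := polyT p) (by decide)
      (fun n hn S => mode_matterT_state hn S hf) (fun n hn => hf.polyT p hn) hS,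
    mode_zero_ghost_normalProd_bos (F := polyM τ p) (by decide)
      (fun n hn S => mode_matterM_state hn S hf) (fun n hn => hf.polyM τ hp hn) hS,
    mode_zero_ghost_normalProd_words (w := ghostTWords) (by decide)
      (fun n hn hn' S hS f => mode_ghostT_state hn hn' hS f)
      (fun n hn S hS f => mode_ghostT_state_eq_zero hn hS f) hS,
    mode_zero_ghost_normalProd_words (w := ghostMWords) (by decide)
      (fun n hn hn' S hS f => mode_ghostM_state hn hn' hS f)
      (fun n hn S hS f => mode_ghostM_state_eq_zero hn hS f) hS, brstWords]
  simp only [sumOp_append, sumOp_flatMap_range, sumOp_map_range,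
    sumOp_cons_words (matterOp τ p) none rfl, sumOp_words_concat (matterOp τ p) none rfl]
  simp only [sumOp, List.map_cons, List.map_nil, List.sum_cons, List.sum_nil, add_zero,
    LinearMap.add_apply, LinearMap.sum_apply, LinearMap.smul_apply, Module.End.mul_apply,
    wordOp, List.prod_cons, List.prod_nil, mul_one, matterOp, ← Finset.smul_sum]
  push_cast
  module

/-- The terms of twice the BRST operator on the ghost set with bit mask `m`. -/
def brstTerms (m : ℕ) : List (ℤ × ℕ × Option (Bool × ℤ)) := collectTerms (runWords brstWords m)

theorem two_smul_brst_bitState {τ : ℝ} {p : Fin 26 → ℝ} (hp : p 0 = 0) {m : ℕ}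
    (hm : LowSet (ghostSet m)) {f : MvPolynomial Osc ℂ} (hf : LowPoly f) :
    (2 : ℂ) • brst τ p (bitState m f) = sumState (matterOp τ p) (brstTerms m) f := by
  rw [bitState, two_smul_brst_state hp hm hf, brstTerms, sumState_collectTerms, ← bitState,
    sumOp_bitState]

end

end CarrollString

namespace CarrollString

noncomputable section

open MvPolynomial (X C pderiv)

/-! ### Linear and quadratic forms in the oscillators -/

/-- The polynomials in the bosonic creation operators. -/
abbrev Poly : Type := MvPolynomial Osc ℂ

/-- The linear form `∑ᵢ vᵢ aᵢ`. -/
def linForm (a : Fin 25 → Poly) : Vect →ₗ[ℂ] Poly where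
  toFun v := ∑ i, v i • a i
  map_add' v w := by simp [add_smul, Finset.sum_add_distrib]
  map_smul' c v := by simp [mul_smul, Finset.smul_sum]

/-- The bilinear form `∑ᵢⱼ Tᵢⱼ aᵢ bⱼ`. -/
def quadForm (a b : Fin 25 → Poly) : Tens →ₗ[ℂ] Poly where
  toFun T := ∑ i, ∑ j, T i j • (a i * b j)
  map_add' T U := by simp [add_smul, Finset.sum_add_distrib]
  map_smul' c T := by simp [mul_smul, Finset.smul_sum]

theorem linForm_apply (a : Fin 25 → Poly) (v : Vect) : linForm a v = ∑ i, v i • a i := rfl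

theorem quadForm_apply (a b : Fin 25 → Poly) (T : Tens) :
    quadForm a b T = ∑ i, ∑ j, T i j • (a i * b j) := rfl

theorem linForm_C (P v : Vect) : linForm (fun i => C (P i)) v = C (v ⬝ᵥ P) := by
  simp [linForm_apply, dotProduct, MvPolynomial.smul_eq_C_mul]

theorem linForm_zero_left (v : Vect) : linForm 0 v = 0 := by simp [linForm_apply]

theorem linForm_smul_left (c : ℂ) (a : Fin 25 → Poly) (v : Vect) :
    linForm (c • a) v = c • linForm a v := by
  simp only [linForm_apply, Finset.smul_sum, Pi.smul_apply]
  exact Finset.sum_congr rfl fun i _ => smul_comm _ _ _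

theorem quadForm_zero_left (b : Fin 25 → Poly) (T : Tens) : quadForm 0 b T = 0 := by
  simp [quadForm_apply]

theorem quadForm_zero_right (a : Fin 25 → Poly) (T : Tens) : quadForm a 0 T = 0 := by
  simp [quadForm_apply]

theorem quadForm_smul_left (c : ℂ) (a b : Fin 25 → Poly) (T : Tens) :
    quadForm (c • a) b T = c • quadForm a b T := by
  simp only [quadForm_apply, Finset.smul_sum, Pi.smul_apply, smul_mul_assoc]
  exact Finset.sum_congr rfl fun i _ => Finset.sum_congr rfl fun j _ => smul_comm _ _ _

theorem quadForm_smul_right (c : ℂ) (a b : Fin 25 → Poly) (T : Tens) :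
    quadForm a (c • b) T = c • quadForm a b T := by
  simp only [quadForm_apply, Finset.smul_sum, Pi.smul_apply, mul_smul_comm]
  exact Finset.sum_congr rfl fun i _ => Finset.sum_congr rfl fun j _ => smul_comm _ _ _

theorem quadForm_comm (a b : Fin 25 → Poly) (T : Tens) :
    quadForm b a T = quadForm a b T.transpose := by
  rw [quadForm_apply, quadForm_apply, Finset.sum_comm]
  simp only [Matrix.transpose_apply, mul_comm]

theorem quadForm_C_right (a : Fin 25 → Poly) (P : Vect) (T : Tens) :
    quadForm a (fun i => C (P i)) T = linForm a (T.mulVec P) := by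
  simp only [quadForm_apply, linForm_apply, Matrix.mulVec, dotProduct, Finset.sum_smul]
  refine Finset.sum_congr rfl fun i _ => Finset.sum_congr rfl fun j _ => ?_
  rw [mul_smul, mul_comm, ← MvPolynomial.smul_eq_C_mul]

theorem quadForm_C_left (b : Fin 25 → Poly) (P : Vect) (T : Tens) :
    quadForm (fun i => C (P i)) b T = linForm b (T.transpose.mulVec P) := by
  rw [quadForm_comm, quadForm_C_right]

theorem linForm_mul_linForm (a b : Fin 25 → Poly) (v w : Vect) :
    linForm a v * linForm b w = quadForm a b (Matrix.vecMulVec v w) := by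
  simp only [quadForm_apply, linForm_apply, Finset.sum_mul_sum, Matrix.vecMulVec_apply]
  refine Finset.sum_congr rfl fun i _ => Finset.sum_congr rfl fun j _ => ?_
  rw [smul_mul_smul_comm]

theorem derivation_linForm (D : Derivation ℂ Poly Poly) (a : Fin 25 → Poly) (v : Vect) :
    D (linForm a v) = linForm (fun i => D (a i)) v := by
  simp [linForm_apply]

theorem derivation_quadForm (D : Derivation ℂ Poly Poly) (a b : Fin 25 → Poly) (T : Tens) :
    D (quadForm a b T) = quadForm (fun i => D (a i)) b T + quadForm a (fun i => D (b i)) T := by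
  simp only [quadForm_apply, map_sum, D.map_smul, D.leibniz, smul_add, Finset.sum_add_distrib,
    smul_eq_mul]
  rw [add_comm]
  refine congrArg (· + _) ?_
  exact Finset.sum_congr rfl fun i _ => Finset.sum_congr rfl fun j _ => by rw [mul_comm]

/-- The oscillators `x^i_{-(k+1)}`. -/
def xOsc (k : ℕ) (i : Fin 25) : Poly := X (.x i.succ k)

/-- The oscillators `(π_i)_{-(k+1)}`. -/
def piOsc (k : ℕ) (i : Fin 25) : Poly := X (.pi i.succ k)

/-- The oscillator `x^0_{-(k+1)}`. -/
def xTime (k : ℕ) : Poly := X (.x 0 k)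

/-- The oscillator `(π_0)_{-(k+1)}`. -/
def piTime (k : ℕ) : Poly := X (.pi 0 k)

/-- Coefficients of linear polynomials in the oscillators of a given level. -/
abbrev Lin : Type := ℂ × ℂ × Vect × Vect

/-- Coefficients of polynomials of weight `2`. -/
abbrev Quad : Type := Lin × (ℂ × ℂ × ℂ) × (Vect × Vect × Vect × Vect) × symTens × Tens × symTens

/-- Linear polynomials in the oscillators of level `k + 1`. -/
def linPoly (k : ℕ) : Lin →ₗ[ℂ] Poly where
  toFun u := u.1 • xTime k + u.2.1 • piTime k + linForm (xOsc k) u.2.2.1 +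
    linForm (piOsc k) u.2.2.2
  map_add' u u' := by
    simp only [Prod.fst_add, Prod.snd_add, map_add]
    module
  map_smul' c u := by
    simp only [Prod.smul_fst, Prod.smul_snd, map_smul, RingHom.id_apply]
    module

theorem linPoly_apply (k : ℕ) (a b : ℂ) (v w : Vect) : linPoly k (a, b, v, w) =
    a • xTime k + b • piTime k + linForm (xOsc k) v + linForm (piOsc k) w := rfl

/-- Polynomials of weight `2`. -/
def quadPoly : Quad →ₗ[ℂ] Poly where
  toFun u := linPoly 1 u.1 + (u.2.1.1 • (xTime 0 * xTime 0) + u.2.1.2.1 • (xTime 0 * piTime 0) +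
      u.2.1.2.2 • (piTime 0 * piTime 0)) +
    (xTime 0 * linForm (xOsc 0) u.2.2.1.1 + xTime 0 * linForm (piOsc 0) u.2.2.1.2.1 +
      piTime 0 * linForm (xOsc 0) u.2.2.1.2.2.1 + piTime 0 * linForm (piOsc 0) u.2.2.1.2.2.2) +
    (quadForm (xOsc 0) (xOsc 0) u.2.2.2.1 + quadForm (xOsc 0) (piOsc 0) u.2.2.2.2.1 +
      quadForm (piOsc 0) (piOsc 0) u.2.2.2.2.2)
  map_add' u u' := by
    simp only [Prod.fst_add, Prod.snd_add, map_add, mul_add, Submodule.coe_add]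
    module
  map_smul' c u := by
    simp only [Prod.smul_fst, Prod.smul_snd, map_smul, RingHom.id_apply, mul_smul_comm,
      Submodule.coe_smul]
    module

theorem quadPoly_apply (u : Lin) (q₁ q₂ q₃ : ℂ) (v₁ v₂ v₃ v₄ : Vect) (S : symTens) (T : Tens)
    (U : symTens) : quadPoly (u, (q₁, q₂, q₃), (v₁, v₂, v₃, v₄), S, T, U) =
    linPoly 1 u + (q₁ • (xTime 0 * xTime 0) + q₂ • (xTime 0 * piTime 0) +
      q₃ • (piTime 0 * piTime 0)) +
    (xTime 0 * linForm (xOsc 0) v₁ + xTime 0 * linForm (piOsc 0) v₂ +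
      piTime 0 * linForm (xOsc 0) v₃ + piTime 0 * linForm (piOsc 0) v₄) +
    (quadForm (xOsc 0) (xOsc 0) S + quadForm (xOsc 0) (piOsc 0) T +
      quadForm (piOsc 0) (piOsc 0) U) := rfl

/-- Twice the symmetric part of a tensor. -/
def symPart : Tens →ₗ[ℂ] symTens where
  toFun T := ⟨T + T.transpose, by
    change Matrix.transpose _ = _
    rw [Matrix.transpose_add, Matrix.transpose_transpose, add_comm]⟩
  map_add' T U := Subtype.ext (by
    simp only [Matrix.transpose_add, Submodule.coe_add]; abel)
  map_smul' c T := Subtype.ext (by simp)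

theorem coe_symPart (T : Tens) : (symPart T : Tens) = T + T.transpose := rfl

/-- In a product of commuting oscillators of the same kind only the symmetric part of the
coefficients matters. For this reason `Quad` takes the coefficients of x^i x^j and π_i π_j in
`symTens`, and those of x^i π_j among all tensors. -/
theorem quadForm_self_symPart (a : Fin 25 → Poly) (T : Tens) :
    quadForm a a (symPart T) = (2 : ℂ) • quadForm a a T := by
  rw [coe_symPart, map_add, ← quadForm_comm, two_smul]

theorem quadForm_self_symProd (a : Fin 25 → Poly) (v w : Vect) :
    quadForm a a (symProd v w) = (2 : ℂ) • quadForm a a (Matrix.vecMulVec v w) := by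
  rw [← quadForm_self_symPart, coe_symPart, coe_symProd, Matrix.transpose_vecMulVec]

/-- The product of two linear polynomials in the oscillators of level one. -/
theorem linPoly_mul_linPoly (P : Vect) (a b : ℂ) (v w : Vect) :
    linForm (xOsc 0) P * linPoly 0 (a, b, v, w) =
      quadPoly (0, (0, 0, 0), (a • P, 0, b • P, 0), (2⁻¹ : ℂ) • symProd P v,
        Matrix.vecMulVec P w, 0) := by
  simp only [linPoly_apply, quadPoly_apply, mul_add, linForm_mul_linForm, map_zero, mul_zero,
    Submodule.coe_smul, Submodule.coe_zero, map_smul, quadForm_self_symProd, mul_smul_comm,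
    mul_comm (linForm (xOsc 0) P) (xTime 0), mul_comm (linForm (xOsc 0) P) (piTime 0)]
  module

theorem map_linForm (F : Module.End ℂ Poly) (a : Fin 25 → Poly) (v : Vect) :
    F (linForm a v) = linForm (fun i => F (a i)) v := by
  simp [linForm_apply]

/-- An operator that maps `x^0` to `π_0` and `π_i` to `-t x^i`, and may change the level. -/
theorem map_linPoly (F : Module.End ℂ Poly) {k l : ℕ} {κ t : ℂ}
    (h1 : F (xTime k) = κ • piTime l) (h2 : F (piTime k) = 0) (h3 : ∀ i, F (xOsc k i) = 0)
    (h4 : ∀ i, F (piOsc k i) = (-t) • xOsc l i) (a b : ℂ) (v w : Vect) :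
    F (linPoly k (a, b, v, w)) = linPoly l (0, κ * a, -(t • w), 0) := by
  have h3' : (fun i => F (xOsc k i)) = 0 := funext h3
  have h4' : (fun i => F (piOsc k i)) = (-t) • xOsc l := funext h4
  simp only [linPoly_apply, map_add, map_smul, map_linForm, h1, h2, h3', h4',
    linForm_zero_left, linForm_smul_left, map_neg, map_zero]
  module

section Derivation

variable (D : Derivation ℂ Poly Poly)

theorem derivation_linPoly (k : ℕ) {α β : ℂ} {Q R : Vect} (h1 : D (xTime k) = C α)
    (h2 : D (piTime k) = C β) (h3 : ∀ i, D (xOsc k i) = C (Q i))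
    (h4 : ∀ i, D (piOsc k i) = C (R i)) (a b : ℂ) (v w : Vect) :
    D (linPoly k (a, b, v, w)) = C (a * α + b * β + v ⬝ᵥ Q + w ⬝ᵥ R) := by
  simp only [linPoly_apply, map_add, D.map_smul, derivation_linForm, h1, h2, h3, h4, linForm_C]
  simp only [MvPolynomial.smul_eq_C_mul, map_mul]

/-- A derivation of degree `-1` in the oscillators of level one. -/
theorem derivation_quadPoly {α β : ℂ} {Q R : Vect} (h1 : D (xTime 0) = C α)
    (h2 : D (piTime 0) = C β) (h3 : ∀ i, D (xOsc 0 i) = C (Q i))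
    (h4 : ∀ i, D (piOsc 0 i) = C (R i)) (u : Lin) (q₁ q₂ q₃ : ℂ) (v₁ v₂ v₃ v₄ : Vect)
    (S : symTens) (T : Tens) (U : symTens) :
    D (quadPoly (u, (q₁, q₂, q₃), (v₁, v₂, v₃, v₄), S, T, U)) = D (linPoly 1 u) +
      linPoly 0 (2 * q₁ * α + q₂ * β + v₁ ⬝ᵥ Q + v₂ ⬝ᵥ R, q₂ * α + 2 * q₃ * β + v₃ ⬝ᵥ Q + v₄ ⬝ᵥ R,
        α • v₁ + β • v₃ + (2 : ℂ) • (S : Tens).mulVec Q + T.mulVec R,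
        α • v₂ + β • v₄ + T.transpose.mulVec Q + (2 : ℂ) • (U : Tens).mulVec R) := by
  simp only [quadPoly_apply, linPoly_apply, map_add, D.map_smul, D.leibniz, derivation_linForm,
    derivation_quadForm, h1, h2, h3, h4, linForm_C, quadForm_C_left, quadForm_C_right,
    symTens_transpose, smul_eq_mul, map_smul, mul_comm _ (C _ : Poly), ← MvPolynomial.smul_eq_C_mul]
  module

/-- A derivation that maps `x^0` to `π_0` and `π_i` to `-t x^i`. -/
theorem derivation_quadPoly_of_weight_zero {t : ℂ} (h1 : D (xTime 0) = piTime 0)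
    (h2 : D (piTime 0) = 0) (h3 : ∀ i, D (xOsc 0 i) = 0)
    (h4 : ∀ i, D (piOsc 0 i) = (-t) • xOsc 0 i) (u : Lin) (q₁ q₂ q₃ : ℂ) (v₁ v₂ v₃ v₄ : Vect)
    (S : symTens) (T : Tens) (U : symTens) :
    D (quadPoly (u, (q₁, q₂, q₃), (v₁, v₂, v₃, v₄), S, T, U)) = D (linPoly 1 u) +
      quadPoly (0, (0, 2 * q₁, q₂), (-(t • v₂), 0, v₁ - t • v₄, v₂), -((t / 2) • symPart T),
        -((2 * t) • (U : Tens)), 0) := by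
  obtain ⟨c, rfl⟩ : ∃ c, t = -c := ⟨-t, by simp⟩
  rw [neg_neg] at h4
  have h3' : (fun i => D (xOsc 0 i)) = 0 := funext h3
  have h4' : (fun i => D (piOsc 0 i)) = c • xOsc 0 := funext h4
  have h5 : quadForm (piOsc 0) (xOsc 0) (U : Tens) = quadForm (xOsc 0) (piOsc 0) U := by
    rw [quadForm_comm, symTens_transpose]
  simp only [quadPoly_apply, map_add, D.map_smul, D.leibniz, derivation_linForm,
    derivation_quadForm, h1, h2, h3', h4', linForm_zero_left, linForm_smul_left, map_neg, map_sub,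
    map_smul, map_zero, quadForm_zero_left, quadForm_zero_right, quadForm_smul_left,
    quadForm_smul_right, smul_eq_mul, mul_zero, Submodule.coe_neg, Submodule.coe_smul,
    quadForm_self_symPart, Submodule.coe_zero, h5, mul_smul_comm, mul_sub, mul_neg, neg_smul,
    mul_comm (linForm (xOsc 0) v₁), mul_comm (linForm (piOsc 0) v₂)]
  module

/-- A derivation that kills the oscillators of level one. -/
theorem derivation_quadPoly_eq (h1 : D (xTime 0) = 0)
    (h2 : D (piTime 0) = 0) (h3 : ∀ i, D (xOsc 0 i) = 0) (h4 : ∀ i, D (piOsc 0 i) = 0) (u : Lin)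
    (q : ℂ × ℂ × ℂ) (v : Vect × Vect × Vect × Vect) (S : symTens × Tens × symTens) :
    D (quadPoly (u, q, v, S)) = D (linPoly 1 u) := by
  obtain ⟨q₁, q₂, q₃⟩ := q
  obtain ⟨v₁, v₂, v₃, v₄⟩ := v
  obtain ⟨S, T, U⟩ := S
  rw [derivation_quadPoly D (α := 0) (β := 0) (Q := 0) (R := 0) (by simpa using h1)
    (by simpa using h2) (by simpa using h3) (by simpa using h4)]
  simp [linPoly_apply]

end Derivation

end

end CarrollString

namespace CarrollString

noncomputable section

open MvPolynomial (X C pderiv)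

/-! ### The matter modes on polynomials of low weight -/

theorem pderiv_X_eq (o o' : Osc) [Decidable (o = o')] :
    pderiv o (X o' : Poly) = if o = o' then 1 else 0 := by
  classical
  rw [MvPolynomial.pderiv_X, Pi.single_apply]
  exact if_congr eq_comm rfl rfl

theorem polyT_apply (p : Fin 26 → ℝ) (n : ℤ) (f : Poly) : polyT p n f =
    ∑ μ : Fin 26, ∑ i ∈ Finset.range 4, (dXPoly μ (-1 - i) (piPoly p μ (n + i) f) +
      piPoly p μ (n - 1 - i) (dXPoly μ i f)) := by
  simp [polyT, LinearMap.sum_apply]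

theorem polyM_apply (τ : ℝ) (p : Fin 26 → ℝ) (n : ℤ) (f : Poly) : polyM τ p n f =
    (1 / 2 : ℂ) • ∑ i ∈ Finset.range 4, (piPoly p 0 (-1 - i) (piPoly p 0 (n + i) f) +
      piPoly p 0 (n - 1 - i) (piPoly p 0 i f)) -
    (1 / 2 * (τ : ℂ) ^ 2) • ∑ j : Fin 25, ∑ i ∈ Finset.range 4,
      (dXPoly j.succ (-1 - i) (dXPoly j.succ (n + i) f) +
        dXPoly j.succ (n - 1 - i) (dXPoly j.succ i f)) := by
  simp [polyM, LinearMap.sum_apply]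

theorem dXPoly_neg (μ : Fin 26) {n : ℤ} (hn : n < 0) (f : Poly) :
    dXPoly μ n f = (-(n : ℂ)) • (X (.x μ (-n - 1).toNat) * f) := by
  rw [dXPoly, if_pos hn]
  rfl

theorem dXPoly_zero (μ : Fin 26) (f : Poly) : dXPoly μ 0 f = 0 := by simp [dXPoly]

theorem dXPoly_pos (μ : Fin 26) {n : ℤ} (hn : 0 < n) (f : Poly) :
    dXPoly μ n f = (n : ℂ) • pderiv (.pi μ (n - 1).toNat) f := by
  rw [dXPoly, if_neg (by omega), if_neg (by omega)]
  rfl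

theorem piPoly_neg (p : Fin 26 → ℝ) (μ : Fin 26) {n : ℤ} (hn : n < 0) (f : Poly) :
    piPoly p μ n f = X (.pi μ (-n - 1).toNat) * f := by
  rw [piPoly, if_pos hn]
  rfl

theorem piPoly_zero (p : Fin 26 → ℝ) (μ : Fin 26) (f : Poly) :
    piPoly p μ 0 f = (Complex.I * (p μ : ℂ)) • f := by simp [piPoly]

theorem piPoly_pos (p : Fin 26 → ℝ) (μ : Fin 26) {n : ℤ} (hn : 0 < n) (f : Poly) :
    piPoly p μ n f = pderiv (.x μ (n - 1).toNat) f := by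
  rw [piPoly, if_neg (by omega), if_neg (by omega)]
  rfl


/-- A linear operator that satisfies the Leibniz rule. -/
def IsLeibniz (F : Module.End ℂ Poly) : Prop := ∀ f g, F (f * g) = f * F g + g * F f

theorem IsLeibniz.exists_derivation {F : Module.End ℂ Poly} (h : IsLeibniz F) :
    ∃ D : Derivation ℂ Poly Poly, ∀ f, F f = D f :=
  ⟨Derivation.mk' F h, fun _ => rfl⟩

/-- In L₀ and L₁ every normal ordered term carries at most one derivative, since ∂X has no zero mode
and (π_μ)₀ is a scalar, and no term is free of derivatives. Such operators are derivations,
determined by their values on generators. -/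
theorem isLeibniz_polyT (p : Fin 26 → ℝ) {n : ℤ} (hn : n = 1 ∨ n = 2) : IsLeibniz (polyT p n) := by
  intro f g
  rw [polyT_apply, polyT_apply, polyT_apply, Finset.mul_sum, Finset.mul_sum,
    ← Finset.sum_add_distrib]
  refine Finset.sum_congr rfl fun μ _ => ?_
  rcases hn with rfl | rfl <;>
  · simp [Finset.sum_range_succ, dXPoly_neg, dXPoly_zero, dXPoly_pos, piPoly_neg, piPoly_zero,
      piPoly_pos]
    simp only [MvPolynomial.smul_eq_C_mul]
    ring

/-- The argument for M₀ and M₁ is the same; p₀ = 0 is needed because the square of (π_0)₀ would add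
a constant to M₀. -/
theorem isLeibniz_polyM (τ : ℝ) {p : Fin 26 → ℝ} (hp : p 0 = 0) {n : ℤ} (hn : n = 1 ∨ n = 2) :
    IsLeibniz (polyM τ p n) := by
  intro f g
  -- The Leibniz rule is proved separately for the term in π_0 and for each spatial index; `key`
  -- assembles these contributions.
  have key : ∀ (F₁ G₁ H₁ : Poly) (F₂ G₂ H₂ : Fin 25 → Poly), F₁ = f * G₁ + g * H₁ →
      (∀ j, F₂ j = f * G₂ j + g * H₂ j) → ∀ a b : ℂ, a • F₁ - b • ∑ j, F₂ j =
        f * (a • G₁ - b • ∑ j, G₂ j) + g * (a • H₁ - b • ∑ j, H₂ j) := by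
    intro F₁ G₁ H₁ F₂ G₂ H₂ h1 h2 a b
    simp only [h1, h2, Finset.sum_add_distrib, ← Finset.mul_sum, MvPolynomial.smul_eq_C_mul]
    ring
  rw [polyM_apply, polyM_apply, polyM_apply]
  refine key _ _ _ _ _ _ ?_ (fun j => ?_) _ _ <;> rcases hn with rfl | rfl <;>
  · simp [Finset.sum_range_succ, dXPoly_neg, dXPoly_zero, dXPoly_pos, piPoly_neg, piPoly_zero,
      piPoly_pos, hp]
    try simp only [MvPolynomial.smul_eq_C_mul]
    ring

/-- The second-order part of `T₍₃₎`. -/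
def polyTSecond : Module.End ℂ Poly :=
  ∑ μ : Fin 26, (pderiv (.x μ 0)).toLinearMap * (pderiv (.pi μ 0)).toLinearMap

/-- The second-order part of `M₍₃₎`. -/
def polyMSecond (τ : ℝ) : Module.End ℂ Poly :=
  (1 / 2 : ℂ) • ((pderiv (.x 0 0)).toLinearMap * (pderiv (.x 0 0)).toLinearMap) -
    (1 / 2 * (τ : ℂ) ^ 2) • ∑ j : Fin 25, (pderiv (.pi j.succ 0)).toLinearMap *
      (pderiv (.pi j.succ 0)).toLinearMap

/-- The only product of two derivatives in L₂ is by the level-one oscillators x^μ₋₁ and (π_μ)₋₁.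
Once it is subtracted, first-order terms remain. The next lemma treats M₂ in the same way. -/
theorem isLeibniz_polyT_three (p : Fin 26 → ℝ) : IsLeibniz (polyT p 3 - polyTSecond) := by
  intro f g
  simp only [LinearMap.sub_apply, polyTSecond, LinearMap.sum_apply, polyT_apply,
    ← Finset.sum_sub_distrib, Finset.mul_sum, ← Finset.sum_add_distrib]
  refine Finset.sum_congr rfl fun μ _ => ?_
  simp [Finset.sum_range_succ, dXPoly_neg, dXPoly_zero, dXPoly_pos, piPoly_neg, piPoly_zero,
    piPoly_pos]
  simp only [MvPolynomial.smul_eq_C_mul]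
  ring

theorem isLeibniz_polyM_three (τ : ℝ) {p : Fin 26 → ℝ} (hp : p 0 = 0) :
    IsLeibniz (polyM τ p 3 - polyMSecond τ) := by
  intro f g
  have key : ∀ (F₁ G₁ H₁ F₁' G₁' H₁' : Poly) (F₂ G₂ H₂ F₂' G₂' H₂' : Fin 25 → Poly),
      F₁ - F₁' = f * (G₁ - G₁') + g * (H₁ - H₁') →
      (∀ j, F₂ j - F₂' j = f * (G₂ j - G₂' j) + g * (H₂ j - H₂' j)) → ∀ a b : ℂ,
        a • F₁ - b • ∑ j, F₂ j - (a • F₁' - b • ∑ j, F₂' j) =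
        f * (a • G₁ - b • ∑ j, G₂ j - (a • G₁' - b • ∑ j, G₂' j)) +
          g * (a • H₁ - b • ∑ j, H₂ j - (a • H₁' - b • ∑ j, H₂' j)) := by
    intro F₁ G₁ H₁ F₁' G₁' H₁' F₂ G₂ H₂ F₂' G₂' H₂' h1 h2 a b
    have h2 : ∑ j, F₂ j - ∑ j, F₂' j =
        f * (∑ j, G₂ j - ∑ j, G₂' j) + g * (∑ j, H₂ j - ∑ j, H₂' j) := by
      simp only [← Finset.sum_sub_distrib, Finset.mul_sum, ← Finset.sum_add_distrib, h2]
    simp only [MvPolynomial.smul_eq_C_mul]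
    linear_combination C a * h1 - C b * h2
  simp only [LinearMap.sub_apply, polyMSecond, LinearMap.sum_apply, LinearMap.smul_apply,
    polyM_apply]
  refine key _ _ _ _ _ _ _ _ _ _ _ _ ?_ (fun j => ?_) _ _ <;>
  · simp [Finset.sum_range_succ, dXPoly_neg, dXPoly_zero, dXPoly_pos, piPoly_neg, piPoly_zero,
      piPoly_pos, hp]
    try simp only [MvPolynomial.smul_eq_C_mul]
    ring

end

end CarrollString

namespace CarrollString

noncomputable section

open MvPolynomial (X C pderiv)

/-! ### The matter modes on single oscillators and on constants -/

section Generators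

theorem pderiv_ite (o : Osc) (q : Prop) [Decidable q] :
    pderiv o (if q then 1 else 0 : Poly) = 0 := by
  split_ifs
  · exact Derivation.map_one_eq_zero _
  · exact map_zero _

attribute [local simp] dXPoly_neg dXPoly_zero dXPoly_pos piPoly_neg piPoly_zero piPoly_pos
  pderiv_X_eq pderiv_ite

attribute [-simp] MvPolynomial.pderiv_X MvPolynomial.C_mul map_mul

variable (p : Fin 26 → ℝ)

open Classical in
theorem polyT_one_X (ν : Fin 26) : polyT p 1 (X (.x ν 0)) = X (.x ν 0) ∧
    polyT p 1 (X (.pi ν 0)) = X (.pi ν 0) ∧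
    polyT p 1 (X (.x ν 1)) = (2 : ℂ) • X (.x ν 1) ∧
    polyT p 1 (X (.pi ν 1)) = (2 : ℂ) • X (.pi ν 1) := by
  refine ⟨?_, ?_, ?_, ?_⟩ <;> simp [polyT_apply, Finset.sum_range_succ]

open Classical in
theorem polyT_two_X (ν : Fin 26) : polyT p 2 (X (.x ν 0)) = 0 ∧
    polyT p 2 (X (.pi ν 0)) = C (Complex.I * (p ν : ℂ)) ∧ polyT p 2 (X (.x ν 1)) = X (.x ν 0) ∧
    polyT p 2 (X (.pi ν 1)) = (2 : ℂ) • X (.pi ν 0) := by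
  refine ⟨?_, ?_, ?_, ?_⟩ <;>
  simp [polyT_apply, Finset.sum_range_succ, MvPolynomial.C_eq_smul_one]

open Classical in
theorem polyT_three_X (ν : Fin 26) : polyT p 3 (X (.x ν 0)) = 0 ∧
    polyT p 3 (X (.pi ν 0)) = 0 ∧ polyT p 3 (X (.x ν 1)) = 0 ∧
    polyT p 3 (X (.pi ν 1)) = C (2 * (Complex.I * (p ν : ℂ))) := by
  refine ⟨?_, ?_, ?_, ?_⟩ <;>
  simp [polyT_apply, Finset.sum_range_succ, MvPolynomial.C_eq_smul_one, smul_smul, mul_comm]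

-- L₋₁ raises the level and in addition multiplies by ∑ i p_μ x^μ₋₁, the contribution of the zero
-- mode of Π. The multiplication prevents it from being a derivation.
open Classical in
theorem polyT_zero_X (ν : Fin 26) : polyT p 0 (X (.x ν 0)) =
      (2 : ℂ) • X (.x ν 1) + (∑ μ, (Complex.I * (p μ : ℂ)) • X (.x μ 0)) * X (.x ν 0) ∧
    polyT p 0 (X (.pi ν 0)) =
      X (.pi ν 1) + (∑ μ, (Complex.I * (p μ : ℂ)) • X (.x μ 0)) * X (.pi ν 0) := by
  refine ⟨?_, ?_⟩ <;>
  simp [polyT_apply, Finset.sum_range_succ, Finset.sum_add_distrib, Finset.sum_mul, add_comm]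

theorem polyT_zero_one : polyT p 0 1 = ∑ μ, (Complex.I * (p μ : ℂ)) • X (.x μ 0) := by
  simp [polyT_apply, Finset.sum_range_succ]

theorem polyT_neg_one_one : polyT p (-1) 1 =
    ∑ μ : Fin 26, (X (.x μ 0) * X (.pi μ 0) + (2 * (Complex.I * (p μ : ℂ))) • X (.x μ 1)) := by
  simp [polyT_apply, Finset.sum_range_succ, smul_smul, mul_comm]

variable (τ : ℝ) {p} (hp : p 0 = 0)
include hp

theorem polyM_zero_one : polyM τ p 0 1 = 0 := by
  simp [polyM_apply, Finset.sum_range_succ, hp]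

theorem polyM_neg_one_one : polyM τ p (-1) 1 =
    (1 / 2 : ℂ) • (X (.pi 0 0) * X (.pi 0 0)) -
      (1 / 2 * (τ : ℂ) ^ 2) • ∑ j : Fin 25, X (.x j.succ 0) * X (.x j.succ 0) := by
  simp [polyM_apply, Finset.sum_range_succ, hp]

-- The modes of M turn x^0 into π_0 and π_i into x^i and kill π_0 and x^i; the following lemmas show
-- the same pattern at other levels. In particular M₀ squares to zero on linear polynomials.
open Classical in
theorem polyM_zero_X (j : Fin 25) : polyM τ p 0 (X (.x 0 0)) = X (.pi 0 1) ∧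
    polyM τ p 0 (X (.pi 0 0)) = 0 ∧ polyM τ p 0 (X (.x j.succ 0)) = 0 ∧
    polyM τ p 0 (X (.pi j.succ 0)) = (-(2 * (τ : ℂ) ^ 2)) • X (.x j.succ 1) := by
  have h : ∀ j : Fin 25, (0 : Fin 26) ≠ j.succ := fun j => (Fin.succ_ne_zero j).symm
  refine ⟨?_, ?_, ?_, ?_⟩ <;> simp [polyM_apply, Finset.sum_range_succ, Finset.sum_add_distrib, hp, h]
  all_goals module

open Classical in
theorem polyM_one_X (j : Fin 25) : polyM τ p 1 (X (.x 0 0)) = X (.pi 0 0) ∧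
    polyM τ p 1 (X (.pi 0 0)) = 0 ∧ polyM τ p 1 (X (.x j.succ 0)) = 0 ∧
    polyM τ p 1 (X (.pi j.succ 0)) = (-(τ : ℂ) ^ 2) • X (.x j.succ 0) ∧
    polyM τ p 1 (X (.x 0 1)) = X (.pi 0 1) ∧
    polyM τ p 1 (X (.pi 0 1)) = 0 ∧ polyM τ p 1 (X (.x j.succ 1)) = 0 ∧
    polyM τ p 1 (X (.pi j.succ 1)) = (-(4 * (τ : ℂ) ^ 2)) • X (.x j.succ 1) := by
  have h : ∀ j : Fin 25, (0 : Fin 26) ≠ j.succ := fun j => (Fin.succ_ne_zero j).symm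
  refine ⟨?_, ?_, ?_, ?_, ?_, ?_, ?_, ?_⟩ <;> simp [polyM_apply, Finset.sum_range_succ, Finset.sum_add_distrib, hp, h]
  all_goals module

open Classical in
theorem polyM_two_X (j : Fin 25) : polyM τ p 2 (X (.x 0 0)) = 0 ∧
    polyM τ p 2 (X (.pi 0 0)) = 0 ∧ polyM τ p 2 (X (.x j.succ 0)) = 0 ∧
    polyM τ p 2 (X (.pi j.succ 0)) = 0 ∧
    polyM τ p 2 (X (.x 0 1)) = X (.pi 0 0) ∧
    polyM τ p 2 (X (.pi 0 1)) = 0 ∧ polyM τ p 2 (X (.x j.succ 1)) = 0 ∧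
    polyM τ p 2 (X (.pi j.succ 1)) = (-(2 * (τ : ℂ) ^ 2)) • X (.x j.succ 0) := by
  have h : ∀ j : Fin 25, (0 : Fin 26) ≠ j.succ := fun j => (Fin.succ_ne_zero j).symm
  refine ⟨?_, ?_, ?_, ?_, ?_, ?_, ?_, ?_⟩ <;> simp [polyM_apply, Finset.sum_range_succ, Finset.sum_add_distrib, hp, h]
  all_goals module

open Classical in
theorem polyM_three_X (j : Fin 25) : polyM τ p 3 (X (.x 0 0)) = 0 ∧
    polyM τ p 3 (X (.pi 0 0)) = 0 ∧ polyM τ p 3 (X (.x j.succ 0)) = 0 ∧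
    polyM τ p 3 (X (.pi j.succ 0)) = 0 ∧
    polyM τ p 3 (X (.x 0 1)) = 0 ∧
    polyM τ p 3 (X (.pi 0 1)) = 0 ∧ polyM τ p 3 (X (.x j.succ 1)) = 0 ∧
    polyM τ p 3 (X (.pi j.succ 1)) = 0 := by
  have h : ∀ j : Fin 25, (0 : Fin 26) ≠ j.succ := fun j => (Fin.succ_ne_zero j).symm
  refine ⟨?_, ?_, ?_, ?_, ?_, ?_, ?_, ?_⟩ <;> simp [polyM_apply, Finset.sum_range_succ, hp, h]

end Generators

end

end CarrollString

namespace CarrollString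

noncomputable section

open MvPolynomial (X C pderiv)

/-! ### The matter modes on coefficients -/

/-- The unit tensor. -/
def symOne : symTens := ⟨1, Matrix.transpose_one⟩

theorem coe_symOne : (symOne : Tens) = 1 := rfl

section Coefficients

/-- The scalar product with a vector. -/
def dotWith (P : Vect) : Vect →ₗ[ℂ] ℂ where
  toFun v := v ⬝ᵥ P
  map_add' v w := add_dotProduct v w P
  map_smul' c v := smul_dotProduct c v P

/-- The contraction of a tensor with a vector. -/
def contractWith (P : Vect) : Tens →ₗ[ℂ] Vect where
  toFun T := T.mulVec P
  map_add' T U := Matrix.add_mulVec T U P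
  map_smul' c T := Matrix.smul_mulVec c T P

/-- The tensor product with a vector. -/
def tensorWith (P : Vect) : Vect →ₗ[ℂ] Tens where
  toFun v := Matrix.vecMulVec P v
  map_add' v w := Matrix.vecMulVec_add P v w
  map_smul' c v := by
    ext i j
    simp [Matrix.vecMulVec_apply, mul_left_comm]

/-- The trace of a tensor. -/
def traceMap : Tens →ₗ[ℂ] ℂ := Matrix.traceLinearMap (Fin 25) ℂ ℂ

/-- The coefficients of `x^0`, `π_0`, `x^i` and `π_i` in a linear polynomial. -/
def linA : Lin →ₗ[ℂ] ℂ := LinearMap.fst ℂ _ _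
def linB : Lin →ₗ[ℂ] ℂ := LinearMap.fst ℂ _ _ ∘ₗ LinearMap.snd ℂ _ _
def linV : Lin →ₗ[ℂ] Vect :=
  LinearMap.fst ℂ _ _ ∘ₗ LinearMap.snd ℂ _ _ ∘ₗ LinearMap.snd ℂ _ _
def linW : Lin →ₗ[ℂ] Vect :=
  LinearMap.snd ℂ _ _ ∘ₗ LinearMap.snd ℂ _ _ ∘ₗ LinearMap.snd ℂ _ _

/-- A linear map into the coefficients of linear polynomials. -/
def toLin {E : Type*} [AddCommGroup E] [Module ℂ E] (a b : E →ₗ[ℂ] ℂ) (v w : E →ₗ[ℂ] Vect) :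
    E →ₗ[ℂ] Lin := a.prod (b.prod (v.prod w))

/-- The coefficients in a polynomial of weight two: of the oscillators of level two, of `x^0 x^0`,
`x^0 π_0`, `π_0 π_0`, of `x^0 x^i`, `x^0 π_i`, `π_0 x^i`, `π_0 π_i`, and of `x^i x^j`, `x^i π_j`, `π_i π_j`. -/
def quadL : Quad →ₗ[ℂ] Lin :=
  LinearMap.fst ℂ _ _
def quadQ₁ : Quad →ₗ[ℂ] ℂ :=
  LinearMap.fst ℂ _ _ ∘ₗ LinearMap.fst ℂ _ _ ∘ₗ LinearMap.snd ℂ _ _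
def quadQ₂ : Quad →ₗ[ℂ] ℂ :=
  LinearMap.fst ℂ _ _ ∘ₗ LinearMap.snd ℂ _ _ ∘ₗ LinearMap.fst ℂ _ _ ∘ₗ LinearMap.snd ℂ _ _
def quadV₁ : Quad →ₗ[ℂ] Vect :=
  LinearMap.fst ℂ _ _ ∘ₗ LinearMap.fst ℂ _ _ ∘ₗ LinearMap.snd ℂ _ _ ∘ₗ LinearMap.snd ℂ _ _
def quadV₂ : Quad →ₗ[ℂ] Vect :=
  LinearMap.fst ℂ _ _ ∘ₗ LinearMap.snd ℂ _ _ ∘ₗ LinearMap.fst ℂ _ _ ∘ₗ LinearMap.snd ℂ _ _ ∘ₗ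
    LinearMap.snd ℂ _ _
def quadV₄ : Quad →ₗ[ℂ] Vect :=
  LinearMap.snd ℂ _ _ ∘ₗ LinearMap.snd ℂ _ _ ∘ₗ LinearMap.snd ℂ _ _ ∘ₗ LinearMap.fst ℂ _ _ ∘ₗ
    LinearMap.snd ℂ _ _ ∘ₗ LinearMap.snd ℂ _ _
def quadT : Quad →ₗ[ℂ] Tens :=
  LinearMap.fst ℂ _ _ ∘ₗ LinearMap.snd ℂ _ _ ∘ₗ LinearMap.snd ℂ _ _ ∘ₗ LinearMap.snd ℂ _ _ ∘ₗ
    LinearMap.snd ℂ _ _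
def quadU : Quad →ₗ[ℂ] symTens :=
  LinearMap.snd ℂ _ _ ∘ₗ LinearMap.snd ℂ _ _ ∘ₗ LinearMap.snd ℂ _ _ ∘ₗ LinearMap.snd ℂ _ _ ∘ₗ
    LinearMap.snd ℂ _ _

/-- A linear map into the coefficients of polynomials of weight two. -/
def toQuad {E : Type*} [AddCommGroup E] [Module ℂ E] (l : E →ₗ[ℂ] Lin) (q₁ q₂ q₃ : E →ₗ[ℂ] ℂ)
    (v₁ v₂ v₃ v₄ : E →ₗ[ℂ] Vect) (S : E →ₗ[ℂ] symTens) (T : E →ₗ[ℂ] Tens) (U : E →ₗ[ℂ] symTens) :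
    E →ₗ[ℂ] Quad :=
  l.prod ((q₁.prod (q₂.prod q₃)).prod ((v₁.prod (v₂.prod (v₃.prod v₄))).prod (S.prod (T.prod U))))

variable (t : ℂ) (P : Vect)

/-- `L₋₁` on constants. -/
def raiseT₀ : ℂ →ₗ[ℂ] Lin := toLin 0 0 (LinearMap.id.smulRight P) 0

/-- `L₋₁` on linear polynomials. -/
def raiseT₁ : Lin →ₗ[ℂ] Quad :=
  toQuad (toLin ((2 : ℂ) • linA) linB ((2 : ℂ) • linV) linW) 0 0 0 (linA.smulRight P) 0
    (linB.smulRight P) 0 ((2⁻¹ : ℂ) • symProd P ∘ₗ linV) (tensorWith P ∘ₗ linW) 0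

/-- `L₋₂` on constants. -/
def raiseTT : ℂ →ₗ[ℂ] Quad :=
  toQuad (toLin 0 0 (LinearMap.id.smulRight ((2 : ℂ) • P)) 0) 0 LinearMap.id 0 0 0 0 0 0
    (LinearMap.id.smulRight 1) 0

/-- `M₋₁` on linear polynomials. -/
def raiseM₁ : Lin →ₗ[ℂ] Quad :=
  toQuad (toLin 0 linA ((-(2 * t)) • linW) 0) 0 0 0 0 0 0 0 0 0 0

/-- `M₋₂` on constants. -/
def raiseMM : ℂ →ₗ[ℂ] Quad :=
  toQuad 0 0 0 ((2⁻¹ : ℂ) • LinearMap.id) 0 0 0 0 (LinearMap.id.smulRight ((-(t / 2)) • symOne)) 0 0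

/-- `M₀` on linear polynomials. -/
def levelM₁ : Lin →ₗ[ℂ] Lin := toLin 0 linA ((-t) • linW) 0

/-- `M₀` on quadratic polynomials. -/
def levelM₂ : Quad →ₗ[ℂ] Quad :=
  toQuad (toLin 0 (linA ∘ₗ quadL) ((-(4 * t)) • linW ∘ₗ quadL) 0) 0 ((2 : ℂ) • quadQ₁) quadQ₂
    ((-t) • quadV₂) 0 (quadV₁ + (-t) • quadV₄) quadV₂ ((-(t / 2)) • symPart ∘ₗ quadT)
    ((-(2 * t)) • symTens.subtype ∘ₗ quadU) 0

/-- `L₁` on linear polynomials. -/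
def lowerT₁ : Lin →ₗ[ℂ] ℂ := dotWith P ∘ₗ linW

/-- `L₁` on quadratic polynomials. -/
def lowerT₂ : Quad →ₗ[ℂ] Lin :=
  toLin (linA ∘ₗ quadL + dotWith P ∘ₗ quadV₂) ((2 : ℂ) • linB ∘ₗ quadL + dotWith P ∘ₗ quadV₄)
    (linV ∘ₗ quadL + contractWith P ∘ₗ quadT)
    ((2 : ℂ) • linW ∘ₗ quadL + (2 : ℂ) • contractWith P ∘ₗ symTens.subtype ∘ₗ quadU)

/-- `M₁` on quadratic polynomials. -/
def lowerM₂ : Quad →ₗ[ℂ] Lin := toLin 0 (linA ∘ₗ quadL) ((-(2 * t)) • linW ∘ₗ quadL) 0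

/-- `L₂` on quadratic polynomials. -/
def lowerTT : Quad →ₗ[ℂ] ℂ :=
  quadQ₂ + traceMap ∘ₗ quadT + (2 : ℂ) • dotWith P ∘ₗ linW ∘ₗ quadL

/-- `M₂` on quadratic polynomials. -/
def lowerMM : Quad →ₗ[ℂ] ℂ := quadQ₁ + (-t) • traceMap ∘ₗ symTens.subtype ∘ₗ quadU

theorem raiseT₀_apply (c : ℂ) : raiseT₀ P c = (0, 0, c • P, 0) := rfl

theorem raiseT₁_apply (a b : ℂ) (v w : Vect) : raiseT₁ P (a, b, v, w) =
    ((2 * a, b, (2 : ℂ) • v, w), (0, 0, 0), (a • P, 0, b • P, 0), (2⁻¹ : ℂ) • symProd P v,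
      Matrix.vecMulVec P w, 0) := rfl

theorem raiseTT_apply (c : ℂ) : raiseTT P c =
    ((0, 0, c • (2 : ℂ) • P, 0), (0, c, 0), (0, 0, 0, 0), 0, c • 1, 0) := rfl

theorem raiseM₁_apply (a b : ℂ) (v w : Vect) : raiseM₁ t (a, b, v, w) =
    ((0, a, (-(2 * t)) • w, 0), (0, 0, 0), (0, 0, 0, 0), 0, 0, 0) := rfl

theorem raiseMM_apply (c : ℂ) : raiseMM t c =
    (0, (0, 0, 2⁻¹ * c), (0, 0, 0, 0), c • (-(t / 2)) • symOne, 0, 0) := rfl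

theorem levelM₁_apply (a b : ℂ) (v w : Vect) : levelM₁ t (a, b, v, w) = (0, a, (-t) • w, 0) := rfl

theorem levelM₂_apply (a b : ℂ) (v w : Vect) (q₁ q₂ q₃ : ℂ) (v₁ v₂ v₃ v₄ : Vect) (S : symTens)
    (T : Tens) (U : symTens) :
    levelM₂ t ((a, b, v, w), (q₁, q₂, q₃), (v₁, v₂, v₃, v₄), S, T, U) =
      ((0, a, (-(4 * t)) • w, 0), (0, 2 * q₁, q₂), ((-t) • v₂, 0, v₁ + (-t) • v₄, v₂),
        (-(t / 2)) • symPart T, (-(2 * t)) • (U : Tens), 0) := rfl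

theorem lowerT₁_apply (a b : ℂ) (v w : Vect) : lowerT₁ P (a, b, v, w) = w ⬝ᵥ P := rfl

theorem lowerT₂_apply (a b : ℂ) (v w : Vect) (q₁ q₂ q₃ : ℂ) (v₁ v₂ v₃ v₄ : Vect) (S : symTens)
    (T : Tens) (U : symTens) :
    lowerT₂ P ((a, b, v, w), (q₁, q₂, q₃), (v₁, v₂, v₃, v₄), S, T, U) =
      (a + v₂ ⬝ᵥ P, 2 * b + v₄ ⬝ᵥ P, v + T.mulVec P,
        (2 : ℂ) • w + (2 : ℂ) • (U : Tens).mulVec P) := rfl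

theorem lowerM₂_apply (a b : ℂ) (v w : Vect) (q : ℂ × ℂ × ℂ) (x : Vect × Vect × Vect × Vect)
    (y : symTens × Tens × symTens) :
    lowerM₂ t ((a, b, v, w), q, x, y) = (0, a, (-(2 * t)) • w, 0) := rfl

theorem lowerTT_apply (a b : ℂ) (v w : Vect) (q₁ q₂ q₃ : ℂ) (x : Vect × Vect × Vect × Vect)
    (S : symTens) (T : Tens) (U : symTens) :
    lowerTT P ((a, b, v, w), (q₁, q₂, q₃), x, S, T, U) = q₂ + T.trace + 2 * (w ⬝ᵥ P) := rfl

theorem lowerMM_apply (l : Lin) (q₁ q₂ q₃ : ℂ) (x : Vect × Vect × Vect × Vect)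
    (S : symTens) (T : Tens) (U : symTens) :
    lowerMM t (l, (q₁, q₂, q₃), x, S, T, U) = q₁ + (-t) * (U : Tens).trace := rfl

end Coefficients

/-- The eigenvalues of `(π_i)₀`. -/
def momentum (p : Fin 26 → ℝ) : Vect := Complex.I • spatial p

theorem momentum_apply (p : Fin 26 → ℝ) (i : Fin 25) :
    momentum p i = Complex.I * (p i.succ : ℂ) := rfl

variable {p : Fin 26 → ℝ}

theorem sum_momentum (hp : p 0 = 0) (k : ℕ) :
    ∑ μ, (Complex.I * (p μ : ℂ)) • (X (.x μ k) : Poly) = linForm (xOsc k) (momentum p) := by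
  rw [Fin.sum_univ_succ, hp]
  simp [linForm_apply, xOsc, momentum_apply]

theorem C_eq_smul_one' (c : ℂ) : (C c : Poly) = c • 1 := by
  rw [MvPolynomial.smul_eq_C_mul, mul_one]

/-! ### The modes raising the weight, and the modes of M on linear polynomials -/

section Raising

variable (hp : p 0 = 0)
include hp

theorem polyT_zero_C (c : ℂ) : polyT p 0 (C c) = linPoly 0 (raiseT₀ (momentum p) c) := by
  rw [C_eq_smul_one', map_smul, polyT_zero_one, sum_momentum hp, raiseT₀_apply, linPoly_apply]
  simp

theorem polyT_neg_one_C (c : ℂ) : polyT p (-1) (C c) = quadPoly (raiseTT (momentum p) c) := by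
  have h : ∑ μ, (2 * (Complex.I * (p μ : ℂ))) • (X (.x μ 1) : Poly) =
      (2 : ℂ) • linForm (xOsc 1) (momentum p) := by
    rw [← sum_momentum hp, Finset.smul_sum]
    simp only [smul_smul]
  have h' : ∑ μ : Fin 26, (X (.x μ 0) * X (.pi μ 0) : Poly) =
      xTime 0 * piTime 0 + quadForm (xOsc 0) (piOsc 0) 1 := by
    rw [Fin.sum_univ_succ, quadForm_apply]
    simp [xTime, piTime, xOsc, piOsc, Matrix.one_apply]
  rw [C_eq_smul_one', map_smul, polyT_neg_one_one, Finset.sum_add_distrib, h, h', raiseTT_apply]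
  simp only [quadPoly_apply, linPoly_apply, map_zero, mul_zero, map_smul, Submodule.coe_zero]
  module

theorem polyM_neg_one_C (τ : ℝ) (c : ℂ) :
    polyM τ p (-1) (C c) = quadPoly (raiseMM ((τ : ℂ) ^ 2) c) := by
  have h' : ∑ j : Fin 25, (X (.x j.succ 0) * X (.x j.succ 0) : Poly) =
      quadForm (xOsc 0) (xOsc 0) 1 := by
    rw [quadForm_apply]
    simp [xOsc, Matrix.one_apply]
  rw [C_eq_smul_one', map_smul, polyM_neg_one_one τ hp, h', raiseMM_apply]
  simp only [quadPoly_apply, map_zero, mul_zero, map_smul, Submodule.coe_zero,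
    Submodule.coe_smul, coe_symOne]
  simp only [piTime]
  module

theorem polyM_zero_C (τ : ℝ) (c : ℂ) : polyM τ p 0 (C c) = 0 := by
  rw [C_eq_smul_one', map_smul, polyM_zero_one τ hp, smul_zero]

theorem polyT_zero_linPoly (u : Lin) :
    polyT p 0 (linPoly 0 u) = quadPoly (raiseT₁ (momentum p) u) := by
  obtain ⟨a, b, v, w⟩ := u
  set Q := linForm (xOsc 0) (momentum p) with hQ
  have h1 : ∀ ν, polyT p 0 (X (.x ν 0)) = (2 : ℂ) • X (.x ν 1) + Q * X (.x ν 0) := fun ν => by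
    rw [(polyT_zero_X p ν).1, sum_momentum hp]
  have h2 : ∀ ν, polyT p 0 (X (.pi ν 0)) = X (.pi ν 1) + Q * X (.pi ν 0) := fun ν => by
    rw [(polyT_zero_X p ν).2, sum_momentum hp]
  -- L₋₁ is the sum of a shift of level, with factor 2 on the x oscillators, and multiplication by
  -- P·x₋₁.
  have h3 : polyT p 0 (linPoly 0 (a, b, v, w)) =
      linPoly 1 (2 * a, b, (2 : ℂ) • v, w) + Q * linPoly 0 (a, b, v, w) := by
    simp only [linPoly_apply, map_add, map_smul, map_linForm, xTime, piTime, xOsc, piOsc, h1, h2]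
    simp only [linForm_apply, smul_add, Finset.sum_add_distrib, mul_add, Finset.mul_sum,
      mul_smul_comm, Finset.smul_sum, smul_comm (2 : ℂ), xOsc, piOsc]
    module
  rw [h3, hQ, linPoly_mul_linPoly, raiseT₁_apply, quadPoly_apply, quadPoly_apply, map_zero]
  abel

theorem polyM_zero_linPoly (τ : ℝ) (u : Lin) :
    polyM τ p 0 (linPoly 0 u) = quadPoly (raiseM₁ ((τ : ℂ) ^ 2) u) := by
  obtain ⟨a, b, v, w⟩ := u
  rw [map_linPoly (polyM τ p 0) (k := 0) (l := 1) (κ := 1) (t := 2 * (τ : ℂ) ^ 2)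
    (by rw [one_smul]; exact (polyM_zero_X τ hp 0).1) (polyM_zero_X τ hp 0).2.1
    (fun i => (polyM_zero_X τ hp i).2.2.1) fun i => (polyM_zero_X τ hp i).2.2.2]
  rw [raiseM₁_apply, quadPoly_apply]
  simp

theorem polyM_one_linPoly (τ : ℝ) (u : Lin) :
    polyM τ p 1 (linPoly 0 u) = linPoly 0 (levelM₁ ((τ : ℂ) ^ 2) u) := by
  obtain ⟨a, b, v, w⟩ := u
  rw [map_linPoly (polyM τ p 1) (k := 0) (l := 0) (κ := 1) (t := (τ : ℂ) ^ 2)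
    (by rw [one_smul]; exact (polyM_one_X τ hp 0).1) (polyM_one_X τ hp 0).2.1
    (fun i => (polyM_one_X τ hp i).2.2.1) fun i => (polyM_one_X τ hp i).2.2.2.1]
  rw [levelM₁_apply, one_mul, neg_smul]

theorem polyM_two_linPoly (τ : ℝ) (u : Lin) : polyM τ p 2 (linPoly 0 u) = 0 := by
  obtain ⟨a, b, v, w⟩ := u
  rw [map_linPoly (polyM τ p 2) (k := 0) (l := 0) (κ := 0) (t := 0)
    (by rw [zero_smul]; exact (polyM_two_X τ hp 0).1) (polyM_two_X τ hp 0).2.1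
    (fun i => (polyM_two_X τ hp i).2.2.1)
    fun i => by rw [neg_zero, zero_smul]; exact (polyM_two_X τ hp i).2.2.2.1]
  simp [linPoly_apply]

theorem polyM_three_linPoly (τ : ℝ) (u : Lin) : polyM τ p 3 (linPoly 0 u) = 0 := by
  obtain ⟨a, b, v, w⟩ := u
  rw [map_linPoly (polyM τ p 3) (k := 0) (l := 0) (κ := 0) (t := 0)
    (by rw [zero_smul]; exact (polyM_three_X τ hp 0).1) (polyM_three_X τ hp 0).2.1
    (fun i => (polyM_three_X τ hp i).2.2.1)
    fun i => by rw [neg_zero, zero_smul]; exact (polyM_three_X τ hp i).2.2.2.1]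
  simp [linPoly_apply]

end Raising

end

end CarrollString

namespace CarrollString

noncomputable section

open MvPolynomial (X C pderiv)

theorem quadPoly_eq_add (l : Lin) (r : (ℂ × ℂ × ℂ) × (Vect × Vect × Vect × Vect) × symTens × Tens ×
    symTens) : quadPoly (l, r) = linPoly 1 l + quadPoly (0, r) := by
  obtain ⟨⟨q₁, q₂, q₃⟩, ⟨v₁, v₂, v₃, v₄⟩, S, T, U⟩ := r
  rw [quadPoly_apply, quadPoly_apply, map_zero, zero_add]
  simp only [add_assoc]

/-! ### The modes preserving or lowering the weight -/

section Lowering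

theorem IsLeibniz.map_C {F : Module.End ℂ Poly} (h : IsLeibniz F) (c : ℂ) : F (C c) = 0 := by
  obtain ⟨D, hD⟩ := h.exists_derivation
  rw [hD, MvPolynomial.derivation_C]

theorem polyT_C (p : Fin 26 → ℝ) {n : ℤ} (hn : n = 1 ∨ n = 2 ∨ n = 3) (c : ℂ) :
    polyT p n (C c) = 0 := by
  rcases hn with rfl | rfl | rfl
  · exact (isLeibniz_polyT p (Or.inl rfl)).map_C c
  · exact (isLeibniz_polyT p (Or.inr rfl)).map_C c
  · have h := (isLeibniz_polyT_three p).map_C c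
    rw [LinearMap.sub_apply, sub_eq_zero] at h
    rw [h, polyTSecond, LinearMap.sum_apply]
    exact Finset.sum_eq_zero fun μ _ => by simp

theorem polyT_one_linPoly (p : Fin 26 → ℝ) (u : Lin) :
    polyT p 1 (linPoly 0 u) = linPoly 0 u := by
  obtain ⟨a, b, v, w⟩ := u
  simp only [linPoly_apply, map_add, map_smul, map_linForm, xTime, piTime]
  rw [(polyT_one_X p 0).1, (polyT_one_X p 0).2.1]
  have h1 : (fun i => polyT p 1 (xOsc 0 i)) = xOsc 0 := funext fun i => (polyT_one_X p i.succ).1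
  have h2 : (fun i => polyT p 1 (piOsc 0 i)) = piOsc 0 :=
    funext fun i => (polyT_one_X p i.succ).2.1
  rw [h1, h2]

theorem polyT_one_quadPoly (p : Fin 26 → ℝ) (u : Quad) :
    polyT p 1 (quadPoly u) = (2 : ℂ) • quadPoly u := by
  obtain ⟨D, hD⟩ := (isLeibniz_polyT p (Or.inl rfl)).exists_derivation
  obtain ⟨⟨a, b, v, w⟩, ⟨q₁, q₂, q₃⟩, ⟨v₁, v₂, v₃, v₄⟩, S, T, U⟩ := u
  simp only [hD, quadPoly_apply, linPoly_apply, map_add, D.map_smul, D.leibniz,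
    derivation_linForm, derivation_quadForm]
  simp only [← hD]
  have h1 : (fun i => polyT p 1 (xOsc 0 i)) = xOsc 0 := funext fun i => (polyT_one_X p i.succ).1
  have h2 : (fun i => polyT p 1 (piOsc 0 i)) = piOsc 0 :=
    funext fun i => (polyT_one_X p i.succ).2.1
  have h3 : (fun i => polyT p 1 (xOsc 1 i)) = (2 : ℂ) • xOsc 1 :=
    funext fun i => (polyT_one_X p i.succ).2.2.1
  have h4 : (fun i => polyT p 1 (piOsc 1 i)) = (2 : ℂ) • piOsc 1 :=
    funext fun i => (polyT_one_X p i.succ).2.2.2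
  have h5 : polyT p 1 (xTime 0) = xTime 0 := (polyT_one_X p 0).1
  have h6 : polyT p 1 (piTime 0) = piTime 0 := (polyT_one_X p 0).2.1
  have h7 : polyT p 1 (xTime 1) = (2 : ℂ) • xTime 1 := (polyT_one_X p 0).2.2.1
  have h8 : polyT p 1 (piTime 1) = (2 : ℂ) • piTime 1 := (polyT_one_X p 0).2.2.2
  simp only [h1, h2, h3, h4, h5, h6, h7, h8, linForm_smul_left, smul_eq_mul,
    mul_comm (linForm _ _), mul_comm (piTime 0) (xTime 0)]
  module

variable {p : Fin 26 → ℝ} (hp : p 0 = 0)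
include hp

theorem polyM_C (τ : ℝ) {n : ℤ} (hn : n = 0 ∨ n = 1 ∨ n = 2 ∨ n = 3) (c : ℂ) :
    polyM τ p n (C c) = 0 := by
  rcases hn with rfl | rfl | rfl | rfl
  · exact polyM_zero_C hp τ c
  · exact (isLeibniz_polyM τ hp (Or.inl rfl)).map_C c
  · exact (isLeibniz_polyM τ hp (Or.inr rfl)).map_C c
  · have h := (isLeibniz_polyM_three τ hp).map_C c
    rw [LinearMap.sub_apply, sub_eq_zero] at h
    rw [h, polyMSecond]
    simp [LinearMap.sum_apply]

theorem polyT_two_linPoly (u : Lin) :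
    polyT p 2 (linPoly 0 u) = C (lowerT₁ (momentum p) u) := by
  obtain ⟨D, hD⟩ := (isLeibniz_polyT p (Or.inr rfl)).exists_derivation
  obtain ⟨a, b, v, w⟩ := u
  rw [hD, derivation_linPoly D 0 (α := 0) (β := 0) (Q := 0) (R := momentum p), lowerT₁_apply]
  · simp
  · rw [← hD, map_zero]; exact (polyT_two_X p 0).1
  · rw [← hD]; exact (polyT_two_X p 0).2.1.trans (by rw [hp]; simp)
  · intro i; rw [← hD]; exact (polyT_two_X p i.succ).1.trans (by simp)
  · intro i; rw [← hD]; exact (polyT_two_X p i.succ).2.1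

theorem polyT_two_quadPoly (u : Quad) :
    polyT p 2 (quadPoly u) = linPoly 0 (lowerT₂ (momentum p) u) := by
  obtain ⟨D, hD⟩ := (isLeibniz_polyT p (Or.inr rfl)).exists_derivation
  obtain ⟨⟨a, b, v, w⟩, ⟨q₁, q₂, q₃⟩, ⟨v₁, v₂, v₃, v₄⟩, S, T, U⟩ := u
  have h1 : (fun i => polyT p 2 (xOsc 1 i)) = xOsc 0 := funext fun i => (polyT_two_X p i.succ).2.2.1
  have h2 : (fun i => polyT p 2 (piOsc 1 i)) = (2 : ℂ) • piOsc 0 :=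
    funext fun i => (polyT_two_X p i.succ).2.2.2
  have h3 : polyT p 2 (xTime 1) = xTime 0 := (polyT_two_X p 0).2.2.1
  have h4 : polyT p 2 (piTime 1) = (2 : ℂ) • piTime 0 := (polyT_two_X p 0).2.2.2
  have h : polyT p 2 (linPoly 1 (a, b, v, w)) = linPoly 0 (a, 2 * b, v, (2 : ℂ) • w) := by
    simp only [linPoly_apply, map_add, map_smul, map_linForm, h1, h2, h3, h4, linForm_smul_left]
    module
  rw [hD, derivation_quadPoly D (α := 0) (β := 0) (Q := 0) (R := momentum p), lowerT₂_apply,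
    ← hD, h, ← map_add]
  · simp
  · rw [← hD, map_zero]; exact (polyT_two_X p 0).1
  · rw [← hD]; exact (polyT_two_X p 0).2.1.trans (by rw [hp]; simp)
  · intro i; rw [← hD]; exact (polyT_two_X p i.succ).1.trans (by simp)
  · intro i; rw [← hD]; exact (polyT_two_X p i.succ).2.1

theorem polyM_one_quadPoly (τ : ℝ) (u : Quad) :
    polyM τ p 1 (quadPoly u) = quadPoly (levelM₂ ((τ : ℂ) ^ 2) u) := by
  obtain ⟨D, hD⟩ := (isLeibniz_polyM τ hp (Or.inl rfl)).exists_derivation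
  obtain ⟨⟨a, b, v, w⟩, ⟨q₁, q₂, q₃⟩, ⟨v₁, v₂, v₃, v₄⟩, S, T, U⟩ := u
  have h : polyM τ p 1 (linPoly 1 (a, b, v, w)) =
      linPoly 1 (0, a, (-(4 * (τ : ℂ) ^ 2)) • w, 0) := by
    rw [map_linPoly (polyM τ p 1) (k := 1) (l := 1) (κ := 1) (t := 4 * (τ : ℂ) ^ 2)
      (by rw [one_smul]; exact (polyM_one_X τ hp 0).2.2.2.2.1) (polyM_one_X τ hp 0).2.2.2.2.2.1
      (fun i => (polyM_one_X τ hp i).2.2.2.2.2.2.1) fun i => (polyM_one_X τ hp i).2.2.2.2.2.2.2,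
      one_mul, neg_smul]
  -- At level one M₀ maps x^0 to π_0 and π_i to −τ²x^i, whereas at level two the factor is −4τ²; the
  -- two levels are therefore treated separately.
  have h' := derivation_quadPoly_of_weight_zero D (t := (τ : ℂ) ^ 2)
    (by rw [← hD]; exact (polyM_one_X τ hp 0).1) (by rw [← hD]; exact (polyM_one_X τ hp 0).2.1)
    (fun i => by rw [← hD]; exact (polyM_one_X τ hp i).2.2.1)
    (fun i => by rw [← hD]; exact (polyM_one_X τ hp i).2.2.2.1) (a, b, v, w) q₁ q₂ q₃ v₁ v₂ v₃ v₄
    S T U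
  rw [← hD, ← hD, h] at h'
  have e : (-((τ : ℂ) ^ 2 / 2)) • symPart T = -(((τ : ℂ) ^ 2 / 2) • symPart T) := by module
  rw [h', levelM₂_apply, quadPoly_eq_add (0, a, (-(4 * (τ : ℂ) ^ 2)) • w, 0), e]
  simp only [neg_smul, sub_eq_add_neg]

theorem polyM_two_quadPoly (τ : ℝ) (u : Quad) :
    polyM τ p 2 (quadPoly u) = linPoly 0 (lowerM₂ ((τ : ℂ) ^ 2) u) := by
  obtain ⟨D, hD⟩ := (isLeibniz_polyM τ hp (Or.inr rfl)).exists_derivation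
  obtain ⟨⟨a, b, v, w⟩, q, x, y⟩ := u
  rw [hD, derivation_quadPoly_eq D
    (by rw [← hD]; exact (polyM_two_X τ hp 0).1) (by rw [← hD]; exact (polyM_two_X τ hp 0).2.1)
    (fun i => by rw [← hD]; exact (polyM_two_X τ hp i).2.2.1)
    (fun i => by rw [← hD]; exact (polyM_two_X τ hp i).2.2.2.1), ← hD,
    map_linPoly (polyM τ p 2) (k := 1) (l := 0) (κ := 1) (t := 2 * (τ : ℂ) ^ 2)
    (by rw [one_smul]; exact (polyM_two_X τ hp 0).2.2.2.2.1) (polyM_two_X τ hp 0).2.2.2.2.2.1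
    (fun i => (polyM_two_X τ hp i).2.2.2.2.2.2.1) fun i => (polyM_two_X τ hp i).2.2.2.2.2.2.2,
    lowerM₂_apply, one_mul, neg_smul]

omit hp in
theorem pderiv_linPoly_one {o : Osc} (ho : o.idx = 0) (u : Lin) : pderiv o (linPoly 1 u) = 0 := by
  obtain ⟨a, b, v, w⟩ := u
  have h : ∀ o' : Osc, o'.idx = 1 → pderiv o (X o' : Poly) = C 0 := fun o' ho' => by
    rw [MvPolynomial.pderiv_X_of_ne (by rintro rfl; omega), map_zero]
  rw [derivation_linPoly (pderiv o) 1 (α := 0) (β := 0) (Q := 0) (R := 0) (h _ rfl) (h _ rfl)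
    (fun i => h _ rfl) fun i => h _ rfl]
  simp

-- First derivatives by oscillators of level one are linear polynomials with explicit coordinates.
-- They give the second-order parts of L₂ and M₂ and later the uniqueness of coordinates.
open Classical in
omit hp in
theorem pderiv_quadPoly_x (μ : Fin 26) (l : Lin) (q₁ q₂ q₃ : ℂ) (v₁ v₂ v₃ v₄ : Vect) (S : symTens)
    (T : Tens) (U : symTens) :
    pderiv (.x μ 0) (quadPoly (l, (q₁, q₂, q₃), (v₁, v₂, v₃, v₄), S, T, U)) =
      Fin.cases (linPoly 0 (2 * q₁, q₂, v₁, v₂)) (fun i => linPoly 0 (v₁ i, v₃ i,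
        (2 : ℂ) • (S : Tens).mulVec (Pi.single i 1), T.transpose.mulVec (Pi.single i 1))) μ := by
  refine Fin.cases ?_ (fun i => ?_) μ
  · rw [derivation_quadPoly _ (α := 1) (β := 0) (Q := 0) (R := 0), pderiv_linPoly_one rfl]
    · simp
    · simp [xTime]
    all_goals simp [piTime, xOsc, piOsc, MvPolynomial.pderiv_X, Pi.single_apply]
  · rw [derivation_quadPoly _ (α := 0) (β := 0) (Q := Pi.single i 1) (R := 0),
      pderiv_linPoly_one rfl]
    · simp
    all_goals simp [xTime, piTime, xOsc, piOsc, MvPolynomial.pderiv_X, Pi.single_apply]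

open Classical in
omit hp in
theorem pderiv_quadPoly_pi (μ : Fin 26) (l : Lin) (q₁ q₂ q₃ : ℂ) (v₁ v₂ v₃ v₄ : Vect) (S : symTens)
    (T : Tens) (U : symTens) :
    pderiv (.pi μ 0) (quadPoly (l, (q₁, q₂, q₃), (v₁, v₂, v₃, v₄), S, T, U)) =
      Fin.cases (linPoly 0 (q₂, 2 * q₃, v₃, v₄)) (fun i => linPoly 0 (v₂ i, v₄ i,
        T.mulVec (Pi.single i 1), (2 : ℂ) • (U : Tens).mulVec (Pi.single i 1))) μ := by
  refine Fin.cases ?_ (fun i => ?_) μ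
  · rw [derivation_quadPoly _ (α := 0) (β := 1) (Q := 0) (R := 0), pderiv_linPoly_one rfl]
    · simp
    all_goals simp [xTime, piTime, xOsc, piOsc, MvPolynomial.pderiv_X, Pi.single_apply]
  · rw [derivation_quadPoly _ (α := 0) (β := 0) (Q := 0) (R := Pi.single i 1),
      pderiv_linPoly_one rfl]
    · simp
    all_goals simp [xTime, piTime, xOsc, piOsc, MvPolynomial.pderiv_X, Pi.single_apply]

open Classical in
omit hp in
theorem pderiv_linPoly (k : ℕ) (a b : ℂ) (v w : Vect) (i : Fin 25) :
    pderiv (.x 0 k) (linPoly k (a, b, v, w)) = C a ∧ pderiv (.pi 0 k) (linPoly k (a, b, v, w)) = C b ∧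
    pderiv (.x i.succ k) (linPoly k (a, b, v, w)) = C (v i) ∧
    pderiv (.pi i.succ k) (linPoly k (a, b, v, w)) = C (w i) := by
  refine ⟨?_, ?_, ?_, ?_⟩
  · rw [derivation_linPoly _ k (α := 1) (β := 0) (Q := 0) (R := 0)] <;>
    simp [xTime, piTime, xOsc, piOsc, MvPolynomial.pderiv_X, Pi.single_apply]
  · rw [derivation_linPoly _ k (α := 0) (β := 1) (Q := 0) (R := 0)] <;>
    simp [xTime, piTime, xOsc, piOsc, MvPolynomial.pderiv_X, Pi.single_apply]
  · rw [derivation_linPoly _ k (α := 0) (β := 0) (Q := Pi.single i 1) (R := 0)] <;>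
    simp [xTime, piTime, xOsc, piOsc, MvPolynomial.pderiv_X, Pi.single_apply]
  · rw [derivation_linPoly _ k (α := 0) (β := 0) (Q := 0) (R := Pi.single i 1)] <;>
    simp [xTime, piTime, xOsc, piOsc, MvPolynomial.pderiv_X, Pi.single_apply]

omit hp in
theorem polyTSecond_apply (f : Poly) :
    polyTSecond f = ∑ μ : Fin 26, pderiv (.x μ 0) (pderiv (.pi μ 0) f) := by
  simp [polyTSecond, LinearMap.sum_apply]

omit hp in
theorem polyMSecond_apply (τ : ℝ) (f : Poly) : polyMSecond τ f =
    (1 / 2 : ℂ) • pderiv (.x 0 0) (pderiv (.x 0 0) f) -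
      (1 / 2 * (τ : ℂ) ^ 2) • ∑ j : Fin 25, pderiv (.pi j.succ 0) (pderiv (.pi j.succ 0) f) := by
  simp [polyMSecond, LinearMap.sum_apply]

open Classical in
omit hp in
theorem polyTSecond_X (o : Osc) : polyTSecond (X o) = 0 := by
  simp [polyTSecond_apply, pderiv_X_eq, pderiv_ite, -MvPolynomial.pderiv_X]

open Classical in
omit hp in
theorem polyMSecond_X (τ : ℝ) (o : Osc) : polyMSecond τ (X o) = 0 := by
  simp [polyMSecond_apply, pderiv_X_eq, pderiv_ite, -MvPolynomial.pderiv_X]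

omit hp in
theorem polyTSecond_linPoly_one (u : Lin) : polyTSecond (linPoly 1 u) = 0 := by
  rw [polyTSecond_apply]
  exact Finset.sum_eq_zero fun μ _ => by rw [pderiv_linPoly_one rfl, map_zero]

omit hp in
theorem polyMSecond_linPoly_one (τ : ℝ) (u : Lin) : polyMSecond τ (linPoly 1 u) = 0 := by
  rw [polyMSecond_apply]
  rw [pderiv_linPoly_one rfl, Finset.sum_eq_zero fun j _ => by rw [pderiv_linPoly_one rfl, map_zero]]
  simp

omit hp in
theorem polyT_three_linPoly (u : Lin) : polyT p 3 (linPoly 0 u) = 0 := by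
  obtain ⟨a, b, v, w⟩ := u
  have h1 : (fun i => polyT p 3 (xOsc 0 i)) = 0 := funext fun i => (polyT_three_X p i.succ).1
  have h2 : (fun i => polyT p 3 (piOsc 0 i)) = 0 := funext fun i => (polyT_three_X p i.succ).2.1
  have h3 : polyT p 3 (xTime 0) = 0 := (polyT_three_X p 0).1
  have h4 : polyT p 3 (piTime 0) = 0 := (polyT_three_X p 0).2.1
  simp only [linPoly_apply, map_add, map_smul, map_linForm, h1, h2, h3, h4, linForm_zero_left]
  simp

/-- The derivation part of L₂ kills level one and sends (π_i)₋₂ to 2P_i, which gives 2 w·P. The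
second-order part pairs each x^μ with its π_μ, which gives q₂ + Tr T. -/
theorem polyT_three_quadPoly (u : Quad) :
    polyT p 3 (quadPoly u) = C (lowerTT (momentum p) u) := by
  obtain ⟨D, hD⟩ := (isLeibniz_polyT_three p).exists_derivation
  obtain ⟨⟨a, b, v, w⟩, ⟨q₁, q₂, q₃⟩, ⟨v₁, v₂, v₃, v₄⟩, S, T, U⟩ := u
  have hX : ∀ o : Osc, polyT p 3 (X o) = 0 → D (X o) = 0 := fun o ho => by
    rw [← hD, LinearMap.sub_apply, ho, polyTSecond_X, sub_zero]
  have h1 : (fun i => polyT p 3 (xOsc 1 i)) = 0 := funext fun i => (polyT_three_X p i.succ).2.2.1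
  have h2 : (fun i => polyT p 3 (piOsc 1 i)) = fun i => C (((2 : ℂ) • momentum p) i) :=
    funext fun i => (polyT_three_X p i.succ).2.2.2
  have h3 : polyT p 3 (xTime 1) = 0 := (polyT_three_X p 0).2.2.1
  have h4 : polyT p 3 (piTime 1) = 0 := (polyT_three_X p 0).2.2.2.trans (by rw [hp]; simp)
  have h5 : polyT p 3 (linPoly 1 (a, b, v, w)) = C (2 * (w ⬝ᵥ momentum p)) := by
    simp only [linPoly_apply, map_add, map_smul, map_linForm, h1, h2, h3, h4, linForm_zero_left,
      linForm_C, dotProduct_smul, smul_eq_mul]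
    simp
  have h6 := derivation_quadPoly_eq D (hX _ (polyT_three_X p 0).1) (hX _ (polyT_three_X p 0).2.1)
    (fun i => hX _ (polyT_three_X p i.succ).1) (fun i => hX _ (polyT_three_X p i.succ).2.1)
    (a, b, v, w) (q₁, q₂, q₃) (v₁, v₂, v₃, v₄) (S, T, U)
  rw [← hD, ← hD, LinearMap.sub_apply, LinearMap.sub_apply, h5, polyTSecond_linPoly_one, sub_zero,
    sub_eq_iff_eq_add] at h6
  rw [h6, polyTSecond_apply, Fin.sum_univ_succ, lowerTT_apply]
  simp only [pderiv_quadPoly_pi, Fin.cases_zero, Fin.cases_succ, (pderiv_linPoly 0 _ _ _ _ 0).1,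
    (pderiv_linPoly 0 _ _ _ _ _).2.2.1, ← map_sum, ← map_add]
  simp [Matrix.trace]
  ring

/-- Only second derivatives contribute to M₂: ½ of that of q₁ x^0 x^0 is q₁, and −½τ² times the
contraction of those of π_i π_j gives −τ² Tr U. -/
theorem polyM_three_quadPoly (τ : ℝ) (u : Quad) :
    polyM τ p 3 (quadPoly u) = C (lowerMM ((τ : ℂ) ^ 2) u) := by
  obtain ⟨D, hD⟩ := (isLeibniz_polyM_three τ hp).exists_derivation
  obtain ⟨⟨a, b, v, w⟩, ⟨q₁, q₂, q₃⟩, ⟨v₁, v₂, v₃, v₄⟩, S, T, U⟩ := u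
  have hX : ∀ o : Osc, polyM τ p 3 (X o) = 0 → D (X o) = 0 := fun o ho => by
    rw [← hD, LinearMap.sub_apply, ho, polyMSecond_X, sub_zero]
  have h1 : (fun i => polyM τ p 3 (xOsc 1 i)) = 0 :=
    funext fun i => (polyM_three_X τ hp i).2.2.2.2.2.2.1
  have h2 : (fun i => polyM τ p 3 (piOsc 1 i)) = 0 :=
    funext fun i => (polyM_three_X τ hp i).2.2.2.2.2.2.2
  have h3 : polyM τ p 3 (xTime 1) = 0 := (polyM_three_X τ hp 0).2.2.2.2.1
  have h4 : polyM τ p 3 (piTime 1) = 0 := (polyM_three_X τ hp 0).2.2.2.2.2.1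
  have h5 : polyM τ p 3 (linPoly 1 (a, b, v, w)) = 0 := by
    simp only [linPoly_apply, map_add, map_smul, map_linForm, h1, h2, h3, h4, linForm_zero_left]
    simp
  have h6 := derivation_quadPoly_eq D (hX _ (polyM_three_X τ hp 0).1)
    (hX _ (polyM_three_X τ hp 0).2.1) (fun i => hX _ (polyM_three_X τ hp i).2.2.1)
    (fun i => hX _ (polyM_three_X τ hp i).2.2.2.1)
    (a, b, v, w) (q₁, q₂, q₃) (v₁, v₂, v₃, v₄) (S, T, U)
  rw [← hD, ← hD, LinearMap.sub_apply, LinearMap.sub_apply, h5, polyMSecond_linPoly_one, sub_zero,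
    sub_eq_zero] at h6
  rw [h6, polyMSecond_apply, lowerMM_apply]
  simp only [pderiv_quadPoly_pi, pderiv_quadPoly_x, Fin.cases_zero, Fin.cases_succ,
    (pderiv_linPoly 0 _ _ _ _ 0).1, (pderiv_linPoly 0 _ _ _ _ _).2.2.2, ← map_sum,
    MvPolynomial.smul_eq_C_mul, ← MvPolynomial.C_mul, ← map_sub]
  refine congrArg C ?_
  simp [Matrix.trace, ← Finset.mul_sum]
  ring

end Lowering

end

end CarrollString

namespace CarrollString

noncomputable section

open MvPolynomial (X C pderiv monomial IsWeightedHomogeneous)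

/-! ### Polynomials of given weight -/

/-- The weights of the oscillators. -/
def oscWeight (o : Osc) : ℕ := o.idx + 1

/-- A polynomial is of weight `k`. -/
abbrev HasWeight (k : ℕ) (f : Poly) : Prop := IsWeightedHomogeneous oscWeight f k

theorem HasWeight.smul {k : ℕ} {f : Poly} (hf : HasWeight k f) (c : ℂ) : HasWeight k (c • f) :=
  (MvPolynomial.weightedHomogeneousSubmodule ℂ oscWeight k).smul_mem c hf

theorem hasWeight_C (c : ℂ) : HasWeight 0 (C c) := MvPolynomial.isWeightedHomogeneous_C _ c

theorem hasWeight_X (o : Osc) : HasWeight (o.idx + 1) (X o) :=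
  MvPolynomial.isWeightedHomogeneous_X ℂ _ o

theorem hasWeight_linForm {k : ℕ} {a : Fin 25 → Poly} (ha : ∀ i, HasWeight k (a i)) (v : Vect) :
    HasWeight k (linForm a v) :=
  IsWeightedHomogeneous.sum _ _ _ fun i _ => (ha i).smul _

theorem hasWeight_quadForm {k l : ℕ} {a b : Fin 25 → Poly} (ha : ∀ i, HasWeight k (a i))
    (hb : ∀ i, HasWeight l (b i)) (T : Tens) : HasWeight (k + l) (quadForm a b T) :=
  IsWeightedHomogeneous.sum _ _ _ fun i _ => IsWeightedHomogeneous.sum _ _ _ fun j _ =>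
    HasWeight.smul (hf := (ha i).mul (hb j)) _

theorem hasWeight_linPoly (k : ℕ) (u : Lin) : HasWeight (k + 1) (linPoly k u) :=
  ((((hasWeight_X (.x 0 k)).smul _).add ((hasWeight_X (.pi 0 k)).smul _)).add
    (hasWeight_linForm (fun i => hasWeight_X (.x i.succ k)) _)).add
    (hasWeight_linForm (fun i => hasWeight_X (.pi i.succ k)) _)

theorem hasWeight_quadPoly (u : Quad) : HasWeight 2 (quadPoly u) := by
  have hx : HasWeight 1 (xTime 0) := hasWeight_X _
  have hp : HasWeight 1 (piTime 0) := hasWeight_X _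
  have hx' : ∀ i, HasWeight 1 (xOsc 0 i) := fun i => hasWeight_X _
  have hp' : ∀ i, HasWeight 1 (piOsc 0 i) := fun i => hasWeight_X _
  refine (((hasWeight_linPoly 1 _).add (((HasWeight.smul (hf := hx.mul hx) _).add (HasWeight.smul (hf := hx.mul hp) _)).add
    (HasWeight.smul (hf := hp.mul hp) _))).add ((((hx.mul (hasWeight_linForm hx' _)).add
    (hx.mul (hasWeight_linForm hp' _))).add (hp.mul (hasWeight_linForm hx' _))).add
    (hp.mul (hasWeight_linForm hp' _)))).add (((hasWeight_quadForm hx' hx' _).add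
    (hasWeight_quadForm hx' hp' _)).add (hasWeight_quadForm hp' hp' _))

/-- A derivative by an oscillator lowers the weight by its level. From weight at most two no level
above two can be removed, and two oscillators only if both have level one. -/
theorem HasWeight.lowPoly {k : ℕ} (hk : k ≤ 2) {f : Poly} (hf : HasWeight k f) : LowPoly f := by
  have h1 : ∀ d ∈ f.support, Finsupp.weight oscWeight d = k := fun d hd =>
    hf (MvPolynomial.mem_support_iff.mp hd)
  constructor
  · intro o ho
    rw [f.as_sum, map_sum]
    refine Finset.sum_eq_zero fun d hd => ?_
    rw [MvPolynomial.pderiv_monomial]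
    by_cases h : d o = 0
    · simp [h]
    · have := Finsupp.le_weight_of_ne_zero' oscWeight h
      rw [h1 d hd, oscWeight] at this
      omega
  · intro o o' ho
    rw [f.as_sum, map_sum, map_sum]
    refine Finset.sum_eq_zero fun d hd => ?_
    rw [MvPolynomial.pderiv_monomial, MvPolynomial.pderiv_monomial]
    by_cases h : d o' = 0
    · simp [h]
    by_cases h' : (d - Finsupp.single o' 1 : Osc →₀ ℕ) o = 0
    · rw [h', Nat.cast_zero, mul_zero, map_zero]
    · have h2 := Finsupp.weight_sub_single_add (w := oscWeight) h
      have h3 := Finsupp.le_weight_of_ne_zero' oscWeight h'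
      rw [h1 d hd] at h2
      simp only [oscWeight] at h2 h3
      omega

theorem weight_eq_zero {d : Osc →₀ ℕ} (hd : Finsupp.weight oscWeight d = 0) : d = 0 := by
  ext o
  by_contra h
  have := Finsupp.le_weight_of_ne_zero' oscWeight h
  rw [hd, oscWeight] at this
  omega

theorem exists_eq_single_add {d : Osc →₀ ℕ} (hd : Finsupp.weight oscWeight d ≠ 0) :
    ∃ o d', d = Finsupp.single o 1 + d' ∧
      Finsupp.weight oscWeight d = o.idx + 1 + Finsupp.weight oscWeight d' := by
  have h : d ≠ 0 := by
    rintro rfl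
    exact hd (map_zero _)
  obtain ⟨o, ho⟩ := Finsupp.ne_iff.mp h
  have ho : d o ≠ 0 := ho
  refine ⟨o, d - Finsupp.single o 1, ?_, ?_⟩
  · rw [add_comm, Finsupp.sub_add_single_one_cancel ho]
  · rw [← Finsupp.weight_sub_single_add (w := oscWeight) ho, oscWeight, add_comm]

/-- The range of a linear map is a subspace, so surjectivity onto a weight space may be tested on
monomials. -/
theorem HasWeight.exists_of_monomial {E : Type*} [AddCommGroup E] [Module ℂ E] {F : E →ₗ[ℂ] Poly}
    {k : ℕ} (h : ∀ d : Osc →₀ ℕ, Finsupp.weight oscWeight d = k → ∃ u, F u = monomial d 1) {f : Poly}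
    (hf : HasWeight k f) : ∃ u, F u = f := by
  change f ∈ LinearMap.range F
  rw [f.as_sum]
  refine Submodule.sum_mem _ fun d hd => ?_
  have h' : monomial d (f.coeff d) = f.coeff d • (monomial d 1 : Poly) := by
    rw [MvPolynomial.smul_monomial, smul_eq_mul, mul_one]
  rw [h']
  exact Submodule.smul_mem _ _ (h d (hf (MvPolynomial.mem_support_iff.mp hd)))

theorem HasWeight.exists_C {f : Poly} (hf : HasWeight 0 f) : ∃ c, C c = f := by
  refine HasWeight.exists_of_monomial (F := (Algebra.linearMap ℂ Poly)) (fun d hd => ⟨1, ?_⟩) hf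
  rw [weight_eq_zero hd]
  rfl

theorem linForm_single (a : Fin 25 → Poly) (i : Fin 25) : linForm a (Pi.single i 1) = a i := by
  simp [linForm_apply, Pi.single_apply]

theorem exists_linPoly_eq_X (o : Osc) : ∃ u, linPoly o.idx u = X o := by
  obtain ⟨μ, k⟩ | ⟨μ, k⟩ := o <;> refine Fin.cases ?_ (fun i => ?_) μ
  · exact ⟨(1, 0, 0, 0), by simp [linPoly_apply, xTime, Osc.idx]⟩
  · exact ⟨(0, 0, Pi.single i 1, 0), by simp [linPoly_apply, linForm_single, xOsc, Osc.idx]⟩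
  · exact ⟨(0, 1, 0, 0), by simp [linPoly_apply, piTime, Osc.idx]⟩
  · exact ⟨(0, 0, 0, Pi.single i 1), by simp [linPoly_apply, linForm_single, piOsc, Osc.idx]⟩

theorem HasWeight.exists_linPoly {f : Poly} (hf : HasWeight 1 f) : ∃ u, linPoly 0 u = f := by
  refine HasWeight.exists_of_monomial (fun d hd => ?_) hf
  obtain ⟨o, d', rfl, h⟩ := exists_eq_single_add (by rw [hd]; exact one_ne_zero)
  rw [hd] at h
  rw [weight_eq_zero (show Finsupp.weight oscWeight d' = 0 by omega), add_zero]
  obtain ⟨u, hu⟩ := exists_linPoly_eq_X o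
  rw [show o.idx = 0 by omega] at hu
  exact ⟨u, hu⟩

theorem exists_quadPoly_eq_mul (u u' : Lin) : ∃ x, quadPoly x = linPoly 0 u * linPoly 0 u' := by
  obtain ⟨a, b, v, w⟩ := u
  obtain ⟨a', b', v', w'⟩ := u'
  -- The factors 2⁻¹ compensate for the two equal halves of `symProd`.
  refine ⟨(0, (a * a', a * b' + b * a', b * b'), (a • v' + a' • v, a • w' + a' • w,
    b • v' + b' • v, b • w' + b' • w), (2⁻¹ : ℂ) • symProd v v',
    Matrix.vecMulVec v w' + Matrix.vecMulVec v' w, (2⁻¹ : ℂ) • symProd w w'), ?_⟩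
  have h : quadForm (xOsc 0) (piOsc 0) (Matrix.vecMulVec v' w) =
      linForm (piOsc 0) w * linForm (xOsc 0) v' := by
    rw [← linForm_mul_linForm, mul_comm]
  simp only [quadPoly_apply, linPoly_apply, map_zero, Submodule.coe_smul, map_smul, map_add,
    quadForm_self_symProd, ← linForm_mul_linForm _ _ v, ← linForm_mul_linForm _ _ w, h,
    MvPolynomial.smul_eq_C_mul, MvPolynomial.C_mul]
  have h2 : (C (2⁻¹ : ℂ) : Poly) * C 2 = 1 := by
    rw [← MvPolynomial.C_mul, inv_mul_cancel₀ two_ne_zero, map_one]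
  linear_combination (linForm (xOsc 0) v * linForm (xOsc 0) v' +
    linForm (piOsc 0) w * linForm (piOsc 0) w') * h2

theorem HasWeight.exists_quadPoly {f : Poly} (hf : HasWeight 2 f) : ∃ u, quadPoly u = f := by
  refine HasWeight.exists_of_monomial (fun d hd => ?_) hf
  obtain ⟨o, d', rfl, h⟩ := exists_eq_single_add (by rw [hd]; exact two_ne_zero)
  rw [hd] at h
  obtain ⟨u, hu⟩ := exists_linPoly_eq_X o
  -- Weight two is either one oscillator of level two or a product of two oscillators of level one.
  by_cases h' : Finsupp.weight oscWeight d' = 0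
  · rw [weight_eq_zero h', add_zero]
    rw [show o.idx = 1 by omega] at hu
    refine ⟨(u, 0), ?_⟩
    rw [quadPoly_eq_add, hu, Prod.mk_zero_zero, map_zero, add_zero]
    rfl
  · obtain ⟨o', d'', rfl, h''⟩ := exists_eq_single_add h'
    rw [weight_eq_zero (show Finsupp.weight oscWeight d'' = 0 by omega), add_zero]
    obtain ⟨u', hu'⟩ := exists_linPoly_eq_X o'
    rw [show o.idx = 0 by omega] at hu
    rw [show o'.idx = 0 by omega] at hu'
    obtain ⟨x, hx⟩ := exists_quadPoly_eq_mul u u'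
    refine ⟨x, ?_⟩
    rw [hx, hu, hu', X, X, MvPolynomial.monomial_mul, mul_one]

/-! ### Injectivity -/

theorem linPoly_eq_zero {k : ℕ} {u : Lin} (h : linPoly k u = 0) : u = 0 := by
  obtain ⟨a, b, v, w⟩ := u
  have h' := fun i => pderiv_linPoly k a b v w i
  simp only [h, map_zero] at h'
  have h0 : ∀ c : ℂ, (0 : Poly) = C c → c = 0 := fun c hc =>
    (MvPolynomial.C_eq_zero (σ := Osc)).mp hc.symm
  rw [h0 a (h' 0).1, h0 b (h' 0).2.1, funext fun i => h0 _ (h' i).2.2.1,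
    funext fun i => h0 _ (h' i).2.2.2]
  rfl

/-- Derivatives by oscillators of level two recover the first component. Derivatives by oscillators
of level one are linear polynomials, whose coordinates contain all remaining components. -/
theorem quadPoly_eq_zero {u : Quad} (h : quadPoly u = 0) : u = 0 := by
  obtain ⟨l, ⟨q₁, q₂, q₃⟩, ⟨v₁, v₂, v₃, v₄⟩, S, T, U⟩ := u
  have hl : l = 0 := by
    have h' : ∀ o : Osc, o.idx = 1 → pderiv o (linPoly 1 l) = 0 := fun o ho => by
      have h0 : ∀ o' : Osc, o'.idx = 0 → pderiv o (X o' : Poly) = 0 := fun o' ho' =>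
        MvPolynomial.pderiv_X_of_ne (by rintro rfl; omega)
      rw [← derivation_quadPoly_eq (pderiv o) (h0 _ rfl) (h0 _ rfl) (fun i => h0 _ rfl)
        (fun i => h0 _ rfl) l (q₁, q₂, q₃) (v₁, v₂, v₃, v₄) (S, T, U), h, map_zero]
    obtain ⟨a, b, v, w⟩ := l
    have h0 : ∀ c : ℂ, (C c : Poly) = 0 → c = 0 := fun c hc =>
      (MvPolynomial.C_eq_zero (σ := Osc)).mp hc
    have h1 := fun i => pderiv_linPoly 1 a b v w i
    rw [h0 a ((h1 0).1.symm.trans (h' _ rfl)), h0 b ((h1 0).2.1.symm.trans (h' _ rfl)),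
      funext fun i => h0 _ ((h1 i).2.2.1.symm.trans (h' _ rfl)),
      funext fun i => h0 _ ((h1 i).2.2.2.symm.trans (h' _ rfl))]
    rfl
  have hx := fun μ => pderiv_quadPoly_x μ l q₁ q₂ q₃ v₁ v₂ v₃ v₄ S T U
  have hp := fun μ => pderiv_quadPoly_pi μ l q₁ q₂ q₃ v₁ v₂ v₃ v₄ S T U
  simp only [h, map_zero] at hx hp
  have hx0 := linPoly_eq_zero (hx 0).symm
  have hp0 := linPoly_eq_zero (hp 0).symm
  have hxi : ∀ i, _ := fun i : Fin 25 => linPoly_eq_zero (hx i.succ).symm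
  have hpi : ∀ i, _ := fun i : Fin 25 => linPoly_eq_zero (hp i.succ).symm
  simp only [Prod.mk_eq_zero, mul_eq_zero, OfNat.ofNat_ne_zero, false_or, smul_eq_zero,
    Matrix.mulVec_single_one] at hx0 hp0 hxi hpi
  obtain ⟨rfl, rfl, rfl, rfl⟩ := hx0
  obtain ⟨-, rfl, rfl, rfl⟩ := hp0
  have hS : S = 0 := Subtype.ext (Matrix.ext fun i j => congrFun (hxi j).2.2.1 i)
  have hU : U = 0 := Subtype.ext (Matrix.ext fun i j => congrFun (hpi j).2.2.2 i)
  have hT : T = 0 := Matrix.ext fun i j => congrFun (hpi j).2.2.1 i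
  rw [hl, hS, hU, hT]
  rfl

/-! ### Rotations -/

theorem rotPoly_xOsc (R : Matrix (Fin 25) (Fin 25) ℝ) (k : ℕ) (i : Fin 25) :
    rotPoly R (xOsc k i) = ∑ j, cplx R j i • xOsc k j := rotPoly_x R i k

theorem rotPoly_piOsc (R : Matrix (Fin 25) (Fin 25) ℝ) (k : ℕ) (i : Fin 25) :
    rotPoly R (piOsc k i) = ∑ j, cplx R j i • piOsc k j := rotPoly_pi R i k

theorem map_linForm_of_sum {φ : Poly →ₐ[ℂ] Poly} {a : Fin 25 → Poly} {M : Tens}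
    (h : ∀ i, φ (a i) = ∑ j, M j i • a j) (v : Vect) :
    φ (linForm a v) = linForm a (M.mulVec v) := by
  simp only [linForm_apply, map_sum, map_smul, h, Matrix.mulVec, dotProduct, Finset.sum_smul,
    Finset.smul_sum]
  rw [Finset.sum_comm]
  exact Finset.sum_congr rfl fun j _ => Finset.sum_congr rfl fun i _ => by
    rw [smul_smul, mul_comm]

theorem map_quadForm_of_sum {φ : Poly →ₐ[ℂ] Poly} {a b : Fin 25 → Poly} {M : Tens}
    (ha : ∀ i, φ (a i) = ∑ j, M j i • a j) (hb : ∀ i, φ (b i) = ∑ j, M j i • b j) (T : Tens) :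
    φ (quadForm a b T) = quadForm a b (M * T * M.transpose) := by
  have h : ∀ T, quadForm a b T = ∑ i, a i * linForm b (T i) := fun T => by
    simp only [quadForm_apply, linForm_apply, Finset.mul_sum, mul_smul_comm]
  rw [h T, map_sum]
  simp only [map_mul, map_linForm_of_sum hb, ha, Finset.sum_mul]
  rw [Finset.sum_comm, h]
  refine Finset.sum_congr rfl fun j _ => ?_
  simp only [smul_mul_assoc, ← mul_smul_comm, ← Finset.mul_sum, ← map_smul, ← map_sum]
  congr 2
  ext k
  simp only [Finset.sum_apply, Pi.smul_apply, Matrix.mulVec, dotProduct, smul_eq_mul,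
    Matrix.mul_apply, Matrix.transpose_apply, Finset.mul_sum, Finset.sum_mul]
  rw [Finset.sum_comm]
  exact Finset.sum_congr rfl fun l _ => Finset.sum_congr rfl fun i _ => by ring

/-- The representation on linear polynomials. -/
abbrev linRep (p : Fin 26 → ℝ) : Representation ℂ (Stab p) Lin :=
  (scalarRep p).prod ((scalarRep p).prod ((vecRep p).prod (vecRep p)))

/-- The representation on polynomials of weight two. -/
abbrev quadRep (p : Fin 26 → ℝ) : Representation ℂ (Stab p) Quad :=
  (linRep p).prod (((scalarRep p).prod ((scalarRep p).prod (scalarRep p))).prod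
    (((vecRep p).prod ((vecRep p).prod ((vecRep p).prod (vecRep p)))).prod
      ((symRep p).prod ((tensorRep p).prod (symRep p)))))

variable {p : Fin 26 → ℝ}

theorem linRep_apply (g : Stab p) (a b : ℂ) (v w : Vect) :
    linRep p g (a, b, v, w) = (a, b, vecRep p g v, vecRep p g w) := rfl

theorem quadRep_apply (g : Stab p) (l : Lin) (q₁ q₂ q₃ : ℂ) (v₁ v₂ v₃ v₄ : Vect) (S : symTens)
    (T : Tens) (U : symTens) :
    quadRep p g (l, (q₁, q₂, q₃), (v₁, v₂, v₃, v₄), S, T, U) =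
      (linRep p g l, (q₁, q₂, q₃), (vecRep p g v₁, vecRep p g v₂, vecRep p g v₃, vecRep p g v₄),
        symRep p g S, tensorRep p g T, symRep p g U) := rfl

theorem rotPoly_linPoly (g : Stab p) (k : ℕ) (u : Lin) :
    rotPoly g.1.1 (linPoly k u) = linPoly k (linRep p g u) := by
  obtain ⟨a, b, v, w⟩ := u
  simp only [linRep_apply, linPoly_apply, map_add, map_smul,
    map_linForm_of_sum (rotPoly_xOsc _ k), map_linForm_of_sum (rotPoly_piOsc _ k), xTime, piTime,
    rotPoly_x_zero, rotPoly_pi_zero, vecRep_apply]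

theorem rotPoly_quadPoly (g : Stab p) (u : Quad) :
    rotPoly g.1.1 (quadPoly u) = quadPoly (quadRep p g u) := by
  obtain ⟨l, ⟨q₁, q₂, q₃⟩, ⟨v₁, v₂, v₃, v₄⟩, S, T, U⟩ := u
  simp only [quadRep_apply, quadPoly_apply, map_add, map_smul, map_mul, rotPoly_linPoly,
    map_linForm_of_sum (rotPoly_xOsc _ 0), map_linForm_of_sum (rotPoly_piOsc _ 0),
    map_quadForm_of_sum (rotPoly_xOsc _ 0) (rotPoly_xOsc _ 0),
    map_quadForm_of_sum (rotPoly_xOsc _ 0) (rotPoly_piOsc _ 0),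
    map_quadForm_of_sum (rotPoly_piOsc _ 0) (rotPoly_piOsc _ 0), xTime, piTime,
    rotPoly_x_zero, rotPoly_pi_zero, vecRep_apply, coe_symRep, tensorRep_apply]

theorem rot_bitState (R : Matrix (Fin 25) (Fin 25) ℝ) (m : ℕ) (f : Poly) :
    rot R (bitState m f) = bitState m (rotPoly R f) := bos_state _ _ _

end

end CarrollString

namespace CarrollString

noncomputable section

open MvPolynomial (X C pderiv monomial IsWeightedHomogeneous)

/-! ### The BRST operator on relative cochains -/

variable {p : Fin 26 → ℝ} (hp : p 0 = 0) (τ : ℝ)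

theorem sumState_nil {ι : Type*} (O : ι → Module.End ℂ Poly) (f : Poly) :
    sumState O [] f = 0 := rfl

theorem sumState_cons {ι : Type*} (O : ι → Module.End ℂ Poly) (c : ℤ) (m : ℕ) (o : ι)
    (L : List (ℤ × ℕ × ι)) (f : Poly) :
    sumState O ((c, m, o) :: L) f = (c : ℂ) • bitState m (O o f) + sumState O L f := by
  rw [sumState, List.map_cons, List.sum_cons, sumState]

include hp

theorem matterOp_C (a : ℂ) :
    matterOp τ p none (C a) = C a ∧
    matterOp τ p (some (false, -1)) (C a) = quadPoly (raiseTT (momentum p) a) ∧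
    matterOp τ p (some (true, -1)) (C a) = quadPoly (raiseMM ((τ : ℂ) ^ 2) a) ∧
    matterOp τ p (some (false, 0)) (C a) = linPoly 0 (raiseT₀ (momentum p) a) ∧
    matterOp τ p (some (true, 0)) (C a) = 0 ∧ matterOp τ p (some (false, 1)) (C a) = 0 ∧
    matterOp τ p (some (true, 1)) (C a) = 0 ∧ matterOp τ p (some (false, 2)) (C a) = 0 ∧
    matterOp τ p (some (true, 2)) (C a) = 0 ∧ matterOp τ p (some (false, 3)) (C a) = 0 ∧
    matterOp τ p (some (true, 3)) (C a) = 0 :=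
  ⟨rfl, polyT_neg_one_C hp a, polyM_neg_one_C hp τ a, polyT_zero_C hp a,
    polyM_C hp τ (Or.inl rfl) a, polyT_C p (Or.inl rfl) a, polyM_C hp τ (Or.inr (Or.inl rfl)) a,
    polyT_C p (Or.inr (Or.inl rfl)) a, polyM_C hp τ (Or.inr (Or.inr (Or.inl rfl))) a,
    polyT_C p (Or.inr (Or.inr rfl)) a, polyM_C hp τ (Or.inr (Or.inr (Or.inr rfl))) a⟩

theorem matterOp_linPoly (u : Lin) :
    matterOp τ p none (linPoly 0 u) = linPoly 0 u ∧
    matterOp τ p (some (false, 0)) (linPoly 0 u) = quadPoly (raiseT₁ (momentum p) u) ∧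
    matterOp τ p (some (true, 0)) (linPoly 0 u) = quadPoly (raiseM₁ ((τ : ℂ) ^ 2) u) ∧
    matterOp τ p (some (false, 1)) (linPoly 0 u) = linPoly 0 u ∧
    matterOp τ p (some (true, 1)) (linPoly 0 u) = linPoly 0 (levelM₁ ((τ : ℂ) ^ 2) u) ∧
    matterOp τ p (some (false, 2)) (linPoly 0 u) = C (lowerT₁ (momentum p) u) ∧
    matterOp τ p (some (true, 2)) (linPoly 0 u) = 0 ∧
    matterOp τ p (some (false, 3)) (linPoly 0 u) = 0 ∧
    matterOp τ p (some (true, 3)) (linPoly 0 u) = 0 :=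
  ⟨rfl, polyT_zero_linPoly hp u, polyM_zero_linPoly hp τ u, polyT_one_linPoly p u,
    polyM_one_linPoly hp τ u, polyT_two_linPoly hp u, polyM_two_linPoly hp τ u,
    polyT_three_linPoly u, polyM_three_linPoly hp τ u⟩

theorem matterOp_quadPoly (u : Quad) :
    matterOp τ p none (quadPoly u) = quadPoly u ∧
    matterOp τ p (some (false, 1)) (quadPoly u) = (2 : ℂ) • quadPoly u ∧
    matterOp τ p (some (true, 1)) (quadPoly u) = quadPoly (levelM₂ ((τ : ℂ) ^ 2) u) ∧
    matterOp τ p (some (false, 2)) (quadPoly u) = linPoly 0 (lowerT₂ (momentum p) u) ∧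
    matterOp τ p (some (true, 2)) (quadPoly u) = linPoly 0 (lowerM₂ ((τ : ℂ) ^ 2) u) ∧
    matterOp τ p (some (false, 3)) (quadPoly u) = C (lowerTT (momentum p) u) ∧
    matterOp τ p (some (true, 3)) (quadPoly u) = C (lowerMM ((τ : ℂ) ^ 2) u) :=
  ⟨rfl, polyT_one_quadPoly p u, polyM_one_quadPoly hp τ u, polyT_two_quadPoly hp u,
    polyM_two_quadPoly hp τ u, polyT_three_quadPoly hp u, polyM_three_quadPoly hp τ u⟩

/-- The pattern of the following computations: the ghost combinatorics is evaluated to an explicit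
list `L`, its matter operators are replaced by their coordinate formulas, and the overall factor 2
is cancelled. -/
theorem brst_bitState_eq {τ : ℝ} {m : ℕ} (hm : LowSet (ghostSet m)) {f : Poly} (hf : LowPoly f)
    {L : List (ℤ × ℕ × Option (Bool × ℤ))} (hL : brstTerms m = L) {g : Fock}
    (h : sumState (matterOp τ p) L f = (2 : ℂ) • g) : brst τ p (bitState m f) = g := by
  have h2 := two_smul_brst_bitState (τ := τ) hp hm hf
  rw [hL, h] at h2
  exact smul_right_injective Fock (two_ne_zero (α := ℂ)) h2

set_option maxRecDepth 10000

theorem brst_bitState_0 (a : ℂ) : brst τ p (bitState 0 (C a)) =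
      bitState 1 (linPoly 0 (raiseT₀ (momentum p) a)) := by
  refine brst_bitState_eq hp (by unfold LowSet; decide +kernel)
    ((hasWeight_C a).lowPoly (by norm_num)) (L :=
    -- The labels `(false, n)` and `(true, n)` stand for T₍ₙ₎ and M₍ₙ₎. Constants are killed by all
    -- modes occurring here except L₋₁ = T₍₀₎; in the case of M₋₁ = M₍₀₎ this is due to p₀ = 0.
    [(2, 2048, some (true, 3)), (2, 1024, some (true, 2)), (2, 512, some (true, 1)),
      (2, 256, some (true, 0)), (2, 8, some (false, 3)), (2, 4, some (false, 2)),
      (2, 2, some (false, 1)), (2, 1, some (false, 0))])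
    (by decide +kernel) ?_
  simp only [sumState_cons, sumState_nil, matterOp_C hp τ, map_zero]
  module

theorem brst_bitState_1 (u : Lin) : brst τ p (bitState 1 (linPoly 0 u)) =
      -bitState 513 (linPoly 0 (levelM₁ ((τ : ℂ) ^ 2) u)) -
      bitState 257 (quadPoly (raiseM₁ ((τ : ℂ) ^ 2) u)) -
      bitState 5 (C (lowerT₁ (momentum p) u)) := by
  refine brst_bitState_eq hp (by unfold LowSet; decide +kernel)
    ((hasWeight_linPoly 0 u).lowPoly (by norm_num)) (L :=
    -- The two terms on the mask 3, that is c₁c₀, cancel since L₀ acts by 1 on linear polynomials.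
    -- In all these lists the terms containing c₀ drop out in this manner, as L₀^tot vanishes.
    [(2, 3, none), (-2, 2049, some (true, 3)), (-2, 1025, some (true, 2)),
      (-2, 513, some (true, 1)), (-2, 257, some (true, 0)), (-2, 9, some (false, 3)),
      (-2, 5, some (false, 2)), (-2, 3, some (false, 1))])
    (by decide +kernel) ?_
  simp only [sumState_cons, sumState_nil, matterOp_linPoly hp τ, map_zero]
  module

theorem brst_bitState_256 (u : Lin) : brst τ p (bitState 256 (linPoly 0 u)) =
      bitState 513 (linPoly 0 u) - bitState 768 (linPoly 0 (levelM₁ ((τ : ℂ) ^ 2) u)) +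
      bitState 260 (C (lowerT₁ (momentum p) u)) +
      bitState 257 (quadPoly (raiseT₁ (momentum p) u)) := by
  refine brst_bitState_eq hp (by unfold LowSet; decide +kernel)
    ((hasWeight_linPoly 0 u).lowPoly (by norm_num)) (L :=
    [(2, 513, none), (-2, 258, none), (-2, 2304, some (true, 3)), (-2, 1280, some (true, 2)),
      (-2, 768, some (true, 1)), (2, 264, some (false, 3)), (2, 260, some (false, 2)),
      (2, 258, some (false, 1)), (2, 257, some (false, 0))])
    (by decide +kernel) ?_
  simp only [sumState_cons, sumState_nil, matterOp_linPoly hp τ, map_zero]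
  module

theorem brst_bitState_65793 (a : ℂ) : brst τ p (bitState 65793 (C a)) =
      (3 : ℂ) • bitState 1025 (C a) + (2 : ℂ) • bitState 16777985 (C a) +
      (3 : ℂ) • bitState 260 (C a) + bitState 257 (quadPoly (raiseTT (momentum p) a)) := by
  refine brst_bitState_eq hp (by unfold LowSet; decide +kernel)
    ((hasWeight_C a).lowPoly (by norm_num)) (L :=
    -- Contracting b₋₂ leaves c₁C₁ together with L₋₂ = T₍₋₁₎. The terms labelled `none` come from
    -- the ghost currents.
    [(6, 1025, none), (4, 16777985, none), (6, 260, none), (2, 257, some (false, -1)),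
      (2, 67841, some (true, 3)), (2, 66817, some (true, 2)), (2, 66305, some (true, 1)),
      (-2, 65801, some (false, 3)), (-2, 65797, some (false, 2)), (-2, 65795, some (false, 1))])
    (by decide +kernel) ?_
  simp only [sumState_cons, sumState_nil, matterOp_C hp τ, map_zero]
  module

theorem brst_bitState_16777473 (a : ℂ) : brst τ p (bitState 16777473 (C a)) =
      (3 : ℂ) • bitState 5 (C a) + bitState 257 (quadPoly (raiseMM ((τ : ℂ) ^ 2) a)) := by
  refine brst_bitState_eq hp (by unfold LowSet; decide +kernel)
    ((hasWeight_C a).lowPoly (by norm_num)) (L :=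
    [(6, 5, none), (2, 257, some (true, -1)), (2, 16779521, some (true, 3)),
      (2, 16778497, some (true, 2)), (2, 16777985, some (true, 1)),
      (-2, 16777481, some (false, 3)), (-2, 16777477, some (false, 2)),
      (-2, 16777475, some (false, 1))])
    (by decide +kernel) ?_
  simp only [sumState_cons, sumState_nil, matterOp_C hp τ, map_zero]
  module

theorem brst_bitState_512 (a : ℂ) : brst τ p (bitState 512 (C a)) =
      (2 : ℂ) • bitState 1025 (C a) - (2 : ℂ) • bitState 260 (C a) +
      bitState 513 (linPoly 0 (raiseT₀ (momentum p) a)) := by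
  refine brst_bitState_eq hp (by unfold LowSet; decide +kernel)
    ((hasWeight_C a).lowPoly (by norm_num)) (L :=
    [(4, 1025, none), (-4, 260, none), (-2, 2560, some (true, 3)), (-2, 1536, some (true, 2)),
      (2, 768, some (true, 0)), (2, 520, some (false, 3)), (2, 516, some (false, 2)),
      (2, 514, some (false, 1)), (2, 513, some (false, 0))])
    (by decide +kernel) ?_
  simp only [sumState_cons, sumState_nil, matterOp_C hp τ, map_zero]
  module

theorem brst_bitState_257 (u : Quad) : brst τ p (bitState 257 (quadPoly u)) =
      bitState 2305 (C (lowerMM ((τ : ℂ) ^ 2) u)) +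
      bitState 1281 (linPoly 0 (lowerM₂ ((τ : ℂ) ^ 2) u)) +
      bitState 769 (quadPoly (levelM₂ ((τ : ℂ) ^ 2) u)) -
      bitState 265 (C (lowerTT (momentum p) u)) -
      bitState 261 (linPoly 0 (lowerT₂ (momentum p) u)) := by
  refine brst_bitState_eq hp (by unfold LowSet; decide +kernel)
    ((hasWeight_quadPoly u).lowPoly le_rfl) (L :=
    -- On weight two L₀ acts by 2, which cancels the coefficient 4 on the mask 259, that is c₁c₀C₁.
    [(4, 259, none), (2, 2305, some (true, 3)), (2, 1281, some (true, 2)),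
      (2, 769, some (true, 1)), (-2, 265, some (false, 3)), (-2, 261, some (false, 2)),
      (-2, 259, some (false, 1))])
    (by decide +kernel) ?_
  simp only [sumState_cons, sumState_nil, matterOp_quadPoly hp τ, map_smul]
  module

theorem brst_bitState_513 (u : Lin) : brst τ p (bitState 513 (linPoly 0 u)) =
      (2 : ℂ) • bitState 261 (linPoly 0 u) - bitState 769 (quadPoly (raiseM₁ ((τ : ℂ) ^ 2) u)) -
      bitState 517 (C (lowerT₁ (momentum p) u)) := by
  refine brst_bitState_eq hp (by unfold LowSet; decide +kernel)
    ((hasWeight_linPoly 0 u).lowPoly (by norm_num)) (L :=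
    [(4, 261, none), (2, 515, none), (2, 2561, some (true, 3)), (2, 1537, some (true, 2)),
      (-2, 769, some (true, 0)), (-2, 521, some (false, 3)), (-2, 517, some (false, 2)),
      (-2, 515, some (false, 1))])
    (by decide +kernel) ?_
  simp only [sumState_cons, sumState_nil, matterOp_linPoly hp τ, map_zero]
  module

theorem brst_bitState_768 (u : Lin) : brst τ p (bitState 768 (linPoly 0 u)) =
      (2 : ℂ) • bitState 1281 (linPoly 0 u) + bitState 772 (C (lowerT₁ (momentum p) u)) +
      bitState 769 (quadPoly (raiseT₁ (momentum p) u)) := by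
  refine brst_bitState_eq hp (by unfold LowSet; decide +kernel)
    ((hasWeight_linPoly 0 u).lowPoly (by norm_num)) (L :=
    [(4, 1281, none), (-2, 770, none), (2, 2816, some (true, 3)), (2, 1792, some (true, 2)),
      (2, 776, some (false, 3)), (2, 772, some (false, 2)), (2, 770, some (false, 1)),
      (2, 769, some (false, 0))])
    (by decide +kernel) ?_
  simp only [sumState_cons, sumState_nil, matterOp_linPoly hp τ, map_zero]
  module

theorem brst_bitState_5 (a : ℂ) : brst τ p (bitState 5 (C a)) = 0 := by
  refine brst_bitState_eq hp (by unfold LowSet; decide +kernel)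
    ((hasWeight_C a).lowPoly (by norm_num)) (L :=
    [(2, 2053, some (true, 3)), (2, 1029, some (true, 2)), (2, 517, some (true, 1)),
      (2, 261, some (true, 0)), (2, 13, some (false, 3)), (-2, 7, some (false, 1))])
    (by decide +kernel) ?_
  simp only [sumState_cons, sumState_nil, matterOp_C hp τ, map_zero]
  module

theorem brst_bitState_1025 (a : ℂ) : brst τ p (bitState 1025 (C a)) =
      bitState 517 (C a) + (3 : ℂ) • bitState 265 (C a) := by
  refine brst_bitState_eq hp (by unfold LowSet; decide +kernel)
    ((hasWeight_C a).lowPoly (by norm_num)) (L :=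
    [(2, 517, none), (6, 265, none), (2, 3073, some (true, 3)), (-2, 1537, some (true, 1)),
      (-2, 1281, some (true, 0)), (-2, 1033, some (false, 3)), (-2, 1029, some (false, 2)),
      (-2, 1027, some (false, 1))])
    (by decide +kernel) ?_
  simp only [sumState_cons, sumState_nil, matterOp_C hp τ, map_zero]
  module

theorem brst_bitState_260 (a : ℂ) : brst τ p (bitState 260 (C a)) =
      bitState 517 (C a) + (3 : ℂ) • bitState 265 (C a) +
      bitState 261 (linPoly 0 (raiseT₀ (momentum p) a)) := by
  refine brst_bitState_eq hp (by unfold LowSet; decide +kernel)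
    ((hasWeight_C a).lowPoly (by norm_num)) (L :=
    [(2, 517, none), (6, 265, none), (2, 2308, some (true, 3)), (2, 1284, some (true, 2)),
      (2, 772, some (true, 1)), (-2, 268, some (false, 3)), (2, 262, some (false, 1)),
      (2, 261, some (false, 0))])
    (by decide +kernel) ?_
  simp only [sumState_cons, sumState_nil, matterOp_C hp τ, map_zero]
  module

theorem brst_bitState_1280 (a : ℂ) : brst τ p (bitState 1280 (C a)) =
      (3 : ℂ) • bitState 2305 (C a) - bitState 772 (C a) + bitState 1537 (C a) +
      bitState 1281 (linPoly 0 (raiseT₀ (momentum p) a)) := by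
  refine brst_bitState_eq hp (by unfold LowSet; decide +kernel)
    ((hasWeight_C a).lowPoly (by norm_num)) (L :=
    [(6, 2305, none), (-2, 772, none), (2, 1537, none), (2, 3328, some (true, 3)),
      (-2, 1792, some (true, 1)), (2, 1288, some (false, 3)), (2, 1284, some (false, 2)),
      (2, 1282, some (false, 1)), (2, 1281, some (false, 0))])
    (by decide +kernel) ?_
  simp only [sumState_cons, sumState_nil, matterOp_C hp τ, map_zero]
  module

theorem brst_bitState_66305 (a : ℂ) : brst τ p (bitState 66305 (C a)) =
      -(4 : ℂ) • bitState 2305 (C a) + (3 : ℂ) • bitState 1537 (C a) -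
      (3 : ℂ) • bitState 772 (C a) - bitState 769 (quadPoly (raiseTT (momentum p) a)) := by
  refine brst_bitState_eq hp (by unfold LowSet; decide +kernel)
    ((hasWeight_C a).lowPoly (by norm_num)) (L :=
    [(-8, 2305, none), (6, 1537, none), (-6, 772, none), (-2, 769, some (false, -1)),
      (-2, 68353, some (true, 3)), (-2, 67329, some (true, 2)), (-2, 66313, some (false, 3)),
      (-2, 66309, some (false, 2)), (-2, 66307, some (false, 1))])
    (by decide +kernel) ?_
  simp only [sumState_cons, sumState_nil, matterOp_C hp τ, map_zero]
  module

theorem brst_bitState_16777985 (a : ℂ) : brst τ p (bitState 16777985 (C a)) =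
      (4 : ℂ) • bitState 265 (C a) - (3 : ℂ) • bitState 517 (C a) -
      bitState 769 (quadPoly (raiseMM ((τ : ℂ) ^ 2) a)) := by
  refine brst_bitState_eq hp (by unfold LowSet; decide +kernel)
    ((hasWeight_C a).lowPoly (by norm_num)) (L :=
    [(8, 265, none), (-6, 517, none), (-2, 769, some (true, -1)), (-2, 16780033, some (true, 3)),
      (-2, 16779009, some (true, 2)), (-2, 16777993, some (false, 3)),
      (-2, 16777989, some (false, 2)), (-2, 16777987, some (false, 1))])
    (by decide +kernel) ?_
  simp only [sumState_cons, sumState_nil, matterOp_C hp τ, map_zero]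
  module

theorem brst_bitState_769 (u : Quad) : brst τ p (bitState 769 (quadPoly u)) =
      -bitState 2817 (C (lowerMM ((τ : ℂ) ^ 2) u)) -
      bitState 1793 (linPoly 0 (lowerM₂ ((τ : ℂ) ^ 2) u)) -
      bitState 777 (C (lowerTT (momentum p) u)) -
      bitState 773 (linPoly 0 (lowerT₂ (momentum p) u)) := by
  refine brst_bitState_eq hp (by unfold LowSet; decide +kernel)
    ((hasWeight_quadPoly u).lowPoly le_rfl) (L :=
    [(4, 771, none), (-2, 2817, some (true, 3)), (-2, 1793, some (true, 2)),
      (-2, 777, some (false, 3)), (-2, 773, some (false, 2)), (-2, 771, some (false, 1))])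
    (by decide +kernel) ?_
  simp only [sumState_cons, sumState_nil, matterOp_quadPoly hp τ, map_smul]
  module

theorem brst_bitState_261 (u : Lin) : brst τ p (bitState 261 (linPoly 0 u)) =
      -bitState 773 (linPoly 0 (levelM₁ ((τ : ℂ) ^ 2) u)) := by
  refine brst_bitState_eq hp (by unfold LowSet; decide +kernel)
    ((hasWeight_linPoly 0 u).lowPoly (by norm_num)) (L :=
    [(2, 263, none), (-2, 2309, some (true, 3)), (-2, 1285, some (true, 2)),
      (-2, 773, some (true, 1)), (2, 269, some (false, 3)), (-2, 263, some (false, 1))])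
    (by decide +kernel) ?_
  simp only [sumState_cons, sumState_nil, matterOp_linPoly hp τ, map_zero]
  module

theorem brst_bitState_1281 (u : Lin) : brst τ p (bitState 1281 (linPoly 0 u)) =
      bitState 773 (linPoly 0 u) + bitState 1793 (linPoly 0 (levelM₁ ((τ : ℂ) ^ 2) u)) -
      bitState 1285 (C (lowerT₁ (momentum p) u)) := by
  refine brst_bitState_eq hp (by unfold LowSet; decide +kernel)
    ((hasWeight_linPoly 0 u).lowPoly (by norm_num)) (L :=
    [(2, 773, none), (2, 1283, none), (-2, 3329, some (true, 3)), (2, 1793, some (true, 1)),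
      (-2, 1289, some (false, 3)), (-2, 1285, some (false, 2)), (-2, 1283, some (false, 1))])
    (by decide +kernel) ?_
  simp only [sumState_cons, sumState_nil, matterOp_linPoly hp τ, map_zero]
  module

theorem brst_bitState_265 (a : ℂ) : brst τ p (bitState 265 (C a)) = 0 := by
  refine brst_bitState_eq hp (by unfold LowSet; decide +kernel)
    ((hasWeight_C a).lowPoly (by norm_num)) (L :=
    [(-2, 2313, some (true, 3)), (-2, 1289, some (true, 2)), (-2, 777, some (true, 1)),
      (-2, 269, some (false, 2)), (-2, 267, some (false, 1))])
    (by decide +kernel) ?_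
  simp only [sumState_cons, sumState_nil, matterOp_C hp τ, map_zero]
  module

theorem brst_bitState_2305 (a : ℂ) : brst τ p (bitState 2305 (C a)) =
      (2 : ℂ) • bitState 777 (C a) := by
  refine brst_bitState_eq hp (by unfold LowSet; decide +kernel)
    ((hasWeight_C a).lowPoly (by norm_num)) (L :=
    [(4, 777, none), (2, 3329, some (true, 2)), (2, 2817, some (true, 1)),
      (-2, 2313, some (false, 3)), (-2, 2309, some (false, 2)), (-2, 2307, some (false, 1))])
    (by decide +kernel) ?_
  simp only [sumState_cons, sumState_nil, matterOp_C hp τ, map_zero]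
  module

theorem brst_bitState_517 (a : ℂ) : brst τ p (bitState 517 (C a)) = 0 := by
  refine brst_bitState_eq hp (by unfold LowSet; decide +kernel)
    ((hasWeight_C a).lowPoly (by norm_num)) (L :=
    [(-2, 2565, some (true, 3)), (-2, 1541, some (true, 2)), (2, 773, some (true, 0)),
      (2, 525, some (false, 3)), (-2, 519, some (false, 1))])
    (by decide +kernel) ?_
  simp only [sumState_cons, sumState_nil, matterOp_C hp τ, map_zero]
  module

theorem brst_bitState_1537 (a : ℂ) : brst τ p (bitState 1537 (C a)) =
      -(3 : ℂ) • bitState 777 (C a) + (2 : ℂ) • bitState 1285 (C a) := by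
  refine brst_bitState_eq hp (by unfold LowSet; decide +kernel)
    ((hasWeight_C a).lowPoly (by norm_num)) (L :=
    [(-6, 777, none), (4, 1285, none), (-2, 3585, some (true, 3)), (-2, 1793, some (true, 0)),
      (-2, 1545, some (false, 3)), (-2, 1541, some (false, 2)), (-2, 1539, some (false, 1))])
    (by decide +kernel) ?_
  simp only [sumState_cons, sumState_nil, matterOp_C hp τ, map_zero]
  module

theorem brst_bitState_772 (a : ℂ) : brst τ p (bitState 772 (C a)) =
      (2 : ℂ) • bitState 1285 (C a) + (3 : ℂ) • bitState 777 (C a) +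
      bitState 773 (linPoly 0 (raiseT₀ (momentum p) a)) := by
  refine brst_bitState_eq hp (by unfold LowSet; decide +kernel)
    ((hasWeight_C a).lowPoly (by norm_num)) (L :=
    [(4, 1285, none), (6, 777, none), (-2, 2820, some (true, 3)), (-2, 1796, some (true, 2)),
      (-2, 780, some (false, 3)), (2, 774, some (false, 1)), (2, 773, some (false, 0))])
    (by decide +kernel) ?_
  simp only [sumState_cons, sumState_nil, matterOp_C hp τ, map_zero]
  module

theorem brst_bitState_1792 (a : ℂ) : brst τ p (bitState 1792 (C a)) =
      (3 : ℂ) • bitState 2817 (C a) + bitState 1793 (linPoly 0 (raiseT₀ (momentum p) a)) := by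
  refine brst_bitState_eq hp (by unfold LowSet; decide +kernel)
    ((hasWeight_C a).lowPoly (by norm_num)) (L :=
    [(6, 2817, none), (-2, 3840, some (true, 3)), (2, 1800, some (false, 3)),
      (2, 1796, some (false, 2)), (2, 1794, some (false, 1)), (2, 1793, some (false, 0))])
    (by decide +kernel) ?_
  simp only [sumState_cons, sumState_nil, matterOp_C hp τ, map_zero]
  module

theorem brst_bitState_773 (u : Lin) : brst τ p (bitState 773 (linPoly 0 u)) = 0 := by
  refine brst_bitState_eq hp (by unfold LowSet; decide +kernel)
    ((hasWeight_linPoly 0 u).lowPoly (by norm_num)) (L :=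
    [(2, 775, none), (2, 2821, some (true, 3)), (2, 1797, some (true, 2)),
      (2, 781, some (false, 3)), (-2, 775, some (false, 1))])
    (by decide +kernel) ?_
  simp only [sumState_cons, sumState_nil, matterOp_linPoly hp τ, map_zero]
  module

theorem brst_bitState_1793 (u : Lin) : brst τ p (bitState 1793 (linPoly 0 u)) =
      -bitState 1797 (C (lowerT₁ (momentum p) u)) := by
  refine brst_bitState_eq hp (by unfold LowSet; decide +kernel)
    ((hasWeight_linPoly 0 u).lowPoly (by norm_num)) (L :=
    [(2, 1795, none), (2, 3841, some (true, 3)), (-2, 1801, some (false, 3)),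
      (-2, 1797, some (false, 2)), (-2, 1795, some (false, 1))])
    (by decide +kernel) ?_
  simp only [sumState_cons, sumState_nil, matterOp_linPoly hp τ, map_zero]
  module

theorem brst_bitState_777 (a : ℂ) : brst τ p (bitState 777 (C a)) = 0 := by
  refine brst_bitState_eq hp (by unfold LowSet; decide +kernel)
    ((hasWeight_C a).lowPoly (by norm_num)) (L :=
    [(2, 2825, some (true, 3)), (2, 1801, some (true, 2)), (-2, 781, some (false, 2)),
      (-2, 779, some (false, 1))])
    (by decide +kernel) ?_
  simp only [sumState_cons, sumState_nil, matterOp_C hp τ, map_zero]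
  module

theorem brst_bitState_2817 (a : ℂ) : brst τ p (bitState 2817 (C a)) = 0 := by
  refine brst_bitState_eq hp (by unfold LowSet; decide +kernel)
    ((hasWeight_C a).lowPoly (by norm_num)) (L :=
    [(-2, 3841, some (true, 2)), (-2, 2825, some (false, 3)), (-2, 2821, some (false, 2)),
      (-2, 2819, some (false, 1))])
    (by decide +kernel) ?_
  simp only [sumState_cons, sumState_nil, matterOp_C hp τ, map_zero]
  module

theorem brst_bitState_1285 (a : ℂ) : brst τ p (bitState 1285 (C a)) = 0 := by
  refine brst_bitState_eq hp (by unfold LowSet; decide +kernel)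
    ((hasWeight_C a).lowPoly (by norm_num)) (L :=
    [(2, 3333, some (true, 3)), (-2, 1797, some (true, 1)), (2, 1293, some (false, 3)),
      (-2, 1287, some (false, 1))])
    (by decide +kernel) ?_
  simp only [sumState_cons, sumState_nil, matterOp_C hp τ, map_zero]
  module

theorem brst_bitState_1797 (a : ℂ) : brst τ p (bitState 1797 (C a)) = 0 := by
  refine brst_bitState_eq hp (by unfold LowSet; decide +kernel)
    ((hasWeight_C a).lowPoly (by norm_num)) (L :=
    [(-2, 3845, some (true, 3)), (2, 1805, some (false, 3)), (-2, 1799, some (false, 1))])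
    (by decide +kernel) ?_
  simp only [sumState_cons, sumState_nil, matterOp_C hp τ, map_zero]
  module

end

end CarrollString

namespace CarrollString

noncomputable section

open MvPolynomial (X C)

/-! ### Coordinates on the relative cochains -/

theorem C_smul' (c a : ℂ) : (C (c * a) : Poly) = c • C a := by
  rw [MvPolynomial.smul_eq_C_mul, map_mul]

/-- Coordinates on the relative cochains of ghost number one. -/
abbrev Coord₁ : Type := Lin × Lin × ℂ × ℂ × ℂ

/-- Coordinates on the relative cochains of ghost number two. -/
abbrev Coord₂ : Type := Quad × Lin × Lin × ℂ × ℂ × ℂ × ℂ × ℂ × ℂ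

/-- Coordinates on the relative cochains of ghost number three. -/
abbrev Coord₃ : Type := Quad × Lin × Lin × ℂ × ℂ × ℂ × ℂ × ℂ × ℂ

/-- Coordinates on the relative cochains of ghost number four. -/
abbrev Coord₄ : Type := Lin × Lin × ℂ × ℂ × ℂ

/-- The constants on a ghost state. -/
def bitConst (m : ℕ) : ℂ →ₗ[ℂ] Fock := bitState m ∘ₗ Algebra.linearMap ℂ Poly

/-- The linear polynomials on a ghost state. -/
def bitLin (m : ℕ) : Lin →ₗ[ℂ] Fock := bitState m ∘ₗ linPoly 0

/-- The polynomials of weight two on a ghost state. -/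
def bitQuad (m : ℕ) : Quad →ₗ[ℂ] Fock := bitState m ∘ₗ quadPoly

/-- The relative cochains of ghost number zero: constants. -/
def cochain₀ : ℂ →ₗ[ℂ] Fock := bitConst 0

/-- The relative cochains of ghost number one: `c₁`, `C₁`, `c₁C₁b₋₂`, `c₁C₁B₋₂`, `C₀`. -/
def cochain₁ : Coord₁ →ₗ[ℂ] Fock :=
  (bitLin 1).coprod <| (bitLin 256).coprod <| (bitConst 65793).coprod <|
    (bitConst 16777473).coprod <| bitConst 512

/-- The relative cochains of ghost number two: `c₁C₁`, `c₁C₀`, `C₁C₀`, `c₁c₋₁`, `c₁C₋₁`, `c₋₁C₁`,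
`C₁C₋₁`, `c₁C₁C₀b₋₂`, `c₁C₁C₀B₋₂`. -/
def cochain₂ : Coord₂ →ₗ[ℂ] Fock :=
  (bitQuad 257).coprod <| (bitLin 513).coprod <| (bitLin 768).coprod <| (bitConst 5).coprod <|
    (bitConst 1025).coprod <| (bitConst 260).coprod <| (bitConst 1280).coprod <|
    (bitConst 66305).coprod <| bitConst 16777985

/-- The relative cochains of ghost number three: `c₁C₁C₀`, `c₁c₋₁C₁`, `c₁C₁C₋₁`, `c₁c₋₂C₁`,
`c₁C₁C₋₂`, `c₁c₋₁C₀`, `c₁C₀C₋₁`, `c₋₁C₁C₀`, `C₁C₀C₋₁`. -/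
def cochain₃ : Coord₃ →ₗ[ℂ] Fock :=
  (bitQuad 769).coprod <| (bitLin 261).coprod <| (bitLin 1281).coprod <| (bitConst 265).coprod <|
    (bitConst 2305).coprod <| (bitConst 517).coprod <| (bitConst 1537).coprod <|
    (bitConst 772).coprod <| bitConst 1792

/-- The relative cochains of ghost number four: `c₁c₋₁C₁C₀`, `c₁C₁C₀C₋₁`, `c₁c₋₂C₁C₀`, `c₁C₁C₀C₋₂`,
`c₁c₋₁C₁C₋₁`. -/
def cochain₄ : Coord₄ →ₗ[ℂ] Fock :=
  (bitLin 773).coprod <| (bitLin 1793).coprod <| (bitConst 777).coprod <|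
    (bitConst 2817).coprod <| bitConst 1285

/-- The relative cochains of ghost number five: `c₁c₋₁C₁C₀C₋₁`. -/
def cochain₅ : ℂ →ₗ[ℂ] Fock := bitConst 1797

theorem cochain₀_apply (u : ℂ) : cochain₀ u = bitState 0 (C u) := rfl

theorem cochain₅_apply (u : ℂ) : cochain₅ u = bitState 1797 (C u) := rfl

theorem cochain₁_apply (f g : Lin) (s₁ s₂ s₃ : ℂ) : cochain₁ (f, g, s₁, s₂, s₃) =
    bitState 1 (linPoly 0 f) + (bitState 256 (linPoly 0 g) + (bitState 65793 (C s₁) +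
      (bitState 16777473 (C s₂) + bitState 512 (C s₃)))) := rfl

theorem cochain₂_apply (F : Quad) (f g : Lin) (s₁ s₂ s₃ s₄ s₅ s₆ : ℂ) :
    cochain₂ (F, f, g, s₁, s₂, s₃, s₄, s₅, s₆) =
      bitState 257 (quadPoly F) + (bitState 513 (linPoly 0 f) + (bitState 768 (linPoly 0 g) +
      (bitState 5 (C s₁) + (bitState 1025 (C s₂) + (bitState 260 (C s₃) + (bitState 1280 (C s₄) +
      (bitState 66305 (C s₅) + bitState 16777985 (C s₆)))))))) := rfl

theorem cochain₃_apply (F : Quad) (f g : Lin) (s₁ s₂ s₃ s₄ s₅ s₆ : ℂ) :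
    cochain₃ (F, f, g, s₁, s₂, s₃, s₄, s₅, s₆) =
      bitState 769 (quadPoly F) + (bitState 261 (linPoly 0 f) + (bitState 1281 (linPoly 0 g) +
      (bitState 265 (C s₁) + (bitState 2305 (C s₂) + (bitState 517 (C s₃) + (bitState 1537 (C s₄) +
      (bitState 772 (C s₅) + bitState 1792 (C s₆)))))))) := rfl

theorem cochain₄_apply (f g : Lin) (s₁ s₂ s₃ : ℂ) : cochain₄ (f, g, s₁, s₂, s₃) =
    bitState 773 (linPoly 0 f) + (bitState 1793 (linPoly 0 g) + (bitState 777 (C s₁) +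
      (bitState 2817 (C s₂) + bitState 1285 (C s₃)))) := rfl

/-! ### The differential in coordinates -/

section Differential

variable (t : ℂ) (P : Vect)

/-- The differential on cochains of ghost number zero. -/
def diff₀ (a : ℂ) : Coord₁ := (raiseT₀ P a, 0, 0, 0, 0)

/-- The differential on cochains of ghost number one. -/
def diff₁ (u : Coord₁) : Coord₂ :=
  (-raiseM₁ t u.1 + raiseT₁ P u.2.1 + raiseTT P u.2.2.1 + raiseMM t u.2.2.2.1,
    -levelM₁ t u.1 + u.2.1 + raiseT₀ P u.2.2.2.2, -levelM₁ t u.2.1,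
    -lowerT₁ P u.1 + 3 * u.2.2.2.1, 3 * u.2.2.1 + 2 * u.2.2.2.2,
    lowerT₁ P u.2.1 + 3 * u.2.2.1 - 2 * u.2.2.2.2, 0, 0, 2 * u.2.2.1)

/-- The differential on cochains of ghost number two. -/
def diff₂ : Coord₂ → Coord₃ := fun ⟨F, f, g, _, s₂, s₃, s₄, s₅, s₆⟩ =>
  (levelM₂ t F - raiseM₁ t f + raiseT₁ P g - raiseTT P s₅ - raiseMM t s₆,
    -lowerT₂ P F + (2 : ℂ) • f + raiseT₀ P s₃, lowerM₂ t F + (2 : ℂ) • g + raiseT₀ P s₄,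
    -lowerTT P F + 3 * s₂ + 3 * s₃ + 4 * s₆, lowerMM t F + 3 * s₄ - 4 * s₅,
    -lowerT₁ P f + s₂ + s₃ - 3 * s₆, s₄ + 3 * s₅, lowerT₁ P g - s₄ - 3 * s₅, 0)

/-- The differential on cochains of ghost number three. -/
def diff₃ : Coord₃ → Coord₄ := fun ⟨F, f, g, _, s₂, _, s₄, s₅, s₆⟩ =>
  (-levelM₁ t f + g - lowerT₂ P F + raiseT₀ P s₅, levelM₁ t g - lowerM₂ t F + raiseT₀ P s₆,
    2 * s₂ - lowerTT P F - 3 * s₄ + 3 * s₅, -lowerMM t F + 3 * s₆,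
    -lowerT₁ P g + 2 * s₄ + 2 * s₅)

/-- The differential on cochains of ghost number four. -/
def diff₄ (u : Coord₄) : ℂ := -lowerT₁ P u.2.1

end Differential

variable {p : Fin 26 → ℝ} (hp : p 0 = 0) (τ : ℝ)
include hp

theorem brst_cochain₀ (u : ℂ) : brst τ p (cochain₀ u) = cochain₁ (diff₀ (momentum p) u) := by
  rw [cochain₀_apply, brst_bitState_0 hp]
  simp only [diff₀, cochain₁_apply, map_zero, add_zero]

/-- The formulas for single ghost monomials are added up; each component of `diff₁` collects the
contributions to one mask of ghost number two. -/
theorem brst_cochain₁ (u : Coord₁) :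
    brst τ p (cochain₁ u) = cochain₂ (diff₁ ((τ : ℂ) ^ 2) (momentum p) u) := by
  obtain ⟨f, g, s₁, s₂, s₃⟩ := u
  simp only [diff₁, cochain₁_apply, cochain₂_apply, map_add, map_sub, map_neg, map_zero, C_smul',
    map_smul, brst_bitState_1 hp, brst_bitState_256 hp, brst_bitState_65793 hp,
    brst_bitState_16777473 hp, brst_bitState_512 hp]
  module

theorem brst_cochain₂ (u : Coord₂) :
    brst τ p (cochain₂ u) = cochain₃ (diff₂ ((τ : ℂ) ^ 2) (momentum p) u) := by
  obtain ⟨F, f, g, s₁, s₂, s₃, s₄, s₅, s₆⟩ := u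
  simp only [diff₂, cochain₃_apply, cochain₂_apply, map_add, map_sub, map_neg, map_zero, C_smul',
    map_smul, brst_bitState_257 hp, brst_bitState_513 hp, brst_bitState_768 hp,
    brst_bitState_5 hp, brst_bitState_1025 hp, brst_bitState_260 hp, brst_bitState_1280 hp,
    brst_bitState_66305 hp, brst_bitState_16777985 hp]
  module

theorem brst_cochain₃ (u : Coord₃) :
    brst τ p (cochain₃ u) = cochain₄ (diff₃ ((τ : ℂ) ^ 2) (momentum p) u) := by
  obtain ⟨F, f, g, s₁, s₂, s₃, s₄, s₅, s₆⟩ := u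
  simp only [diff₃, cochain₃_apply, cochain₄_apply, map_add, map_sub, map_neg, C_smul',
    map_smul, brst_bitState_769 hp, brst_bitState_261 hp, brst_bitState_1281 hp,
    brst_bitState_265 hp, brst_bitState_2305 hp, brst_bitState_517 hp, brst_bitState_1537 hp,
    brst_bitState_772 hp, brst_bitState_1792 hp]
  module

theorem brst_cochain₄ (u : Coord₄) :
    brst τ p (cochain₄ u) = cochain₅ (diff₄ (momentum p) u) := by
  obtain ⟨f, g, s₁, s₂, s₃⟩ := u
  simp only [diff₄, cochain₄_apply, cochain₅_apply, map_add, brst_bitState_773 hp,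
    brst_bitState_1793 hp, brst_bitState_777 hp, brst_bitState_2817 hp, brst_bitState_1285 hp,
    add_zero, zero_add, map_neg]

theorem brst_cochain₅ (u : ℂ) : brst τ p (cochain₅ u) = 0 := by
  rw [cochain₅_apply, brst_bitState_1797 hp]

omit hp

/-! ### Injectivity and rotations -/

theorem C_eq_zero' {a : ℂ} (h : (C a : Poly) = 0) : a = 0 :=
  (MvPolynomial.C_eq_zero (σ := Osc)).mp h

theorem coeff_bitState_self {m : ℕ} (hm : m < 2 ^ 32) (f : Poly) :
    coeff (ghostSet m) (bitState m f) = f := by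
  rw [coeff_bitState hm hm, if_pos rfl]

theorem coeff_bitState_of_ne {m n : ℕ} (hm : m < 2 ^ 32) (hn : n < 2 ^ 32) (h : m ≠ n) (f : Poly) :
    coeff (ghostSet n) (bitState m f) = 0 := by
  rw [coeff_bitState hm hn, if_neg h]

theorem cochain₀_injective (u : ℂ) (h : cochain₀ u = 0) : u = 0 := by
  rw [cochain₀_apply] at h
  have h1 := congrArg (coeff (ghostSet 0)) h
  rw [coeff_bitState_self (by norm_num), map_zero] at h1
  exact C_eq_zero' h1

/-- Different masks label different basis monomials of the ghosts, so each coordinate polynomial is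
recovered as one coefficient. -/
theorem cochain₁_injective (u : Coord₁) (h : cochain₁ u = 0) : u = 0 := by
  obtain ⟨f, g, s₁, s₂, s₃⟩ := u
  rw [cochain₁_apply] at h
  have h1 := congrArg (coeff (ghostSet 1)) h
  have h2 := congrArg (coeff (ghostSet 256)) h
  have h3 := congrArg (coeff (ghostSet 65793)) h
  have h4 := congrArg (coeff (ghostSet 16777473)) h
  have h5 := congrArg (coeff (ghostSet 512)) h
  simp (discharger := norm_num) only [map_add, coeff_bitState_self, coeff_bitState_of_ne, map_zero,
    add_zero, zero_add] at h1 h2 h3 h4 h5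
  rw [linPoly_eq_zero h1, linPoly_eq_zero h2, C_eq_zero' h3, C_eq_zero' h4, C_eq_zero' h5]
  rfl

theorem cochain₂_injective (u : Coord₂) (h : cochain₂ u = 0) : u = 0 := by
  obtain ⟨F, f, g, s₁, s₂, s₃, s₄, s₅, s₆⟩ := u
  rw [cochain₂_apply] at h
  have h1 := congrArg (coeff (ghostSet 257)) h
  have h2 := congrArg (coeff (ghostSet 513)) h
  have h3 := congrArg (coeff (ghostSet 768)) h
  have h4 := congrArg (coeff (ghostSet 5)) h
  have h5 := congrArg (coeff (ghostSet 1025)) h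
  have h6 := congrArg (coeff (ghostSet 260)) h
  have h7 := congrArg (coeff (ghostSet 1280)) h
  have h8 := congrArg (coeff (ghostSet 66305)) h
  have h9 := congrArg (coeff (ghostSet 16777985)) h
  simp (discharger := norm_num) only [map_add, coeff_bitState_self, coeff_bitState_of_ne, map_zero,
    add_zero, zero_add] at h1 h2 h3 h4 h5 h6 h7 h8 h9
  rw [quadPoly_eq_zero h1, linPoly_eq_zero h2, linPoly_eq_zero h3, C_eq_zero' h4, C_eq_zero' h5, C_eq_zero' h6, C_eq_zero' h7, C_eq_zero' h8, C_eq_zero' h9]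
  rfl

theorem cochain₃_injective (u : Coord₃) (h : cochain₃ u = 0) : u = 0 := by
  obtain ⟨F, f, g, s₁, s₂, s₃, s₄, s₅, s₆⟩ := u
  rw [cochain₃_apply] at h
  have h1 := congrArg (coeff (ghostSet 769)) h
  have h2 := congrArg (coeff (ghostSet 261)) h
  have h3 := congrArg (coeff (ghostSet 1281)) h
  have h4 := congrArg (coeff (ghostSet 265)) h
  have h5 := congrArg (coeff (ghostSet 2305)) h
  have h6 := congrArg (coeff (ghostSet 517)) h
  have h7 := congrArg (coeff (ghostSet 1537)) h
  have h8 := congrArg (coeff (ghostSet 772)) h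
  have h9 := congrArg (coeff (ghostSet 1792)) h
  simp (discharger := norm_num) only [map_add, coeff_bitState_self, coeff_bitState_of_ne, map_zero,
    add_zero, zero_add] at h1 h2 h3 h4 h5 h6 h7 h8 h9
  rw [quadPoly_eq_zero h1, linPoly_eq_zero h2, linPoly_eq_zero h3, C_eq_zero' h4, C_eq_zero' h5, C_eq_zero' h6, C_eq_zero' h7, C_eq_zero' h8, C_eq_zero' h9]
  rfl

theorem cochain₄_injective (u : Coord₄) (h : cochain₄ u = 0) : u = 0 := by
  obtain ⟨f, g, s₁, s₂, s₃⟩ := u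
  rw [cochain₄_apply] at h
  have h1 := congrArg (coeff (ghostSet 773)) h
  have h2 := congrArg (coeff (ghostSet 1793)) h
  have h3 := congrArg (coeff (ghostSet 777)) h
  have h4 := congrArg (coeff (ghostSet 2817)) h
  have h5 := congrArg (coeff (ghostSet 1285)) h
  simp (discharger := norm_num) only [map_add, coeff_bitState_self, coeff_bitState_of_ne, map_zero,
    add_zero, zero_add] at h1 h2 h3 h4 h5
  rw [linPoly_eq_zero h1, linPoly_eq_zero h2, C_eq_zero' h3, C_eq_zero' h4, C_eq_zero' h5]
  rfl

theorem cochain₅_injective (u : ℂ) (h : cochain₅ u = 0) : u = 0 := by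
  rw [cochain₅_apply] at h
  have h1 := congrArg (coeff (ghostSet 1797)) h
  rw [coeff_bitState_self (by norm_num), map_zero] at h1
  exact C_eq_zero' h1

/-- The representation on the coordinates of ghost number one. -/
abbrev coordRep₁ (p : Fin 26 → ℝ) : Representation ℂ (Stab p) Coord₁ :=
  (linRep p).prod <| (linRep p).prod <| (scalarRep p).prod <| (scalarRep p).prod <| scalarRep p

/-- The representation on the coordinates of ghost numbers two and three. -/
abbrev coordRep₂ (p : Fin 26 → ℝ) : Representation ℂ (Stab p) Coord₂ :=
  (quadRep p).prod <| (linRep p).prod <| (linRep p).prod <| (scalarRep p).prod <|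
    (scalarRep p).prod <| (scalarRep p).prod <| (scalarRep p).prod <| (scalarRep p).prod <|
    scalarRep p

theorem rotPoly_C (R : Matrix (Fin 25) (Fin 25) ℝ) (a : ℂ) : rotPoly R (C a) = C a :=
  (rotPoly R).commutes a

theorem rot_cochain₀ (g : Stab p) (u : ℂ) :
    rot g.1.1 (cochain₀ u) = cochain₀ u := by
  rw [cochain₀_apply, rot_bitState, rotPoly_C]

theorem rot_cochain₁ (g : Stab p) (u : Coord₁) :
    rot g.1.1 (cochain₁ u) = cochain₁ (coordRep₁ p g u) := by
  obtain ⟨f, g, s₁, s₂, s₃⟩ := u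
  simp only [cochain₁_apply, map_add, rot_bitState, rotPoly_C, rotPoly_linPoly]
  rfl

theorem rot_cochain₂ (g : Stab p) (u : Coord₂) :
    rot g.1.1 (cochain₂ u) = cochain₂ (coordRep₂ p g u) := by
  obtain ⟨F, f, g, s₁, s₂, s₃, s₄, s₅, s₆⟩ := u
  simp only [cochain₂_apply, map_add, rot_bitState, rotPoly_C, rotPoly_linPoly, rotPoly_quadPoly]
  rfl

theorem rot_cochain₃ (g : Stab p) (u : Coord₃) :
    rot g.1.1 (cochain₃ u) = cochain₃ (coordRep₂ p g u) := by
  obtain ⟨F, f, g, s₁, s₂, s₃, s₄, s₅, s₆⟩ := u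
  simp only [cochain₃_apply, map_add, rot_bitState, rotPoly_C, rotPoly_linPoly, rotPoly_quadPoly]
  rfl

theorem rot_cochain₄ (g : Stab p) (u : Coord₄) :
    rot g.1.1 (cochain₄ u) = cochain₄ (coordRep₁ p g u) := by
  obtain ⟨f, g, s₁, s₂, s₃⟩ := u
  simp only [cochain₄_apply, map_add, rot_bitState, rotPoly_C, rotPoly_linPoly]
  rfl

theorem rot_cochain₅ (g : Stab p) (u : ℂ) :
    rot g.1.1 (cochain₅ u) = cochain₅ u := by
  rw [cochain₅_apply, rot_bitState, rotPoly_C]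

end

end CarrollString

namespace CarrollString

noncomputable section

open MvPolynomial (X C pderiv monomial IsWeightedHomogeneous)

/-! ### The spectrum of `L₀` -/

theorem Fock.lhom_ext {W : Type*} [AddCommGroup W] [Module ℂ W] {A B : Fock →ₗ[ℂ] W}
    (h : ∀ S d c, A (state S (monomial d c)) = B (state S (monomial d c))) : A = B := by
  refine Finsupp.lhom_ext' (M := MvPolynomial Osc ℂ) (R := ℂ) fun S => ?_
  exact MvPolynomial.linearMap_ext fun d => LinearMap.ext fun c => h S d c

theorem create_annihilate_state (g : Ghost) (S : Finset Ghost) (f : Poly) :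
    create g (annihilate g (state S f)) = if g ∈ S then state S f else 0 := by
  rw [annihilate_state]
  by_cases h : g ∈ S
  · have h' : ghostSign g (S.erase g) = ghostSign g S := by
      rw [ghostSign, ghostSign, Finset.filter_erase, Finset.erase_eq_of_notMem (by simp)]
    rw [if_pos h, if_pos h, map_smul, create_state, if_neg (Finset.notMem_erase g S),
      Finset.insert_erase h, h', smul_smul, ghostSign, ← pow_add, Even.neg_one_pow ⟨_, rfl⟩, one_smul]
  · rw [if_neg h, if_neg h, map_zero]

/-- The case n = 1 of the pair formula with arbitrary truncation. L₀ has to be diagonalised on the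
whole Fock space before relative cochains are known to be of low weight. The coefficients j + 2 and
j − 1 are the weights of b₋₂₋ⱼ and c₁₋ⱼ. -/
theorem mode_one_pair {W : Type*} [AddCommGroup W] [Module ℂ W] (b c : Fields W) (v : W) (N : ℕ)
    (hb : ∀ i : ℤ, N ≤ i → mode b i v = 0) (hc : ∀ i : ℤ, N ≤ i → mode c i v = 0) :
    (-2 : ℂ) • mode (normalProd (-1) b (deriv c)) 1 v - mode (normalProd (-1) (deriv b) c) 1 v =
      ∑ j ∈ Finset.range N, (((j + 2 : ℤ) : ℂ) • mode b (-1 - j) (mode c j v) +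
        ((j - 1 : ℤ) : ℂ) • mode c (-1 - j) (mode b j v)) := by
  set F : ℕ → W := fun j => mode b (-1 - j) (mode c j v) with hF
  set G : ℕ → W := fun j => mode c (-1 - j) (mode b j v) with hG
  have h1 : ∀ i : ℕ, normalTerm (-1) b (deriv c) 1 i v = (-(1 + i : ℂ)) • F i + (-i : ℂ) • G i := by
    intro i
    rw [normalTerm_apply, mode_deriv, mode_deriv, LinearMap.smul_apply, map_smul,
      LinearMap.smul_apply, smul_smul, hF, hG]
    rw [show 1 - 1 - (i : ℤ) - 1 = -1 - i by ring, show (1 : ℤ) + i - 1 = i by ring]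
    push_cast
    module
  have h2 : ∀ i : ℕ, normalTerm (-1) (deriv b) c 1 (i + 1) v =
      (i + 2 : ℂ) • F (i + 2) + (i + 1 : ℂ) • G i := by
    intro i
    rw [normalTerm_apply, mode_deriv, mode_deriv, LinearMap.smul_apply, LinearMap.smul_apply,
      map_smul, hF, hG]
    push_cast
    rw [show -1 - ((i : ℤ) + 1) - 1 = -1 - (i + 2) by ring, show (i : ℤ) + 1 - 1 = i by ring,
      show (1 : ℤ) + ((i : ℤ) + 1) = i + 2 by ring,
      show (0 : ℤ) - ((i : ℤ) + 1) = -1 - i by ring]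
    module
  have h3 : normalTerm (-1) (deriv b) c 1 0 v = F 1 := by
    rw [normalTerm_apply, mode_deriv, mode_deriv, LinearMap.smul_apply, LinearMap.smul_apply, hF]
    simp
  have hF0 : ∀ j : ℕ, N ≤ j → F j = 0 := fun j hj => by
    rw [hF]
    dsimp only
    rw [hc _ (by omega), map_zero]
  have hG0 : ∀ j : ℕ, N ≤ j → G j = 0 := fun j hj => by
    rw [hG]
    dsimp only
    rw [hb _ (by omega), map_zero]
  -- A shift of the index by two turns this into ∑ i F_i; the boundary terms F_N and F_{N+1} vanish.
  have h4 : ∑ i ∈ Finset.range N, (i + 2 : ℂ) • F (i + 2) + F 1 =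
      ∑ i ∈ Finset.range N, (i : ℂ) • F i := by
    have h := Finset.sum_range_succ' (fun i : ℕ => (i : ℂ) • F i) (N + 1)
    have h' := Finset.sum_range_succ' (fun i : ℕ => ((i + 1 : ℕ) : ℂ) • F (i + 1)) N
    rw [h', Finset.sum_range_succ, Finset.sum_range_succ, hF0 N le_rfl, hF0 (N + 1) (by omega)] at h
    simp only [zero_add, Nat.cast_one, Nat.cast_zero, smul_zero, zero_smul, add_zero, one_smul] at h
    rw [h]
    refine congrArg (· + _) (Finset.sum_congr rfl fun i _ => ?_)
    push_cast
    rw [add_assoc, one_add_one_eq_two]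
  change _ = ∑ j ∈ Finset.range N, (((j + 2 : ℤ) : ℂ) • F j + ((j - 1 : ℤ) : ℂ) • G j)
  rw [mode_normalProd_eq_sum (-1) b (deriv c) 1 v N fun i hi => by
      rw [h1, hF0 i hi, hG0 i hi, smul_zero, smul_zero, add_zero],
    mode_normalProd_eq_sum (-1) (deriv b) c 1 v (N + 1) fun i hi => by
      obtain ⟨i, rfl⟩ := Nat.exists_eq_add_of_le' (show 1 ≤ i by omega)
      rw [h2, hF0 (i + 2) (by omega), hG0 i (by omega), smul_zero, smul_zero, add_zero],
    Finset.sum_range_succ' (fun i => normalTerm (-1) (deriv b) c 1 i v), h3]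
  simp only [h1, h2, Finset.sum_add_distrib]
  rw [add_right_comm, h4, smul_add, Finset.smul_sum, Finset.smul_sum, ← Finset.sum_add_distrib,
    ← Finset.sum_add_distrib, ← Finset.sum_sub_distrib, ← Finset.sum_add_distrib]
  refine Finset.sum_congr rfl fun i _ => ?_
  push_cast
  module

/-- The weight of a fermionic creation operator. -/
def ghostWeight (g : Ghost) : ℤ := if (ofLex g).1 < 2 then (ofLex g).2 - 1 else (ofLex g).2 + 2

theorem sum_eq_sum_range {S : Finset Ghost} {N : ℕ} (hN : ∀ g ∈ S, (ofLex g).2 < N) (w : Ghost → ℤ) :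
    ∑ g ∈ S, w g =
      ∑ t : Fin 4, ∑ i ∈ Finset.range N, if toLex (t, i) ∈ S then w (toLex (t, i)) else 0 := by
  rw [← Finset.sum_product', ← Finset.sum_filter]
  refine Finset.sum_nbij' ofLex toLex (fun g hg => ?_) (fun x hx => ?_) (fun _ _ => rfl)
    (fun _ _ => rfl) fun _ _ => rfl
  · simp only [Finset.mem_filter, Finset.mem_product, Finset.mem_univ, true_and, Finset.mem_range]
    exact ⟨hN g hg, hg⟩
  · exact (Finset.mem_filter.mp hx).2

theorem mode_ghostField_state_eq_zero (t t' : Fin 4) {S : Finset Ghost} {N : ℕ}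
    (hN : ∀ g ∈ S, (ofLex g).2 < N) (f : Poly) (i : ℤ) (hi : N ≤ i) :
    mode (ghostField t t') i (state S f) = 0 := by
  change ghostMode t t' i (state S f) = 0
  rw [ghostMode, if_neg (by omega), annihilate_state, if_neg]
  intro h
  have h' : i.toNat < N := hN _ h
  omega

theorem mode_one_ghost_pair_state (t t' : Fin 4) {S : Finset Ghost} {N : ℕ}
    (hN : ∀ g ∈ S, (ofLex g).2 < N) (f : Poly) :
    (-2 : ℂ) • mode (normalProd (-1) (ghostField t' t) (deriv (ghostField t t'))) 1 (state S f) -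
      mode (normalProd (-1) (deriv (ghostField t' t)) (ghostField t t')) 1 (state S f) =
    ((∑ i ∈ Finset.range N, ((if toLex (t', i) ∈ S then (i + 2 : ℤ) else 0) +
      (if toLex (t, i) ∈ S then (i - 1 : ℤ) else 0)) : ℤ) : ℂ) • state S f := by
  have h : ∀ (t t' : Fin 4) (i : ℕ), mode (ghostField t' t) (-1 - i)
      (mode (ghostField t t') i (state S f)) = if toLex (t', i) ∈ S then state S f else 0 := by
    intro t t' i
    change ghostMode t' t (-1 - i) (ghostMode t t' i (state S f)) = _
    rw [ghostMode, ghostMode, if_pos (by omega), if_neg (by omega),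
      show (-(-1 - (i : ℤ)) - 1).toNat = i by omega, Int.toNat_natCast, create_annihilate_state]
  rw [mode_one_pair _ _ _ N (mode_ghostField_state_eq_zero t' t hN f)
    (mode_ghostField_state_eq_zero t t' hN f), Int.cast_sum, Finset.sum_smul]
  refine Finset.sum_congr rfl fun i _ => ?_
  rw [h, h]
  split_ifs <;> push_cast <;> module

theorem mode_ghostT_one_state (S : Finset Ghost) (f : Poly) :
    mode ghostT 1 (state S f) = ((∑ g ∈ S, ghostWeight g : ℤ) : ℂ) • state S f := by
  obtain ⟨N, hN⟩ : ∃ N, ∀ g ∈ S, (ofLex g).2 < N := by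
    obtain ⟨N, hN⟩ := (S.image fun g => (ofLex g).2).bddAbove
    exact ⟨N + 1, fun g hg => Nat.lt_succ_of_le (hN (Finset.mem_coe.mpr
      (Finset.mem_image_of_mem _ hg)))⟩
  have h1 := mode_one_ghost_pair_state 0 2 hN f
  have h2 := mode_one_ghost_pair_state 1 3 hN f
  have h3 := congrArg₂ (· + ·) h1 h2
  have h4 : ∀ x y z w : Fock, (-2 : ℂ) • x - y + ((-2 : ℂ) • z - w) =
    (-2 : ℂ) • x - y - (2 : ℂ) • z - w := fun x y z w => by module
  rw [h4] at h3
  rw [show mode ghostT 1 (state S f) = _ from h3, ← add_smul, ← Int.cast_add, sum_eq_sum_range hN]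
  congr 2
  simp only [Fin.sum_univ_four, ghostWeight, ofLex_toLex, Finset.sum_add_distrib]
  simp
  ring

theorem weight_eq_sum_range (N : ℕ) (d : Osc →₀ ℕ) (hd : ∀ o, N ≤ o.idx → d o = 0) :
    Finsupp.weight oscWeight d =
      ∑ μ, ∑ i ∈ Finset.range N, (i + 1) * (d (.x μ i) + d (.pi μ i)) := by
  classical
  induction d using Finsupp.induction_linear with
  | zero => simp
  | add d e hd' he' =>
    have h1 : ∀ o, N ≤ o.idx → d o = 0 := fun o ho => by
      have := hd o ho
      rw [Finsupp.add_apply] at this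
      omega
    have h2 : ∀ o, N ≤ o.idx → e o = 0 := fun o ho => by
      have := hd o ho
      rw [Finsupp.add_apply] at this
      omega
    rw [map_add, hd' h1, he' h2, ← Finset.sum_add_distrib]
    refine Finset.sum_congr rfl fun μ _ => ?_
    rw [← Finset.sum_add_distrib]
    exact Finset.sum_congr rfl fun i _ => by simp only [Finsupp.add_apply]; ring
  | single o n =>
    by_cases hn : n = 0
    · simp [hn]
    have ho : o.idx < N := by
      by_contra h
      exact hn (by simpa using hd o (not_lt.mp h))
    obtain ⟨ν, k⟩ | ⟨ν, k⟩ := o <;> rw [Finset.sum_eq_single ν, Finset.sum_eq_single k]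
    all_goals simp_all [Finsupp.weight_single, oscWeight, Osc.idx, mul_comm, Finsupp.single_apply]

/-- Each half of the term is a number operator: multiplication by an oscillator after its derivative
multiplies a monomial by the exponent. For i = 0 the truncated `i - 1` is harmless because of the
factor `i`. -/
theorem mode_one_dX_Pi_term (p : Fin 26 → ℝ) (μ : Fin 26) (i : ℕ) (S : Finset Ghost)
    (d : Osc →₀ ℕ) (c : ℂ) :
    normalTerm 1 (dX μ) (Pi p μ) 1 i (state S (monomial d c)) =
      (((i + 1) * d (.x μ i) + i * d (.pi μ (i - 1)) : ℕ) : ℂ) • state S (monomial d c) := by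
  have h0 : ∀ o, X o * (pderiv o).toLinearMap (monomial d c) = (d o : ℂ) • (monomial d c : Poly) :=
    fun o => MvPolynomial.X_mul_pderiv_monomial.trans (Nat.cast_smul_eq_nsmul ℂ _ _).symm
  have h1 : dXPoly μ (-1 - i) (piPoly p μ (1 + i) (monomial d c)) =
      (((i + 1) * d (.x μ i) : ℕ) : ℂ) • monomial d c := by
    rw [dXPoly, piPoly, if_pos (by omega), if_neg (by omega), if_neg (by omega),
      show (-(-1 - (i : ℤ)) - 1).toNat = i by omega, show (1 + (i : ℤ) - 1).toNat = i by omega,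
      LinearMap.smul_apply, LinearMap.mulLeft_apply, h0, smul_smul]
    congr 1
    push_cast
    ring
  have h2 : piPoly p μ (1 - 1 - i) (dXPoly μ i (monomial d c)) =
      ((i * d (.pi μ (i - 1)) : ℕ) : ℂ) • monomial d c := by
    obtain _ | i := i
    · simp [dXPoly]
    · rw [dXPoly, piPoly, if_pos (by omega), if_neg (by omega), if_neg (by omega),
        show (-(1 - 1 - ((i + 1 : ℕ) : ℤ)) - 1).toNat = i by omega,
        show (((i + 1 : ℕ) : ℤ) - 1).toNat = i by omega, LinearMap.smul_apply, map_smul,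
        LinearMap.mulLeft_apply, h0, smul_smul]
      congr 1
      push_cast
      rfl
  rw [normalTerm_apply, mode_Pi_state, mode_dX_state, mode_dX_state, mode_Pi_state, h1, h2,
    one_smul, map_smul, map_smul, ← add_smul]
  push_cast
  rfl

theorem mode_matterT_one_state (p : Fin 26 → ℝ) (S : Finset Ghost) (d : Osc →₀ ℕ) (c : ℂ) :
    mode (matterT p) 1 (state S (monomial d c)) =
      (Finsupp.weight oscWeight d : ℂ) • state S (monomial d c) := by
  obtain ⟨N, hN⟩ : ∃ N, ∀ o : Osc, N ≤ o.idx → d o = 0 := by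
    obtain ⟨N, hN⟩ := (d.support.image Osc.idx).bddAbove
    refine ⟨N + 1, fun o ho => ?_⟩
    by_contra h
    have := hN (Finset.mem_coe.mpr (Finset.mem_image_of_mem _ (Finsupp.mem_support_iff.mpr h)))
    omega
  rw [matterT, mode_sum, weight_eq_sum_range N d hN, Nat.cast_sum, Finset.sum_smul]
  refine Finset.sum_congr rfl fun μ _ => ?_
  rw [mode_normalProd_eq_sum _ _ _ _ _ (N + 1) fun i hi => by
    rw [mode_one_dX_Pi_term, hN (.x μ i) (by simp only [Osc.idx]; omega),
      hN (.pi μ (i - 1)) (by simp only [Osc.idx]; omega)]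
    simp]
  simp only [mode_one_dX_Pi_term, ← Finset.sum_smul, ← Nat.cast_sum]
  congr 2
  rw [Finset.sum_add_distrib, Finset.sum_range_succ, hN (.x μ N) le_rfl,
    Finset.sum_range_succ' (fun i => i * d (.pi μ (i - 1)))]
  simp only [Nat.add_sub_cancel, mul_add, Finset.sum_add_distrib]
  ring

/-- The matter and the ghost part of L₀^tot are both diagonal on monomials, with eigenvalues the
respective weights, so the operator acts coefficientwise. -/
theorem coeff_LZero (p : Fin 26 → ℝ) (S : Finset Ghost) (d : Osc →₀ ℕ) (v : Fock) :
    (coeff S (LZero p v)).coeff d =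
      ((Finsupp.weight oscWeight d + ∑ g ∈ S, ghostWeight g : ℤ) : ℂ) * (coeff S v).coeff d := by
  suffices h : MvPolynomial.lcoeff ℂ d ∘ₗ coeff S ∘ₗ LZero p =
      ((Finsupp.weight oscWeight d + ∑ g ∈ S, ghostWeight g : ℤ) : ℂ) •
        MvPolynomial.lcoeff ℂ d ∘ₗ coeff S from LinearMap.congr_fun h v
  classical
  refine Fock.lhom_ext fun S' d' c => ?_
  change (coeff S (mode (matterT p + ghostT) 1 (state S' (monomial d' c)))).coeff d =
    _ * (coeff S (state S' (monomial d' c))).coeff d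
  rw [mode_add, LinearMap.add_apply, mode_matterT_one_state, mode_ghostT_one_state, ← add_smul,
    map_smul, coeff_state, MvPolynomial.coeff_smul]
  by_cases hS : S' = S
  · subst hS
    rw [if_pos rfl, MvPolynomial.coeff_monomial]
    split_ifs with hd
    · subst hd
      push_cast
      rfl
    · simp
  · simp [hS]

/-! ### The relative cochains -/

theorem coeff_annihilate (g : Ghost) (S : Finset Ghost) (v : Fock) :
    coeff S (annihilate g v) =
      if g ∈ S then 0 else ghostSign g (insert g S) • coeff (insert g S) v := by
  suffices h : coeff S ∘ₗ annihilate g =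
      if g ∈ S then 0 else ghostSign g (insert g S) • coeff (insert g S) by
    have h' := LinearMap.congr_fun h v
    split_ifs at h' ⊢ <;> exact h'
  refine Fock.lhom_ext fun S' d c => ?_
  rw [LinearMap.comp_apply, annihilate_state]
  split_ifs with h1 h2 h2
  · rw [map_smul, coeff_state, if_neg, smul_zero, LinearMap.zero_apply]
    rintro rfl
    exact Finset.notMem_erase g S' h2
  · rw [map_smul, coeff_state, LinearMap.smul_apply, coeff_state]
    by_cases h : S' = insert g S
    · subst h
      rw [if_pos rfl, if_pos (Finset.erase_insert h2)]
    · rw [if_neg h, if_neg, smul_zero, smul_zero]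
      rintro rfl
      exact h (Finset.insert_erase h1).symm
  · simp
  · rw [map_zero, LinearMap.smul_apply, coeff_state, if_neg, smul_zero]
    rintro rfl
    exact h1 (Finset.mem_insert_self g S)

theorem bZero_eq_zero_iff (v : Fock) :
    bZero v = 0 ↔ ∀ S : Finset Ghost, toLex (0, 1) ∈ S → coeff S v = 0 := by
  have hb : bZero = annihilate (toLex (0, 1)) := by
    change ghostMode 2 0 1 = _
    rw [ghostMode, if_neg (by norm_num)]
    rfl
  rw [hb]
  constructor
  · intro h S hS
    have h' := congrArg (coeff (S.erase (toLex (0, 1)))) h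
    rw [coeff_annihilate, if_neg (Finset.notMem_erase _ S), Finset.insert_erase hS, map_zero,
      smul_eq_zero] at h'
    exact h'.resolve_left (pow_ne_zero _ (by norm_num))
  · intro h
    refine Fock.ext fun S => ?_
    rw [coeff_annihilate, map_zero]
    split_ifs
    · rfl
    · rw [h _ (Finset.mem_insert_self _ S), smul_zero]

/-- The kernel of b₀ consists of the states without c₀. In the kernel of L₀^tot the matter weight
has to cancel the ghost weight, which makes the coefficient of each ghost monomial homogeneous. -/
theorem mem_Crel_iff (p : Fin 26 → ℝ) (n : ℤ) (v : Fock) :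
    v ∈ Crel p n ↔ ∀ S : Finset Ghost, coeff S v ≠ 0 →
      toLex (0, 1) ∉ S ∧ ghostNumber S = n ∧ ∃ k : ℕ, ∑ g ∈ S, ghostWeight g = -k ∧
        HasWeight k (coeff S v) := by
  have hL : LZero p v = 0 ↔ ∀ S d, (coeff S v).coeff d ≠ 0 →
      (Finsupp.weight oscWeight d : ℤ) + ∑ g ∈ S, ghostWeight g = 0 := by
    constructor
    · intro h S d hd
      have h' := coeff_LZero p S d v
      rw [h, map_zero, MvPolynomial.coeff_zero, eq_comm, mul_eq_zero] at h'
      exact_mod_cast h'.resolve_right hd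
    · intro h
      refine Fock.ext fun S => MvPolynomial.ext _ _ fun d => ?_
      rw [coeff_LZero, map_zero, MvPolynomial.coeff_zero]
      by_cases hd : (coeff S v).coeff d = 0
      · rw [hd, mul_zero]
      · rw [h S d hd, Int.cast_zero, zero_mul]
  constructor
  · rintro ⟨⟨hb, hl⟩, hn⟩ S hS
    have hl := hL.mp hl
    refine ⟨fun h => hS ((bZero_eq_zero_iff v).mp hb S h), by_contra fun h => hS (hn S h), ?_⟩
    obtain ⟨d, hd⟩ := MvPolynomial.ne_zero_iff.mp hS
    refine ⟨Finsupp.weight oscWeight d, ?_, fun e he => ?_⟩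
    · have := hl S d hd
      omega
    · have h1 := hl S d hd
      have h2 := hl S e he
      omega
  · intro h
    refine ⟨⟨(bZero_eq_zero_iff v).mpr fun S hS => ?_, hL.mpr fun S d hd => ?_⟩, fun S hS => ?_⟩
    · by_contra h'
      exact (h S h').1 hS
    · obtain ⟨-, -, k, hk, hw⟩ := h S fun h' => hd (by rw [h', MvPolynomial.coeff_zero])
      rw [hw hd, hk, add_neg_cancel]
    · by_contra h'
      exact hS (h S h').2.1

end

end CarrollString

namespace CarrollString

noncomputable section

open MvPolynomial (X C)

/-! ### Ghost states of the relative complex -/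

/-- The bit masks of the ghost states without `c₀` and of weight at most zero, with their ghost
number and the negative of their weight. -/
def relMasks : List (ℕ × ℤ × ℕ) :=
  [(0, 0, 0), (1, 1, 1), (256, 1, 1), (65793, 1, 0), (16777473, 1, 0), (512, 1, 0), (257, 2, 2),
    (513, 2, 1), (768, 2, 1), (5, 2, 0), (1025, 2, 0), (260, 2, 0), (1280, 2, 0), (66305, 2, 0),
    (16777985, 2, 0), (769, 3, 2), (261, 3, 1), (1281, 3, 1), (265, 3, 0), (2305, 3, 0),
    (517, 3, 0), (1537, 3, 0), (772, 3, 0), (1792, 3, 0), (773, 4, 1), (1793, 4, 1), (777, 4, 0),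
    (2817, 4, 0), (1285, 4, 0), (1797, 5, 0)]

/-- The fermionic creation operators of weight at most two, except for `c₀`. -/
def lowGhosts : Finset Ghost :=
  {toLex (0, 0), toLex (0, 2), toLex (0, 3), toLex (1, 0), toLex (1, 1), toLex (1, 2),
    toLex (1, 3), toLex (2, 0), toLex (3, 0)}

-- A finite check of the 2⁹ subsets of `lowGhosts`; it determines the ghost content of the relative
-- complex.
set_option maxRecDepth 10000 in
theorem exists_relMasks_of_subset : ∀ S ∈ lowGhosts.powerset, ∑ g ∈ S, ghostWeight g ≤ 0 →
    ∃ x ∈ relMasks, S = ghostSet x.1 := by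
  decide +kernel

set_option maxRecDepth 10000 in
theorem relMasks_spec : ∀ x ∈ relMasks, toLex (0, 1) ∉ ghostSet x.1 ∧
    ghostNumber (ghostSet x.1) = x.2.1 ∧ ∑ g ∈ ghostSet x.1, ghostWeight g = -x.2.2 := by
  decide +kernel

theorem three_le_ghostWeight {g : Ghost} (h : g ≠ toLex (0, 1)) (hg : g ∉ lowGhosts) :
    3 ≤ ghostWeight g := by
  obtain ⟨t, k, rfl⟩ : ∃ t k, g = toLex (t, k) := ⟨(ofLex g).1, (ofLex g).2, rfl⟩
  simp only [lowGhosts, Finset.mem_insert, Finset.mem_singleton, not_or, ne_eq,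
    EmbeddingLike.apply_eq_iff_eq, Prod.mk.injEq] at h hg
  simp only [ghostWeight, ofLex_toLex]
  fin_cases t <;> simp at h hg ⊢ <;> omega

/-- Only c₁ and C₁ have negative weight, −1 each, and they cannot compensate for a ghost of weight
three or more. -/
theorem subset_lowGhosts {S : Finset Ghost} (h : toLex (0, 1) ∉ S)
    (hS : ∑ g ∈ S, ghostWeight g ≤ 0) : S ⊆ lowGhosts := by
  by_contra hsub
  obtain ⟨g, hg, hg'⟩ := Finset.not_subset.mp hsub
  have h3 := three_le_ghostWeight (fun h' => h (h' ▸ hg)) hg'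
  -- The weights are bounded below by −1 on c₁ and C₁, by 3 on `g` and by 0 elsewhere; the total
  -- would be at least 1.
  have hle : ∑ x ∈ S, ((if x = toLex (0, 0) then -1 else 0) + (if x = toLex (1, 0) then -1 else 0) +
      (if x = g then 3 else 0)) ≤ ∑ x ∈ S, ghostWeight x := by
    refine Finset.sum_le_sum fun x hx => ?_
    by_cases hxg : x = g
    · subst hxg
      rw [if_neg (by rintro rfl; exact hg' (by decide)), if_neg (by rintro rfl; exact hg' (by decide)),
        if_pos rfl]
      exact h3
    by_cases hx' : x ∈ lowGhosts
    · rw [if_neg hxg]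
      have key : ∀ x ∈ lowGhosts, (if x = toLex (0, 0) then (-1 : ℤ) else 0) +
          (if x = toLex (1, 0) then -1 else 0) + 0 ≤ ghostWeight x := by decide +kernel
      exact key x hx'
    · have := three_le_ghostWeight (fun h' => h (h' ▸ hx)) hx'
      rw [if_neg hxg]
      split_ifs <;> omega
  rw [Finset.sum_add_distrib, Finset.sum_add_distrib, Finset.sum_ite_eq', Finset.sum_ite_eq',
    Finset.sum_ite_eq', if_pos hg] at hle
  split_ifs at hle <;> omega

/-- The relative cochains in coordinates. -/
def cochainRange : ℤ → Submodule ℂ Fock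
  | 0 => LinearMap.range cochain₀
  | 1 => LinearMap.range cochain₁
  | 2 => LinearMap.range cochain₂
  | 3 => LinearMap.range cochain₃
  | 4 => LinearMap.range cochain₄
  | 5 => LinearMap.range cochain₅
  | _ => ⊥

theorem bitState_mem_Crel (p : Fin 26 → ℝ) (x : ℕ × ℤ × ℕ) (hx : x ∈ relMasks) {f : Poly}
    (hf : HasWeight x.2.2 f) : bitState x.1 f ∈ Crel p x.2.1 := by
  rw [mem_Crel_iff]
  intro S hS
  rw [bitState, coeff_state] at hS ⊢
  split_ifs at hS ⊢ with h
  · subst h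
    obtain ⟨h1, h2, h3⟩ := relMasks_spec x hx
    exact ⟨h1, h2, _, h3, hf⟩
  · exact absurd rfl hS

theorem exists_of_mem_Crel {p : Fin 26 → ℝ} {n : ℤ} {v : Fock} (hv : v ∈ Crel p n)
    {S : Finset Ghost} (hS : coeff S v ≠ 0) :
    ∃ x ∈ relMasks, x.2.1 = n ∧ S = ghostSet x.1 ∧ HasWeight x.2.2 (coeff S v) := by
  obtain ⟨h0, hn, k, hk, hw⟩ := (mem_Crel_iff p n v).mp hv S hS
  have hle : ∑ g ∈ S, ghostWeight g ≤ 0 := by omega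
  obtain ⟨x, hx, rfl⟩ := exists_relMasks_of_subset S
    (Finset.mem_powerset.mpr (subset_lowGhosts h0 hle)) hle
  obtain ⟨-, h2, h3⟩ := relMasks_spec x hx
  refine ⟨x, hx, h2.symm.trans hn, rfl, ?_⟩
  rwa [show x.2.2 = k by omega]

theorem Crel_eq_bot (p : Fin 26 → ℝ) {n : ℤ} (hn : n < 0 ∨ 5 < n) : Crel p n = ⊥ := by
  rw [eq_bot_iff]
  intro v hv
  refine (Submodule.mem_bot ℂ).mpr (Fock.ext fun S => ?_)
  by_contra hS
  rw [map_zero] at hS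
  obtain ⟨x, hx, rfl, -⟩ := exists_of_mem_Crel hv hS
  have key : ∀ x ∈ relMasks, 0 ≤ x.2.1 ∧ x.2.1 ≤ 5 := by decide +kernel
  have := key x hx
  omega

theorem bitState_mem_cochainRange (x : ℕ × ℤ × ℕ) (hx : x ∈ relMasks) {f : Poly}
    (hf : HasWeight x.2.2 f) : bitState x.1 f ∈ cochainRange x.2.1 := by
  simp only [relMasks, List.mem_cons, List.not_mem_nil, or_false] at hx
  rcases hx with rfl | rfl | rfl | rfl | rfl | rfl | rfl | rfl | rfl | rfl | rfl | rfl |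
    rfl | rfl | rfl | rfl | rfl | rfl | rfl | rfl | rfl | rfl | rfl | rfl | rfl | rfl | rfl | rfl | rfl | rfl
  · obtain ⟨u, rfl⟩ := HasWeight.exists_C hf
    exact ⟨u, by simp [cochain₀_apply]⟩
  · obtain ⟨u, rfl⟩ := HasWeight.exists_linPoly hf
    exact ⟨(u, 0, 0, 0, 0), by simp [cochain₁_apply]⟩
  · obtain ⟨u, rfl⟩ := HasWeight.exists_linPoly hf
    exact ⟨(0, u, 0, 0, 0), by simp [cochain₁_apply]⟩
  · obtain ⟨u, rfl⟩ := HasWeight.exists_C hf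
    exact ⟨(0, 0, u, 0, 0), by simp [cochain₁_apply]⟩
  · obtain ⟨u, rfl⟩ := HasWeight.exists_C hf
    exact ⟨(0, 0, 0, u, 0), by simp [cochain₁_apply]⟩
  · obtain ⟨u, rfl⟩ := HasWeight.exists_C hf
    exact ⟨(0, 0, 0, 0, u), by simp [cochain₁_apply]⟩
  · obtain ⟨u, rfl⟩ := HasWeight.exists_quadPoly hf
    exact ⟨(u, 0, 0, 0, 0, 0, 0, 0, 0), by simp [cochain₂_apply]⟩
  · obtain ⟨u, rfl⟩ := HasWeight.exists_linPoly hf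
    exact ⟨(0, u, 0, 0, 0, 0, 0, 0, 0), by simp [cochain₂_apply]⟩
  · obtain ⟨u, rfl⟩ := HasWeight.exists_linPoly hf
    exact ⟨(0, 0, u, 0, 0, 0, 0, 0, 0), by simp [cochain₂_apply]⟩
  · obtain ⟨u, rfl⟩ := HasWeight.exists_C hf
    exact ⟨(0, 0, 0, u, 0, 0, 0, 0, 0), by simp [cochain₂_apply]⟩
  · obtain ⟨u, rfl⟩ := HasWeight.exists_C hf
    exact ⟨(0, 0, 0, 0, u, 0, 0, 0, 0), by simp [cochain₂_apply]⟩
  · obtain ⟨u, rfl⟩ := HasWeight.exists_C hf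
    exact ⟨(0, 0, 0, 0, 0, u, 0, 0, 0), by simp [cochain₂_apply]⟩
  · obtain ⟨u, rfl⟩ := HasWeight.exists_C hf
    exact ⟨(0, 0, 0, 0, 0, 0, u, 0, 0), by simp [cochain₂_apply]⟩
  · obtain ⟨u, rfl⟩ := HasWeight.exists_C hf
    exact ⟨(0, 0, 0, 0, 0, 0, 0, u, 0), by simp [cochain₂_apply]⟩
  · obtain ⟨u, rfl⟩ := HasWeight.exists_C hf
    exact ⟨(0, 0, 0, 0, 0, 0, 0, 0, u), by simp [cochain₂_apply]⟩
  · obtain ⟨u, rfl⟩ := HasWeight.exists_quadPoly hf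
    exact ⟨(u, 0, 0, 0, 0, 0, 0, 0, 0), by simp [cochain₃_apply]⟩
  · obtain ⟨u, rfl⟩ := HasWeight.exists_linPoly hf
    exact ⟨(0, u, 0, 0, 0, 0, 0, 0, 0), by simp [cochain₃_apply]⟩
  · obtain ⟨u, rfl⟩ := HasWeight.exists_linPoly hf
    exact ⟨(0, 0, u, 0, 0, 0, 0, 0, 0), by simp [cochain₃_apply]⟩
  · obtain ⟨u, rfl⟩ := HasWeight.exists_C hf
    exact ⟨(0, 0, 0, u, 0, 0, 0, 0, 0), by simp [cochain₃_apply]⟩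
  · obtain ⟨u, rfl⟩ := HasWeight.exists_C hf
    exact ⟨(0, 0, 0, 0, u, 0, 0, 0, 0), by simp [cochain₃_apply]⟩
  · obtain ⟨u, rfl⟩ := HasWeight.exists_C hf
    exact ⟨(0, 0, 0, 0, 0, u, 0, 0, 0), by simp [cochain₃_apply]⟩
  · obtain ⟨u, rfl⟩ := HasWeight.exists_C hf
    exact ⟨(0, 0, 0, 0, 0, 0, u, 0, 0), by simp [cochain₃_apply]⟩
  · obtain ⟨u, rfl⟩ := HasWeight.exists_C hf
    exact ⟨(0, 0, 0, 0, 0, 0, 0, u, 0), by simp [cochain₃_apply]⟩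
  · obtain ⟨u, rfl⟩ := HasWeight.exists_C hf
    exact ⟨(0, 0, 0, 0, 0, 0, 0, 0, u), by simp [cochain₃_apply]⟩
  · obtain ⟨u, rfl⟩ := HasWeight.exists_linPoly hf
    exact ⟨(u, 0, 0, 0, 0), by simp [cochain₄_apply]⟩
  · obtain ⟨u, rfl⟩ := HasWeight.exists_linPoly hf
    exact ⟨(0, u, 0, 0, 0), by simp [cochain₄_apply]⟩
  · obtain ⟨u, rfl⟩ := HasWeight.exists_C hf
    exact ⟨(0, 0, u, 0, 0), by simp [cochain₄_apply]⟩
  · obtain ⟨u, rfl⟩ := HasWeight.exists_C hf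
    exact ⟨(0, 0, 0, u, 0), by simp [cochain₄_apply]⟩
  · obtain ⟨u, rfl⟩ := HasWeight.exists_C hf
    exact ⟨(0, 0, 0, 0, u), by simp [cochain₄_apply]⟩
  · obtain ⟨u, rfl⟩ := HasWeight.exists_C hf
    exact ⟨u, by simp [cochain₅_apply]⟩

theorem cochainRange_le_Crel (p : Fin 26 → ℝ) (n : ℤ) : cochainRange n ≤ Crel p n := by
  have hC : ∀ (m : ℕ) (n : ℤ) (a : ℂ), (m, n, 0) ∈ relMasks → bitState m (C a) ∈ Crel p n :=
    fun m n a h => bitState_mem_Crel p _ h (hasWeight_C a)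
  have hl : ∀ (m : ℕ) (n : ℤ) (u : Lin), (m, n, 1) ∈ relMasks →
      bitState m (linPoly 0 u) ∈ Crel p n := fun m n u h =>
    bitState_mem_Crel p _ h (hasWeight_linPoly 0 u)
  have hq : ∀ (m : ℕ) (n : ℤ) (u : Quad), (m, n, 2) ∈ relMasks →
      bitState m (quadPoly u) ∈ Crel p n := fun m n u h =>
    bitState_mem_Crel p _ h (hasWeight_quadPoly u)
  unfold cochainRange
  split
  · rintro _ ⟨u, rfl⟩
    rw [cochain₀_apply]
    exact hC 0 0 _ (by decide)
  · rintro _ ⟨⟨f, g, s₁, s₂, s₃⟩, rfl⟩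
    rw [cochain₁_apply]
    exact add_mem (hl 1 1 _ (by decide)) <| add_mem (hl 256 1 _ (by decide)) <| add_mem (hC
      65793 1 _ (by decide)) <| add_mem (hC 16777473 1 _ (by decide)) <| hC 512 1 _ (by decide)
  · rintro _ ⟨⟨F, f, g, s₁, s₂, s₃, s₄, s₅, s₆⟩, rfl⟩
    rw [cochain₂_apply]
    exact add_mem (hq 257 2 _ (by decide)) <| add_mem (hl 513 2 _ (by decide)) <| add_mem (hl
      768 2 _ (by decide)) <| add_mem (hC 5 2 _ (by decide)) <| add_mem (hC 1025 2 _ (by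
      decide)) <| add_mem (hC 260 2 _ (by decide)) <| add_mem (hC 1280 2 _ (by decide)) <|
      add_mem (hC 66305 2 _ (by decide)) <| hC 16777985 2 _ (by decide)
  · rintro _ ⟨⟨F, f, g, s₁, s₂, s₃, s₄, s₅, s₆⟩, rfl⟩
    rw [cochain₃_apply]
    exact add_mem (hq 769 3 _ (by decide)) <| add_mem (hl 261 3 _ (by decide)) <| add_mem (hl
      1281 3 _ (by decide)) <| add_mem (hC 265 3 _ (by decide)) <| add_mem (hC 2305 3 _ (by
      decide)) <| add_mem (hC 517 3 _ (by decide)) <| add_mem (hC 1537 3 _ (by decide)) <|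
      add_mem (hC 772 3 _ (by decide)) <| hC 1792 3 _ (by decide)
  · rintro _ ⟨⟨f, g, s₁, s₂, s₃⟩, rfl⟩
    rw [cochain₄_apply]
    exact add_mem (hl 773 4 _ (by decide)) <| add_mem (hl 1793 4 _ (by decide)) <| add_mem (hC
      777 4 _ (by decide)) <| add_mem (hC 2817 4 _ (by decide)) <| hC 1285 4 _ (by decide)
  · rintro _ ⟨u, rfl⟩
    rw [cochain₅_apply]
    exact hC 1797 5 _ (by decide)
  · exact bot_le

/-- A relative cochain is the sum of its components on ghost monomials; each of these monomials is
in the list, and its coefficient has the weight for which coordinates are available. -/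
theorem Crel_eq_cochainRange (p : Fin 26 → ℝ) (n : ℤ) : Crel p n = cochainRange n := by
  refine le_antisymm (fun v hv => ?_) (cochainRange_le_Crel p n)
  rw [v.eq_sum]
  refine Submodule.sum_mem _ fun S hS => ?_
  obtain ⟨x, hx, rfl, rfl, hw⟩ := exists_of_mem_Crel hv (by simpa using hS)
  exact bitState_mem_cochainRange x hx hw

end

end CarrollString

namespace CarrollString

noncomputable section

set_option linter.unusedSimpArgs false

section Projections

variable (t : ℂ) (P : Vect) (c : ℂ) (u : Lin) (F : Quad)

theorem raiseT₀_eq : raiseT₀ P c = (0, 0, c • P, 0) := rfl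

theorem raiseT₁_eq : raiseT₁ P u =
    ((2 * u.1, u.2.1, (2 : ℂ) • u.2.2.1, u.2.2.2), (0, 0, 0), (u.1 • P, 0, u.2.1 • P, 0),
      (2⁻¹ : ℂ) • symProd P u.2.2.1, Matrix.vecMulVec P u.2.2.2, 0) := rfl

theorem raiseTT_eq : raiseTT P c =
    ((0, 0, c • (2 : ℂ) • P, 0), (0, c, 0), (0, 0, 0, 0), 0, c • 1, 0) := rfl

theorem raiseM₁_eq : raiseM₁ t u =
    ((0, u.1, (-(2 * t)) • u.2.2.2, 0), (0, 0, 0), (0, 0, 0, 0), 0, 0, 0) := rfl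

theorem raiseMM_eq : raiseMM t c =
    ((0, 0, 0, 0), (0, 0, 2⁻¹ * c), (0, 0, 0, 0), c • (-(t / 2)) • symOne, 0, 0) := rfl

theorem levelM₁_eq : levelM₁ t u = (0, u.1, (-t) • u.2.2.2, 0) := rfl

theorem levelM₂_eq : levelM₂ t F =
    ((0, F.1.1, (-(4 * t)) • F.1.2.2.2, 0), (0, 2 * F.2.1.1, F.2.1.2.1),
      ((-t) • F.2.2.1.2.1, 0, F.2.2.1.1 + (-t) • F.2.2.1.2.2.2, F.2.2.1.2.1),
      (-(t / 2)) • symPart F.2.2.2.2.1, (-(2 * t)) • (F.2.2.2.2.2 : Tens), 0) := rfl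

theorem lowerT₁_eq : lowerT₁ P u = u.2.2.2 ⬝ᵥ P := rfl

theorem lowerT₂_eq : lowerT₂ P F = (F.1.1 + F.2.2.1.2.1 ⬝ᵥ P, 2 * F.1.2.1 + F.2.2.1.2.2.2 ⬝ᵥ P,
    F.1.2.2.1 + F.2.2.2.2.1.mulVec P,
    (2 : ℂ) • F.1.2.2.2 + (2 : ℂ) • (F.2.2.2.2.2 : Tens).mulVec P) := rfl

theorem lowerM₂_eq : lowerM₂ t F = (0, F.1.1, (-(2 * t)) • F.1.2.2.2, 0) := rfl

theorem lowerTT_eq : lowerTT P F =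
    F.2.1.2.1 + F.2.2.2.2.1.trace + 2 * (F.1.2.2.2 ⬝ᵥ P) := rfl

theorem lowerMM_eq : lowerMM t F = F.2.1.1 + (-t) * (F.2.2.2.2.2 : Tens).trace := rfl

end Projections

/-! ### Splitting off contractible summands -/

/-- Coordinates on a complement of the cocycles of ghost numbers one and three. -/
abbrev Excess₁ : Type := Lin × ℂ × ℂ × ℂ

/-- Coordinates on a complement of the cocycles of ghost number two. -/
abbrev Excess₂ : Type := Lin × Lin × (ℂ × ℂ × ℂ × ℂ) × (Vect × Vect) × symTens × symTens

/-- Coordinates on the reduced cochains of ghost numbers two and three. -/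
abbrev Core₂ : Type := ℂ × ℂ × Vect × Vect × symTens × skewTens

/-- The inclusion of the complement in ghost number one. -/
def excess₁ : Excess₁ →ₗ[ℂ] Coord₁ := LinearMap.inr ℂ Lin _

/-- The inclusion of the complement in ghost number two. -/
def excess₂ : Excess₂ →ₗ[ℂ] Coord₂ where
  toFun x := ((x.2.1, (x.2.2.1.1, x.2.2.1.2.1, 0), (0, x.2.2.2.1.1, 0, x.2.2.2.1.2), 0,
    (x.2.2.2.2.2 : Tens), x.2.2.2.2.1), 0, x.1, 0, 0, x.2.2.1.2.2.1, x.2.2.1.2.2.2, 0, 0)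
  map_add' x y := by simp
  map_smul' a x := by simp

/-- The inclusion of the complement in ghost number three. -/
def excess₃ : Excess₁ →ₗ[ℂ] Coord₃ where
  toFun x := ((x.1, 0), 0, 0, 0, x.2.1, 0, x.2.2.1, 0, x.2.2.2)
  map_add' x y := by simp
  map_smul' a x := by simp

theorem excess₁_apply (g : Lin) (s₁ s₂ s₃ : ℂ) : excess₁ (g, s₁, s₂, s₃) = (0, g, s₁, s₂, s₃) := rfl

theorem excess₂_apply (g h : Lin) (q₁ q₂ s₁ s₂ : ℂ) (y₁ y₂ : Vect) (U T : symTens) :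
    excess₂ (g, h, (q₁, q₂, s₁, s₂), (y₁, y₂), U, T) =
      ((h, (q₁, q₂, 0), (0, y₁, 0, y₂), 0, (T : Tens), U), 0, g, 0, 0, s₁, s₂, 0, 0) := rfl

theorem excess₃_apply (h : Lin) (s₁ s₂ s₃ : ℂ) :
    excess₃ (h, s₁, s₂, s₃) =
      ((h, (0, 0, 0), (0, 0, 0, 0), 0, 0, 0), 0, 0, 0, s₁, 0, s₂, 0, s₃) := rfl

/-- The coordinates on the reduced cochains. -/
def coreA : Core₂ →ₗ[ℂ] ℂ := LinearMap.fst ℂ _ _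
def coreB : Core₂ →ₗ[ℂ] ℂ := LinearMap.fst ℂ _ _ ∘ₗ LinearMap.snd ℂ _ _
def coreV : Core₂ →ₗ[ℂ] Vect :=
  LinearMap.fst ℂ _ _ ∘ₗ LinearMap.snd ℂ _ _ ∘ₗ LinearMap.snd ℂ _ _
def coreW : Core₂ →ₗ[ℂ] Vect :=
  LinearMap.fst ℂ _ _ ∘ₗ LinearMap.snd ℂ _ _ ∘ₗ LinearMap.snd ℂ _ _ ∘ₗ LinearMap.snd ℂ _ _
def coreSym : Core₂ →ₗ[ℂ] symTens :=
  LinearMap.fst ℂ _ _ ∘ₗ LinearMap.snd ℂ _ _ ∘ₗ LinearMap.snd ℂ _ _ ∘ₗ LinearMap.snd ℂ _ _ ∘ₗ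
    LinearMap.snd ℂ _ _
def coreSkew : Core₂ →ₗ[ℂ] Tens :=
  skewTens.subtype ∘ₗ LinearMap.snd ℂ _ _ ∘ₗ LinearMap.snd ℂ _ _ ∘ₗ LinearMap.snd ℂ _ _ ∘ₗ
    LinearMap.snd ℂ _ _ ∘ₗ LinearMap.snd ℂ _ _

section Core

variable (t : ℂ) (P : Vect)

/-- The reduced cochains of ghost number one. -/
def core₁ : Lin →ₗ[ℂ] Coord₁ := LinearMap.id.prod ((levelM₁ t).prod 0)

/-- The reduced cochains of ghost number two. -/
def core₂ : Core₂ →ₗ[ℂ] Coord₂ :=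
  (toQuad 0 coreA 0 0 (t • coreW) 0 coreV coreW coreSym
    (coreSkew + coreA.smulRight ((3 / t) • Matrix.vecMulVec P P))
    (coreA.smulRight ((-t⁻¹) • symOne))).prod <|
  (toLin 0 ((2⁻¹ : ℂ) • dotWith P ∘ₗ coreW) ((2⁻¹ : ℂ) • contractWith P ∘ₗ coreSkew)
    (coreA.smulRight ((-t⁻¹) • P))).prod <|
  (toLin 0 0 (coreA.smulRight ((3 : ℂ) • P)) 0).prod <| coreB.prod <|
  LinearMap.prod 0 <| ((3 * (P ⬝ᵥ P) / t) • coreA).prod <| ((-6 : ℂ) • coreA).prod <|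
  ((2 : ℂ) • coreA).prod 0

/-- The reduced cochains of ghost number three. -/
def core₃ : Core₂ →ₗ[ℂ] Coord₃ :=
  let U : Core₂ →ₗ[ℂ] symTens := coreSym + coreA.smulRight symOne
  let UP : Core₂ →ₗ[ℂ] Vect := contractWith P ∘ₗ symTens.subtype ∘ₗ U
  (toQuad 0 ((31 * t) • coreA + t • traceMap ∘ₗ symTens.subtype ∘ₗ coreSym) 0 0 coreW coreV 0 0 0
    coreSkew U).prod <|
  LinearMap.prod 0 <|
  (toLin (dotWith P ∘ₗ coreV) 0 (contractWith P ∘ₗ coreSkew) ((2 : ℂ) • UP)).prod <|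
  ((3 : ℂ) • coreB).prod <| ((3 / 2 : ℂ) • dotWith P ∘ₗ UP).prod <| ((2 : ℂ) • coreB).prod <|
  (dotWith P ∘ₗ UP).prod <| LinearMap.prod 0 ((2 * t) • coreA)

/-- The reduced cochains of ghost number four. -/
def core₄ : Lin →ₗ[ℂ] Coord₄ := LinearMap.prod 0 (LinearMap.id.prod 0)

/-- The component M₀x on C₁ is chosen to cancel the c₁C₀-component −M₀f + g of the differential; the
C₁C₀-component −M₀g then vanishes since M₀ squares to zero on linear polynomials. -/
theorem core₁_apply (x : Lin) : core₁ t x = (x, levelM₁ t x, 0) := rfl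

/-- All components are fixed by the wish that the differential leave only multiples of (P·P)a. The
coefficient τ²w of x^0x^i cancels M₀ of the term in π_0π_i; 2a on c₁C₁C₀b₋₂ cancels M₀(a x^0x^0)
against L₋₂; the C₁C₋₁-coefficient −6a = −3·2a removes the ghost terms. In the c₁C₁C₋₂-component
this requires 26a = 3·6a + 4·2a, where 26a is M₂ applied to the terms in x^0x^0 and π_iπ_i. -/
theorem core₂_apply (a b : ℂ) (v w : Vect) (S : symTens) (A : skewTens) :
    core₂ t P (a, b, v, w, S, A) =
      ((0, (a, 0, 0), (t • w, 0, v, w), S, (A : Tens) + a • (3 / t) • Matrix.vecMulVec P P,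
        a • (-t⁻¹) • symOne), (0, 2⁻¹ * (w ⬝ᵥ P), (2⁻¹ : ℂ) • (A : Tens).mulVec P, a • (-t⁻¹) • P),
        (0, 0, a • (3 : ℂ) • P, 0), b, 0, 3 * (P ⬝ᵥ P) / t * a, -6 * a, 2 * a, 0) := rfl

/-- The linear coefficient of c₁C₁C₋₁ equals L₁ of the quadratic part and cancels it. The symmetric
tensor is shifted by a·1 so that the term 2τ²aP coming from C₁C₀C₋₁ cancels, and a does not enter
`coreDiff₃`. The constant 31 = 25 + 6 makes M₂ of the quadratic part equal to 6τ²a, the threefold of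
2τ²a; the 25 is the trace of the shift. The pair 3b, 2b is the combination produced by `diff₂`. -/
theorem core₃_apply (a b : ℂ) (v w : Vect) (S : symTens) (A : skewTens) :
    core₃ t P (a, b, v, w, S, A) =
      ((0, (31 * t * a + t * (S : Tens).trace, 0, 0), (w, v, 0, 0), 0, (A : Tens), S + a • symOne), 0,
        (v ⬝ᵥ P, 0, (A : Tens).mulVec P, (2 : ℂ) • (S + a • symOne : symTens).1.mulVec P), 3 * b,
        3 / 2 * ((S + a • symOne : symTens).1.mulVec P ⬝ᵥ P), 2 * b,
        (S + a • symOne : symTens).1.mulVec P ⬝ᵥ P, 0, 2 * t * a) := rfl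

theorem core₄_apply (x : Lin) : core₄ x = (0, x, 0) := rfl

/-- The differential on reduced cochains of ghost number zero. -/
def coreDiff₀ (a : ℂ) : Lin := (0, 0, a • P, 0)

/-- The differential on reduced cochains of ghost number one. -/
def coreDiff₁ (x : Lin) : Core₂ :=
  (0, -(x.2.2.2 ⬝ᵥ P), x.1 • P, 0, (-(t / 2)) • symProd P x.2.2.2, 0)

/-- The differential on reduced cochains of ghost number two. -/
def coreDiff₂ (x : Core₂) : Core₂ := (0, 2 * (P ⬝ᵥ P) / t * x.1, 0, 0, 0, 0)

/-- The differential on reduced cochains of ghost number three. -/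
def coreDiff₃ (x : Core₂) : Lin :=
  (0, x.2.2.1 ⬝ᵥ P, (-(2 * t)) • (x.2.2.2.2.1 : Tens).mulVec P, 0)

/-- The differential on reduced cochains of ghost number four. -/
def coreDiff₄ (x : Lin) : ℂ := -(x.2.2.2 ⬝ᵥ P)

theorem symPart_skewTens (A : skewTens) : symPart (A : Tens) = 0 :=
  Subtype.ext (by rw [coe_symPart, skewTens_transpose, add_neg_cancel]; rfl)

theorem trace_skewTens (A : skewTens) : (A : Tens).trace = 0 := by
  have h := congrArg Matrix.trace (skewTens_transpose A)
  rw [Matrix.trace_transpose, Matrix.trace_neg] at h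
  exact self_eq_neg.mp h

theorem symPart_vecMulVec (v w : Vect) : symPart (Matrix.vecMulVec v w) = symProd v w :=
  Subtype.ext (by rw [coe_symPart, Matrix.transpose_vecMulVec, coe_symProd])

theorem symPart_one : symPart 1 = (2 : ℂ) • symOne :=
  Subtype.ext (by rw [coe_symPart, Matrix.transpose_one, Submodule.coe_smul, coe_symOne, two_smul])

theorem trace_vecMulVec' (v w : Vect) : (Matrix.vecMulVec v w).trace = w ⬝ᵥ v := by
  rw [Matrix.trace_vecMulVec, dotProduct_comm]

theorem diff₀_eq (a : ℂ) : diff₀ P a = core₁ t (coreDiff₀ P a) := by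
  simp only [diff₀, core₁_apply, coreDiff₀, raiseT₀_eq, levelM₁_eq, smul_zero]
  rfl

theorem diff₁_core₁ (x : Lin) : diff₁ t P (core₁ t x) = core₂ t P (coreDiff₁ t P x) := by
  obtain ⟨a, b, v, w⟩ := x
  simp only [core₁_apply, core₂_apply, coreDiff₁, diff₁, raiseT₀_eq, raiseT₁_eq, raiseTT_eq, raiseM₁_eq, raiseMM_eq,
    levelM₁_eq, levelM₂_eq, lowerT₁_eq, lowerT₂_eq, lowerM₂_eq, lowerTT_eq, lowerMM_eq,
    Prod.fst_add, Prod.snd_add, Prod.fst_neg, Prod.snd_neg, Prod.fst_sub, Prod.snd_sub,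
    Prod.smul_fst, Prod.smul_snd, Prod.fst_zero, Prod.snd_zero]
  refine Prod.ext (Prod.ext (Prod.ext ?_ (Prod.ext ?_ (Prod.ext ?_ ?_)))
    (Prod.ext (Prod.ext ?_ (Prod.ext ?_ ?_)) (Prod.ext (Prod.ext ?_ (Prod.ext ?_ (Prod.ext ?_ ?_)))
    (Prod.ext ?_ (Prod.ext ?_ ?_)))))
    (Prod.ext (Prod.ext ?_ (Prod.ext ?_ (Prod.ext ?_ ?_))) (Prod.ext (Prod.ext ?_ (Prod.ext ?_ (Prod.ext ?_ ?_)))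
    (Prod.ext ?_ (Prod.ext ?_ (Prod.ext ?_ (Prod.ext ?_ (Prod.ext ?_ ?_)))))))
  all_goals try simp [symPart_skewTens, trace_skewTens, symPart_vecMulVec, symPart_one,
    trace_vecMulVec', -Matrix.trace_vecMulVec, coe_symOne, Matrix.add_mulVec, Matrix.smul_mulVec, Matrix.neg_mulVec,
    Matrix.vecMulVec_mulVec]
  all_goals try ring1
  all_goals try module

/-- The surviving components are 6(P·P)a/τ² on c₁c₋₂C₁ and 4(P·P)a/τ² on c₁c₋₁C₀, in the ratio 3 : 2
built into `core₃`. -/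
theorem diff₂_core₂ (ht : t ≠ 0) (x : Core₂) :
    diff₂ t P (core₂ t P x) = core₃ t P (coreDiff₂ t P x) := by
  obtain ⟨a, b, v, w, S, A⟩ := x
  simp only [core₂_apply, core₃_apply, coreDiff₂, diff₂, raiseT₀_eq, raiseT₁_eq, raiseTT_eq, raiseM₁_eq, raiseMM_eq,
    levelM₁_eq, levelM₂_eq, lowerT₁_eq, lowerT₂_eq, lowerM₂_eq, lowerTT_eq, lowerMM_eq,
    Prod.fst_add, Prod.snd_add, Prod.fst_neg, Prod.snd_neg, Prod.fst_sub, Prod.snd_sub,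
    Prod.smul_fst, Prod.smul_snd, Prod.fst_zero, Prod.snd_zero]
  refine Prod.ext (Prod.ext (Prod.ext ?_ (Prod.ext ?_ (Prod.ext ?_ ?_)))
    (Prod.ext (Prod.ext ?_ (Prod.ext ?_ ?_)) (Prod.ext (Prod.ext ?_ (Prod.ext ?_ (Prod.ext ?_ ?_)))
    (Prod.ext ?_ (Prod.ext ?_ ?_)))))
    (Prod.ext (Prod.ext ?_ (Prod.ext ?_ (Prod.ext ?_ ?_))) (Prod.ext (Prod.ext ?_ (Prod.ext ?_ (Prod.ext ?_ ?_)))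
    (Prod.ext ?_ (Prod.ext ?_ (Prod.ext ?_ (Prod.ext ?_ (Prod.ext ?_ ?_)))))))
  all_goals try simp [symPart_skewTens, trace_skewTens, symPart_vecMulVec, symPart_one,
    trace_vecMulVec', -Matrix.trace_vecMulVec, coe_symOne, Matrix.add_mulVec, Matrix.smul_mulVec, Matrix.neg_mulVec,
    Matrix.vecMulVec_mulVec]
  all_goals try ring1
  all_goals try module
  all_goals first
    | (field_simp; ring1)
    | (match_scalars <;> field_simp <;> ring1)

theorem diff₃_core₃ (x : Core₂) : diff₃ t P (core₃ t P x) = core₄ (coreDiff₃ t P x) := by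
  obtain ⟨a, b, v, w, S, A⟩ := x
  simp only [core₃_apply, core₄_apply, coreDiff₃, diff₃, raiseT₀_eq, raiseT₁_eq, raiseTT_eq, raiseM₁_eq, raiseMM_eq,
    levelM₁_eq, levelM₂_eq, lowerT₁_eq, lowerT₂_eq, lowerM₂_eq, lowerTT_eq, lowerMM_eq,
    Prod.fst_add, Prod.snd_add, Prod.fst_neg, Prod.snd_neg, Prod.fst_sub, Prod.snd_sub,
    Prod.smul_fst, Prod.smul_snd, Prod.fst_zero, Prod.snd_zero]
  refine Prod.ext (Prod.ext ?_ (Prod.ext ?_ (Prod.ext ?_ ?_))) (Prod.ext (Prod.ext ?_ (Prod.ext ?_ (Prod.ext ?_ ?_)))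
    (Prod.ext ?_ (Prod.ext ?_ ?_)))
  all_goals try simp [symPart_skewTens, trace_skewTens, symPart_vecMulVec, symPart_one,
    trace_vecMulVec', -Matrix.trace_vecMulVec, coe_symOne, Matrix.add_mulVec, Matrix.smul_mulVec, Matrix.neg_mulVec,
    Matrix.vecMulVec_mulVec]
  all_goals try ring1
  all_goals try module

theorem diff₄_core₄ (x : Lin) : diff₄ P (core₄ x) = coreDiff₄ P x := rfl

/-- This is d² = 0 on the complement, checked in coordinates. The critical dimension enters through
the coefficient of b₋₂ in the c₁c₋₂C₁-component: L₂L₋₂ contributes −(1 + 25), and the ghosts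
contribute 9 + 9 + 8. -/
theorem diff₂_diff₁_excess₁ (x : Excess₁) : diff₂ t P (diff₁ t P (excess₁ x)) = 0 := by
  obtain ⟨⟨a, b, v, w⟩, s₁, s₂, s₃⟩ := x
  simp only [excess₁_apply, diff₁, diff₂, raiseT₀_eq, raiseT₁_eq, raiseTT_eq, raiseM₁_eq, raiseMM_eq,
    levelM₁_eq, levelM₂_eq, lowerT₁_eq, lowerT₂_eq, lowerM₂_eq, lowerTT_eq, lowerMM_eq,
    Prod.fst_add, Prod.snd_add, Prod.fst_neg, Prod.snd_neg, Prod.fst_sub, Prod.snd_sub,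
    Prod.smul_fst, Prod.smul_snd, Prod.fst_zero, Prod.snd_zero]
  refine Prod.ext (Prod.ext (Prod.ext ?_ (Prod.ext ?_ (Prod.ext ?_ ?_)))
    (Prod.ext (Prod.ext ?_ (Prod.ext ?_ ?_)) (Prod.ext (Prod.ext ?_ (Prod.ext ?_ (Prod.ext ?_ ?_)))
    (Prod.ext ?_ (Prod.ext ?_ ?_)))))
    (Prod.ext (Prod.ext ?_ (Prod.ext ?_ (Prod.ext ?_ ?_))) (Prod.ext (Prod.ext ?_ (Prod.ext ?_ (Prod.ext ?_ ?_)))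
    (Prod.ext ?_ (Prod.ext ?_ (Prod.ext ?_ (Prod.ext ?_ (Prod.ext ?_ ?_)))))))
  all_goals try simp [symPart_skewTens, trace_skewTens, symPart_vecMulVec, symPart_one,
    trace_vecMulVec', -Matrix.trace_vecMulVec, coe_symOne, Matrix.add_mulVec, Matrix.smul_mulVec, Matrix.neg_mulVec,
    Matrix.vecMulVec_mulVec]
  all_goals try ring1
  all_goals try module

theorem diff₃_diff₂_excess₂ (x : Excess₂) : diff₃ t P (diff₂ t P (excess₂ x)) = 0 := by
  obtain ⟨⟨a, b, v, w⟩, ⟨a', b', v', w'⟩, ⟨q₁, q₂, s₁, s₂⟩, ⟨y₁, y₂⟩, U, T⟩ := x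
  simp only [excess₂_apply, diff₂, diff₃, raiseT₀_eq, raiseT₁_eq, raiseTT_eq, raiseM₁_eq, raiseMM_eq,
    levelM₁_eq, levelM₂_eq, lowerT₁_eq, lowerT₂_eq, lowerM₂_eq, lowerTT_eq, lowerMM_eq,
    Prod.fst_add, Prod.snd_add, Prod.fst_neg, Prod.snd_neg, Prod.fst_sub, Prod.snd_sub,
    Prod.smul_fst, Prod.smul_snd, Prod.fst_zero, Prod.snd_zero]
  refine Prod.ext (Prod.ext ?_ (Prod.ext ?_ (Prod.ext ?_ ?_))) (Prod.ext (Prod.ext ?_ (Prod.ext ?_ (Prod.ext ?_ ?_)))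
    (Prod.ext ?_ (Prod.ext ?_ ?_)))
  all_goals try simp [symPart_skewTens, trace_skewTens, symPart_vecMulVec, symPart_one,
    trace_vecMulVec', -Matrix.trace_vecMulVec, coe_symOne, Matrix.add_mulVec, Matrix.smul_mulVec, Matrix.neg_mulVec,
    Matrix.vecMulVec_mulVec]
  all_goals try ring1
  all_goals try module

theorem diff₄_diff₃_excess₃ (x : Excess₁) : diff₄ P (diff₃ t P (excess₃ x)) = 0 := by
  obtain ⟨⟨a, b, v, w⟩, s₁, s₂, s₃⟩ := x
  simp only [excess₃_apply, diff₃, diff₄, raiseT₀_eq, raiseT₁_eq, raiseTT_eq, raiseM₁_eq, raiseMM_eq,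
    levelM₁_eq, levelM₂_eq, lowerT₁_eq, lowerT₂_eq, lowerM₂_eq, lowerTT_eq, lowerMM_eq,
    Prod.fst_add, Prod.snd_add, Prod.fst_neg, Prod.snd_neg, Prod.fst_sub, Prod.snd_sub,
    Prod.smul_fst, Prod.smul_snd, Prod.fst_zero, Prod.snd_zero]
  all_goals try simp [symPart_skewTens, trace_skewTens, symPart_vecMulVec, symPart_one,
    trace_vecMulVec', -Matrix.trace_vecMulVec, coe_symOne, Matrix.add_mulVec, Matrix.smul_mulVec, Matrix.neg_mulVec,
    Matrix.vecMulVec_mulVec]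
  all_goals try ring1
  all_goals try module

end Core

end

end CarrollString

namespace CarrollString

noncomputable section

/-! ### Injectivity of the splittings -/

section Injectivity

variable {t : ℂ} (P : Vect)

theorem symPart_symTens (S : symTens) : symPart (S : Tens) = (2 : ℂ) • S :=
  Subtype.ext (by rw [coe_symPart, symTens_transpose, Submodule.coe_smul, two_smul])

theorem core₁_injective (r : Lin) (h : core₁ t r = 0) : r = 0 :=
  congrArg Prod.fst h

-- One statement combines the injectivity of d on the complement in degree one with the independence
-- of its image from the reduced cochains. The system is triangular: taken in a suitable order, each
-- component determines one unknown in terms of those already found to vanish.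
set_option linter.unusedSimpArgs false in
theorem diff₁_excess₁_add_core₂_injective (x : Excess₁) (r : Core₂)
    (h : diff₁ t P (excess₁ x) + core₂ t P r = 0) : x = 0 ∧ r = 0 := by
  obtain ⟨⟨γ, e, v, w⟩, s₁, s₂, s₃⟩ := x
  obtain ⟨a, b, v', w', S, A⟩ := r
  simp only [excess₁_apply, core₂_apply, diff₁, raiseT₀_eq, raiseT₁_eq, raiseTT_eq, raiseM₁_eq, raiseMM_eq,
    levelM₁_eq, levelM₂_eq, lowerT₁_eq, lowerT₂_eq, lowerM₂_eq, lowerTT_eq, lowerMM_eq,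
    Prod.fst_add, Prod.snd_add, Prod.fst_neg, Prod.snd_neg, Prod.fst_sub, Prod.snd_sub,
    Prod.smul_fst, Prod.smul_snd, Prod.fst_zero, Prod.snd_zero, Prod.ext_iff, Prod.mk_zero_zero,
    add_zero, zero_add, sub_zero, zero_sub, smul_zero, mul_zero, zero_mul, zero_smul, neg_zero,
    dotProduct_zero, zero_dotProduct, Matrix.trace_zero, map_zero, Matrix.zero_mulVec,
    Matrix.vecMulVec_zero, Submodule.coe_zero] at h
  obtain ⟨⟨⟨-, rfl, hv, rfl⟩, ⟨rfl, rfl, hs₂⟩, ⟨-, -, hv', rfl⟩, hS, hA, -⟩, ⟨rfl, -, hs₃, -⟩, -, hb,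
    hs₃, -⟩ := h
  obtain rfl : s₂ = 0 := by simpa using hs₂
  obtain rfl : s₃ = 0 := by simpa using hs₃
  obtain rfl : b = 0 := by simpa using hb
  obtain rfl : v = 0 := by simpa using hv
  obtain rfl : v' = 0 := by simpa using hv'
  obtain rfl : S = 0 := by simpa using hS
  obtain rfl : A = 0 := by simpa using hA
  exact ⟨rfl, rfl⟩

set_option linter.unusedSimpArgs false in
theorem diff₂_excess₂_add_core₃_injective (ht : t ≠ 0) (x : Excess₂) (r : Core₂)
    (h : diff₂ t P (excess₂ x) + core₃ t P r = 0) : x = 0 ∧ r = 0 := by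
  obtain ⟨⟨γ, e, v, w⟩, ⟨a, b, v', w'⟩, ⟨q₁, q₂, s₁, s₂⟩, ⟨y₁, y₂⟩, U, T⟩ := x
  obtain ⟨ρ₁, ρ₂, w₁, w₂, U', A⟩ := r
  simp only [excess₂_apply, core₃_apply, diff₂, raiseT₀_eq, raiseT₁_eq, raiseTT_eq, raiseM₁_eq, raiseMM_eq,
    levelM₁_eq, levelM₂_eq, lowerT₁_eq, lowerT₂_eq, lowerM₂_eq, lowerTT_eq, lowerMM_eq,
    Prod.fst_add, Prod.snd_add, Prod.fst_neg, Prod.snd_neg, Prod.fst_sub, Prod.snd_sub,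
    Prod.smul_fst, Prod.smul_snd, Prod.fst_zero, Prod.snd_zero, Prod.ext_iff, Prod.mk_zero_zero,
    add_zero, zero_add, sub_zero, zero_sub, smul_zero, mul_zero, zero_mul, zero_smul, neg_zero,
    dotProduct_zero, zero_dotProduct, Matrix.trace_zero, map_zero, Matrix.zero_mulVec,
    Matrix.vecMulVec_zero, Submodule.coe_zero] at h
  obtain ⟨⟨⟨hγ, he, hv, rfl⟩, ⟨-, hq₁, rfl⟩, ⟨hw₂, rfl, hy₂, rfl⟩, hT, hU, hU'⟩, ⟨ha, hb, hv', hw'⟩,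
    -, hs, -, hs₁, -, hs₂, hρ₁⟩ := h
  obtain rfl : ρ₁ = 0 := by simpa [ht] using hρ₁
  obtain rfl : U' = 0 := by simpa using hU'
  obtain rfl : q₁ = 0 := by simpa using hq₁
  obtain rfl : γ = 0 := by simpa using hγ
  obtain rfl : a = 0 := by simpa using ha
  obtain rfl : e = 0 := by simpa using he
  obtain rfl : y₂ = 0 := by simpa [ht] using hy₂
  obtain rfl : w₂ = 0 := by simpa using hw₂
  obtain rfl : b = 0 := by simpa using hb
  -- The equation reads −2tU + A = 0 with U symmetric and A skewsymmetric; symmetrisation isolates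
  -- U.
  obtain rfl : U = 0 := by
    simpa [symPart_symTens, symPart_skewTens, ht] using congrArg symPart hU
  obtain rfl : A = 0 := by simpa using hU
  obtain rfl : w' = 0 := by simpa using hw'
  obtain rfl : v = 0 := by simpa using hv
  obtain rfl : T = 0 := by simpa [symPart_symTens, ht] using hT
  obtain rfl : s₂ = 0 := by simpa using hs₂
  replace hs : 3 * s₁ + 3 * ρ₂ = 0 := by simpa using hs
  -- The components on c₁c₋₂C₁ and c₁c₋₁C₀ give 3s₁ + 3ρ₂ = 0 and s₁ + 2ρ₂ = 0, which are
  -- independent.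
  obtain rfl : ρ₂ = 0 := by linear_combination hs₁ - hs / 3
  obtain rfl : s₁ = 0 := by simpa using hs₁
  obtain rfl : v' = 0 := by simpa using hv'
  exact ⟨rfl, rfl⟩

set_option linter.unusedSimpArgs false in
theorem diff₃_excess₃_add_core₄_injective (x : Excess₁) (r : Lin)
    (h : diff₃ t P (excess₃ x) + core₄ r = 0) : x = 0 ∧ r = 0 := by
  obtain ⟨⟨γ, e, v, w⟩, s₁, s₂, s₃⟩ := x
  obtain ⟨a, b, v', w'⟩ := r
  simp only [excess₃_apply, core₄_apply, diff₃, raiseT₀_eq, raiseT₁_eq, raiseTT_eq, raiseM₁_eq, raiseMM_eq,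
    levelM₁_eq, levelM₂_eq, lowerT₁_eq, lowerT₂_eq, lowerM₂_eq, lowerTT_eq, lowerMM_eq,
    Prod.fst_add, Prod.snd_add, Prod.fst_neg, Prod.snd_neg, Prod.fst_sub, Prod.snd_sub,
    Prod.smul_fst, Prod.smul_snd, Prod.fst_zero, Prod.snd_zero, Prod.ext_iff, Prod.mk_zero_zero,
    add_zero, zero_add, sub_zero, zero_sub, smul_zero, mul_zero, zero_mul, zero_smul, neg_zero,
    dotProduct_zero, zero_dotProduct, Matrix.trace_zero, map_zero, Matrix.zero_mulVec,
    Matrix.vecMulVec_zero, Submodule.coe_zero] at h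
  obtain ⟨⟨hγ, he, hv, hw⟩, ⟨rfl, hb, hv', rfl⟩, hs₁, hs₃, hs₂⟩ := h
  obtain rfl : γ = 0 := by simpa using hγ
  obtain rfl : e = 0 := by simpa using he
  obtain rfl : v = 0 := by simpa using hv
  obtain rfl : w = 0 := by simpa using hw
  obtain rfl : s₂ = 0 := by simpa using hs₂
  obtain rfl : s₃ = 0 := by simpa using hs₃
  obtain rfl : s₁ = 0 := by simpa using hs₁
  obtain rfl : b = 0 := by simpa using hb
  obtain rfl : v' = 0 := by simpa using hv'
  exact ⟨rfl, rfl⟩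

end Injectivity

end

end CarrollString

namespace CarrollString

noncomputable section

/-! ### Splittings of the cochains -/

section Splitting

variable {p : Fin 26 → ℝ} {τ : ℝ} {n : ℤ}

/-- A `Stab p`-equivariant identification of `A × H × A'` with the relative cochains of ghost
number `n`. -/
structure IsSplitting {A H A' : Type} [AddCommGroup A] [Module ℂ A] [AddCommGroup H] [Module ℂ H]
    [AddCommGroup A'] [Module ℂ A'] (n : ℤ) (ρ : Representation ℂ (Stab p) A)
    (σ : Representation ℂ (Stab p) H) (ρ' : Representation ℂ (Stab p) A')
    (Φ : A × H × A' →ₗ[ℂ] Fock) : Prop where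
  injective : ∀ x, Φ x = 0 → x = 0
  range_eq : LinearMap.range Φ = Crel p n
  rot_apply : ∀ g x, rot g.1.1 (Φ x) = Φ (ρ g x.1, σ g x.2.1, ρ' g x.2.2)

variable {A H A' A'' B B' H' : Type} [AddCommGroup A] [Module ℂ A] [AddCommGroup H] [Module ℂ H]
  [AddCommGroup A'] [Module ℂ A'] [AddCommGroup A''] [Module ℂ A''] [AddCommGroup B] [Module ℂ B]
  [AddCommGroup B'] [Module ℂ B'] [AddCommGroup H'] [Module ℂ H']
  {ρ : Representation ℂ (Stab p) A} {σ : Representation ℂ (Stab p) H}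
  {ρ' : Representation ℂ (Stab p) A'} {θ : Representation ℂ (Stab p) B}
  {θ' : Representation ℂ (Stab p) B'} {σ' : Representation ℂ (Stab p) H'}

/-- The map built from a complement `D` of the cocycles one degree below, a space `F` of reduced
cochains and a complement `E` of the cocycles. -/
def splitMap (τ : ℝ) (p : Fin 26 → ℝ) (D : A →ₗ[ℂ] Fock) (F : H →ₗ[ℂ] Fock) (E : A' →ₗ[ℂ] Fock) :
    A × H × A' →ₗ[ℂ] Fock :=
  (brst τ p ∘ₗ D).coprod (F.coprod E)

theorem splitMap_apply (D : A →ₗ[ℂ] Fock) (F : H →ₗ[ℂ] Fock) (E : A' →ₗ[ℂ] Fock)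
    (x : A × H × A') :
    splitMap τ p D F E x = brst τ p (D x.1) + (F x.2.1 + E x.2.2) := by
  simp only [splitMap, LinearMap.coprod_apply, LinearMap.comp_apply]

/-- Injectivity reduces to two independence statements. Applying d to dDx + Fr + Ex' = 0 removes the
exact term, and independence in the next degree forces x' = 0; independence in the present degree
then gives x = r = 0. Since the dimensions agree, the map is onto the relative cochains. -/
theorem isSplitting_splitMap [FiniteDimensional ℂ (Crel p n)]
    {D : A →ₗ[ℂ] Fock} {F : H →ₗ[ℂ] Fock} {E : A' →ₗ[ℂ] Fock}
    (hD : ∀ (g : Stab p) x, rot g.1.1 (D x) = D (ρ g x))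
    (hF : ∀ (g : Stab p) x, rot g.1.1 (F x) = F (σ g x))
    (hE : ∀ (g : Stab p) x, rot g.1.1 (E x) = E (ρ' g x))
    (hD' : ∀ x, brst τ p (brst τ p (D x)) = 0)
    (hinj : ∀ x r, brst τ p (D x) + F r = 0 → x = 0 ∧ r = 0)
    (hnext : ∀ x r, brst τ p (E x) + brst τ p (F r) = 0 → x = 0)
    (hDmem : ∀ x, brst τ p (D x) ∈ Crel p n) (hFmem : ∀ x, F x ∈ Crel p n)
    (hEmem : ∀ x, E x ∈ Crel p n)
    (hdim : Module.finrank ℂ (A × H × A') = Module.finrank ℂ (Crel p n)) :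
    IsSplitting n ρ σ ρ' (splitMap τ p D F E) := by
  have hi : ∀ x, splitMap τ p D F E x = 0 → x = 0 := by
    rintro ⟨x, r, x'⟩ h
    have h' := congrArg (brst τ p) h
    simp only [splitMap_apply, map_add, hD', zero_add, map_zero] at h'
    obtain rfl := hnext x' r (by rw [add_comm]; exact h')
    simp only [splitMap_apply, map_zero, add_zero] at h
    obtain ⟨rfl, rfl⟩ := hinj x r h
    rfl
  refine ⟨hi, ?_, fun g x => ?_⟩
  · refine Submodule.eq_of_le_of_finrank_eq ?_ ?_
    · rintro _ ⟨x, rfl⟩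
      exact add_mem (hDmem _) (add_mem (hFmem _) (hEmem _))
    · rw [LinearMap.finrank_range_of_inj ((injective_iff_map_eq_zero _).mpr hi), hdim]
  · simp only [splitMap_apply, map_add, rot_brst, hD, hF, hE]

theorem brst_splitMap {D : A →ₗ[ℂ] Fock} {F : H →ₗ[ℂ] Fock} {E : A' →ₗ[ℂ] Fock}
    {F' : H' →ₗ[ℂ] Fock} {E' : A'' →ₗ[ℂ] Fock} {d : H → H'}
    (hD : ∀ x, brst τ p (brst τ p (D x)) = 0) (hF : ∀ r, brst τ p (F r) = F' (d r))
    (x : A) (r : H) (x' : A') :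
    brst τ p (splitMap τ p D F E (x, r, x')) = splitMap τ p E F' E' (x', d r, 0) := by
  simp only [splitMap_apply, map_add, hD, hF, map_zero]
  abel

/-- Splits the middle summand further. -/
def refineMap (Φ : A × H × A' →ₗ[ℂ] Fock) (φ : B × H' × B' →ₗ[ℂ] H) :
    (A × B) × H' × A' × B' →ₗ[ℂ] Fock where
  toFun x := Φ (x.1.1, φ (x.1.2, x.2.1, x.2.2.2), x.2.2.1)
  map_add' x y := by
    rw [← map_add]
    exact congrArg Φ (Prod.ext rfl (Prod.ext (φ.map_add (x.1.2, x.2.1, x.2.2.2) (y.1.2, y.2.1, y.2.2.2)) rfl))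
  map_smul' a x := by
    rw [RingHom.id_apply, ← map_smul]
    exact congrArg Φ (Prod.ext rfl (Prod.ext (φ.map_smul a (x.1.2, x.2.1, x.2.2.2)) rfl))

theorem refineMap_apply (Φ : A × H × A' →ₗ[ℂ] Fock) (φ : B × H' × B' →ₗ[ℂ] H)
    (x : (A × B) × H' × A' × B') :
    refineMap Φ φ x = Φ (x.1.1, φ (x.1.2, x.2.1, x.2.2.2), x.2.2.1) := rfl

/-- When the reduced cochains split further, their first part joins the boundaries and their last
part joins the complement of the cocycles. -/
theorem IsSplitting.refine {Φ : A × H × A' →ₗ[ℂ] Fock} (h : IsSplitting n ρ σ ρ' Φ)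
    {φ : B × H' × B' →ₗ[ℂ] H} (hinj : ∀ x, φ x = 0 → x = 0) (hsurj : ∀ y, ∃ x, φ x = y)
    (hrot : ∀ g x, σ g (φ x) = φ (θ g x.1, σ' g x.2.1, θ' g x.2.2)) :
    IsSplitting n (ρ.prod θ) σ' (ρ'.prod θ') (refineMap Φ φ) := by
  refine ⟨?_, le_antisymm ?_ ?_, fun g x => ?_⟩
  · rintro ⟨⟨x, b⟩, r, x', b'⟩ hx
    have hx' := h.injective _ hx
    simp only [Prod.mk_eq_zero] at hx'
    obtain ⟨rfl, hφ, rfl⟩ := hx'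
    have := hinj _ hφ
    simp only [Prod.mk_eq_zero] at this
    obtain ⟨rfl, rfl, rfl⟩ := this
    rfl
  · rw [← h.range_eq]
    rintro _ ⟨x, rfl⟩
    exact ⟨_, rfl⟩
  · rw [← h.range_eq]
    rintro _ ⟨⟨x, r, x'⟩, rfl⟩
    obtain ⟨⟨b, s, b'⟩, rfl⟩ := hsurj r
    exact ⟨((x, b), s, x', b'), rfl⟩
  · rw [refineMap_apply, refineMap_apply, h.rot_apply, hrot]
    rfl

theorem isSplitting_zero (hn : n < 0 ∨ 5 < n) :
    IsSplitting (A := PUnit) (H := PUnit) (A' := PUnit) (p := p) n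
      (Representation.trivial ℂ _ PUnit) (Representation.trivial ℂ _ PUnit)
      (Representation.trivial ℂ _ PUnit) 0 :=
  ⟨fun _ _ => rfl, by rw [LinearMap.range_zero, Crel_eq_bot p hn], fun _ _ => map_zero _⟩

/-! ### Rows of the tables -/

variable {Φ : A × H × A' →ₗ[ℂ] Fock} {zA zH zA' zC zZ : Fin 4 → ℕ}

/-- The differential kills the first two summands and embeds the third into the next degree. -/
theorem IsSplitting.mem_Zrel_iff (h : IsSplitting n ρ σ ρ' Φ)
    {Φ' : A' × B × B' →ₗ[ℂ] Fock} (hΦ' : ∀ x, Φ' x = 0 → x = 0)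
    (hb : ∀ x y z, brst τ p (Φ (x, y, z)) = Φ' (z, 0, 0)) (v : Fock) :
    v ∈ Zrel τ p n ↔ ∃ x y, Φ (x, y, 0) = v := by
  constructor
  · rintro ⟨hv, hv'⟩
    rw [SetLike.mem_coe, ← h.range_eq] at hv
    obtain ⟨⟨x, y, z⟩, rfl⟩ := hv
    rw [SetLike.mem_coe, LinearMap.mem_ker, hb] at hv'
    obtain rfl : z = 0 := congrArg Prod.fst (hΦ' _ hv')
    exact ⟨x, y, rfl⟩
  · rintro ⟨x, y, rfl⟩
    refine ⟨?_, ?_⟩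
    · rw [SetLike.mem_coe, ← h.range_eq]
      exact ⟨_, rfl⟩
    · rw [SetLike.mem_coe, LinearMap.mem_ker, hb]
      exact map_zero Φ'

theorem IsSplitting.mem_Brel_iff {Φ₀ : B × B' × A →ₗ[ℂ] Fock} {θ₀ : Representation ℂ (Stab p) A}
    (h : IsSplitting (n - 1) θ θ' θ₀ Φ₀)
    (hb : ∀ x y z, brst τ p (Φ₀ (x, y, z)) = Φ (z, 0, 0)) (v : Fock) :
    v ∈ Brel τ p n ↔ ∃ x, Φ (x, 0, 0) = v := by
  rw [Brel, ← h.range_eq]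
  constructor
  · rintro ⟨_, ⟨⟨x, y, z⟩, rfl⟩, rfl⟩
    exact ⟨z, (hb x y z).symm⟩
  · rintro ⟨z, rfl⟩
    exact ⟨_, ⟨(0, 0, z), rfl⟩, hb 0 0 z⟩

/-- If d only shifts the last summand of one degree to the first summand of the next, then cochains,
cocycles, coboundaries and cohomology are A ⊕ H ⊕ A', A ⊕ H, A and H, and the isomorphisms are
equivariant because Φ is. -/
theorem tableRow_of_isSplitting {B₁ H₁ H₂ B₂ : Type} [AddCommGroup B₁] [Module ℂ B₁]
    [AddCommGroup H₁] [Module ℂ H₁] [AddCommGroup H₂] [Module ℂ H₂] [AddCommGroup B₂] [Module ℂ B₂]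
    {θ₁ : Representation ℂ (Stab p) B₁} {σ₁ : Representation ℂ (Stab p) H₁}
    {θ₂ : Representation ℂ (Stab p) B₂} {σ₂ : Representation ℂ (Stab p) H₂}
    {Φ₁ : B₁ × H₁ × A →ₗ[ℂ] Fock} {Φ₂ : A' × H₂ × B₂ →ₗ[ℂ] Fock} {n₁ n₂ : ℤ}
    (h₁ : IsSplitting n₁ θ₁ σ₁ ρ Φ₁) (h : IsSplitting n ρ σ ρ' Φ) (h₂ : IsSplitting n₂ ρ' σ₂ θ₂ Φ₂)
    (hn : n₁ = n - 1)
    (hb₁ : ∀ x y z, brst τ p (Φ₁ (x, y, z)) = Φ (z, 0, 0))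
    (hb : ∀ x y z, brst τ p (Φ (x, y, z)) = Φ₂ (z, 0, 0))
    (hA : Decomposes ρ zA) (hH : Decomposes σ zH) (hA' : Decomposes ρ' zA')
    (hzC : zA + (zH + zA') = zC) (hzZ : zA + zH = zZ) :
    TableRow τ p n zC zZ zA zH ∧ Brel τ p n ≤ Zrel τ p n := by
  subst hn hzC hzZ
  have hC : ∀ x, Φ x ∈ Crel p n := fun x => h.range_eq ▸ ⟨x, rfl⟩
  have hZ := h.mem_Zrel_iff h₂.injective hb
  have hB := h₁.mem_Brel_iff hb₁
  have hZ' : ∀ x : A × H, Φ (x.1, x.2, 0) ∈ Zrel τ p n := fun x => (hZ _).mpr ⟨_, _, rfl⟩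
  let ΦZ : A × H →ₗ[ℂ] Zrel τ p n :=
    (Φ ∘ₗ LinearMap.prodMap LinearMap.id (LinearMap.inl ℂ H A')).codRestrict _ hZ'
  refine ⟨⟨?_, ?_, ?_, ?_⟩, fun v hv => ?_⟩
  · refine (hA.prod (hH.prod hA')).of_bijective (Φ.codRestrict _ hC)
      (fun x hx => h.injective x (congrArg Subtype.val hx)) (fun y => ?_)
      fun g x => Subtype.ext (h.rot_apply g x).symm
    obtain ⟨x, hx⟩ : (y : Fock) ∈ LinearMap.range Φ := by
      rw [h.range_eq]
      exact y.2
    exact ⟨x, Subtype.ext hx⟩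
  · refine (hA.prod hH).of_bijective ΦZ (fun x hx => ?_) (fun y => ?_) fun g x => Subtype.ext ?_
    · have := h.injective (x.1, x.2, 0) (congrArg Subtype.val hx)
      exact Prod.ext (congrArg (fun z => z.1) this :) (congrArg (fun z => z.2.1) this :)
    · obtain ⟨a, b, hx⟩ := (hZ _).mp y.2
      exact ⟨(a, b), Subtype.ext hx⟩
    · refine Eq.trans ?_ (h.rot_apply g (x.1, x.2, 0)).symm
      simp only [map_zero]
      rfl
  · refine hA.of_bijective ((Φ ∘ₗ LinearMap.inl ℂ A (H × A')).codRestrict _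
      fun x => (hB _).mpr ⟨x, rfl⟩) (fun x hx => ?_) (fun y => ?_) fun g x => Subtype.ext ?_
    · exact congrArg Prod.fst (h.injective _ (congrArg Subtype.val hx))
    · obtain ⟨a, hx⟩ := (hB _).mp y.2
      exact ⟨a, Subtype.ext hx⟩
    · refine Eq.trans ?_ (h.rot_apply g (x, 0, 0)).symm
      simp only [map_zero]
      rfl
  · refine hH.of_bijective (Submodule.mkQ _ ∘ₗ ΦZ ∘ₗ LinearMap.inr ℂ A H)
      (fun y hy => ?_) (fun y => ?_) fun g y => ?_
    · have hy' := (Submodule.Quotient.mk_eq_zero _).mp hy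
      obtain ⟨x, hx⟩ := (hB _).mp hy'
      have hx' : Φ ((x, 0, 0) - (0, y, 0)) = 0 := by
        rw [map_sub, hx, sub_eq_zero]
        rfl
      have := congrArg (fun z => z.2.1) (h.injective _ hx')
      simpa using this
    · obtain ⟨z, rfl⟩ := Submodule.mkQ_surjective _ y
      obtain ⟨a, b, hx⟩ := (hZ _).mp z.2
      refine ⟨b, ?_⟩
      -- Φ(0, b, 0) and the given representative Φ(a, b, 0) differ by the coboundary Φ(−a, 0, 0).
      refine (Submodule.Quotient.eq _).mpr ((hB _).mpr ⟨-a, ?_⟩)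
      have : (-a, (0 : H), (0 : A')) = (0, b, 0) - (a, b, 0) := by simp
      rw [this, map_sub, hx]
      rfl
    · refine congrArg (Submodule.mkQ _) (Subtype.ext ?_)
      refine Eq.trans ?_ (h.rot_apply g (0, y, 0)).symm
      simp only [map_zero]
      rfl
  · obtain ⟨x, rfl⟩ := (hB v).mp hv
    exact hZ' (x, 0)

end Splitting

end

end CarrollString

namespace CarrollString

noncomputable section

/-! ### The splittings in each ghost number -/

section Equivariance

/-- The representation on the complements in ghost numbers one and three. -/
abbrev excessRep₁ (p : Fin 26 → ℝ) : Representation ℂ (Stab p) Excess₁ :=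
  (linRep p).prod <| (scalarRep p).prod <| (scalarRep p).prod <| scalarRep p

/-- The representation on the complement in ghost number two. -/
abbrev excessRep₂ (p : Fin 26 → ℝ) : Representation ℂ (Stab p) Excess₂ :=
  (linRep p).prod <| (linRep p).prod <|
    ((scalarRep p).prod <| (scalarRep p).prod <| (scalarRep p).prod <| scalarRep p).prod <|
    ((vecRep p).prod <| vecRep p).prod <| (symRep p).prod <| symRep p

/-- The representation on the reduced cochains of ghost numbers two and three. -/
abbrev coreRep₂ (p : Fin 26 → ℝ) : Representation ℂ (Stab p) Core₂ :=
  (scalarRep p).prod <| (scalarRep p).prod <| (vecRep p).prod <| (vecRep p).prod <|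
    (symRep p).prod <| skewRep p

variable {p : Fin 26 → ℝ}

/-- The stabiliser fixes P, so that every map built from P, the metric and tensor operations is
equivariant; the lemmas below spell this out. -/
theorem momentum_rot (g : Stab p) : (cplx g.1.1).mulVec (momentum p) = momentum p := by
  rw [momentum, Matrix.mulVec_smul, cplx_fix]

theorem vecRep_momentum (g : Stab p) : vecRep p g (momentum p) = momentum p := momentum_rot g

theorem vecRep_dotProduct_momentum (g : Stab p) (v : Vect) :
    vecRep p g v ⬝ᵥ momentum p = v ⬝ᵥ momentum p := by
  conv_lhs => rw [← vecRep_momentum g]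
  exact dotProduct_cplx g _ _

theorem tensorRep_mulVec_momentum (g : Stab p) (T : Tens) :
    (tensorRep p g T).mulVec (momentum p) = vecRep p g (T.mulVec (momentum p)) := by
  conv_lhs => rw [← vecRep_momentum g]
  exact mulVec_cplx g _ _

theorem symRep_mulVec_momentum (g : Stab p) (S : symTens) :
    (symRep p g S : Tens).mulVec (momentum p) = vecRep p g ((S : Tens).mulVec (momentum p)) :=
  tensorRep_mulVec_momentum g S

theorem skewRep_mulVec_momentum (g : Stab p) (A : skewTens) :
    (skewRep p g A : Tens).mulVec (momentum p) = vecRep p g ((A : Tens).mulVec (momentum p)) :=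
  tensorRep_mulVec_momentum g A

theorem trace_symRep (g : Stab p) (S : symTens) : (symRep p g S : Tens).trace = (S : Tens).trace :=
  trace_cplx g S

theorem tensorRep_vecMulVec_momentum (g : Stab p) :
    tensorRep p g (Matrix.vecMulVec (momentum p) (momentum p)) =
      Matrix.vecMulVec (momentum p) (momentum p) := by
  rw [tensorRep_apply, ← vecMulVec_cplx, momentum_rot]

theorem symRep_symOne (g : Stab p) : symRep p g symOne = symOne :=
  Subtype.ext (by rw [coe_symRep, coe_symOne, Matrix.mul_one, cplx_orth'])

theorem tensorRep_skew (g : Stab p) (A : skewTens) :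
    tensorRep p g (A : Tens) = (skewRep p g A : Tens) := rfl

theorem tensorRep_sym (g : Stab p) (A : symTens) :
    tensorRep p g (A : Tens) = (symRep p g A : Tens) := rfl

theorem excess₁_rot (g : Stab p) (x : Excess₁) :
    coordRep₁ p g (excess₁ x) = excess₁ (excessRep₁ p g x) :=
  Prod.ext (map_zero (linRep p g)) rfl

theorem excess₂_rot (g : Stab p) (x : Excess₂) :
    coordRep₂ p g (excess₂ x) = excess₂ (excessRep₂ p g x) := by
  obtain ⟨g, h, ⟨q₁, q₂, s₁, s₂⟩, ⟨y₁, y₂⟩, U, T⟩ := x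
  simp only [excess₂_apply, Representation.prod_apply_apply, tensorRep_sym, map_zero]

theorem excess₃_rot (g : Stab p) (x : Excess₁) :
    coordRep₂ p g (excess₃ x) = excess₃ (excessRep₁ p g x) := by
  obtain ⟨h, s₁, s₂, s₃⟩ := x
  simp only [excess₃_apply, Representation.prod_apply_apply, map_zero]

theorem core₁_rot (t : ℂ) (g : Stab p) (x : Lin) :
    coordRep₁ p g (core₁ t x) = core₁ t (linRep p g x) := by
  obtain ⟨a, b, v, w⟩ := x
  simp only [core₁_apply, levelM₁_eq, Representation.prod_apply_apply, map_zero, map_smul]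

theorem core₂_rot (t : ℂ) (g : Stab p) (x : Core₂) :
    coordRep₂ p g (core₂ t (momentum p) x) = core₂ t (momentum p) (coreRep₂ p g x) := by
  obtain ⟨a, b, v, w, S, A⟩ := x
  simp only [core₂_apply, Representation.prod_apply_apply, map_zero, map_smul, map_add,
    tensorRep_vecMulVec_momentum, symRep_symOne, vecRep_momentum, vecRep_dotProduct_momentum,
    skewRep_mulVec_momentum, tensorRep_skew]
  rfl

theorem core₃_rot (t : ℂ) (g : Stab p) (x : Core₂) :
    coordRep₂ p g (core₃ t (momentum p) x) = core₃ t (momentum p) (coreRep₂ p g x) := by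
  obtain ⟨a, b, v, w, S, A⟩ := x
  have h : symRep p g S + a • symOne = symRep p g (S + a • symOne) := by
    rw [map_add, map_smul, symRep_symOne]
  simp only [core₃_apply, Representation.prod_apply_apply, Representation.trivial_apply, map_zero,
    h, symRep_mulVec_momentum, vecRep_dotProduct_momentum, trace_symRep, skewRep_mulVec_momentum,
    tensorRep_skew, map_smul]

theorem core₄_rot (g : Stab p) (x : Lin) :
    coordRep₁ p g (core₄ x) = core₄ (linRep p g x) := by
  simp only [core₄_apply, Representation.prod_apply_apply, map_zero]

end Equivariance

section Dimensions

theorem isCompl_symTens_skewTens : IsCompl symTens skewTens := by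
  constructor
  · rw [Submodule.disjoint_def]
    intro T h h'
    have h₁ : T.transpose = T := h
    have h₂ : T.transpose = -T := h'
    rw [h₁] at h₂
    exact Matrix.ext fun i j => self_eq_neg.mp (congrFun (congrFun h₂ i) j)
  · rw [codisjoint_iff, eq_top_iff]
    intro T _
    refine Submodule.mem_sup.mpr ⟨_, (((2⁻¹ : ℂ) • symPart T : symTens)).2,
      (2⁻¹ : ℂ) • (T - T.transpose), ?_, ?_⟩
    · change Matrix.transpose _ = _
      simp
      module
    · rw [Submodule.coe_smul, coe_symPart]
      module

/-- This enters the count of dimensions in ghost numbers two and three: the coordinates of x^i π_j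
form one full tensor, which the splitting distributes over a symmetric and a skewsymmetric one. -/
theorem finrank_symTens_add_skewTens :
    Module.finrank ℂ symTens + Module.finrank ℂ skewTens = Module.finrank ℂ Tens :=
  Submodule.finrank_add_eq_of_isCompl isCompl_symTens_skewTens

end Dimensions

section Splittings

variable {p : Fin 26 → ℝ} {τ : ℝ} {n : ℤ}
variable {A H A' U : Type} [AddCommGroup A] [Module ℂ A] [AddCommGroup H] [Module ℂ H]
  [AddCommGroup A'] [Module ℂ A'] [AddCommGroup U] [Module ℂ U] [FiniteDimensional ℂ U]
  {ρ : Representation ℂ (Stab p) A} {σ : Representation ℂ (Stab p) H}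
  {ρ' : Representation ℂ (Stab p) A'} {θ : Representation ℂ (Stab p) U}

/-- The criterion `isSplitting_splitMap` transported along an equivariant coordinate map `j`;
independence and dimensions are now statements about coordinates alone. -/
theorem isSplitting_of_coordinates {j : U →ₗ[ℂ] Fock} (hj : ∀ u, j u = 0 → u = 0)
    (hC : Crel p n = LinearMap.range j) (hrot : ∀ (g : Stab p) u, rot g.1.1 (j u) = j (θ g u))
    {D : A →ₗ[ℂ] Fock} {d : A → U} {f : H →ₗ[ℂ] U} {e : A' →ₗ[ℂ] U}
    (hD : ∀ (g : Stab p) x, rot g.1.1 (D x) = D (ρ g x)) (hd : ∀ x, brst τ p (D x) = j (d x))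
    (hf : ∀ g x, θ g (f x) = f (σ g x)) (he : ∀ g x, θ g (e x) = e (ρ' g x))
    (hD' : ∀ x, brst τ p (brst τ p (D x)) = 0)
    (hinj : ∀ x r, d x + f r = 0 → x = 0 ∧ r = 0)
    (hnext : ∀ x r, brst τ p (j (e x)) + brst τ p (j (f r)) = 0 → x = 0)
    (hdim : Module.finrank ℂ (A × H × A') = Module.finrank ℂ U) :
    IsSplitting n ρ σ ρ' (splitMap τ p D (j ∘ₗ f) (j ∘ₗ e)) := by
  have hmem : ∀ u, j u ∈ Crel p n := by
    rw [hC]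
    exact fun u => ⟨u, rfl⟩
  have : FiniteDimensional ℂ (Crel p n) := by
    rw [hC]
    infer_instance
  refine isSplitting_splitMap hD (fun g x => ?_) (fun g x => ?_) hD' (fun x r h => ?_)
    (fun x r h => hnext x r ?_) (fun x => by rw [hd]; exact hmem _) (fun x => hmem _) (fun x => hmem _) ?_
  · rw [LinearMap.comp_apply, hrot, hf]
    rfl
  · rw [LinearMap.comp_apply, hrot, he]
    rfl
  · refine hinj x r (hj _ ?_)
    rw [map_add, ← hd]
    exact h
  · simpa only [LinearMap.comp_apply] using h
  · rw [hdim, hC, LinearMap.finrank_range_of_inj ((injective_iff_map_eq_zero _).mpr hj)]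

end Splittings

end

end CarrollString

namespace CarrollString

noncomputable section

/-! ### The reduced complex and its contractible complement in each ghost number -/

section Splittings

attribute [local irreducible] brst

instance : FiniteDimensional ℂ Coord₂ := by
  have : FiniteDimensional ℂ (Lin × Lin × ℂ × ℂ × ℂ × ℂ × ℂ × ℂ) := inferInstance
  exact Module.Finite.prod

/-- The splitting in ghost number zero. -/
def split₀ (τ : ℝ) (p : Fin 26 → ℝ) : PUnit.{1} × ℂ × PUnit.{1} →ₗ[ℂ] Fock :=
  splitMap τ p 0 (cochain₀ ∘ₗ LinearMap.id) (cochain₀ ∘ₗ 0)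

/-- The splitting in ghost number one. -/
def split₁ (τ : ℝ) (p : Fin 26 → ℝ) : PUnit.{1} × Lin × Excess₁ →ₗ[ℂ] Fock :=
  splitMap τ p (cochain₀ ∘ₗ 0) (cochain₁ ∘ₗ core₁ ((τ : ℂ) ^ 2)) (cochain₁ ∘ₗ excess₁)

/-- The splitting in ghost number two. -/
def split₂ (τ : ℝ) (p : Fin 26 → ℝ) : Excess₁ × Core₂ × Excess₂ →ₗ[ℂ] Fock :=
  splitMap τ p (cochain₁ ∘ₗ excess₁) (cochain₂ ∘ₗ core₂ ((τ : ℂ) ^ 2) (momentum p))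
    (cochain₂ ∘ₗ excess₂)

/-- The splitting in ghost number three. -/
def split₃ (τ : ℝ) (p : Fin 26 → ℝ) : Excess₂ × Core₂ × Excess₁ →ₗ[ℂ] Fock :=
  splitMap τ p (cochain₂ ∘ₗ excess₂) (cochain₃ ∘ₗ core₃ ((τ : ℂ) ^ 2) (momentum p))
    (cochain₃ ∘ₗ excess₃)

/-- The splitting in ghost number four. -/
def split₄ (τ : ℝ) (p : Fin 26 → ℝ) : Excess₁ × Lin × PUnit.{1} →ₗ[ℂ] Fock :=
  splitMap τ p (cochain₃ ∘ₗ excess₃) (cochain₄ ∘ₗ core₄) (cochain₄ ∘ₗ 0)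

/-- The splitting in ghost number five. -/
def split₅ (τ : ℝ) (p : Fin 26 → ℝ) : PUnit.{1} × ℂ × PUnit.{1} →ₗ[ℂ] Fock :=
  splitMap τ p (cochain₄ ∘ₗ 0) (cochain₅ ∘ₗ LinearMap.id) (cochain₅ ∘ₗ 0)

/-- The trivial representation on the zero space. -/
abbrev zeroRep (p : Fin 26 → ℝ) : Representation ℂ (Stab p) PUnit.{1} :=
  Representation.trivial ℂ _ _

variable {p : Fin 26 → ℝ} (hp : p 0 = 0) {τ : ℝ} (hτ : τ ≠ 0)
include hp

theorem brst_brst_excess₁ (x : Excess₁) :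
    brst τ p (brst τ p ((cochain₁ ∘ₗ excess₁) x)) = 0 := by
  rw [LinearMap.comp_apply, brst_cochain₁ hp, brst_cochain₂ hp, diff₂_diff₁_excess₁, map_zero]

theorem brst_brst_excess₂ (x : Excess₂) :
    brst τ p (brst τ p ((cochain₂ ∘ₗ excess₂) x)) = 0 := by
  rw [LinearMap.comp_apply, brst_cochain₂ hp, brst_cochain₃ hp, diff₃_diff₂_excess₂, map_zero]

theorem brst_brst_excess₃ (x : Excess₁) :
    brst τ p (brst τ p ((cochain₃ ∘ₗ excess₃) x)) = 0 := by
  rw [LinearMap.comp_apply, brst_cochain₃ hp, brst_cochain₄ hp, diff₄_diff₃_excess₃, map_zero]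

theorem brst_core₀ (a : ℂ) : brst τ p ((cochain₀ ∘ₗ LinearMap.id) a) =
    (cochain₁ ∘ₗ core₁ ((τ : ℂ) ^ 2)) (coreDiff₀ (momentum p) a) := by
  rw [LinearMap.comp_apply, LinearMap.comp_apply, LinearMap.id_apply, brst_cochain₀ hp, diff₀_eq]

theorem brst_core₁ (x : Lin) : brst τ p ((cochain₁ ∘ₗ core₁ ((τ : ℂ) ^ 2)) x) =
    (cochain₂ ∘ₗ core₂ ((τ : ℂ) ^ 2) (momentum p)) (coreDiff₁ ((τ : ℂ) ^ 2) (momentum p) x) := by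
  rw [LinearMap.comp_apply, LinearMap.comp_apply, brst_cochain₁ hp, diff₁_core₁]

theorem brst_core₃ (x : Core₂) :
    brst τ p ((cochain₃ ∘ₗ core₃ ((τ : ℂ) ^ 2) (momentum p)) x) =
      (cochain₄ ∘ₗ core₄) (coreDiff₃ ((τ : ℂ) ^ 2) (momentum p) x) := by
  rw [LinearMap.comp_apply, LinearMap.comp_apply, brst_cochain₃ hp, diff₃_core₃]

theorem brst_core₄ (x : Lin) : brst τ p ((cochain₄ ∘ₗ core₄) x) =
    (cochain₅ ∘ₗ LinearMap.id) (coreDiff₄ (momentum p) x) := by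
  rw [LinearMap.comp_apply, LinearMap.comp_apply, LinearMap.id_apply, brst_cochain₄ hp,
    diff₄_core₄]

omit hp in
theorem brst_cochain_comp_zero {U : Type} [AddCommGroup U] [Module ℂ U] (j : U →ₗ[ℂ] Fock)
    (x : PUnit.{1}) : brst τ p (brst τ p ((j ∘ₗ (0 : PUnit.{1} →ₗ[ℂ] U)) x)) = 0 := by
  rw [LinearMap.comp_apply, LinearMap.zero_apply, map_zero, map_zero, map_zero]

theorem brst_split₀ (x : PUnit) (r : ℂ) (x' : PUnit) :
    brst τ p (split₀ τ p (x, r, x')) = split₁ τ p (x', coreDiff₀ (momentum p) r, 0) :=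
  brst_splitMap (fun x => by rw [LinearMap.zero_apply, map_zero, map_zero]) (brst_core₀ hp) _ _ _

theorem brst_split₁ (x : PUnit) (r : Lin) (x' : Excess₁) :
    brst τ p (split₁ τ p (x, r, x')) =
      split₂ τ p (x', coreDiff₁ ((τ : ℂ) ^ 2) (momentum p) r, 0) :=
  brst_splitMap (brst_cochain_comp_zero _) (brst_core₁ hp) _ _ _

theorem brst_split₃ (x : Excess₂) (r : Core₂) (x' : Excess₁) :
    brst τ p (split₃ τ p (x, r, x')) =
      split₄ τ p (x', coreDiff₃ ((τ : ℂ) ^ 2) (momentum p) r, 0) :=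
  brst_splitMap (brst_brst_excess₂ hp) (brst_core₃ hp) _ _ _

theorem brst_split₄ (x : Excess₁) (r : Lin) (x' : PUnit) :
    brst τ p (split₄ τ p (x, r, x')) = split₅ τ p (x', coreDiff₄ (momentum p) r, 0) :=
  brst_splitMap (brst_brst_excess₃ hp) (brst_core₄ hp) _ _ _

theorem brst_split₅ (x : PUnit) (r : ℂ) (x' : PUnit) : brst τ p (split₅ τ p (x, r, x')) = 0 := by
  simp only [split₅, splitMap_apply, LinearMap.comp_apply, LinearMap.zero_apply, LinearMap.id_apply,
    map_add, map_zero, brst_cochain₅ hp, add_zero]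

theorem isSplitting_split₀ :
    IsSplitting 0 (zeroRep p) (scalarRep p) (zeroRep p) (split₀ τ p) := by
  refine isSplitting_of_coordinates (θ := scalarRep p) (d := 0) (fun u => cochain₀_injective u)
    (Crel_eq_cochainRange p 0) rot_cochain₀ (fun g x => ?_) (fun x => ?_) (fun g x => rfl)
    (fun g x => rfl) (fun x => ?_) (fun x r h => ⟨rfl, ?_⟩) (fun x r h => rfl) ?_
  · simp only [LinearMap.zero_apply, map_zero]
  · rw [LinearMap.zero_apply, Pi.zero_apply, map_zero, map_zero]
  · rw [LinearMap.zero_apply, map_zero, map_zero]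
  · simpa using h
  · simp [Module.finrank_zero_of_subsingleton]

theorem isSplitting_split₁ :
    IsSplitting 1 (zeroRep p) (linRep p) (excessRep₁ p) (split₁ τ p) := by
  refine isSplitting_of_coordinates (θ := coordRep₁ p) (d := 0) (fun u => cochain₁_injective u)
    (Crel_eq_cochainRange p 1) rot_cochain₁ (fun g x => ?_) (fun x => ?_) (core₁_rot _)
    excess₁_rot (brst_cochain_comp_zero _) (fun x r h => ⟨rfl, core₁_injective (t := (τ : ℂ) ^ 2) r ?_⟩)
    (fun x r h => ?_) ?_
  · simp only [LinearMap.comp_apply, LinearMap.zero_apply, map_zero]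
  · rw [LinearMap.comp_apply, LinearMap.zero_apply, Pi.zero_apply, map_zero, map_zero, map_zero]
  · simpa using h
  · rw [brst_cochain₁ hp, brst_cochain₁ hp, diff₁_core₁, ← map_add] at h
    exact (diff₁_excess₁_add_core₂_injective _ _ _ (cochain₂_injective _ h)).1
  · simp [Module.finrank_zero_of_subsingleton, Module.finrank_prod]

include hτ

theorem brst_core₂ (x : Core₂) :
    brst τ p ((cochain₂ ∘ₗ core₂ ((τ : ℂ) ^ 2) (momentum p)) x) =
      (cochain₃ ∘ₗ core₃ ((τ : ℂ) ^ 2) (momentum p))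
        (coreDiff₂ ((τ : ℂ) ^ 2) (momentum p) x) := by
  rw [LinearMap.comp_apply, LinearMap.comp_apply, brst_cochain₂ hp,
    diff₂_core₂ _ _ (pow_ne_zero 2 (Complex.ofReal_ne_zero.mpr hτ))]

theorem brst_split₂ (x : Excess₁) (r : Core₂) (x' : Excess₂) :
    brst τ p (split₂ τ p (x, r, x')) =
      split₃ τ p (x', coreDiff₂ ((τ : ℂ) ^ 2) (momentum p) r, 0) :=
  brst_splitMap (brst_brst_excess₁ hp) (brst_core₂ hp hτ) _ _ _

theorem isSplitting_split₂ :
    IsSplitting 2 (excessRep₁ p) (coreRep₂ p) (excessRep₂ p) (split₂ τ p) := by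
  refine isSplitting_of_coordinates (θ := coordRep₂ p) (fun u => cochain₂_injective u)
    (Crel_eq_cochainRange p 2) rot_cochain₂ (fun g x => ?_) (fun x => brst_cochain₁ hp τ _)
    (core₂_rot _) excess₂_rot (brst_brst_excess₁ hp)
    (fun x r h => diff₁_excess₁_add_core₂_injective _ _ _ h) (fun x r h => ?_) ?_
  · rw [LinearMap.comp_apply, rot_cochain₁, excess₁_rot, LinearMap.comp_apply]
  · rw [brst_cochain₂ hp, brst_cochain₂ hp,
      diff₂_core₂ _ _ (pow_ne_zero 2 (Complex.ofReal_ne_zero.mpr hτ)), ← map_add] at h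
    exact (diff₂_excess₂_add_core₃_injective _ (pow_ne_zero 2 (Complex.ofReal_ne_zero.mpr hτ)) _ _
      (cochain₃_injective _ h)).1
  -- The two sides agree summand by summand except for ⊙² and ⋀² on one side and all 2-tensors on
  -- the other.
  · have := finrank_symTens_add_skewTens
    simp only [Module.finrank_prod]
    omega

theorem isSplitting_split₃ :
    IsSplitting 3 (excessRep₂ p) (coreRep₂ p) (excessRep₁ p) (split₃ τ p) := by
  refine isSplitting_of_coordinates (θ := coordRep₂ p) (fun u => cochain₃_injective u)
    (Crel_eq_cochainRange p 3) rot_cochain₃ (fun g x => ?_) (fun x => brst_cochain₂ hp τ _)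
    (core₃_rot _) excess₃_rot (brst_brst_excess₂ hp) (fun x r h =>
      diff₂_excess₂_add_core₃_injective _ (pow_ne_zero 2 (Complex.ofReal_ne_zero.mpr hτ)) _ _ h)
    (fun x r h => ?_) ?_
  · rw [LinearMap.comp_apply, rot_cochain₂, excess₂_rot, LinearMap.comp_apply]
  · rw [brst_cochain₃ hp, brst_cochain₃ hp, diff₃_core₃, ← map_add] at h
    exact (diff₃_excess₃_add_core₄_injective _ _ _ (cochain₄_injective _ h)).1
  · have := finrank_symTens_add_skewTens
    simp only [Module.finrank_prod]
    omega

omit hτ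

theorem isSplitting_split₄ :
    IsSplitting 4 (excessRep₁ p) (linRep p) (zeroRep p) (split₄ τ p) := by
  refine isSplitting_of_coordinates (θ := coordRep₁ p) (fun u => cochain₄_injective u)
    (Crel_eq_cochainRange p 4) rot_cochain₄ (fun g x => ?_) (fun x => brst_cochain₃ hp τ _)
    core₄_rot (fun g x => map_zero _) (brst_brst_excess₃ hp) (fun x r h =>
      diff₃_excess₃_add_core₄_injective _ _ _ h)
    (fun x r h => rfl) ?_
  · rw [LinearMap.comp_apply, rot_cochain₃, excess₃_rot, LinearMap.comp_apply]
  · simp only [Module.finrank_prod, Module.finrank_zero_of_subsingleton]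
    omega

omit hp in
theorem isSplitting_split₅ :
    IsSplitting 5 (zeroRep p) (scalarRep p) (zeroRep p) (split₅ τ p) := by
  refine isSplitting_of_coordinates (θ := scalarRep p) (d := 0) (fun u => cochain₅_injective u)
    (Crel_eq_cochainRange p 5) rot_cochain₅ (fun g x => ?_) (fun x => ?_) (fun g x => rfl)
    (fun g x => rfl) (brst_cochain_comp_zero _) (fun x r h => ⟨rfl, ?_⟩) (fun x r h => rfl) ?_
  · simp only [LinearMap.comp_apply, LinearMap.zero_apply, map_zero]
  · rw [LinearMap.comp_apply, LinearMap.zero_apply, Pi.zero_apply, map_zero, map_zero, map_zero]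
  · simpa using h
  · simp [Module.finrank_zero_of_subsingleton]

end Splittings

end

end CarrollString

namespace CarrollString

noncomputable section

/-! ### Vanishing momentum -/

section ZeroMomentum

attribute [local irreducible] brst

variable {p : Fin 26 → ℝ}

theorem Decomposes.linRep {y : Fin 4 → ℕ} (h : Decomposes (vecRep p) y) :
    Decomposes (linRep p) (![2, 0, 0, 0] + (y + y)) := by
  have h' := Decomposes.trivial.prod (Decomposes.trivial.prod (h.prod h))
  rwa [← add_assoc] at h'

theorem Decomposes.excessRep₁ {y : Fin 4 → ℕ} (h : Decomposes (vecRep p) y) :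
    Decomposes (excessRep₁ p) (![5, 0, 0, 0] + (y + y)) := by
  have h' := h.linRep.prod (Decomposes.trivial.prod (Decomposes.trivial.prod Decomposes.trivial))
  rwa [add_right_comm] at h'

theorem Decomposes.excessRep₂ {y z : Fin 4 → ℕ} (h : Decomposes (vecRep p) y)
    (hs : Decomposes (symRep p) z) :
    Decomposes (excessRep₂ p) (![8, 0, 0, 0] + (6 • y + 2 • z)) := by
  have h' := h.linRep.prod (h.linRep.prod ((Decomposes.trivial.prod (Decomposes.trivial.prod
    (Decomposes.trivial.prod Decomposes.trivial))).prod ((h.prod h).prod (hs.prod hs))))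
  convert h' using 1
  rw [show (![8, 0, 0, 0] : Fin 4 → ℕ) = ![2, 0, 0, 0] + ![2, 0, 0, 0] + (![1, 0, 0, 0] +
    (![1, 0, 0, 0] + (![1, 0, 0, 0] + ![1, 0, 0, 0]))) by decide]
  abel

theorem Decomposes.coreRep₂ {y z w : Fin 4 → ℕ} (h : Decomposes (vecRep p) y)
    (hs : Decomposes (symRep p) z) (ha : Decomposes (skewRep p) w) :
    Decomposes (coreRep₂ p) (![2, 0, 0, 0] + (y + (y + (z + w)))) := by
  have h' := Decomposes.trivial.prod (Decomposes.trivial.prod (h.prod (h.prod (hs.prod ha))))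
  rwa [← add_assoc] at h'

variable (hp : p 0 = 0) (hp' : Fin.tail p = 0) {τ : ℝ} (hτ : τ ≠ 0)

include hp'

theorem momentum_eq_zero : momentum p = 0 := by rw [momentum, spatial_eq_zero hp', smul_zero]

include hp

theorem brst_split₀_of_tail_eq_zero (x : PUnit) (r : ℂ) (x' : PUnit) :
    brst τ p (split₀ τ p (x, r, x')) = split₁ τ p (x', 0, 0) := by
  rw [brst_split₀ hp, momentum_eq_zero hp', coreDiff₀, smul_zero]
  rfl

theorem brst_split₁_of_tail_eq_zero (x : PUnit) (r : Lin) (x' : Excess₁) :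
    brst τ p (split₁ τ p (x, r, x')) = split₂ τ p (x', 0, 0) := by
  rw [brst_split₁ hp, momentum_eq_zero hp', coreDiff₁, smul_zero, dotProduct_zero, neg_zero,
    show symProd 0 r.2.2.2 = 0 from Subtype.ext (by simp [coe_symProd]), smul_zero]
  rfl

include hτ in
theorem brst_split₂_of_tail_eq_zero (x : Excess₁) (r : Core₂) (x' : Excess₂) :
    brst τ p (split₂ τ p (x, r, x')) = split₃ τ p (x', 0, 0) := by
  rw [brst_split₂ hp hτ, momentum_eq_zero hp', coreDiff₂, dotProduct_zero, mul_zero, zero_div,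
    zero_mul]
  rfl

theorem brst_split₃_of_tail_eq_zero (x : Excess₂) (r : Core₂) (x' : Excess₁) :
    brst τ p (split₃ τ p (x, r, x')) = split₄ τ p (x', 0, 0) := by
  rw [brst_split₃ hp, momentum_eq_zero hp', coreDiff₃, dotProduct_zero, Matrix.mulVec_zero,
    smul_zero]
  rfl

theorem brst_split₄_of_tail_eq_zero (x : Excess₁) (r : Lin) (x' : PUnit) :
    brst τ p (split₄ τ p (x, r, x')) = split₅ τ p (x', 0, 0) := by
  rw [brst_split₄ hp, momentum_eq_zero hp', coreDiff₄, dotProduct_zero, neg_zero]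

include hτ

/-- For 𝐩 = 0 each formula for the differential of the reduced complex contains the factor P = 0.
The reduced cochains are therefore the cohomology, and the complements supply all coboundaries. -/
theorem tableRow_of_tail_eq_zero :
    (TableRow τ p 0 ![1, 0, 0, 0] ![1, 0, 0, 0] ![0, 0, 0, 0] ![1, 0, 0, 0] ∧
      Brel τ p 0 ≤ Zrel τ p 0) ∧
    (TableRow τ p 1 ![7, 4, 0, 0] ![2, 2, 0, 0] ![0, 0, 0, 0] ![2, 2, 0, 0] ∧
      Brel τ p 1 ≤ Zrel τ p 1) ∧
    (TableRow τ p 2 ![18, 10, 3, 1] ![8, 4, 1, 1] ![5, 2, 0, 0] ![3, 2, 1, 1] ∧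
      Brel τ p 2 ≤ Zrel τ p 2) ∧
    (TableRow τ p 3 ![18, 10, 3, 1] ![13, 8, 3, 1] ![10, 6, 2, 0] ![3, 2, 1, 1] ∧
      Brel τ p 3 ≤ Zrel τ p 3) ∧
    (TableRow τ p 4 ![7, 4, 0, 0] ![7, 4, 0, 0] ![5, 2, 0, 0] ![2, 2, 0, 0] ∧
      Brel τ p 4 ≤ Zrel τ p 4) ∧
    (TableRow τ p 5 ![1, 0, 0, 0] ![1, 0, 0, 0] ![0, 0, 0, 0] ![1, 0, 0, 0] ∧
      Brel τ p 5 ≤ Zrel τ p 5) := by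
  have hv := Decomposes.vect_of_tail_eq_zero hp'
  have hs := Decomposes.symTens_of_tail_eq_zero hp'
  have ha := Decomposes.skewTens_of_tail_eq_zero hp'
  have h0 := Decomposes.of_subsingleton (zeroRep p)
  have hL : Decomposes (linRep p) ![2, 2, 0, 0] := by
    convert hv.linRep using 1
    decide
  have hE : Decomposes (excessRep₁ p) ![5, 2, 0, 0] := by
    convert hv.excessRep₁ using 1
    decide
  have hE' : Decomposes (excessRep₂ p) ![10, 6, 2, 0] := by
    convert hv.excessRep₂ hs using 1
    decide
  have hC : Decomposes (coreRep₂ p) ![3, 2, 1, 1] := by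
    convert hv.coreRep₂ hs ha using 1
    decide
  refine ⟨?_, ?_, ?_, ?_, ?_, ?_⟩
  -- The neighbours of the extreme degrees, −1 here and 6 below, are zero spaces.
  · exact tableRow_of_isSplitting (isSplitting_zero (n := -1) (by decide)) (isSplitting_split₀ hp)
      (isSplitting_split₁ hp) (by norm_num) (fun x y z => by
        rw [LinearMap.zero_apply, map_zero]
        exact (map_zero _).symm)
      (brst_split₀_of_tail_eq_zero hp hp') h0 Decomposes.trivial h0 (by decide) (by decide)
  · exact tableRow_of_isSplitting (isSplitting_split₀ hp) (isSplitting_split₁ hp)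
      (isSplitting_split₂ hp hτ) (by norm_num) (brst_split₀_of_tail_eq_zero hp hp')
      (brst_split₁_of_tail_eq_zero hp hp') h0 hL hE (by decide) (by decide)
  · exact tableRow_of_isSplitting (isSplitting_split₁ hp) (isSplitting_split₂ hp hτ)
      (isSplitting_split₃ hp hτ) (by norm_num) (brst_split₁_of_tail_eq_zero hp hp')
      (brst_split₂_of_tail_eq_zero hp hp' hτ) hE hC hE' (by decide) (by decide)
  · exact tableRow_of_isSplitting (isSplitting_split₂ hp hτ) (isSplitting_split₃ hp hτ)
      (isSplitting_split₄ hp) (by norm_num) (brst_split₂_of_tail_eq_zero hp hp' hτ)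
      (brst_split₃_of_tail_eq_zero hp hp') hE' hC hE (by decide) (by decide)
  · exact tableRow_of_isSplitting (isSplitting_split₃ hp hτ) (isSplitting_split₄ hp)
      isSplitting_split₅ (by norm_num) (brst_split₃_of_tail_eq_zero hp hp')
      (brst_split₄_of_tail_eq_zero hp hp') hE hL h0 (by decide) (by decide)
  · exact tableRow_of_isSplitting (isSplitting_split₄ hp) isSplitting_split₅
      (isSplitting_zero (n := 6) (by decide)) (by norm_num) (brst_split₄_of_tail_eq_zero hp hp')
      (fun x y z => by rw [brst_split₅ hp, LinearMap.zero_apply])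
      h0 Decomposes.trivial h0 (by decide) (by decide)

end ZeroMomentum

end

end CarrollString

namespace CarrollString

noncomputable section

/-! ### Nonvanishing momentum -/

section NonzeroMomentum

attribute [local irreducible] brst

/-- The cohomology of ghost numbers two and three at nonvanishing momentum. -/
abbrev Transverse₂ (p : Fin 26 → ℝ) : Type :=
  ℂ × transVec p × Vect × transSymTens p × skewTens

/-- The representation on `Transverse₂ p`. -/
abbrev transverseRep₂ (p : Fin 26 → ℝ) : Representation ℂ (Stab p) (Transverse₂ p) :=
  (scalarRep p).prod <| (transVecRep p).prod <| (vecRep p).prod <|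
    (transSymTensRep p).prod <| skewRep p

section Refinements

variable (t : ℂ) (p : Fin 26 → ℝ)

/-- The contraction of `symProd (momentum p) y` with the momentum. -/
def longContract : Vect →ₗ[ℂ] Vect :=
  (dotWith (momentum p)).smulRight (momentum p) + (momentum p ⬝ᵥ momentum p) • LinearMap.id

/-- Decomposes the reduced cochains of ghost number zero. -/
def refine₀ : PUnit.{1} × PUnit.{1} × ℂ →ₗ[ℂ] ℂ :=
  LinearMap.snd ℂ _ _ ∘ₗ LinearMap.snd ℂ _ _

/-- Decomposes the reduced cochains of ghost number one. -/
def refine₁ : ℂ × (ℂ × transVec p) × (ℂ × Vect) →ₗ[ℂ] Lin where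
  toFun x := (x.2.2.1, x.2.1.1, joinVec p (Complex.I * x.1, x.2.1.2), x.2.2.2)
  map_add' x y := by
    simp only [Prod.fst_add, Prod.snd_add, mul_add, ← Prod.mk_add_mk, map_add]
  map_smul' a x := by
    simp only [Prod.smul_fst, Prod.smul_snd, smul_eq_mul, mul_left_comm _ a, RingHom.id_apply,
      Prod.smul_mk]
    simp only [← smul_eq_mul a, ← Prod.smul_mk, map_smul]

/-- Decomposes the reduced cochains of ghost number two. -/
def refine₂ : (ℂ × Vect) × Transverse₂ p × ℂ →ₗ[ℂ] Core₂ where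
  toFun x := (x.2.2, x.2.1.1 - x.1.2 ⬝ᵥ momentum p, joinVec p (Complex.I * x.1.1, x.2.1.2.1),
    x.2.1.2.2.1, joinSym p (x.2.1.2.2.2.1, (-(t / 2) * Complex.I) • x.1.2), x.2.1.2.2.2.2)
  map_add' x y := by
    simp only [Prod.fst_add, Prod.snd_add, mul_add, smul_add, ← Prod.mk_add_mk, map_add,
      add_dotProduct, add_sub_add_comm]
  map_smul' a x := by
    simp only [Prod.smul_fst, Prod.smul_snd, smul_eq_mul, mul_left_comm _ a, smul_comm _ a,
      smul_dotProduct, ← mul_sub, RingHom.id_apply, Prod.smul_mk]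
    simp only [← smul_eq_mul a, ← Prod.smul_mk, map_smul]

/-- Decomposes the reduced cochains of ghost number three. -/
def refine₃ : ℂ × Transverse₂ p × (ℂ × Vect) →ₗ[ℂ] Core₂ where
  toFun x := (x.2.1.1, 2 * (momentum p ⬝ᵥ momentum p) / t * x.1,
    joinVec p (Complex.I * x.2.2.1, x.2.1.2.1), x.2.1.2.2.1,
    joinSym p (x.2.1.2.2.2.1, Complex.I • x.2.2.2), x.2.1.2.2.2.2)
  map_add' x y := by
    simp only [Prod.fst_add, Prod.snd_add, mul_add, smul_add, ← Prod.mk_add_mk, map_add]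
  map_smul' a x := by
    simp only [Prod.smul_fst, Prod.smul_snd, smul_eq_mul, mul_left_comm _ a, smul_comm _ a,
      RingHom.id_apply, Prod.smul_mk]
    simp only [← smul_eq_mul a, ← Prod.smul_mk, map_smul]

/-- Decomposes the reduced cochains of ghost number four. -/
def refine₄ : (ℂ × Vect) × (ℂ × transVec p) × ℂ →ₗ[ℂ] Lin where
  toFun x := (x.2.1.1, x.1.1 * (momentum p ⬝ᵥ momentum p), (-(2 * t)) • longContract p x.1.2,
    joinVec p (Complex.I * x.2.2, x.2.1.2))
  map_add' x y := by
    simp only [Prod.fst_add, Prod.snd_add, mul_add, add_mul, smul_add, ← Prod.mk_add_mk, map_add]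
  map_smul' a x := by
    simp only [Prod.smul_fst, Prod.smul_snd, smul_eq_mul, mul_left_comm _ a, smul_comm _ a,
      mul_assoc a, map_smul, RingHom.id_apply, Prod.smul_mk]
    simp only [← smul_eq_mul a, ← Prod.smul_mk, map_smul]

/-- Decomposes the reduced cochains of ghost number five. -/
def refine₅ : ℂ × PUnit.{1} × PUnit.{1} →ₗ[ℂ] ℂ :=
  (-(momentum p ⬝ᵥ momentum p)) • LinearMap.fst ℂ _ _

end Refinements

variable {t : ℂ} (ht : t ≠ 0) {p : Fin 26 → ℝ} (hp' : Fin.tail p ≠ 0)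

/-- The splittings are along the real vector 𝐩, the differential contains P = i𝐩; the factors i in
the refinements convert between the two. -/
theorem joinVec_I_mul (c : ℂ) (v : transVec p) :
    joinVec p (Complex.I * c, v) = c • momentum p + v := by
  rw [momentum, smul_smul, mul_comm]
  rfl

theorem joinSym_smul_I (S : transSymTens p) (a : ℂ) (w : Vect) :
    joinSym p (S, (a * Complex.I) • w) = ⟨S, S.2.1⟩ + a • symProd (momentum p) w := by
  refine congrArg ((⟨S, S.2.1⟩ : symTens) + ·) (Subtype.ext ?_)
  rw [Submodule.coe_smul, coe_symProd, coe_symProd, momentum, Matrix.smul_vecMulVec,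
    Matrix.vecMulVec_smul, Matrix.smul_vecMulVec, Matrix.vecMulVec_smul]
  module

theorem longContract_apply (y : Vect) : longContract p y =
    (y ⬝ᵥ momentum p) • momentum p + (momentum p ⬝ᵥ momentum p) • y := rfl

theorem longContract_rot (g : Stab p) (y : Vect) :
    longContract p (vecRep p g y) = vecRep p g (longContract p y) := by
  simp only [longContract_apply, map_add, map_smul, vecRep_momentum, vecRep_dotProduct_momentum]

/-- In this and the next four lemmas the first summand of a refinement is by design the image of the
last summand of the refinement one degree below, while the other summands are closed. -/
theorem coreDiff₀_refine₀ (x : PUnit) (h : PUnit) (c : ℂ) :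
    coreDiff₀ (momentum p) (refine₀ (x, h, c)) = refine₁ p (c, 0, 0) := by
  refine Prod.ext rfl (Prod.ext rfl (Prod.ext ?_ rfl))
  exact (joinVec_I_mul c 0).trans (add_zero _) |>.symm

theorem coreDiff₁_refine₁ (c : ℂ) (x : ℂ × transVec p) (y : ℂ × Vect) :
    coreDiff₁ t (momentum p) (refine₁ p (c, x, y)) = refine₂ t p (y, 0, 0) := by
  refine Prod.ext rfl (Prod.ext (zero_sub _).symm (Prod.ext ?_ (Prod.ext rfl (Prod.ext ?_ rfl))))
  · exact (joinVec_I_mul y.1 0).trans (add_zero _) |>.symm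
  · exact (joinSym_smul_I 0 _ y.2).trans (zero_add _) |>.symm

theorem coreDiff₂_refine₂ (y : ℂ × Vect) (x : Transverse₂ p) (c : ℂ) :
    coreDiff₂ t (momentum p) (refine₂ t p (y, x, c)) = refine₃ t p (c, 0, 0) := by
  refine Prod.ext rfl (Prod.ext rfl (Prod.ext ?_ (Prod.ext rfl (Prod.ext ?_ rfl))))
  · exact (joinVec_I_mul 0 0).trans (by rw [zero_smul, zero_add]; rfl) |>.symm
  · refine Eq.symm (Eq.trans ?_ (map_zero (joinSym p)))
    exact congrArg (joinSym p) (Prod.ext rfl (smul_zero _))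

theorem transVec_dotProduct_momentum (v : transVec p) : (v : Vect) ⬝ᵥ momentum p = 0 := by
  have h : spatial p ⬝ᵥ (v : Vect) = 0 := v.2
  rw [dotProduct_comm, momentum, smul_dotProduct, h, smul_zero]

theorem transSymTens_mulVec_momentum (S : transSymTens p) :
    (S : Tens).mulVec (momentum p) = 0 := by
  have h : (S : Tens).mulVec (spatial p) = 0 := S.2.2
  rw [momentum, Matrix.mulVec_smul, h, smul_zero]

theorem coreDiff₃_refine₃ (c : ℂ) (x : Transverse₂ p) (y : ℂ × Vect) :
    coreDiff₃ t (momentum p) (refine₃ t p (c, x, y)) = refine₄ t p (y, 0, 0) := by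
  refine Prod.ext rfl (Prod.ext ?_ (Prod.ext (congrArg ((-(2 * t)) • ·) ?_) ?_))
  · change joinVec p _ ⬝ᵥ _ = _
    rw [joinVec_I_mul, add_dotProduct, transVec_dotProduct_momentum, add_zero, smul_dotProduct]
    rfl
  · change (joinSym p (x.2.2.2.1, Complex.I • y.2)).1.mulVec (momentum p) = _
    rw [← one_mul Complex.I, joinSym_smul_I, one_smul]
    -- The transverse tensor contracts to zero with P, so only P⊙y contributes; this gives (y·P)P +
    -- (P·P)y.
    change ((x.2.2.2.1 : Tens) + (symProd (momentum p) y.2 : Tens)).mulVec (momentum p) = _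
    rw [Matrix.add_mulVec, transSymTens_mulVec_momentum, zero_add, symProd_mulVec,
      longContract_apply]
  · exact (joinVec_I_mul 0 0).trans (by rw [zero_smul, zero_add]; rfl) |>.symm

theorem coreDiff₄_refine₄ (y : ℂ × Vect) (x : ℂ × transVec p) (c : ℂ) :
    coreDiff₄ (momentum p) (refine₄ t p (y, x, c)) = refine₅ p (c, 0, 0) := by
  change -(joinVec p _ ⬝ᵥ _) = -(momentum p ⬝ᵥ momentum p) * c
  rw [joinVec_I_mul, add_dotProduct, transVec_dotProduct_momentum, add_zero, smul_dotProduct,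
    smul_eq_mul]
  ring

theorem refine₁_rot (g : Stab p) (x : ℂ × (ℂ × transVec p) × (ℂ × Vect)) :
    linRep p g (refine₁ p x) = refine₁ p (scalarRep p g x.1,
      ((scalarRep p).prod (transVecRep p)) g x.2.1, ((scalarRep p).prod (vecRep p)) g x.2.2) :=
  Prod.ext rfl (Prod.ext rfl (Prod.ext (joinVec_rot g (Complex.I * x.1, x.2.1.2)).symm rfl))

theorem refine₂_rot (g : Stab p) (x : (ℂ × Vect) × Transverse₂ p × ℂ) :
    coreRep₂ p g (refine₂ t p x) = refine₂ t p (((scalarRep p).prod (vecRep p)) g x.1,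
      transverseRep₂ p g x.2.1, scalarRep p g x.2.2) := by
  refine Prod.ext rfl (Prod.ext ?_ (Prod.ext (joinVec_rot g (Complex.I * x.1.1, x.2.1.2.1)).symm
    (Prod.ext rfl (Prod.ext ?_ rfl))))
  · exact congrArg (x.2.1.1 - ·) (vecRep_dotProduct_momentum g _).symm
  · refine (joinSym_rot g (x.2.1.2.2.2.1, (-(t / 2) * Complex.I) • x.1.2)).symm.trans ?_
    rw [map_smul]
    rfl

theorem refine₃_rot (g : Stab p) (x : ℂ × Transverse₂ p × (ℂ × Vect)) :
    coreRep₂ p g (refine₃ t p x) = refine₃ t p (scalarRep p g x.1, transverseRep₂ p g x.2.1,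
      ((scalarRep p).prod (vecRep p)) g x.2.2) := by
  refine Prod.ext rfl (Prod.ext rfl (Prod.ext (joinVec_rot g (Complex.I * x.2.2.1, x.2.1.2.1)).symm
    (Prod.ext rfl (Prod.ext ?_ rfl))))
  refine (joinSym_rot g (x.2.1.2.2.2.1, Complex.I • x.2.2.2)).symm.trans ?_
  rw [map_smul]
  rfl

theorem refine₄_rot (g : Stab p) (x : (ℂ × Vect) × (ℂ × transVec p) × ℂ) :
    linRep p g (refine₄ t p x) = refine₄ t p (((scalarRep p).prod (vecRep p)) g x.1,
      ((scalarRep p).prod (transVecRep p)) g x.2.1, scalarRep p g x.2.2) := by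
  refine Prod.ext rfl (Prod.ext rfl (Prod.ext ?_
    (joinVec_rot g (Complex.I * x.2.2, x.2.1.2)).symm))
  change vecRep p g ((-(2 * t)) • longContract p x.1.2) = _
  rw [map_smul, ← longContract_rot]
  rfl

include hp'

/-- P·P equals −𝐩·𝐩. -/
theorem momentum_dotProduct_ne_zero : momentum p ⬝ᵥ momentum p ≠ 0 := by
  rw [momentum, smul_dotProduct, dotProduct_smul]
  simpa using spatial_dotProduct_ne_zero hp'

/-- Pairing (y·P)P + (P·P)y = 0 with P gives 2(P·P)(y·P) = 0, and then (P·P)y = 0. -/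
theorem longContract_injective (y : Vect) (h : longContract p y = 0) : y = 0 := by
  have h0 := momentum_dotProduct_ne_zero hp'
  rw [longContract_apply] at h
  have h' := congrArg (· ⬝ᵥ momentum p) h
  simp only [add_dotProduct, smul_dotProduct, smul_eq_mul, zero_dotProduct] at h'
  have h₁ : y ⬝ᵥ momentum p = 0 := by
    have : (momentum p ⬝ᵥ momentum p) * (y ⬝ᵥ momentum p) = 0 := by linear_combination h' / 2
    exact (mul_eq_zero.mp this).resolve_left h0
  rw [h₁, zero_smul, zero_add] at h
  exact (smul_eq_zero.mp h).resolve_left h0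

theorem longContract_surjective (u : Vect) : ∃ y, longContract p y = u :=
  LinearMap.surjective_of_injective
    ((injective_iff_map_eq_zero (longContract p)).mpr (longContract_injective hp')) u

theorem joinVec_I_injective {c : ℂ} {v : transVec p} (h : joinVec p (Complex.I * c, v) = 0) :
    c = 0 ∧ v = 0 := by
  have := joinVec_injective hp' _ h
  simpa using this

theorem joinVec_I_surjective (u : Vect) : ∃ c v, joinVec p (Complex.I * c, v) = u := by
  obtain ⟨⟨c, v⟩, rfl⟩ := joinVec_surjective hp' u
  exact ⟨Complex.I⁻¹ * c, v, by rw [mul_inv_cancel_left₀ Complex.I_ne_zero]⟩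

theorem joinSym_smul_injective {a : ℂ} (ha : a ≠ 0) {S : transSymTens p} {w : Vect}
    (h : joinSym p (S, a • w) = 0) : S = 0 ∧ w = 0 := by
  have := joinSym_injective hp' _ h
  simpa [ha] using this

theorem joinSym_smul_surjective {a : ℂ} (ha : a ≠ 0) (U : symTens) :
    ∃ S w, joinSym p (S, a • w) = U := by
  obtain ⟨⟨S, w⟩, rfl⟩ := joinSym_surjective hp' U
  exact ⟨S, a⁻¹ • w, by rw [smul_inv_smul₀ ha]⟩

theorem refine₁_injective (x : ℂ × (ℂ × transVec p) × (ℂ × Vect)) (h : refine₁ p x = 0) :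
    x = 0 := by
  obtain ⟨c, ⟨b, v⟩, a, w⟩ := x
  have h' : (a, b, joinVec p (Complex.I * c, v), w) = (0 : Lin) := h
  simp only [Prod.mk_eq_zero] at h'
  obtain ⟨rfl, rfl, hv, rfl⟩ := h'
  obtain ⟨rfl, rfl⟩ := joinVec_I_injective hp' hv
  rfl

theorem refine₁_surjective (y : Lin) : ∃ x, refine₁ p x = y := by
  obtain ⟨a, b, v, w⟩ := y
  obtain ⟨c, v, rfl⟩ := joinVec_I_surjective hp' v
  exact ⟨(c, (b, v), (a, w)), rfl⟩

include ht

theorem refine₂_injective (x : (ℂ × Vect) × Transverse₂ p × ℂ) (h : refine₂ t p x = 0) :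
    x = 0 := by
  obtain ⟨⟨a, w⟩, ⟨b, v, w', S, A⟩, c⟩ := x
  have h' : (c, b - w ⬝ᵥ momentum p, joinVec p (Complex.I * a, v), w',
    joinSym p (S, (-(t / 2) * Complex.I) • w), A) = (0 : Core₂) := h
  simp only [Prod.mk_eq_zero] at h'
  obtain ⟨rfl, hb, hv, rfl, hS, rfl⟩ := h'
  obtain ⟨rfl, rfl⟩ := joinVec_I_injective hp' hv
  obtain ⟨rfl, rfl⟩ := joinSym_smul_injective hp' (by simp [ht]) hS
  rw [zero_dotProduct, sub_zero] at hb
  subst hb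
  rfl

theorem refine₂_surjective (y : Core₂) : ∃ x, refine₂ t p x = y := by
  obtain ⟨c, b, v, w', S, A⟩ := y
  obtain ⟨a, v, rfl⟩ := joinVec_I_surjective hp' v
  obtain ⟨S, w, rfl⟩ := joinSym_smul_surjective hp' (a := -(t / 2) * Complex.I) (by simp [ht]) S
  -- The boundary of w carries the scalar −w·P, which has to be compensated in the scalar class.
  exact ⟨((a, w), (b + w ⬝ᵥ momentum p, v, w', S, A), c),
    Prod.ext rfl (Prod.ext (add_sub_cancel_right _ _) rfl)⟩

theorem refine₃_injective (x : ℂ × Transverse₂ p × (ℂ × Vect)) (h : refine₃ t p x = 0) :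
    x = 0 := by
  obtain ⟨c, ⟨a, v, w', S, A⟩, s, w⟩ := x
  have h' : (a, 2 * (momentum p ⬝ᵥ momentum p) / t * c, joinVec p (Complex.I * s, v), w',
    joinSym p (S, Complex.I • w), A) = (0 : Core₂) := h
  simp only [Prod.mk_eq_zero] at h'
  obtain ⟨rfl, hc, hv, rfl, hS, rfl⟩ := h'
  obtain ⟨rfl, rfl⟩ := joinVec_I_injective hp' hv
  obtain ⟨rfl, rfl⟩ := joinSym_smul_injective hp' Complex.I_ne_zero hS
  obtain rfl : c = 0 := by simpa [ht, momentum_dotProduct_ne_zero hp'] using hc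
  rfl

theorem refine₃_surjective (y : Core₂) : ∃ x, refine₃ t p x = y := by
  obtain ⟨a, b, v, w', S, A⟩ := y
  obtain ⟨s, v, rfl⟩ := joinVec_I_surjective hp' v
  obtain ⟨S, w, rfl⟩ := joinSym_smul_surjective hp' Complex.I_ne_zero S
  have h0 : 2 * (momentum p ⬝ᵥ momentum p) / t ≠ 0 :=
    div_ne_zero (mul_ne_zero two_ne_zero (momentum_dotProduct_ne_zero hp')) ht
  exact ⟨(b / (2 * (momentum p ⬝ᵥ momentum p) / t), (a, v, w', S, A), s, w),
    Prod.ext rfl (Prod.ext (mul_div_cancel₀ b h0) rfl)⟩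

theorem refine₄_injective (x : (ℂ × Vect) × (ℂ × transVec p) × ℂ) (h : refine₄ t p x = 0) :
    x = 0 := by
  obtain ⟨⟨s, y⟩, ⟨a, v⟩, c⟩ := x
  have h' : (a, s * (momentum p ⬝ᵥ momentum p), (-(2 * t)) • longContract p y,
    joinVec p (Complex.I * c, v)) = (0 : Lin) := h
  simp only [Prod.mk_eq_zero] at h'
  obtain ⟨rfl, hs, hy, hv⟩ := h'
  obtain ⟨rfl, rfl⟩ := joinVec_I_injective hp' hv
  obtain rfl : s = 0 := by simpa [momentum_dotProduct_ne_zero hp'] using hs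
  obtain rfl := longContract_injective hp' y (by simpa [ht] using hy)
  rfl

theorem refine₄_surjective (y : Lin) : ∃ x, refine₄ t p x = y := by
  obtain ⟨a, b, v, w⟩ := y
  obtain ⟨c, w, rfl⟩ := joinVec_I_surjective hp' w
  obtain ⟨y, hy⟩ := longContract_surjective hp' ((-(2 * t))⁻¹ • v)
  refine ⟨((b / (momentum p ⬝ᵥ momentum p), y), (a, w), c), Prod.ext rfl (Prod.ext
    (div_mul_cancel₀ b (momentum_dotProduct_ne_zero hp')) (Prod.ext ?_ rfl))⟩
  change (-(2 * t)) • longContract p y = v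
  rw [hy, smul_inv_smul₀ (by simp [ht])]

end NonzeroMomentum

end

end CarrollString

namespace CarrollString

noncomputable section

/-! ### The table at nonvanishing momentum -/

section NonzeroMomentumTable

attribute [local irreducible] brst

/-- If the reduced differential is itself a shift (b, g, b') ↦ (b', 0, 0), then on the refined
splitting d is again a pure shift, with both kinds of complements combined. -/
theorem brst_refineMap {τ : ℝ} {p : Fin 26 → ℝ} {A H A' K K' B B' G B'' G' : Type}
    [AddCommGroup A] [Module ℂ A] [AddCommGroup H] [Module ℂ H] [AddCommGroup A'] [Module ℂ A']
    [AddCommGroup K] [Module ℂ K] [AddCommGroup K'] [Module ℂ K'] [AddCommGroup B] [Module ℂ B]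
    [AddCommGroup B'] [Module ℂ B'] [AddCommGroup G] [Module ℂ G] [AddCommGroup B''] [Module ℂ B'']
    [AddCommGroup G'] [Module ℂ G']
    {Φ : A × H × A' →ₗ[ℂ] Fock} {Φ' : A' × K × K' →ₗ[ℂ] Fock} {d : H → K}
    {φ : B × G × B' →ₗ[ℂ] H} {φ' : B' × G' × B'' →ₗ[ℂ] K}
    (h : ∀ x r x', brst τ p (Φ (x, r, x')) = Φ' (x', d r, 0))
    (hd : ∀ b g b', d (φ (b, g, b')) = φ' (b', 0, 0))
    (x : A × B) (r : G) (x' : A' × B') :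
    brst τ p (refineMap Φ φ (x, r, x')) = refineMap Φ' φ' (x', 0, 0) := by
  rw [refineMap_apply, h, hd]
  rfl

variable {p : Fin 26 → ℝ} (hp : p 0 = 0) (hp' : Fin.tail p ≠ 0) {τ : ℝ} (hτ : τ ≠ 0)
include hp hp' hτ

/-- The following cancel in the reduced complex: the constants of degree 0 against longitudinal x in
degree 1; x^0 and π_i in degree 1 against longitudinal v and 𝐩⊙V in degree 2; the scalar a of degree
2 against b in degree 3; longitudinal v and 𝐩⊙V in degree 3 against π_0 and x^i in degree 4;
longitudinal π_i in degree 4 against degree 5. Transverse parts and the untouched coordinates form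
the cohomology. -/
theorem tableRow_of_tail_ne_zero :
    (TableRow τ p 0 ![1, 0, 0, 0] ![0, 0, 0, 0] ![0, 0, 0, 0] ![0, 0, 0, 0] ∧
      Brel τ p 0 ≤ Zrel τ p 0) ∧
    (TableRow τ p 1 ![11, 4, 0, 0] ![2, 1, 0, 0] ![1, 0, 0, 0] ![1, 1, 0, 0] ∧
      Brel τ p 1 ≤ Zrel τ p 1) ∧
    (TableRow τ p 2 ![31, 14, 3, 1] ![12, 6, 1, 1] ![9, 3, 0, 0] ![3, 3, 1, 1] ∧
      Brel τ p 2 ≤ Zrel τ p 2) ∧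
    (TableRow τ p 3 ![31, 14, 3, 1] ![22, 11, 3, 1] ![19, 8, 2, 0] ![3, 3, 1, 1] ∧
      Brel τ p 3 ≤ Zrel τ p 3) ∧
    (TableRow τ p 4 ![11, 4, 0, 0] ![10, 4, 0, 0] ![9, 3, 0, 0] ![1, 1, 0, 0] ∧
      Brel τ p 4 ≤ Zrel τ p 4) ∧
    (TableRow τ p 5 ![1, 0, 0, 0] ![1, 0, 0, 0] ![1, 0, 0, 0] ![0, 0, 0, 0] ∧
      Brel τ p 5 ≤ Zrel τ p 5) := by
  have ht : (τ : ℂ) ^ 2 ≠ 0 := pow_ne_zero 2 (Complex.ofReal_ne_zero.mpr hτ)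
  have hv := Decomposes.vect hp'
  have hs := Decomposes.symTens hp'
  have ha := Decomposes.skewTens hp'
  have h0 := Decomposes.of_subsingleton (zeroRep p)
  have h00 : Decomposes ((zeroRep p).prod (zeroRep p)) ![0, 0, 0, 0] :=
    Decomposes.of_subsingleton _
  have hA₁ : Decomposes ((zeroRep p).prod (scalarRep p)) ![1, 0, 0, 0] := by
    convert h0.prod Decomposes.trivial using 1
    decide
  have hA₂ : Decomposes ((excessRep₁ p).prod ((scalarRep p).prod (vecRep p))) ![9, 3, 0, 0] := by
    convert hv.excessRep₁.prod (Decomposes.trivial.prod hv) using 1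
    decide
  have hA₃ : Decomposes ((excessRep₂ p).prod (scalarRep p)) ![19, 8, 2, 0] := by
    convert (hv.excessRep₂ hs).prod Decomposes.trivial using 1
    decide
  have hH₁ : Decomposes ((scalarRep p).prod (transVecRep p)) ![1, 1, 0, 0] := by
    convert Decomposes.trivial.prod Decomposes.transVec using 1
    decide
  have hH₂ : Decomposes (transverseRep₂ p) ![3, 3, 1, 1] := by
    convert Decomposes.trivial.prod (Decomposes.transVec.prod (hv.prod
      (Decomposes.transSymTens.prod ha))) using 1
    decide
  have s₀ := (isSplitting_split₀ (τ := τ) hp).refine (θ := zeroRep p) (σ' := zeroRep p)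
    (θ' := scalarRep p) (φ := refine₀) (fun x h => Prod.ext rfl (Prod.ext rfl h))
    (fun y => ⟨(0, 0, y), rfl⟩) (fun g x => rfl)
  have s₁ := (isSplitting_split₁ (τ := τ) hp).refine (refine₁_injective hp')
    (refine₁_surjective hp') refine₁_rot
  have s₂ := (isSplitting_split₂ hp hτ).refine (refine₂_injective ht hp')
    (refine₂_surjective ht hp') refine₂_rot
  have s₃ := (isSplitting_split₃ hp hτ).refine (refine₃_injective ht hp')
    (refine₃_surjective ht hp') refine₃_rot
  have s₄ := (isSplitting_split₄ (τ := τ) hp).refine (refine₄_injective ht hp')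
    (refine₄_surjective ht hp') refine₄_rot
  have hPP : -(momentum p ⬝ᵥ momentum p) ≠ 0 := neg_ne_zero.mpr (momentum_dotProduct_ne_zero hp')
  have s₅ := (isSplitting_split₅ (p := p) (τ := τ)).refine (θ := scalarRep p) (σ' := zeroRep p)
    (θ' := zeroRep p) (φ := refine₅ p)
    (fun x h => Prod.ext ((mul_eq_zero.mp h).resolve_left hPP) rfl)
    (fun y => ⟨(y / -(momentum p ⬝ᵥ momentum p), 0, 0), mul_div_cancel₀ y hPP⟩) (fun g x => rfl)
  have b₀ := brst_refineMap (brst_split₀ (τ := τ) hp) (coreDiff₀_refine₀ (p := p))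
  have b₁ := brst_refineMap (brst_split₁ (τ := τ) hp) (coreDiff₁_refine₁ (p := p))
  have b₂ := brst_refineMap (brst_split₂ (τ := τ) hp hτ) (coreDiff₂_refine₂ (p := p))
  have b₃ := brst_refineMap (brst_split₃ (τ := τ) hp) (coreDiff₃_refine₃ (p := p))
  have b₄ := brst_refineMap (brst_split₄ (τ := τ) hp) (coreDiff₄_refine₄ (t := (τ : ℂ) ^ 2) (p := p))
  have z₀ := isSplitting_zero (p := p) (n := -1) (by decide)
  have z₆ := isSplitting_zero (p := p) (n := 6) (by decide)
  -- Refining the zero splitting by zero spaces only adjusts its shape to the refined neighbours.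
  have z₀' := z₀.refine (θ := zeroRep p) (σ' := zeroRep p) (θ' := zeroRep p) (φ := 0)
    (fun x _ => rfl) (fun y => ⟨0, rfl⟩) (fun g x => rfl)
  have z₆' := z₆.refine (θ := zeroRep p) (σ' := zeroRep p) (θ' := zeroRep p) (φ := 0)
    (fun x _ => rfl) (fun y => ⟨0, rfl⟩) (fun g x => rfl)
  refine ⟨?_, ?_, ?_, ?_, ?_, ?_⟩
  · exact tableRow_of_isSplitting z₀' s₀ s₁ (by norm_num) (fun x y z => by
      rw [refineMap_apply, LinearMap.zero_apply, map_zero]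
      exact (map_zero _).symm) b₀ h00 h0 hA₁ (by decide) (by decide)
  · exact tableRow_of_isSplitting s₀ s₁ s₂ (by norm_num) b₀ b₁ hA₁ hH₁ hA₂ (by decide) (by decide)
  · exact tableRow_of_isSplitting s₁ s₂ s₃ (by norm_num) b₁ b₂ hA₂ hH₂ hA₃ (by decide) (by decide)
  · exact tableRow_of_isSplitting s₂ s₃ s₄ (by norm_num) b₂ b₃ hA₃ hH₂ hA₂ (by decide) (by decide)
  · exact tableRow_of_isSplitting s₃ s₄ s₅ (by norm_num) b₃ b₄ hA₂ hH₁ hA₁ (by decide) (by decide)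
  · exact tableRow_of_isSplitting s₄ s₅ z₆' (by norm_num) b₄ (fun x y z => by
      rw [refineMap_apply, refineMap_apply, brst_split₅ hp, LinearMap.zero_apply])
      hA₁ h0 h00 (by decide) (by decide)

end NonzeroMomentumTable

/-! ### Poincaré duality -/

section Duality

variable {τ : ℝ} {p : Fin 26 → ℝ}

theorem decomposes_cohomologyRep_of_lt_or_lt {n : ℤ} (hn : n < 0 ∨ 5 < n) :
    Decomposes (cohomologyRep τ p n) ![0, 0, 0, 0] := by
  have : Subsingleton (Zrel τ p n) := by
    refine ⟨fun v w => Subtype.ext ?_⟩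
    have hv : (v : Fock) ∈ Crel p n := v.2.1
    have hw : (w : Fock) ∈ Crel p n := w.2.1
    rw [Crel_eq_bot p hn, Submodule.mem_bot] at hv hw
    rw [hv, hw]
  have : Subsingleton (Hrel τ p n) := (Submodule.mkQ_surjective _).subsingleton
  exact Decomposes.of_subsingleton _

theorem Brel_le_Zrel_of_lt_or_lt {n : ℤ} (hn : n - 1 < 0 ∨ 5 < n - 1) :
    Brel τ p n ≤ Zrel τ p n := by
  rw [Brel, Crel_eq_bot p hn, Submodule.map_bot]
  exact bot_le

/-- No pairing is constructed: the isomorphism exists because the decompositions in degrees n and 5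
− n have equal multiplicities, and outside 0, …, 5 both sides vanish. -/
theorem poincareDuality {z : ℤ → Fin 4 → ℕ}
    (h : ∀ n, 0 ≤ n → n ≤ 5 → Decomposes (cohomologyRep τ p n) (z n))
    (hz : ∀ n, 0 ≤ n → n ≤ 5 → z n = z (5 - n)) (n : ℤ) :
    Nonempty ((cohomologyRep τ p n).Equiv (cohomologyRep τ p (5 - n))) := by
  by_cases hn : 0 ≤ n ∧ n ≤ 5
  · obtain ⟨e⟩ := h n hn.1 hn.2
    have h' := h (5 - n) (by omega) (by omega)
    rw [← hz n hn.1 hn.2] at h'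
    obtain ⟨e'⟩ := h'
    exact ⟨e.trans e'.symm⟩
  · obtain ⟨e⟩ := decomposes_cohomologyRep_of_lt_or_lt (τ := τ) (p := p) (n := n) (by omega)
    obtain ⟨e'⟩ := decomposes_cohomologyRep_of_lt_or_lt (τ := τ) (p := p) (n := 5 - n) (by omega)
    exact ⟨e.trans e'.symm⟩

theorem complex_of_tableRows (hp : p 0 = 0)
    {zC₀ zC₁ zC₂ zC₃ zC₄ zC₅ zZ₀ zZ₁ zZ₂ zZ₃ zZ₄ zZ₅ zB₀ zB₁ zB₂ zB₃ zB₄ zB₅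
    zH₀ zH₁ zH₂ : Fin 4 → ℕ}
    (h : (TableRow τ p 0 zC₀ zZ₀ zB₀ zH₀ ∧ Brel τ p 0 ≤ Zrel τ p 0) ∧
      (TableRow τ p 1 zC₁ zZ₁ zB₁ zH₁ ∧ Brel τ p 1 ≤ Zrel τ p 1) ∧
      (TableRow τ p 2 zC₂ zZ₂ zB₂ zH₂ ∧ Brel τ p 2 ≤ Zrel τ p 2) ∧
      (TableRow τ p 3 zC₃ zZ₃ zB₃ zH₂ ∧ Brel τ p 3 ≤ Zrel τ p 3) ∧
      (TableRow τ p 4 zC₄ zZ₄ zB₄ zH₁ ∧ Brel τ p 4 ≤ Zrel τ p 4) ∧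
      (TableRow τ p 5 zC₅ zZ₅ zB₅ zH₀ ∧ Brel τ p 5 ≤ Zrel τ p 5)) :
    (∀ n : ℤ, Brel τ p n ≤ Zrel τ p n) ∧ (∀ n : ℤ, (n < 0 ∨ 5 < n) → Crel p n = ⊥) ∧
      ∀ n : ℤ, Nonempty ((cohomologyRep τ p n).Equiv (cohomologyRep τ p (5 - n))) := by
  obtain ⟨⟨h₀, b₀⟩, ⟨h₁, b₁⟩, ⟨h₂, b₂⟩, ⟨h₃, b₃⟩, ⟨h₄, b₄⟩, ⟨h₅, b₅⟩⟩ := h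
  refine ⟨fun n => ?_, fun n hn => Crel_eq_bot p hn, ?_⟩
  · by_cases hn : 0 ≤ n ∧ n ≤ 5
    · obtain ⟨hn₀, hn₅⟩ := hn
      interval_cases n <;> assumption
    -- In degree 6 the coboundaries come from C⁵, which is nonzero, but all its elements are closed.
    -- In the remaining degrees Cⁿ⁻¹ is zero.
    · by_cases hn' : n = 6
      · subst hn'
        rw [Brel, show (6 - 1 : ℤ) = 5 by norm_num, Crel_eq_cochainRange]
        rintro _ ⟨_, ⟨a, rfl⟩, rfl⟩
        rw [brst_cochain₅ hp]
        exact zero_mem _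
      · exact Brel_le_Zrel_of_lt_or_lt (by omega)
  -- The symmetry of the last column is expressed by the repetition of `zH₀`, `zH₁`, `zH₂` in the
  -- hypothesis.
  · refine poincareDuality (z := fun n => if n = 0 ∨ n = 5 then zH₀ else if n = 1 ∨ n = 4 then zH₁
      else zH₂) (fun n hn₀ hn₅ => ?_) (fun n hn₀ hn₅ => ?_)
    · interval_cases n
      exacts [h₀.2.2.2, h₁.2.2.2, h₂.2.2.2, h₃.2.2.2, h₄.2.2.2, h₅.2.2.2]
    · interval_cases n <;> rfl

end Duality

end

end CarrollString

/-! ### The tables and Poincaré duality -/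

theorem mainTheorem2 (τ : ℝ) (hτ : τ ≠ 0) :
    -- `C_rel(p)` is a complex and satisfies Poincaré duality, for `p = (0, 𝐩)` with arbitrary `𝐩`
    (∀ p : Fin 26 → ℝ, p 0 = 0 →
      (∀ n : ℤ, CarrollString.Brel τ p n ≤ CarrollString.Zrel τ p n) ∧
      (∀ n : ℤ, (n < 0 ∨ 5 < n) → CarrollString.Crel p n = ⊥) ∧
      (∀ n : ℤ, Nonempty ((CarrollString.cohomologyRep τ p n).Equiv
        (CarrollString.cohomologyRep τ p (5 - n))))) ∧
    -- the table for `p = (0, 𝐩)`, `𝐩 ≠ 0`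
    (∀ p : Fin 26 → ℝ, p 0 = 0 → Fin.tail p ≠ 0 →
      CarrollString.TableRow τ p 0 ![1, 0, 0, 0] ![0, 0, 0, 0] ![0, 0, 0, 0] ![0, 0, 0, 0] ∧
      CarrollString.TableRow τ p 1 ![11, 4, 0, 0] ![2, 1, 0, 0] ![1, 0, 0, 0] ![1, 1, 0, 0] ∧
      CarrollString.TableRow τ p 2 ![31, 14, 3, 1] ![12, 6, 1, 1] ![9, 3, 0, 0] ![3, 3, 1, 1] ∧
      CarrollString.TableRow τ p 3 ![31, 14, 3, 1] ![22, 11, 3, 1] ![19, 8, 2, 0] ![3, 3, 1, 1] ∧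
      CarrollString.TableRow τ p 4 ![11, 4, 0, 0] ![10, 4, 0, 0] ![9, 3, 0, 0] ![1, 1, 0, 0] ∧
      CarrollString.TableRow τ p 5 ![1, 0, 0, 0] ![1, 0, 0, 0] ![1, 0, 0, 0] ![0, 0, 0, 0]) ∧
    -- the table for `p = 0`
    (CarrollString.TableRow τ 0 0 ![1, 0, 0, 0] ![1, 0, 0, 0] ![0, 0, 0, 0] ![1, 0, 0, 0] ∧
      CarrollString.TableRow τ 0 1 ![7, 4, 0, 0] ![2, 2, 0, 0] ![0, 0, 0, 0] ![2, 2, 0, 0] ∧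
      CarrollString.TableRow τ 0 2 ![18, 10, 3, 1] ![8, 4, 1, 1] ![5, 2, 0, 0] ![3, 2, 1, 1] ∧
      CarrollString.TableRow τ 0 3 ![18, 10, 3, 1] ![13, 8, 3, 1] ![10, 6, 2, 0] ![3, 2, 1, 1] ∧
      CarrollString.TableRow τ 0 4 ![7, 4, 0, 0] ![7, 4, 0, 0] ![5, 2, 0, 0] ![2, 2, 0, 0] ∧
      CarrollString.TableRow τ 0 5 ![1, 0, 0, 0] ![1, 0, 0, 0] ![0, 0, 0, 0] ![1, 0, 0, 0]) := by
  have hz := CarrollString.tableRow_of_tail_eq_zero (p := 0) rfl rfl hτ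
  refine ⟨fun p hp => ?_, fun p hp hp' => ?_, hz.1.1, hz.2.1.1, hz.2.2.1.1, hz.2.2.2.1.1,
    hz.2.2.2.2.1.1, hz.2.2.2.2.2.1⟩
  · by_cases hp' : Fin.tail p = 0
    · exact CarrollString.complex_of_tableRows hp (CarrollString.tableRow_of_tail_eq_zero hp hp' hτ)
    · exact CarrollString.complex_of_tableRows hp (CarrollString.tableRow_of_tail_ne_zero hp hp' hτ)
  · have h := CarrollString.tableRow_of_tail_ne_zero hp hp' hτ
    exact ⟨h.1.1, h.2.1.1, h.2.2.1.1, h.2.2.2.1.1, h.2.2.2.2.1.1, h.2.2.2.2.2.1⟩
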